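/- **Notation.** Let $K$ be a field of characteristic $0$, and for $z\in K\setminus\{0,1\}$ put $z'=1/(1-z)$, $z''=1-1/z$. Let $$\psi_\hbar(x,z)=\exp\Big(-\sum_{k,\ell\ge 0,\ k+\ell/2>1}\frac{B_k\,x^\ell\,\hbar^{k+\ell/2-1}}{\ell!\,k!}\,\mathrm{Li}_{2-k-\ell}(z)\Big)\in K[x][[\hbar^{1/2}]],$$ with $B_k$ the Bernoulli numbers ($B_1=-\tfrac12$) and $\mathrm{Li}_{-n}(z)=(z\,\tfrac{d}{dz})^n\tfrac{z}{1-z}$. For an invertible matrix $\Lambda$ and $f\in K[x_1,\dots,x_n][[\hbar^{1/2}]]$ let $\langle f\rangle_{x,\Lambda}=\exp\big(\tfrac12\sum_{i,j}(\Lambda^{-1})_{ij}\partial_{x_i}\partial_{x_j}\big)f\,\big|_{x=0}$. A *Neumann–Zagier (NZ) datum* $\Xi=(A,B,\nu,z,f,f'')$ of size $n$ consists of integer $n\times n$ matrices $A,B$ with $AB^t$ symmetric, $\nu\in\mathbb Z^n$, shapes $z\in (K\setminus\{0,1\})^n$ (they need not solve the gluing equations) and a flattening $f,f''\in\mathbb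 Z^n$, $Af+Bf''=\nu$. A *change of quad* replaces at each tetrahedron $j$ the columns $(a_j\,|\,b_j)$ of $(A\,|\,B)$, the vector $\nu$, the shape $z_j$ and $(f_j,f_j'')$ by one of: themselves; $(-b_j\,|\,a_j-b_j)$, $\nu-b_j$, $z_j'$, $(f_j',f_j)$; $(b_j-a_j\,|\,-a_j)$, $\nu-a_j$, $z_j''$, $(f_j'',f_j')$, where $f_j'=1-f_j-f_j''$. If $\det B\ne0$ and $\Lambda=-B^{-1}A+\mathrm{diag}(1/(1-z_j))$ has $\det\Lambda\neq0$, put $$\Phi^\Xi(\hbar)=\Big\langle \exp\Big(\tfrac{\hbar^{1/2}}2x^t1-\tfrac{\hbar^{1/2}}2x^tB^{-1}\nu+\tfrac\hbar8f^tB^{-1}Af\Big)\prod_j\psi_\hbar(x_j,z_j)\Big\rangle_{x,\Lambda}\in K[[\hbar^{1/2}]].$$ **The 2–3 move.** Let $\Xi$ have size $N+2$ ($N\ge0$) with $A=(a_1|a_2|a_*)$, $B=(b_1|b_2|b_*)$. An NZ datum $\widetilde\Xi$ of size $N+3$ arises from it by the 2–3 move if $$\widetilde A=\begin{pmatrix}-1&0&0&0\\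 a_1+a_2-b_1-b_2&a_1-b_2&a_2-b_1&a_*\end{pmatrix},\quad \widetilde B=\begin{pmatrix}-1&1&1&0\\0&b_1&b_2&b_*\end{pmatrix},\quad\widetilde\nu=(1,\nu),$$ $\widetilde z=(z_0,z_1z_0^{-1},z_2z_0^{-1},z^*)$ with $z_0=z_1+z_2-z_1z_2$; the flattenings of $\Xi$ and $\widetilde\Xi$ are arbitrary. **Theorem.** (1) Let the NZ datum $\widetilde\Xi$ arise from the NZ datum $\Xi$ by the 2–3 move. Let $\mathbf\Xi$ and $\widetilde{\mathbf\Xi}$ be obtained from $\Xi$ and $\widetilde\Xi$ by any changes of quad for which their matrices $\mathbf B$, $\widetilde{\mathbf B}$ are invertible. (No condition is put on the rank of $B$.) Then $\det\Lambda^{\mathbf\Xi}\ne0$ if and only if $\det\Lambda^{\widetilde{\mathbf\Xi}}\neq0$, and in that case there is $c\in\frac1{24}\mathbb Z$ with $$\Phi^{\mathbf\Xi}(\hbar)=e^{c\hbar}\,\Phi^{\widetilde{\mathbf\Xi}}(\hbar).$$ (2) The same conclusion holds if $\mathcal T$ and $\widetilde{\mathcal T}$ are concrete oriented ideal triangulations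 with $N+2$ and $N+3$ tetrahedra, $\widetilde{\mathcal T}$ arises from $\mathcal T$ by a 2–3 Pachner move (the two tetrahedra of a bipyramid are replaced by three tetrahedra around a new edge between the apexes, labelled so that $z_1=\tilde z_0\tilde z_1$, $z_2=\tilde z_0\tilde z_2$, $\tilde z_0'=z_1'z_2'$, etc.), and $\Xi$, $\widetilde\Xi$ are data of $\mathcal T$, $\widetilde{\mathcal T}$, with shapes in $K\setminus\{0,1\}$ related by $\widetilde z=(z_0,z_1z_0^{-1},z_2z_0^{-1},z^*)$ and with arbitrary flattenings. Here $A=\mathbf G-\mathbf G'$, $B=\mathbf G''-\mathbf G'$ and $\nu=(2,\dots,2,0)^t-\mathbf G'(1,\dots,1)^t$ come from the gluing equations of the edges, one of them being replaced by the equation of a peripheral curve. The number of edges equals the number of tetrahedra, the peripheral curve is the same on both triangulations, and the orderings of the edges and the removed edges are arbitrary. -/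

import Mathlib

open scoped PowerSeries Polynomial

noncomputable section

/-! ### Formal power series in `t = ħ^(1/2)`

Throughout, `S⟦X⟧` is the ring of power series in `t = ħ^(1/2)`, so that `ħ = X ^ 2`. -/

/-- `exp F = ∑ Fⁿ / n!`, for a power series `F` without constant term. -/
def formalExp {S : Type*} [CommRing S] [Algebra ℚ S] (F : S⟦X⟧) : S⟦X⟧ :=
  PowerSeries.subst F (PowerSeries.exp ℚ)

/-- The polynomial `Pₙ` with `Li₋ₙ(z) = Pₙ(z / (1 - z))`: one has `Li₀(z) = z / (1 - z)` and
`Li₋ₙ₋₁ = z d/dz Li₋ₙ`, and in the coordinate `u = z / (1 - z)` the operator `z d/dz`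
is `(u + u²) d/du`. -/
def polylogPoly : ℕ → ℤ[X]
  | 0 => Polynomial.X
  | n + 1 => (Polynomial.X + Polynomial.X ^ 2) * Polynomial.derivative (polylogPoly n)

/-- The polylogarithm `Li₋ₙ(z)` of non-positive order `-n`, a rational function of `z`. -/
def polylogNeg {K : Type*} [Field K] (n : ℕ) (z : K) : K :=
  Polynomial.aeval (z / (1 - z)) (polylogPoly n)

section Series

variable {ι K : Type*} [Field K] [CharZero K]

/-- The exponent `-∑ B_k x^ℓ ħ^(k + ℓ/2 - 1) / (ℓ! k!) Li_{2-k-ℓ}(z)` of `ψ_ħ(x, z)`, the sum being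
over `k, ℓ ≥ 0` with `k + ℓ/2 > 1`. The terms with `2k + ℓ = n + 2` contribute to `t^n`, and
`k + ℓ/2 > 1` means `n > 0`; for these terms `k + ℓ ≥ 2`. Here `B_1 = -1/2`. -/
def psiExponent (x : MvPolynomial ι K) (z : K) : (MvPolynomial ι K)⟦X⟧ :=
  PowerSeries.mk fun n => if n = 0 then 0 else
    -∑ p ∈ (Finset.range (n + 3) ×ˢ Finset.range (n + 3)).filter (fun p => 2 * p.1 + p.2 = n + 2),
      MvPolynomial.C ((bernoulli p.1 : K) / ((p.2.factorial : K) * (p.1.factorial : K))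
        * polylogNeg (p.1 + p.2 - 2) z) * x ^ p.2

/-- The series `ψ_ħ(x, z)`. -/
def psi (x : MvPolynomial ι K) (z : K) : (MvPolynomial ι K)⟦X⟧ :=
  formalExp (psiExponent x z)

variable [Fintype ι] [DecidableEq ι]

/-- The operator `(1/2) ∑ (Λ⁻¹)_{ij} ∂_i ∂_j` on polynomials. -/
def gaussOperator (L : Matrix ι ι K) (p : MvPolynomial ι K) : MvPolynomial ι K :=
  MvPolynomial.C (1 / 2) *
    ∑ i, ∑ j, MvPolynomial.C (L⁻¹ i j) * MvPolynomial.pderiv i (MvPolynomial.pderiv j p)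

/-- The formal Gaussian integral of a polynomial:
`exp ((1/2) ∑ (Λ⁻¹)_{ij} ∂_i ∂_j) p` at `x = 0`. The operator lowers the degree,
so that the exponential series stops. -/
def gaussPoly (L : Matrix ι ι K) (p : MvPolynomial ι K) : K :=
  ∑ k ∈ Finset.range (p.totalDegree + 1),
    (k.factorial : K)⁻¹ * MvPolynomial.constantCoeff ((gaussOperator L)^[k] p)

/-- The formal Gaussian integral `⟨f⟩_{x, Λ}` of a series with polynomial coefficients. -/
def gaussIntegral (L : Matrix ι ι K) (f : (MvPolynomial ι K)⟦X⟧) : K⟦X⟧ :=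
  PowerSeries.mk fun n => gaussPoly L (PowerSeries.coeff n f)

end Series

/-! ### Neumann–Zagier data -/

/-- The tuple `(A, B, ν, z, f, f'')`. The laws are in `NZDatum.IsNZ`. -/
structure NZDatum (ι K : Type*) where
  A : Matrix ι ι ℤ
  B : Matrix ι ι ℤ
  ν : ι → ℤ
  z : ι → K
  f : ι → ℤ
  f'' : ι → ℤ

namespace NZDatum

variable {ι K : Type*} [Fintype ι] [Field K]

/-- All shapes differ from `0` and `1`. -/
def Shapes (Ξ : NZDatum ι K) : Prop := ∀ j, Ξ.z j ≠ 0 ∧ Ξ.z j ≠ 1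

/-- `(f, f'')` is a flattening: `A f + B f'' = ν`. -/
def Flattened (Ξ : NZDatum ι K) : Prop := Ξ.A.mulVec Ξ.f + Ξ.B.mulVec Ξ.f'' = Ξ.ν

/-- The laws of a Neumann–Zagier datum. (It is not asked that `z` solves the equations
`∏ z_j ^ A_ij * (1 - 1/z_j) ^ B_ij = (-1) ^ ν_i`; the series does not need it.) -/
structure IsNZ (Ξ : NZDatum ι K) : Prop where
  symm : (Ξ.A * Ξ.B.transpose).IsSymm
  shapes : Ξ.Shapes
  flattened : Ξ.Flattened

/-- Change of quad. At the tetrahedron `j` the shape `z_j` is kept, replaced by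
`z_j' = 1 / (1 - z_j)`, or replaced by `z_j'' = 1 - 1 / z_j`, when `q j` is `0`, `1`, `2`. -/
def quad (Ξ : NZDatum ι K) (q : ι → Fin 3) : NZDatum ι K where
  A := Matrix.of fun i j => ![Ξ.A i j, -Ξ.B i j, Ξ.B i j - Ξ.A i j] (q j)
  B := Matrix.of fun i j => ![Ξ.B i j, Ξ.A i j - Ξ.B i j, -Ξ.A i j] (q j)
  ν := fun i => Ξ.ν i - ∑ j, ![0, Ξ.B i j, Ξ.A i j] (q j)
  z := fun j => ![Ξ.z j, 1 / (1 - Ξ.z j), 1 - 1 / Ξ.z j] (q j)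
  f := fun j => ![Ξ.f j, 1 - Ξ.f j - Ξ.f'' j, Ξ.f'' j] (q j)
  f'' := fun j => ![Ξ.f'' j, Ξ.f j, 1 - Ξ.f j - Ξ.f'' j] (q j)

variable [DecidableEq ι]

/-- `A` with entries in `K`. -/
def AK (Ξ : NZDatum ι K) : Matrix ι ι K := Ξ.A.map (Int.cast : ℤ → K)

/-- `B` with entries in `K`. -/
def BK (Ξ : NZDatum ι K) : Matrix ι ι K := Ξ.B.map (Int.cast : ℤ → K)

/-- The matrix `Λ = -B⁻¹ A + diag (1 / (1 - z_j))`. -/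
def Lam (Ξ : NZDatum ι K) : Matrix ι ι K :=
  -(Ξ.BK⁻¹ * Ξ.AK) + Matrix.diagonal fun j => 1 / (1 - Ξ.z j)

variable [CharZero K]

/-- The exponent `(ħ^(1/2)/2) xᵗ1 - (ħ^(1/2)/2) xᵗ B⁻¹ ν + (ħ/8) fᵗ B⁻¹ A f`. -/
def exponent (Ξ : NZDatum ι K) : (MvPolynomial ι K)⟦X⟧ :=
  PowerSeries.C (∑ j, MvPolynomial.C ((1 - Ξ.BK⁻¹.mulVec (fun i => (Ξ.ν i : K)) j) / 2)
      * MvPolynomial.X j) * PowerSeries.X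
  + PowerSeries.C (MvPolynomial.C
      ((fun i => (Ξ.f i : K)) ⬝ᵥ (Ξ.BK⁻¹ * Ξ.AK).mulVec (fun i => (Ξ.f i : K)) / 8))
      * PowerSeries.X ^ 2

/-- The integrand `f_ħ^Ξ(x, z)`. -/
def integrand (Ξ : NZDatum ι K) : (MvPolynomial ι K)⟦X⟧ :=
  formalExp Ξ.exponent * ∏ j, psi (MvPolynomial.X j) (Ξ.z j)

/-- The series `Φ^Ξ(ħ)`, as a power series in `ħ^(1/2)`; it is defined by these formulas
when `det B ≠ 0` and `det Λ ≠ 0`. -/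
def Phi (Ξ : NZDatum ι K) : K⟦X⟧ := gaussIntegral Ξ.Lam Ξ.integrand

/-- For two data with `det B ≠ 0`: the series of one is defined if and only if that of the other
is, and then they agree up to multiplication by `e^(cħ)` with `c ∈ (1/24)ℤ`. -/
def SameSeries {ι' : Type*} [Fintype ι'] [DecidableEq ι']
    (Ξ : NZDatum ι K) (Ξ' : NZDatum ι' K) : Prop :=
  (Ξ.Lam.det ≠ 0 ↔ Ξ'.Lam.det ≠ 0) ∧
    (Ξ.Lam.det ≠ 0 → ∃ k : ℤ,
      Ξ.Phi = formalExp (PowerSeries.C ((k : K) / 24) * PowerSeries.X ^ 2) * Ξ'.Phi)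

end NZDatum

/-! ### The 2–3 move on Neumann–Zagier data

The tetrahedra of the two sides are indexed by `Fin 2 ⊕ Fin N` and `Fin 3 ⊕ Fin N`. The rows of the
new matrices are the new row, followed by one row for each old row. -/

/-- Puts a new entry in front of the old ones. -/
def stackRows {N : ℕ} {α : Type*} (new : α) (old : Fin 2 ⊕ Fin N → α) : Fin 3 ⊕ Fin N → α :=
  Sum.elim ![new, old (.inl 0), old (.inl 1)] fun j => old (.inr j)

/-- The matrix with first row `(-1, 0, 0, 0)` and columns
`a₁ + a₂ - b₁ - b₂ | a₁ - b₂ | a₂ - b₁ | a_*` below it. -/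
def pachnerA {N : ℕ} (A B : Matrix (Fin 2 ⊕ Fin N) (Fin 2 ⊕ Fin N) ℤ) :
    Matrix (Fin 3 ⊕ Fin N) (Fin 3 ⊕ Fin N) ℤ :=
  Matrix.of <| stackRows (Sum.elim ![-1, 0, 0] fun _ => 0) fun i =>
    Sum.elim ![A i (.inl 0) + A i (.inl 1) - B i (.inl 0) - B i (.inl 1),
      A i (.inl 0) - B i (.inl 1), A i (.inl 1) - B i (.inl 0)] fun j => A i (.inr j)

/-- The matrix with first row `(-1, 1, 1, 0)` and columns `0 | b₁ | b₂ | b_*` below it. -/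
def pachnerB {N : ℕ} (B : Matrix (Fin 2 ⊕ Fin N) (Fin 2 ⊕ Fin N) ℤ) :
    Matrix (Fin 3 ⊕ Fin N) (Fin 3 ⊕ Fin N) ℤ :=
  Matrix.of <| stackRows (Sum.elim ![-1, 1, 1] fun _ => 0) fun i =>
    Sum.elim ![0, B i (.inl 0), B i (.inl 1)] fun j => B i (.inr j)

/-- The shapes `(z₀, z₁ z₀⁻¹, z₂ z₀⁻¹, z^*)` with `z₀ = z₁ + z₂ - z₁ z₂`. -/
def pachnerShape {N : ℕ} {K : Type*} [Field K] (z : Fin 2 ⊕ Fin N → K) : Fin 3 ⊕ Fin N → K :=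
  let z₀ := z (.inl 0) + z (.inl 1) - z (.inl 0) * z (.inl 1)
  Sum.elim ![z₀, z (.inl 0) * z₀⁻¹, z (.inl 1) * z₀⁻¹] fun j => z (.inr j)

/-- `Ξ'` arises from `Ξ` by a 2–3 move. The flattenings of the two data may be chosen
independently of each other. -/
structure NZDatum.IsPachner {N : ℕ} {K : Type*} [Field K] (Ξ : NZDatum (Fin 2 ⊕ Fin N) K)
    (Ξ' : NZDatum (Fin 3 ⊕ Fin N) K) : Prop where
  A_eq : Ξ'.A = pachnerA Ξ.A Ξ.B
  B_eq : Ξ'.B = pachnerB Ξ.B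
  ν_eq : Ξ'.ν = stackRows 1 Ξ.ν
  z_eq : Ξ'.z = pachnerShape Ξ.z

/-! ### Ideal triangulations and their gluing equations -/

/-- A concrete oriented ideal triangulation: tetrahedra indexed by `ι`, each with vertices `0, 1, 2,
3`, the face `f` being opposite to the vertex `f`. If `glue t f = (t', σ)`, then the face `f` of `t`
is glued to the face `σ f` of `t'`, its vertex `v` to the vertex `σ v`. -/
structure IdealTriangulation (ι : Type*) where
  glue : ι → Fin 4 → ι × Equiv.Perm (Fin 4)
  sign_glue : ∀ t f, Equiv.Perm.sign (glue t f).2 = -1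
  glue_glue : ∀ t f, glue (glue t f).1 ((glue t f).2 f) = (t, (glue t f).2⁻¹)
  glue_ne : ∀ t f, ((glue t f).1, (glue t f).2 f) ≠ (t, f)

/-- The label of the edge `vw` of a tetrahedron: `0`, `1`, `2` for the shapes `z`, `z'`, `z''`, which
sit at the edges `01, 23`, at `02, 13` and at `03, 12`. (The value at `v = w` is not used.) -/
def edgeLabel (v w : Fin 4) : Fin 3 :=
  ![![0, 0, 1, 2], ![0, 0, 2, 1], ![1, 2, 0, 0], ![2, 1, 0, 0]] v w

/-- An edge of a tetrahedron, with a direction. -/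
structure TetEdge (ι : Type*) where
  tet : ι
  v : Fin 4
  w : Fin 4
  ne : v ≠ w

/-- A side of a triangle of the vertex links: the face `face` of the tetrahedron `tet` meets the link
of the vertex `vtx` in it. -/
structure Side (ι : Type*) where
  tet : ι
  face : Fin 4
  vtx : Fin 4
  ne : vtx ≠ face

/-- A step of a normal curve in the triangulated vertex links: in the tetrahedron `tet`, in the
triangle at the vertex `π 0`, from the side on the face `π 2` to the side on the face `π 3`. The
curve turns around the corner of the triangle at the edge from `π 0` to `π 1`,
to the left or to the right according to the sign of `π`. -/
structure LinkStep (ι : Type*) where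
  tet : ι
  π : Equiv.Perm (Fin 4)

namespace LinkStep

variable {ι ι' : Type*}

def entry (s : LinkStep ι) : Side ι := ⟨s.tet, s.π 2, s.π 0, by simp⟩

def exit (s : LinkStep ι) : Side ι := ⟨s.tet, s.π 3, s.π 0, by simp⟩

def map (g : ι → ι') (s : LinkStep ι) : LinkStep ι' := ⟨g s.tet, s.π⟩

end LinkStep

def Side.map {ι ι' : Type*} (g : ι → ι') (s : Side ι) : Side ι' := ⟨g s.tet, s.face, s.vtx, s.ne⟩

namespace IdealTriangulation

variable {ι : Type*} (T : IdealTriangulation ι)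

/-- Identifications among the edges of the tetrahedra: reversal of the direction, and
gluing along a face that contains the edge. -/
inductive EdgeStep : TetEdge ι → TetEdge ι → Prop
  | flip (e : TetEdge ι) : EdgeStep e ⟨e.tet, e.w, e.v, e.ne.symm⟩
  | glue (e : TetEdge ι) (f : Fin 4) (hv : e.v ≠ f) (hw : e.w ≠ f) :
      EdgeStep e ⟨(T.glue e.tet f).1, (T.glue e.tet f).2 e.v, (T.glue e.tet f).2 e.w,
        fun h => e.ne ((T.glue e.tet f).2.injective h)⟩

/-- The edges of the triangulation. -/
def EdgeClass : Type _ := Quot T.EdgeStep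

/-- The side of the neighbouring triangle to which a side is glued. -/
def cross (s : Side ι) : Side ι :=
  ⟨(T.glue s.tet s.face).1, (T.glue s.tet s.face).2 s.face, (T.glue s.tet s.face).2 s.vtx,
    fun h => s.ne ((T.glue s.tet s.face).2.injective h)⟩

/-- A peripheral curve: a closed normal curve in the boundary, i.e. in the vertex links. -/
structure PeripheralCurve where
  steps : List (LinkStep ι)
  ne_nil : steps ≠ []
  closed : Cycle.Chain (fun s s' => T.cross s.exit = s'.entry) (steps : Cycle (LinkStep ι))

variable {T}

open Classical in
/-- How many of the edges of the tetrahedron `t` with label `k` lie at the edge `c`: the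
numbers `G`, `G'`, `G''` for `k = 0, 1, 2`. -/
def edgeCoeff (c : T.EdgeClass) (k : Fin 3) (t : ι) : ℤ :=
  ((Finset.univ : Finset (Fin 4 × Fin 4)).filter fun p => ∃ h : p.1 < p.2,
    edgeLabel p.1 p.2 = k ∧ Quot.mk T.EdgeStep ⟨t, p.1, p.2, h.ne⟩ = c).card

open Classical in
/-- The signed number of corners with label `k` of the tetrahedron `t` around which the
peripheral curve turns. -/
def PeripheralCurve.coeff (γ : T.PeripheralCurve) (k : Fin 3) (t : ι) : ℤ :=
  (γ.steps.map fun s =>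
    if s.tet = t ∧ edgeLabel (s.π 0) (s.π 1) = k then (Equiv.Perm.sign s.π : ℤ) else 0).sum

open Classical in
/-- The matrices `G`, `G'`, `G''` for `k = 0, 1, 2`, with the edges ordered by `e`, and with the
equation of the edge `e r` replaced by that of the peripheral curve. -/
def gluingMatrix (e : ι ≃ T.EdgeClass) (r : ι) (γ : T.PeripheralCurve) (k : Fin 3) :
    Matrix ι ι ℤ :=
  Matrix.of fun i t => if i = r then γ.coeff k t else edgeCoeff (e i) k t

open Classical in
/-- `Ξ` is a Neumann–Zagier datum of the triangulation, before a change of quad, for the peripheral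
curve `γ`: for some ordering of the edges and some choice of the edge `e r` that is removed,
`A = G - G'`, `B = G'' - G'`, `ν = (2, …, 2, 0) - G' (1, …, 1)`, with shapes different from
`0` and `1` and with a flattening. -/
def IsDatum {K : Type*} [Fintype ι] [Field K] (T : IdealTriangulation ι) (γ : T.PeripheralCurve)
    (Ξ : NZDatum ι K) : Prop :=
  (∃ (e : ι ≃ T.EdgeClass) (r : ι),
    Ξ.A = gluingMatrix e r γ 0 - gluingMatrix e r γ 1 ∧
    Ξ.B = gluingMatrix e r γ 2 - gluingMatrix e r γ 1 ∧
    Ξ.ν = (fun i => if i = r then 0 else 2) - (gluingMatrix e r γ 1).mulVec 1) ∧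
  Ξ.Shapes ∧ Ξ.Flattened

end IdealTriangulation

/-! ### The 2–3 move on ideal triangulations

The bipyramid has five vertices, the apexes `0` and `1` and the equatorial vertices `2, 3, 4`. It is
cut into the two tetrahedra `0 4 2 3` and `1 3 2 4`, or into the three tetrahedra `0 4 1 3`,
`0 4 2 1` and `0 2 3 1`. With the labels of the edges, the dihedral angles on the two sides satisfy
`z₁ = z̃₀ z̃₁`, `z₁' = z̃₁' z̃₂`, `z₁'' = z̃₀'' z̃₂'`, `z₂ = z̃₀ z̃₂`, `z₂' = z̃₁ z̃₂'`, `z₂'' = z̃₀'' z̃₁'`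
at the edges with an apex and `z̃₀' = z₁' z₂'`, `z̃₁'' = z₁'' z₂`, `z̃₂'' = z₁ z₂''` at the
equatorial edges, and the new edge has the angles `z̃₀'`, `z̃₁''`, `z̃₂''`. -/

/-- The vertices of the two tetrahedra, as vertices of the bipyramid. -/
def bip2 : Fin 2 → Fin 4 → Fin 5 := ![![0, 4, 2, 3], ![1, 3, 2, 4]]

/-- The vertices of the three tetrahedra, as vertices of the bipyramid. -/
def bip3 : Fin 3 → Fin 4 → Fin 5 := ![![0, 4, 1, 3], ![0, 4, 2, 1], ![0, 2, 3, 1]]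

/-- The set of the vertices of a face of one of the tetrahedra in the bipyramid. -/
def faceVertices {κ : Type*} (L : κ → Fin 4 → Fin 5) (i : κ) (f : Fin 4) : Finset (Fin 5) :=
  (Finset.univ.erase f).image (L i)

/-- Two sides lie on the same triangle in the bipyramid, and at the same vertex of it. -/
def SameSide {κ κ' : Type*} (L : κ → Fin 4 → Fin 5) (L' : κ' → Fin 4 → Fin 5)
    (s : Side κ) (s' : Side κ') : Prop :=
  faceVertices L s.tet s.face = faceVertices L' s'.tet s'.face ∧
    L s.tet s.vtx = L' s'.tet s'.vtx

/-- The correspondence of the sides on the two triangulations: the sides on the boundary of the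
bipyramid correspond to each other, and those of the other tetrahedra to themselves. -/
inductive SideCorr {N : ℕ} : Side (Fin 2 ⊕ Fin N) → Side (Fin 3 ⊕ Fin N) → Prop
  | bip (s : Side (Fin 2)) (s' : Side (Fin 3)) (h : SameSide bip2 bip3 s s') :
      SideCorr (s.map Sum.inl) (s'.map Sum.inl)
  | rest (s : Side (Fin N)) : SideCorr (s.map Sum.inr) (s.map Sum.inr)

/-- `T'` arises from `T` by a 2–3 Pachner move: the two tetrahedra of `T` with indices in `Fin 2` form
a bipyramid, which is replaced by three tetrahedra around a new edge between the apexes. -/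
structure IdealTriangulation.IsPachner {N : ℕ} (T : IdealTriangulation (Fin 2 ⊕ Fin N))
    (T' : IdealTriangulation (Fin 3 ⊕ Fin N)) : Prop where
  inner2 : ∀ s s' : Side (Fin 2), s.tet ≠ s'.tet → SameSide bip2 bip2 s s' →
    T.cross (s.map Sum.inl) = s'.map Sum.inl
  inner3 : ∀ s s' : Side (Fin 3), s.tet ≠ s'.tet → SameSide bip3 bip3 s s' →
    T'.cross (s.map Sum.inl) = s'.map Sum.inl
  outer : ∀ s s', SideCorr s s' → SideCorr (T.cross s) (T'.cross s')

/-- An arc of a normal curve inside the bipyramid, which visits every triangle at most once. -/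
def IsBipArc {κ : Type*} (L : κ → Fin 4 → Fin 5) (l : List (LinkStep κ)) : Prop :=
  l.IsChain (fun s s' => s.tet ≠ s'.tet ∧ SameSide L L s.exit s'.entry) ∧
    (l.map LinkStep.tet).Nodup

/-- Corresponding pieces of normal curves: a step outside the bipyramid corresponds to itself, and
an arc that crosses the bipyramid to an arc with the same end sides. -/
inductive ArcCorr {N : ℕ} :
    List (LinkStep (Fin 2 ⊕ Fin N)) → List (LinkStep (Fin 3 ⊕ Fin N)) → Prop
  | bip (l : List (LinkStep (Fin 2))) (l' : List (LinkStep (Fin 3))) (hl : l ≠ []) (hl' : l' ≠ [])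
      (h : IsBipArc bip2 l) (h' : IsBipArc bip3 l')
      (first_side : SameSide bip2 bip3 (l.head hl).entry (l'.head hl').entry)
      (last_side : SameSide bip2 bip3 (l.getLast hl).exit (l'.getLast hl').exit) :
      ArcCorr (l.map (LinkStep.map Sum.inl)) (l'.map (LinkStep.map Sum.inl))
  | rest (s : LinkStep (Fin N)) : ArcCorr [s.map Sum.inr] [s.map Sum.inr]

/-- `γ` and `γ'` are the same peripheral curve on the two triangulations: they are made, up to the
choice of the starting point, of corresponding pieces. -/
def SameCurve {N : ℕ} {T : IdealTriangulation (Fin 2 ⊕ Fin N)}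
    {T' : IdealTriangulation (Fin 3 ⊕ Fin N)} (γ : T.PeripheralCurve)
    (γ' : T'.PeripheralCurve) : Prop :=
  ∃ P : List (List (LinkStep (Fin 2 ⊕ Fin N)) × List (LinkStep (Fin 3 ⊕ Fin N))),
    (∀ p ∈ P, ArcCorr p.1 p.2) ∧ γ.steps ~r (P.map Prod.fst).flatten ∧
      γ'.steps ~r (P.map Prod.snd).flatten

end

open scoped PowerSeries Polynomial

set_option linter.unusedSectionVars false
set_option linter.unusedSimpArgs false

noncomputable section

/-! The series are compared modulo every power of `t = ħ^(1/2)`. There `t` is nilpotent, all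
exponentials are finite sums, and every statement can be made over an arbitrary `ℚ`-algebra and
transported along ring homomorphisms. Shapes enter through `u = z / (1 - z)`.

The analytic core is a pentagon identity for `ψ` (`pentagon`). Average `ψ(X₀, U) ψ(X₁, V)` over the
direction `(1, -1)` with variance `τ = 1 / (1 + U + V)`. The result is an elementary exponential
times three factors `ψ`, with parameters `U V τ`, `-(1 + U) τ`, `-(1 + V) τ` and with linear forms
in `X₀, X₁` as arguments. The difference equation of the Bernoulli polynomials gives a functional
equation for `ψ(y + t)` (`psiNil_add`). Hence the average satisfies two linear relations between
three of its translates. Eliminating one translate at a time leaves two first-order equations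
(`shift_pentLeft`), which the product on the right satisfies as well (`shift_pentRight_fst`,
`shift_pentRight_snd`). So the ratio of the two sides is invariant under two independent
translations by multiples of `t`, and is constant in `X₀, X₁` up to a high power of `t`
(`eq_C_add_of_shift_eq`). The Appell property of the Bernoulli polynomials, together with the heat
equation for Gaussian averages, gives both sides the same logarithmic derivative in the parameters,
so the constant is independent of them. When the parameters are scaled to `0`, both sides become
`1`. Some powers of `t` are lost on the way; they are recovered by working with a generic nilpotent
of larger order and specialising it to `t`.

For a datum put `M = B diag(1 / (1 - z)) - A`. Then `Λ⁻¹ = M⁻¹ B`, an expression that makes sense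
for singular `B`. With the flattening absorbed into building blocks `phi`, the series becomes a
Gaussian average `amp` that involves `B` only through this matrix (`mk_Phi`). Three rules describe
`amp`: a change of flattening is a translation (`amp_flattening`), a change of quad is the
degenerate pentagon with `U = 0` (`amp_quad`), and the 2–3 move is the pentagon applied to two
variables (`amp_pachner`). Each rule costs an explicit factor `e^(cħ)` with `c ∈ (1/24)ℤ`. Since
singular `B` is harmless, one may pass through whichever quads suit the pentagon, and no rank
condition appears.

For triangulations, the series depends only on the lattice spanned by the rows of `(A | B | ν)`
(`rel_of_row_span`). This lattice contains the equation of the removed edge, because the edge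
equations add up to zero. Comparing edges and curves inside the bipyramid shows that the lattice of
the new triangulation is the one that the algebraic 2–3 move produces (`span_row_pachner`). The
symmetry of `A Bᵗ` comes from a sign-reversing involution on tetrahedra with ordered vertices, and
from telescoping along the curve. -/

/-! ### Exponentials of nilpotent elements -/

section TExp

variable {S S' : Type*} [CommRing S] [Algebra ℚ S] [CommRing S'] [Algebra ℚ S']

/-- The exponential `e^(t a)`, for nilpotent `t`. -/
def texp (t a : S) : S := IsNilpotent.exp (t * a)

variable {t : S}

omit [Algebra ℚ S] in
lemma IsNilpotent.mul_left' (ht : IsNilpotent t) (a : S) : IsNilpotent (t * a) :=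
  (Commute.all t a).isNilpotent_mul_right ht

lemma texp_add (ht : IsNilpotent t) (a b : S) : texp t (a + b) = texp t a * texp t b := by
  unfold texp
  rw [mul_add, IsNilpotent.exp_add_of_commute (Commute.all _ _) (ht.mul_left' a) (ht.mul_left' b)]

@[simp] lemma texp_zero : texp t (0 : S) = 1 := by simp [texp]

lemma texp_neg_mul_self (ht : IsNilpotent t) (a : S) : texp t (-a) * texp t a = 1 := by
  rw [← texp_add ht]; simp

lemma isUnit_texp (ht : IsNilpotent t) (a : S) : IsUnit (texp t a) :=
  IsNilpotent.isUnit_exp (ht.mul_left' a)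

lemma map_texp (ht : IsNilpotent t) (f : S →+* S') (a : S) :
    f (texp t a) = texp (f t) (f a) := by
  unfold texp
  rw [IsNilpotent.map_exp (ht.mul_left' a) f, map_mul]

lemma texp_sub_one (ht : IsNilpotent t) (a : S) : IsNilpotent (texp t a - 1) :=
  IsNilpotent.isNilpotent_exp_sub_one (ht.mul_left' a)

lemma Derivation.map_nilpotent_exp {R : Type*} [CommSemiring R] [Algebra R S]
    (D : Derivation R S S) {a : S} (ha : IsNilpotent a) :
    D (IsNilpotent.exp a) = D a * IsNilpotent.exp a := by
  obtain ⟨k, hk⟩ := ha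
  -- The exponential is cut after `k + 1` terms before differentiation and after `k` terms in the
  -- result, because differentiation lowers the index by one.
  rw [IsNilpotent.exp_eq_sum (pow_eq_zero_of_le (Nat.le_succ k) hk), map_sum,
    Finset.sum_range_succ']
  rw [← IsNilpotent.exp_eq_sum (pow_eq_zero_of_le (Nat.le_succ k) hk)]
  have h0 : D (((Nat.factorial 0 : ℕ) : ℚ)⁻¹ • a ^ 0) = 0 := by simp
  rw [h0, add_zero, IsNilpotent.exp_eq_sum hk, Finset.mul_sum]
  refine Finset.sum_congr rfl fun i _ => ?_
  rw [map_rat_smul D, Derivation.leibniz_pow, Nat.factorial_succ, Nat.add_sub_cancel, smul_eq_mul,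
    ← Nat.cast_smul_eq_nsmul ℚ, smul_smul, mul_smul_comm, mul_comm (D a)]
  congr 1
  push_cast
  field_simp

lemma Derivation.map_texp {R : Type*} [CommSemiring R] [Algebra R S] (ht : IsNilpotent t)
    (D : Derivation R S S) (hD : D t = 0) (a : S) :
    D (texp t a) = t * D a * texp t a := by
  unfold texp
  rw [D.map_nilpotent_exp (ht.mul_left' a), D.leibniz, hD]
  simp

end TExp

/-! ### Gaussian operators on polynomials -/

namespace MvPolynomial

section Directional

variable {σ A : Type*} [CommRing A]

/-- The derivative in the direction `v`. -/
def dirD (v : σ → A) : Derivation A (MvPolynomial σ A) (MvPolynomial σ A) :=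
  mkDerivation A fun j => C (v j)

@[simp] lemma dirD_X (v : σ → A) (j : σ) : dirD v (X j) = C (v j) := mkDerivation_X _ _ _

@[simp] lemma dirD_C (v : σ → A) (a : A) : dirD v (C a) = 0 := by
  rw [← algebraMap_eq, Derivation.map_algebraMap]

lemma dirD_smul (c : A) (v : σ → A) (p : MvPolynomial σ A) :
    dirD (fun j => c * v j) p = C c * dirD v p := by
  have : dirD (fun j => c * v j) = c • dirD v := by
    refine derivation_ext fun j => ?_
    simp [smul_eq_C_mul]
  rw [this, Derivation.smul_apply, smul_eq_C_mul]

lemma dirD_add (v w : σ → A) (p : MvPolynomial σ A) :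
    dirD (fun j => v j + w j) p = dirD v p + dirD w p := by
  have : dirD (fun j => v j + w j) = dirD v + dirD w := by
    refine derivation_ext fun j => ?_
    simp
  rw [this, Derivation.add_apply]

lemma dirD_eq_sum [Fintype σ] (v : σ → A) (p : MvPolynomial σ A) :
    dirD v p = ∑ j, C (v j) * pderiv j p := by
  classical
  have : dirD v = ∑ j, v j • (pderiv j : Derivation A (MvPolynomial σ A) (MvPolynomial σ A)) := by
    refine derivation_ext fun j => ?_
    have h : ∀ (s : Finset σ) (f : σ → Derivation A (MvPolynomial σ A) (MvPolynomial σ A))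
        (x : MvPolynomial σ A), (∑ i ∈ s, f i) x = ∑ i ∈ s, f i x := by
      intro s f x
      induction s using Finset.induction_on with
      | empty => simp
      | insert a s ha ih => rw [Finset.sum_insert ha, Finset.sum_insert ha, ← ih]; rfl
    rw [h]
    simp [pderiv_X, Pi.single_apply, smul_eq_C_mul]
  have h : ∀ (s : Finset σ) (f : σ → Derivation A (MvPolynomial σ A) (MvPolynomial σ A))
      (x : MvPolynomial σ A), (∑ i ∈ s, f i) x = ∑ i ∈ s, f i x := by
    intro s f x
    induction s using Finset.induction_on with
    | empty => simp
    | insert a s ha ih => rw [Finset.sum_insert ha, Finset.sum_insert ha, ← ih]; rfl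
  rw [this, h]
  simp [smul_eq_C_mul]

lemma dirD_comm (v w : σ → A) (p : MvPolynomial σ A) :
    dirD v (dirD w p) = dirD w (dirD v p) := by
  have : ⁅dirD v, dirD w⁆ = (0 : Derivation A (MvPolynomial σ A) (MvPolynomial σ A)) := by
    refine derivation_ext fun j => ?_
    simp [Derivation.commutator_apply]
  have h := congrArg (fun D => D p) this
  simpa [Derivation.commutator_apply, sub_eq_zero] using h

end Directional

section Wick

variable {σ τ A B : Type*} [Fintype σ] [Fintype τ] [CommRing A] [CommRing B]
  [Algebra ℚ A] [Algebra ℚ B]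

variable (A) in
/-- The element `1/2`. -/
def half : A := algebraMap ℚ A (1 / 2)

lemma half_mul_two : half A * 2 = 1 := by
  have : (2 : A) = algebraMap ℚ A 2 := (map_ofNat (algebraMap ℚ A) 2).symm
  rw [half, this, ← map_mul]
  norm_num

lemma map_half (f : A →+* B) : f (half A) = half B := by
  have h2 : (2 : B) * half B = 1 := by rw [mul_comm]; exact half_mul_two
  have h1 : f (half A) * 2 = 1 := by
    have := congrArg f (half_mul_two (A := A))
    rwa [map_mul, map_one, map_ofNat] at this
  calc f (half A) = f (half A) * (2 * half B) := by rw [h2, mul_one]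
    _ = half B := by rw [← mul_assoc, h1, one_mul]

omit [Fintype σ] in
lemma C_half_mul_two : (C (half A) : MvPolynomial σ A) * 2 = 1 := by
  have : (2 : MvPolynomial σ A) = C 2 := (map_ofNat C 2).symm
  rw [this, ← C_mul, half_mul_two, C_1]

/-- The operator `(1/2) ∑ Q_{ij} ∂_i ∂_j`. -/
def wickOp (Q : Matrix σ σ A) : MvPolynomial σ A →ₗ[A] MvPolynomial σ A :=
  half A • ∑ i, (pderiv i).toLinearMap ∘ₗ (dirD (Q.row i)).toLinearMap

lemma wickOp_apply (Q : Matrix σ σ A) (p : MvPolynomial σ A) :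
    wickOp Q p = C (half A) * ∑ i, pderiv i (dirD (Q.row i) p) := by
  simp [wickOp, smul_eq_C_mul]

omit [Fintype σ] [Algebra ℚ A] in
lemma pderiv_eq_dirD [DecidableEq σ] (j : σ) :
    (pderiv j : Derivation A (MvPolynomial σ A) (MvPolynomial σ A)) = dirD (Pi.single j 1) := by
  refine derivation_ext fun l => ?_
  simp [pderiv_X, Pi.single_apply, eq_comm, apply_ite C]

/-- The commutator of the second-order operator with a variable. One derivative hits `X i`, which
gives row `i` and column `i` of `Q`; by symmetry they agree and cancel the factor `1/2`. -/
lemma wickOp_X_mul {Q : Matrix σ σ A} (hQ : Q.IsSymm) (i : σ) (p : MvPolynomial σ A) :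
    wickOp Q (X i * p) = X i * wickOp Q p + dirD (Q.row i) p := by
  classical
  have hs : ∑ j, pderiv j (dirD (Q.row j) (X i * p)) =
      X i * ∑ j, pderiv j (dirD (Q.row j) p) + 2 * dirD (Q.row i) p := by
    have : ∀ j, pderiv j (dirD (Q.row j) (X i * p)) = X i * pderiv j (dirD (Q.row j) p)
        + (C (Q i j) * pderiv j p + (if j = i then dirD (Q.row i) p else 0)) := by
      intro j
      have hsym : Q j i = Q i j := hQ.apply i j
      simp only [Derivation.leibniz, smul_eq_mul, dirD_X, map_add, pderiv_C, pderiv_X,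
        Pi.single_apply, Matrix.row_apply, hsym]
      by_cases h : j = i
      · subst h; simp; ring
      · simp [h, Ne.symm h]
    rw [Finset.sum_congr rfl fun j _ => this j, Finset.sum_add_distrib, Finset.sum_add_distrib,
      ← Finset.mul_sum, dirD_eq_sum (Q.row i)]
    simp [two_mul]
  rw [wickOp_apply, wickOp_apply, hs]
  linear_combination (dirD (Q.row i) p) * C_half_mul_two (σ := σ) (A := A)

@[simp] lemma wickOp_C (Q : Matrix σ σ A) (a : A) : wickOp Q (C a) = 0 := by
  rw [wickOp_apply]
  simp only [dirD_C, map_zero, Finset.sum_const_zero, mul_zero]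

lemma wickOp_dirD (Q : Matrix σ σ A) (v : σ → A) (p : MvPolynomial σ A) :
    wickOp Q (dirD v p) = dirD v (wickOp Q p) := by
  classical
  rw [wickOp_apply, wickOp_apply, Derivation.leibniz, dirD_C, smul_zero, add_zero, smul_eq_mul,
    map_sum]
  refine congrArg (C (half A) * ·) (Finset.sum_congr rfl fun j _ => ?_)
  rw [pderiv_eq_dirD, dirD_comm (Q.row j) v, dirD_comm _ v]

/-- The Heisenberg relation: `d = [f, x]` commutes with `f`, so each of the `k + 1` factors
contributes one equal term. -/
lemma iterate_of_commutator {R M : Type*} [CommRing R] [AddCommGroup M] [Module R M]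
    (f x d : M →ₗ[R] M) (hx : ∀ p, f (x p) = x (f p) + d p) (hd : ∀ p, f (d p) = d (f p))
    (k : ℕ) (p : M) : f^[k + 1] (x p) = x (f^[k + 1] p) + ((k + 1 : ℕ) : R) • d (f^[k] p) := by
  induction k with
  | zero => simp [hx]
  | succ k ih =>
    rw [Function.iterate_succ_apply', ih, map_add, map_smul, hx, hd,
      Function.iterate_succ_apply' f (k + 1) p, Function.iterate_succ_apply' f k p, add_assoc]
    congr 1
    push_cast
    module

lemma iterate_wickOp_X_mul {Q : Matrix σ σ A} (hQ : Q.IsSymm) (i : σ) (k : ℕ)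
    (p : MvPolynomial σ A) :
    (wickOp Q)^[k + 1] (X i * p) =
      X i * (wickOp Q)^[k + 1] p + ((k + 1 : ℕ) : A) • dirD (Q.row i) ((wickOp Q)^[k] p) :=
  iterate_of_commutator (wickOp Q) (LinearMap.mulLeft A (X i)) (dirD (Q.row i)).toLinearMap
    (wickOp_X_mul hQ i) (wickOp_dirD Q _) k p

omit [Fintype σ] [Algebra ℚ A] in
lemma totalDegree_pderiv_le (i : σ) {p : MvPolynomial σ A} {n : ℕ} (h : p.totalDegree ≤ n) :
    (pderiv i p).totalDegree ≤ n - 1 := by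
  refine Finset.sup_le fun s hs => ?_
  rw [mem_support_iff, coeff_pderiv] at hs
  have hs' : s + Finsupp.single i 1 ∈ p.support := by
    rw [mem_support_iff]
    exact left_ne_zero_of_mul hs
  have := (le_totalDegree hs').trans h
  rw [Finsupp.sum_add_index' (by simp) (by simp), Finsupp.sum_single_index rfl] at this
  omega

lemma totalDegree_wickOp_le (Q : Matrix σ σ A) {p : MvPolynomial σ A} {n : ℕ}
    (h : p.totalDegree ≤ n) : (wickOp Q p).totalDegree ≤ n - 1 := by
  rw [wickOp_apply]
  refine (totalDegree_mul _ _).trans ?_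
  rw [totalDegree_C, zero_add]
  refine totalDegree_finsetSum_le fun i _ => ?_
  refine (totalDegree_pderiv_le i (n := n) ?_)
  rw [dirD_eq_sum]
  refine totalDegree_finsetSum_le fun j _ => ?_
  refine (totalDegree_mul _ _).trans ?_
  rw [totalDegree_C, zero_add]
  exact (totalDegree_pderiv_le j h).trans (Nat.sub_le _ _)

lemma iterate_wickOp_eq_zero (Q : Matrix σ σ A) {k : ℕ} {p : MvPolynomial σ A}
    (h : p.totalDegree < k) : (wickOp Q)^[k] p = 0 := by
  induction k generalizing p with
  | zero => omega
  | succ k ih =>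
    rw [Function.iterate_succ_apply]
    rcases Nat.eq_zero_or_pos p.totalDegree with h0 | h0
    · rw [totalDegree_eq_zero_iff_eq_C.1 h0, wickOp_C, Function.iterate_fixed (map_zero _)]
    · exact ih (by have := totalDegree_wickOp_le Q (le_refl p.totalDegree); omega)

/-- The operator `exp ((1/2) ∑ Q_{ij} ∂_i ∂_j)` on polynomials. -/
def wick (Q : Matrix σ σ A) (p : MvPolynomial σ A) : MvPolynomial σ A :=
  ∑ k ∈ Finset.range (p.totalDegree + 1), (k.factorial : ℚ)⁻¹ • (wickOp Q)^[k] p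

lemma wick_eq_sum (Q : Matrix σ σ A) {p : MvPolynomial σ A} {n : ℕ} (h : p.totalDegree < n) :
    wick Q p = ∑ k ∈ Finset.range n, (k.factorial : ℚ)⁻¹ • (wickOp Q)^[k] p := by
  refine Finset.sum_subset (Finset.range_mono h) fun k _ hk => ?_
  rw [iterate_wickOp_eq_zero Q (by simpa using hk), smul_zero]

lemma wick_add (Q : Matrix σ σ A) (p q : MvPolynomial σ A) :
    wick Q (p + q) = wick Q p + wick Q q := by
  have hp : p.totalDegree < max p.totalDegree q.totalDegree + 1 := by omega
  have hq : q.totalDegree < max p.totalDegree q.totalDegree + 1 := by omega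
  have hpq : (p + q).totalDegree < max p.totalDegree q.totalDegree + 1 :=
    Nat.lt_succ_of_le (totalDegree_add p q)
  rw [wick_eq_sum Q hp, wick_eq_sum Q hq, wick_eq_sum Q hpq, ← Finset.sum_add_distrib]
  refine Finset.sum_congr rfl fun k _ => ?_
  rw [iterate_map_add, smul_add]

@[simp] lemma wick_C (Q : Matrix σ σ A) (a : A) : wick Q (C a) = C a := by
  simp [wick]

/-- `wick` as an additive map. -/
def wickHom (Q : Matrix σ σ A) : MvPolynomial σ A →+ MvPolynomial σ A :=
  AddMonoidHom.mk' (wick Q) (wick_add Q)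

lemma wickHom_apply (Q : Matrix σ σ A) (p : MvPolynomial σ A) : wickHom Q p = wick Q p := rfl

/-- Conjugating multiplication by `X i` with the exponential of the operator adds the commutator,
once. Together with `wick_C` and additivity this rule determines `wick`; most later rules follow
from it by induction on the polynomial, without the exponential series. -/
lemma wick_X_mul {Q : Matrix σ σ A} (hQ : Q.IsSymm) (i : σ) (p : MvPolynomial σ A) :
    wick Q (X i * p) = X i * wick Q p + dirD (Q.row i) (wick Q p) := by
  have h1 : (X i * p).totalDegree < p.totalDegree + 1 + 1 := by
    have := totalDegree_mul (X i) p
    have := (totalDegree_monomial_le (Finsupp.single i 1) (1 : A))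
    rw [Finsupp.sum_single_index rfl] at this
    change (X i).totalDegree ≤ 1 at this
    omega
  have h2 : p.totalDegree < p.totalDegree + 1 + 1 := by omega
  have hw : wick Q p = ∑ k ∈ Finset.range (p.totalDegree + 1),
      ((k + 1).factorial : ℚ)⁻¹ • (wickOp Q)^[k + 1] p + (Nat.factorial 0 : ℚ)⁻¹ • p := by
    rw [wick_eq_sum Q h2, Finset.sum_range_succ']
    rfl
  have hd : dirD (Q.row i) (wick Q p) = ∑ k ∈ Finset.range (p.totalDegree + 1),
      dirD (Q.row i) ((k.factorial : ℚ)⁻¹ • (wickOp Q)^[k] p) := by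
    rw [wick, map_sum]
  rw [hd, hw, wick_eq_sum Q h1, Finset.sum_range_succ', mul_add, Finset.mul_sum, add_right_comm,
    ← Finset.sum_add_distrib]
  simp only [Function.iterate_zero, id_eq, mul_smul_comm]
  congr 1
  refine Finset.sum_congr rfl fun k _ => ?_
  have hk : (((k + 1).factorial : ℕ) : ℚ)⁻¹ * ((k + 1 : ℕ) : ℚ) = ((k.factorial : ℕ) : ℚ)⁻¹ := by
    rw [Nat.factorial_succ]
    push_cast
    field_simp
  have hsm : dirD (Q.row i) (((k.factorial : ℕ) : ℚ)⁻¹ • (wickOp Q)^[k] p) =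
      ((k.factorial : ℕ) : ℚ)⁻¹ • dirD (Q.row i) ((wickOp Q)^[k] p) :=
    map_rat_smul (dirD (Q.row i)) _ _
  rw [iterate_wickOp_X_mul hQ, smul_add, hsm, Nat.cast_smul_eq_nsmul A, ← Nat.cast_smul_eq_nsmul ℚ, smul_smul, hk]

end Wick

-- Transformation rules of Gaussian averages.

end MvPolynomial

namespace MvPolynomial

variable {σ τ A B : Type*} [CommRing A] [CommRing B]

section Substitution

variable [Fintype τ]

/-- The affine substitution `X_i ↦ ∑ P_{ij} X_j + c_i`. -/
def affineSubst (P : Matrix σ τ A) (c : σ → A) : MvPolynomial σ A →ₐ[A] MvPolynomial τ A :=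
  aeval fun i => ∑ j, C (P i j) * X j + C (c i)

@[simp] lemma affineSubst_X (P : Matrix σ τ A) (c : σ → A) (i : σ) :
    affineSubst P c (X i) = ∑ j, C (P i j) * X j + C (c i) := aeval_X _ _

@[simp] lemma affineSubst_C (P : Matrix σ τ A) (c : σ → A) (a : A) :
    affineSubst P c (C a) = C a := by
  rw [← algebraMap_eq, AlgHom.commutes]; rfl

lemma dirD_affineSubst (P : Matrix σ τ A) (c : σ → A) (v : τ → A) (p : MvPolynomial σ A) :
    dirD v (affineSubst P c p) = affineSubst P c (dirD (P.mulVec v) p) := by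
  induction p using MvPolynomial.induction_on with
  | C a => simp
  | add p q hp hq => simp only [map_add, hp, hq]
  | mul_X p i hp =>
    have hX : dirD v (affineSubst P c (X i)) = C (P.mulVec v i) := by
      simp [Matrix.mulVec, dotProduct, Derivation.leibniz, map_sum]
    rw [map_mul, Derivation.leibniz, Derivation.leibniz, hp, hX, dirD_X]
    simp only [smul_eq_mul, map_add, map_mul, affineSubst_C]

end Substitution

/-- The translation `X_i ↦ X_i + c_i`. -/
def shift (c : σ → A) : MvPolynomial σ A →ₐ[A] MvPolynomial σ A := aeval fun i => X i + C (c i)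

@[simp] lemma shift_X (c : σ → A) (i : σ) : shift c (X i) = X i + C (c i) := aeval_X _ _

@[simp] lemma shift_C (c : σ → A) (a : A) : shift c (C a) = C a := by
  rw [← algebraMap_eq, AlgHom.commutes]

lemma dirD_shift (c v : σ → A) (p : MvPolynomial σ A) :
    dirD v (shift c p) = shift c (dirD v p) := by
  induction p using MvPolynomial.induction_on with
  | C a => simp
  | add p q hp hq => simp only [map_add, hp, hq]
  | mul_X p i hp =>
    rw [map_mul, Derivation.leibniz, Derivation.leibniz, hp, shift_X]
    simp

lemma shift_shift (c d : σ → A) (p : MvPolynomial σ A) :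
    shift c (shift d p) = shift (fun i => c i + d i) p := by
  have : (shift c).comp (shift d) = shift (fun i => c i + d i) := by
    refine algHom_ext fun i => ?_
    simp [add_assoc]
  rw [← this]; rfl

lemma shift_zero (p : MvPolynomial σ A) : shift (fun _ => (0 : A)) p = p := by
  have : shift (fun _ => (0 : A)) = AlgHom.id A (MvPolynomial σ A) := by
    refine algHom_ext fun i => ?_
    simp
  rw [this]; rfl

lemma map_dirD (f : A →+* B) (v : σ → A) (p : MvPolynomial σ A) :
    map f (dirD v p) = dirD (fun i => f (v i)) (map f p) := by
  induction p using MvPolynomial.induction_on with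
  | C a => simp
  | add p q hp hq => simp only [map_add, hp, hq]
  | mul_X p i hp => simp [Derivation.leibniz, hp]

variable [Algebra ℚ A] [Algebra ℚ B]

section Wick

variable [Fintype σ] [Fintype τ] {Q Q' : Matrix σ σ A}

lemma wick_C_mul (Q : Matrix σ σ A) (a : A) (p : MvPolynomial σ A) :
    wick Q (C a * p) = C a * wick Q p := by
  have h : (C a * p).totalDegree < p.totalDegree + 1 := by
    have := totalDegree_mul (C a) p
    rw [totalDegree_C] at this
    omega
  have hl : ∀ k, (wickOp Q)^[k] (C a * p) = C a * (wickOp Q)^[k] p := by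
    intro k
    induction k with
    | zero => rfl
    | succ k ih =>
      rw [Function.iterate_succ_apply', Function.iterate_succ_apply', ih, ← smul_eq_C_mul,
        map_smul, smul_eq_C_mul]
  rw [wick_eq_sum Q h, wick, Finset.mul_sum]
  refine Finset.sum_congr rfl fun k _ => ?_
  rw [hl, mul_smul_comm]

lemma wick_dirD (hQ : Q.IsSymm) (v : σ → A) (p : MvPolynomial σ A) :
    wick Q (dirD v p) = dirD v (wick Q p) := by
  induction p using MvPolynomial.induction_on with
  | C a =>
    rw [dirD_C, wick_C, dirD_C, ← C_0, wick_C]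
  | add p q hp hq => rw [map_add, wick_add, hp, hq, wick_add, map_add]
  | mul_X p i hp =>
    rw [mul_comm, Derivation.leibniz, dirD_X, smul_eq_mul, smul_eq_mul, wick_add,
      wick_X_mul hQ, mul_comm p, wick_C_mul, wick_X_mul hQ, hp, map_add, Derivation.leibniz, dirD_X,
      smul_eq_mul, smul_eq_mul, dirD_comm v]
    ring

lemma wick_sub (Q : Matrix σ σ A) (p q : MvPolynomial σ A) :
    wick Q (p - q) = wick Q p - wick Q q := map_sub (wickHom Q) p q

omit [Algebra ℚ A] [Fintype σ] in
lemma row_add (Q Q' : Matrix σ σ A) (i : σ) (p : MvPolynomial σ A) :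
    dirD ((Q + Q').row i) p = dirD (Q.row i) p + dirD (Q'.row i) p :=
  dirD_add (Q.row i) (Q'.row i) p

/-- The semigroup property. It allows integration over a single direction first, which is where the
pentagon is applied. -/
lemma wick_add_matrix (hQ : Q.IsSymm) (hQ' : Q'.IsSymm) (p : MvPolynomial σ A) :
    wick (Q + Q') p = wick Q (wick Q' p) := by
  induction p using MvPolynomial.induction_on with
  | C a => simp
  | add p q hp hq => simp only [wick_add, hp, hq]
  | mul_X p i hp =>
    rw [mul_comm, wick_X_mul (hQ.add hQ'), wick_X_mul hQ', wick_add, wick_X_mul hQ, wick_dirD hQ,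
      row_add, hp]
    ring

/-- Covariances push forward under linear maps. Neither invertibility nor equal dimensions are
needed, so the two variables of the pentagon may be replaced by arbitrary linear forms. -/
lemma wick_affineSubst {Q : Matrix τ τ A} (hQ : Q.IsSymm) (P : Matrix σ τ A) (c : σ → A)
    (p : MvPolynomial σ A) :
    wick Q (affineSubst P c p) = affineSubst P c (wick (P * Q * P.transpose) p) := by
  have hs : (P * Q * P.transpose).IsSymm := by
    simp [Matrix.IsSymm, Matrix.transpose_mul, hQ.eq, Matrix.mul_assoc]
  have hsum : ∀ (s : Finset τ) (f : τ → MvPolynomial τ A),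
      wick Q (∑ j ∈ s, f j) = ∑ j ∈ s, wick Q (f j) := fun s f => map_sum (wickHom Q) f s
  induction p using MvPolynomial.induction_on with
  | C a => simp
  | add p q hp hq => simp only [map_add, wick_add, hp, hq]
  | mul_X p i hp =>
    have h1 : dirD ((P * Q * P.transpose).row i) (wick (P * Q * P.transpose) p)
        = dirD (P.mulVec ((P * Q).row i)) (wick (P * Q * P.transpose) p) := by
      refine congrArg (fun v => dirD v _) ?_
      ext j
      simp [Matrix.row_apply, Matrix.mul_apply, Matrix.mulVec, dotProduct, mul_comm]
    have h2 : ∀ q : MvPolynomial τ A, dirD ((P * Q).row i) q =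
        ∑ j, C (P i j) * dirD (Q.row j) q := by
      intro q
      simp only [dirD_eq_sum, Finset.mul_sum]
      rw [Finset.sum_comm]
      refine Finset.sum_congr rfl fun k _ => ?_
      simp only [Matrix.row_apply, Matrix.mul_apply, map_sum, Finset.sum_mul, C_mul, mul_assoc]
    rw [mul_comm, map_mul, wick_X_mul hs, map_add, map_mul, h1, ← dirD_affineSubst, ← hp, h2,
      affineSubst_X, add_mul, wick_add, wick_C_mul, Finset.sum_mul, hsum, add_mul, Finset.sum_mul,
      add_right_comm, ← Finset.sum_add_distrib]
    congr 1
    refine Finset.sum_congr rfl fun j _ => ?_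
    rw [mul_assoc, wick_C_mul, wick_X_mul hQ]
    ring

lemma wick_mul_of_dirD_eq_zero (hQ : Q.IsSymm) {r : MvPolynomial σ A}
    (hr : ∀ i, dirD (Q.row i) r = 0) (p : MvPolynomial σ A) : wick Q (p * r) = wick Q p * r := by
  have hr0 : wick Q r = r := by
    have h0 : wickOp Q r = 0 := by simp [wickOp_apply, hr]
    rw [wick_eq_sum Q (Nat.lt_succ_self _), Finset.sum_range_succ', Finset.sum_eq_zero]
    · simp
    · intro k _
      rw [Function.iterate_succ_apply, h0, Function.iterate_fixed (map_zero _), smul_zero]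
  induction p using MvPolynomial.induction_on with
  | C a => rw [wick_C_mul, wick_C, hr0]
  | add p q hp hq => rw [add_mul, wick_add, wick_add, hp, hq, add_mul]
  | mul_X p i hp =>
    rw [mul_comm p, mul_assoc, wick_X_mul hQ, wick_X_mul hQ, hp, Derivation.leibniz, hr]
    simp only [smul_eq_mul]
    ring

lemma map_wick (f : A →+* B) (hQ : Q.IsSymm) (p : MvPolynomial σ A) :
    map f (wick Q p) = wick (Q.map f) (map f p) := by
  induction p using MvPolynomial.induction_on with
  | C a => simp
  | add p q hp hq => simp only [map_add, wick_add, hp, hq]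
  | mul_X p i hp =>
    rw [mul_comm, wick_X_mul hQ, map_mul, map_add, map_mul, map_X, wick_X_mul (hQ.map f), ← hp,
      map_dirD]
    rfl

/-- The linear form `∑ b_j X_j`. -/
def linForm (b : σ → A) : MvPolynomial σ A := ∑ j, C (b j) * X j

omit [Algebra ℚ A] in
@[simp] lemma dirD_linForm (v b : σ → A) : dirD v (linForm b) = C (v ⬝ᵥ b) := by
  simp [linForm, Derivation.leibniz, dotProduct, mul_comm]

omit [Algebra ℚ A] [Fintype σ] in
lemma isNilpotent_C {t : A} (ht : IsNilpotent t) : IsNilpotent (C t : MvPolynomial σ A) :=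
  ht.map C

omit [Fintype σ] in
lemma dirD_texp {t : A} (ht : IsNilpotent t) (v : σ → A) (a : MvPolynomial σ A) :
    dirD v (texp (C t) a) = C t * dirD v a * texp (C t) a :=
  Derivation.map_texp (isNilpotent_C ht) (dirD v) (dirD_C v t) a

lemma wick_texp {t : A} (ht : IsNilpotent t) (b : σ → A) :
    wick Q (texp (C t) (linForm b)) =
      texp (C t) (linForm b + C (t * (half A * (b ⬝ᵥ Q.mulVec b)))) := by
  classical
  set e := texp (C t) (linForm b) with he
  set c : A := t * (t * (half A * (b ⬝ᵥ Q.mulVec b))) with hc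
  have hop : wickOp Q e = C c * e := by
    rw [wickOp_apply]
    have : ∀ i, pderiv i (dirD (Q.row i) e) = C (t * t * (b i * (Q.mulVec b) i)) * e := by
      intro i
      rw [pderiv_eq_dirD, he, dirD_texp ht, dirD_linForm, ← C_mul, Derivation.leibniz, dirD_C,
        dirD_texp ht, dirD_linForm]
      simp only [smul_eq_mul, mul_zero, add_zero, ← C_mul, ← mul_assoc]
      refine congrArg (fun a => C a * _) ?_
      simp [Matrix.mulVec, Matrix.row]
      ring
    rw [Finset.sum_congr rfl fun i _ => this i, ← Finset.sum_mul,
      ← map_sum (C : A →+* MvPolynomial σ A), ← mul_assoc, ← C_mul,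
      hc]
    refine congrArg (fun a => C a * e) ?_
    simp only [dotProduct, Finset.mul_sum]
    refine Finset.sum_congr rfl fun i _ => ?_
    ring
  have hit : ∀ k, (wickOp Q)^[k] e = C c ^ k * e := by
    intro k
    induction k with
    | zero => simp
    | succ k ih =>
      rw [Function.iterate_succ_apply', ih, ← C_pow, ← smul_eq_C_mul, map_smul, hop, smul_eq_C_mul,
        ← mul_assoc, C_pow, pow_succ]
  have hcn : IsNilpotent c := ht.mul_left' _
  obtain ⟨n, hn⟩ := hcn
  -- The linear exponential is an eigenvector of the operator, with nilpotent eigenvalue `c`. This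
  -- bound is long enough to cut off both the series of `wick` and the exponential of `c`.
  have hn' : (C c : MvPolynomial σ A) ^ (n + e.totalDegree + 1) = 0 := by
    rw [← C_pow, pow_eq_zero_of_le (by omega) hn, C_0]
  rw [wick_eq_sum Q (show e.totalDegree < n + e.totalDegree + 1 by omega),
    texp_add (isNilpotent_C ht), ← he, texp, ← C_mul, ← hc, IsNilpotent.exp_eq_sum hn',
    Finset.mul_sum]
  refine Finset.sum_congr rfl fun k _ => ?_
  rw [hit, mul_smul_comm, mul_comm]

/-- Completing the square: a linear exponential under the average turns into a translation by `t Q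
b` and an elementary factor. -/
lemma wick_texp_mul {t : A} (ht : IsNilpotent t) (hQ : Q.IsSymm) (b : σ → A)
    (p : MvPolynomial σ A) :
    wick Q (texp (C t) (linForm b) * p) =
      texp (C t) (linForm b + C (t * (half A * (b ⬝ᵥ Q.mulVec b)))) *
        shift (fun i => t * Q.mulVec b i) (wick Q p) := by
  induction p using MvPolynomial.induction_on with
  | C a => rw [mul_comm, wick_C_mul, wick_texp ht, wick_C, shift_C, mul_comm]
  | add p q hp hq => rw [mul_add, wick_add, hp, hq, wick_add, map_add, mul_add]
  | mul_X p i hp =>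
    rw [mul_comm p, mul_left_comm, wick_X_mul hQ, hp, wick_X_mul hQ, map_add,
      map_mul (shift _), shift_X,
      Derivation.leibniz, dirD_texp ht, dirD_shift, map_add (dirD _), dirD_linForm, dirD_C]
    simp only [smul_eq_mul, add_zero]
    have : (C t * C (Q.row i ⬝ᵥ b) : MvPolynomial σ A) = C (t * Q.mulVec b i) := by
      rw [← C_mul]; rfl
    rw [this]
    ring

end Wick

/-! ### Derivations of the coefficients and the heat equation. -/

section Coefficients

/-- A derivation of the coefficients, applied to a polynomial. -/
def coeffDFun (D : Derivation ℚ A A) (p : MvPolynomial σ A) : MvPolynomial σ A :=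
  ∑ s ∈ p.support, monomial s (D (coeff s p))

lemma coeff_coeffDFun (D : Derivation ℚ A A) (p : MvPolynomial σ A) (s : σ →₀ ℕ) :
    coeff s (coeffDFun D p) = D (coeff s p) := by
  classical
  rw [coeffDFun, coeff_sum]
  simp only [coeff_monomial]
  rw [Finset.sum_ite_eq' p.support s]
  split_ifs with h
  · rfl
  · rw [notMem_support_iff.1 h, map_zero]

/-- The derivation of the polynomial ring that a derivation of the coefficients induces. -/
def coeffD (D : Derivation ℚ A A) : Derivation ℚ (MvPolynomial σ A) (MvPolynomial σ A) :=
  Derivation.mk'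
    { toFun := coeffDFun D
      map_add' := fun p q => by ext s; simp [coeff_coeffDFun]
      map_smul' := fun c p => by ext s; simp [coeff_coeffDFun] }
    fun p q => by
      classical
      ext s
      change coeff s (coeffDFun D (p * q)) = coeff s (p * coeffDFun D q + q * coeffDFun D p)
      rw [coeff_coeffDFun, coeff_add, coeff_mul, mul_comm q, coeff_mul, coeff_mul, map_sum,
        ← Finset.sum_add_distrib]
      refine Finset.sum_congr rfl fun x _ => ?_
      rw [Derivation.leibniz, coeff_coeffDFun, coeff_coeffDFun, smul_eq_mul, smul_eq_mul,
        mul_comm (coeff x.2 q)]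

lemma coeff_coeffD (D : Derivation ℚ A A) (p : MvPolynomial σ A) (s : σ →₀ ℕ) :
    coeff s (coeffD D p) = D (coeff s p) := coeff_coeffDFun D p s

@[simp] lemma coeffD_C (D : Derivation ℚ A A) (a : A) :
    coeffD D (C a : MvPolynomial σ A) = C (D a) := by
  classical
  ext s
  rw [coeff_coeffD, coeff_C, coeff_C]
  split_ifs <;> simp

@[simp] lemma coeffD_X (D : Derivation ℚ A A) (i : σ) :
    coeffD D (X i : MvPolynomial σ A) = 0 := by
  classical
  ext s
  rw [coeff_coeffD, coeff_X, coeff_zero]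
  split_ifs <;> simp

lemma coeffD_dirD (D : Derivation ℚ A A) (v : σ → A) (p : MvPolynomial σ A) :
    coeffD D (dirD v p) = dirD (fun i => D (v i)) p + dirD v (coeffD D p) := by
  induction p using MvPolynomial.induction_on with
  | C a => simp
  | add p q hp hq => simp only [map_add, hp, hq]; ring
  | mul_X p i hp =>
    simp only [Derivation.leibniz, map_add, dirD_X, coeffD_X, coeffD_C, hp, smul_eq_mul, map_zero]
    ring

/-- The heat equation: varying the covariance inserts one second-order operator. -/
lemma coeffD_wick [Fintype σ] {Q : Matrix σ σ A} (hQ : Q.IsSymm) (D : Derivation ℚ A A)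
    (p : MvPolynomial σ A) :
    coeffD D (wick Q p) = wick Q (coeffD D p) + wickOp (Q.map D) (wick Q p) := by
  induction p using MvPolynomial.induction_on with
  | C a => rw [wick_C, coeffD_C, wick_C, wickOp_C, add_zero]
  | add p q hp hq => simp only [wick_add, map_add, hp, hq]; ring
  | mul_X p i hp =>
    have hr : (fun j => D (Q.row i j)) = (Q.map D).row i := rfl
    rw [mul_comm, wick_X_mul hQ, map_add, Derivation.leibniz, coeffD_X, coeffD_dirD, hp, map_add,
      map_add, wickOp_X_mul (hQ.map D), wickOp_dirD, Derivation.leibniz, coeffD_X, smul_zero,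
      smul_zero, add_zero, add_zero, smul_eq_mul, smul_eq_mul, wick_X_mul hQ, hr]
    ring

end Coefficients

end MvPolynomial

/-! ### Evaluation of power series at nilpotent elements -/

section NilEval

variable {S S' : Type*} [CommRing S] [CommRing S']

/-- The evaluation of a power series at an element `w` with `w ^ N = 0`. -/
def nilEval (φ : S →+* S') {w : S'} {N : ℕ} (hw : w ^ N = 0) : S⟦X⟧ →+* S' where
  toFun f := ∑ n ∈ Finset.range N, φ (PowerSeries.coeff n f) * w ^ n
  map_zero' := by simp
  map_add' f g := by simp [add_mul, Finset.sum_add_distrib]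
  map_one' := by
    rcases N with _ | N
    · have : Subsingleton S' := subsingleton_of_zero_eq_one (by simpa using hw.symm)
      exact Subsingleton.elim _ _
    · rw [Finset.sum_range_succ', Finset.sum_eq_zero]
      · simp
      · intro n _
        simp [PowerSeries.coeff_one]
  map_mul' f g := by
    -- Multiplicativity reduces to polynomials: coefficients of a product below `N` depend only on
    -- the truncations of the factors.
    have hp : ∀ p : S[X], p.eval₂ φ w = ∑ n ∈ Finset.range N, φ (p.coeff n) * w ^ n := by
      intro p
      rw [Polynomial.eval₂_eq_sum_range' φ (n := N + p.natDegree + 1) (by omega)]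
      refine (Finset.sum_subset (Finset.range_mono (by omega)) fun n _ hn => ?_).symm
      rw [pow_eq_zero_of_le (by simpa using hn) hw, mul_zero]
    have hf : ∀ f : S⟦X⟧, ∑ n ∈ Finset.range N, φ (PowerSeries.coeff n f) * w ^ n
        = (PowerSeries.trunc N f).eval₂ φ w := by
      intro f
      rw [hp]
      refine Finset.sum_congr rfl fun n hn => ?_
      rw [PowerSeries.coeff_trunc, if_pos (Finset.mem_range.1 hn)]
    rw [hf f, hf g, ← Polynomial.eval₂_mul, hp]
    refine Finset.sum_congr rfl fun n hn => ?_
    rw [PowerSeries.coeff_mul_eq_coeff_trunc_mul_trunc f g (Finset.mem_range.1 hn),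
      ← Polynomial.coe_mul, Polynomial.coeff_coe]

lemma nilEval_apply (φ : S →+* S') {w : S'} {N : ℕ} (hw : w ^ N = 0) (f : S⟦X⟧) :
    nilEval φ hw f = ∑ n ∈ Finset.range N, φ (PowerSeries.coeff n f) * w ^ n := rfl

@[simp] lemma nilEval_C (φ : S →+* S') {w : S'} {N : ℕ} (hw : w ^ N = 0) (a : S) :
    nilEval φ hw (PowerSeries.C a) = φ a := by
  rcases N with _ | N
  · have : Subsingleton S' := subsingleton_of_zero_eq_one (by simpa using hw.symm)
    exact Subsingleton.elim _ _
  · rw [nilEval_apply, Finset.sum_range_succ', Finset.sum_eq_zero]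
    · simp
    · intro n _
      simp

@[simp] lemma nilEval_X (φ : S →+* S') {w : S'} {N : ℕ} (hw : w ^ N = 0) :
    nilEval φ hw PowerSeries.X = w := by
  rcases N with _ | _ | N
  · have : Subsingleton S' := subsingleton_of_zero_eq_one (by simpa using hw.symm)
    exact Subsingleton.elim _ _
  · rw [nilEval_apply]
    simpa using hw.symm
  · rw [nilEval_apply, Finset.sum_eq_single 1]
    · simp
    · intro n _ hn
      simp [PowerSeries.coeff_X, hn]
    · simp

lemma nilEval_isNilpotent (φ : S →+* S') {w : S'} {N : ℕ} (hw : w ^ N = 0) {F : S⟦X⟧}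
    (hF : PowerSeries.constantCoeff F = 0) : (nilEval φ hw F) ^ N = 0 := by
  obtain ⟨G, rfl⟩ := PowerSeries.X_dvd_iff.2 hF
  rw [map_mul, nilEval_X, mul_pow, hw, zero_mul]

variable [Algebra ℚ S] [Algebra ℚ S']

lemma coeff_formalExp {F : S⟦X⟧} (hF : PowerSeries.constantCoeff F = 0) {n N : ℕ} (h : n < N) :
    PowerSeries.coeff n (formalExp F) =
      ∑ d ∈ Finset.range N, (d.factorial : ℚ)⁻¹ • PowerSeries.coeff n (F ^ d) := by
  rw [formalExp, PowerSeries.coeff_subst' (PowerSeries.HasSubst.of_constantCoeff_zero' hF),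
    finsum_eq_sum_of_support_subset (s := Finset.range N)]
  · refine Finset.sum_congr rfl fun d _ => ?_
    simp
  · intro d hd
    by_contra hdN
    refine hd ?_
    have : PowerSeries.coeff n (F ^ d) = 0 := by
      obtain ⟨G, rfl⟩ := PowerSeries.X_dvd_iff.2 hF
      rw [mul_pow, PowerSeries.coeff_X_pow_mul', if_neg]
      have : N ≤ d := by simpa using hdN
      omega
    simp only [this, smul_zero]

lemma nilEval_formalExp (φ : S →+* S') {w : S'} {N : ℕ} (hw : w ^ N = 0) {F : S⟦X⟧}
    (hF : PowerSeries.constantCoeff F = 0) :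
    nilEval φ hw (formalExp F) = IsNilpotent.exp (nilEval φ hw F) := by
  rw [IsNilpotent.exp_eq_sum (nilEval_isNilpotent φ hw hF), nilEval_apply]
  have : ∀ d, nilEval φ hw F ^ d = ∑ n ∈ Finset.range N, φ (PowerSeries.coeff n (F ^ d)) * w ^ n :=
    fun d => by rw [← map_pow, nilEval_apply]
  simp only [this, Finset.smul_sum]
  rw [Finset.sum_comm]
  refine Finset.sum_congr rfl fun n hn => ?_
  rw [coeff_formalExp hF (Finset.mem_range.1 hn), map_sum, Finset.sum_mul]
  refine Finset.sum_congr rfl fun d _ => ?_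
  rw [map_rat_smul φ, smul_mul_assoc]

lemma formalExp_eq_subst {F : S⟦X⟧} (hF : PowerSeries.constantCoeff F = 0) :
    formalExp F = (PowerSeries.exp S).subst F := by
  have hs := PowerSeries.HasSubst.of_constantCoeff_zero' hF
  ext n
  rw [formalExp, PowerSeries.coeff_subst' hs, PowerSeries.coeff_subst' hs]
  refine finsum_congr fun d => ?_
  rw [PowerSeries.coeff_exp, PowerSeries.coeff_exp]
  simp [Algebra.smul_def]

lemma derivative_formalExp {F : S⟦X⟧} (hF : PowerSeries.constantCoeff F = 0) :
    PowerSeries.derivative S (formalExp F) = formalExp F * PowerSeries.derivative S F := by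
  rw [formalExp_eq_subst hF, PowerSeries.derivative_subst
    (PowerSeries.HasSubst.of_constantCoeff_zero' hF), PowerSeries.derivative_exp]

lemma constantCoeff_formalExp {F : S⟦X⟧} (hF : PowerSeries.constantCoeff F = 0) :
    PowerSeries.constantCoeff (formalExp F) = 1 := by
  rw [← PowerSeries.coeff_zero_eq_constantCoeff_apply, coeff_formalExp hF Nat.zero_lt_one]
  simp

end NilEval

/-! ### The generating series of the polylogarithms -/

section Polylog

variable {S : Type*} [CommRing S] [Algebra ℚ S]

/-- The value of the polynomial `Pₙ` at `u`. -/
def polylogAt (n : ℕ) (u : S) : S := Polynomial.aeval u (polylogPoly n)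

omit [Algebra ℚ S] in
lemma map_polylogAt {S' : Type*} [CommRing S'] (f : S →+* S') (n : ℕ) (u : S) :
    f (polylogAt n u) = polylogAt n (f u) := by
  have := Polynomial.hom_eval₂ (polylogPoly n) (algebraMap ℤ S) f u
  rw [polylogAt, polylogAt, Polynomial.aeval_def, Polynomial.aeval_def, this]
  congr 1
  exact RingHom.ext_int _ _

omit [Algebra ℚ S] in
lemma derivation_polylogAt {R : Type*} [CommRing R] [Algebra R S] (D : Derivation R S S) (n : ℕ)
    {u l : S} (hD : D u = l * (u + u ^ 2)) :
    D (polylogAt n u) = l * polylogAt (n + 1) u := by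
  have h := (D.restrictScalars ℤ).map_aeval (polylogPoly n) u
  change D (polylogAt n u) = _ • D u at h
  rw [h, hD, polylogAt, polylogPoly, map_mul, map_add, map_pow, Polynomial.aeval_X, smul_eq_mul]
  ring

/-- The exponent `-∑ P_{n-1}(u) Yⁿ / n!` -/
def polylogSeries (u : S) : S⟦X⟧ :=
  PowerSeries.mk fun n => if n = 0 then 0 else -((n.factorial : ℚ)⁻¹ • polylogAt (n - 1) u)

/-- The series `w = u e^Y / (1 + u - u e^Y)` solves `w' = w + w²` with `w(0) = u`. Its iterated
derivatives are therefore the polynomials `Pₙ` at `w`, and its coefficients are `Pₙ(u) / n!`. Since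
`-w` is the logarithmic derivative of the right side as well as the derivative of the exponent, the
two sides agree. -/
lemma formalExp_polylogSeries (u : S) :
    formalExp (polylogSeries u) = PowerSeries.C (1 + u) - PowerSeries.C u * PowerSeries.exp S := by
  set G : S⟦X⟧ := PowerSeries.C (1 + u) - PowerSeries.C u * PowerSeries.exp S with hG
  have hG0 : PowerSeries.constantCoeff G = ((1 : Sˣ) : S) := by simp [hG]
  set H : S⟦X⟧ := PowerSeries.invOfUnit G 1 with hH
  have hGH : H * G = 1 := by rw [mul_comm]; exact PowerSeries.mul_invOfUnit G 1 hG0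
  have dG : PowerSeries.derivative S G = - (PowerSeries.C u * PowerSeries.exp S) := by
    rw [hG, map_sub, PowerSeries.derivative_C, Derivation.leibniz, PowerSeries.derivative_C,
      PowerSeries.derivative_exp]
    simp
  have dH : PowerSeries.derivative S H = H ^ 2 * (PowerSeries.C u * PowerSeries.exp S) := by
    rw [Derivation.leibniz_of_mul_eq_one _ hGH, dG, smul_eq_mul]
    ring
  set w : S⟦X⟧ := PowerSeries.C u * PowerSeries.exp S * H with hw
  have dw : PowerSeries.derivative S w = 1 * (w + w ^ 2) := by
    rw [hw, Derivation.leibniz, Derivation.leibniz, PowerSeries.derivative_C, dH,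
      PowerSeries.derivative_exp]
    simp only [smul_eq_mul, mul_zero, add_zero]
    ring
  have hw0 : PowerSeries.constantCoeff w = u := by
    simp [hw, hH, PowerSeries.constantCoeff_invOfUnit]
  have hiter : ∀ n, (PowerSeries.derivative S)^[n] w = polylogAt n w := by
    intro n
    induction n with
    | zero => simp [polylogAt, polylogPoly]
    | succ n ih =>
      rw [Function.iterate_succ_apply', ih, derivation_polylogAt _ n dw, one_mul]
  have hcoeff : ∀ n, PowerSeries.coeff n w = (n.factorial : ℚ)⁻¹ • polylogAt n u := by
    intro n
    have h := PowerSeries.constantCoeff_iterate_derivative w n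
    rw [hiter, map_polylogAt, hw0] at h
    rw [h, ← nsmul_eq_mul, ← Nat.cast_smul_eq_nsmul ℚ, smul_smul, inv_mul_cancel₀ (by positivity), one_smul]
  have hF0 : PowerSeries.constantCoeff (polylogSeries u) = 0 := by
    rw [← PowerSeries.coeff_zero_eq_constantCoeff_apply, polylogSeries, PowerSeries.coeff_mk,
      if_pos rfl]
  have dF : PowerSeries.derivative S (polylogSeries u) = -w := by
    ext n
    rw [PowerSeries.coeff_derivative, map_neg, hcoeff, polylogSeries, PowerSeries.coeff_mk,
      if_neg (Nat.succ_ne_zero n), Nat.add_sub_cancel, Nat.factorial_succ, neg_mul, smul_mul_assoc,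
      mul_comm]
    have : polylogAt n u * ((n : S) + 1) = ((n + 1 : ℕ) : ℚ) • polylogAt n u := by
      rw [Nat.cast_smul_eq_nsmul, nsmul_eq_mul]; push_cast; ring
    rw [this, smul_smul]
    congr 2
    push_cast
    field_simp
  have key : formalExp (polylogSeries u) * H = 1 := by
    have : IsAddTorsionFree S := IsAddTorsionFree.of_module_rat S
    refine PowerSeries.derivative.ext ?_ ?_
    · rw [Derivation.leibniz, derivative_formalExp hF0, dF, dH, smul_eq_mul, smul_eq_mul,
        PowerSeries.derivative_one, hw]
      ring
    · rw [map_mul, constantCoeff_formalExp hF0, hH, PowerSeries.constantCoeff_invOfUnit]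
      simp
  calc formalExp (polylogSeries u) = formalExp (polylogSeries u) * (H * G) := by rw [hGH, mul_one]
    _ = G := by rw [← mul_assoc, key, one_mul]

lemma exp_polylogSum {w : S} {N : ℕ} (hw : w ^ N = 0) (u : S) :
    IsNilpotent.exp (-∑ m ∈ Finset.range N, ((m + 1).factorial : ℚ)⁻¹ •
      (w ^ (m + 1) * polylogAt m u)) = 1 + u - u * IsNilpotent.exp w := by
  have hF0 : PowerSeries.constantCoeff (polylogSeries u) = 0 := by
    rw [← PowerSeries.coeff_zero_eq_constantCoeff_apply, polylogSeries, PowerSeries.coeff_mk,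
      if_pos rfl]
  -- The exponent has no constant term, so `N` terms of the sum correspond to truncation at `N + 1`.
  have hw' : w ^ (N + 1) = 0 := pow_eq_zero_of_le (Nat.le_succ N) hw
  have h1 : nilEval (RingHom.id S) hw' (polylogSeries u) =
      -∑ m ∈ Finset.range N, ((m + 1).factorial : ℚ)⁻¹ • (w ^ (m + 1) * polylogAt m u) := by
    rw [nilEval_apply, Finset.sum_range_succ', ← Finset.sum_neg_distrib]
    simp [polylogSeries]
    refine Finset.sum_congr rfl fun m _ => ?_
    rw [mul_comm]
  have h2 : nilEval (RingHom.id S) hw' (PowerSeries.exp S) = IsNilpotent.exp w := by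
    rw [nilEval_apply, IsNilpotent.exp_eq_sum hw']
    refine Finset.sum_congr rfl fun m _ => ?_
    simp [PowerSeries.coeff_exp, Algebra.smul_def]
  have := congrArg (nilEval (RingHom.id S) hw') (formalExp_polylogSeries u)
  rwa [nilEval_formalExp _ _ hF0, h1, map_sub, map_mul, nilEval_C, nilEval_C, h2, RingHom.id_apply,
    RingHom.id_apply] at this

end Polylog

/-! ### Homogeneous Bernoulli polynomials -/

section Bernoulli

variable {S S' : Type*} [CommRing S] [Algebra ℚ S] [CommRing S'] [Algebra ℚ S']

/-- The homogeneous Bernoulli polynomial `tᵐ B_m(y / t)`. -/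
def bernH (m : ℕ) (t y : S) : S :=
  ∑ k ∈ Finset.range (m + 1), (bernoulli k * m.choose k : ℚ) • (t ^ k * y ^ (m - k))

lemma map_bernH (f : S →+* S') (m : ℕ) (t y : S) : f (bernH m t y) = bernH m (f t) (f y) := by
  simp [bernH, map_rat_smul f]

lemma bernH_eq_eval (m : ℕ) {t : ℚ} (ht : t ≠ 0) (y : ℚ) :
    bernH m t y = t ^ m * (Polynomial.bernoulli m).eval (y / t) := by
  rw [bernH, Polynomial.bernoulli, Polynomial.eval_finsetSum, Finset.mul_sum]
  refine Finset.sum_congr rfl fun k hk => ?_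
  have hk' : k ≤ m := Nat.lt_succ_iff.1 (Finset.mem_range.1 hk)
  obtain ⟨j, rfl⟩ := Nat.exists_eq_add_of_le hk'
  rw [Polynomial.eval_monomial, Nat.add_sub_cancel_left, smul_eq_mul, pow_add, div_pow]
  field_simp

lemma bernH_add_rat (m : ℕ) (t y : ℚ) :
    bernH (m + 1) t (y + t) = bernH (m + 1) t y + ((m + 1 : ℕ) : ℚ) • (t * y ^ m) := by
  rcases eq_or_ne t 0 with rfl | ht
  · simp
  · rw [bernH_eq_eval _ ht, bernH_eq_eval _ ht, add_div, div_self ht, add_comm (y / t),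
      Polynomial.bernoulli_eval_one_add, Nat.add_sub_cancel, mul_add, smul_eq_mul, div_pow, pow_succ]
    field_simp

/-- The homogeneous form of `B_m(x + 1) - B_m(x) = m x^(m-1)`. As an identity of polynomials over
`ℚ` it is checked at rational points, where division by `t` is possible, and then specialised to
nilpotent `t`. -/
lemma bernH_add (m : ℕ) (t y : S) :
    bernH (m + 1) t (y + t) = bernH (m + 1) t y + ((m + 1 : ℕ) : ℚ) • (t * y ^ m) := by
  have h : (bernH (m + 1) (MvPolynomial.X 0) (MvPolynomial.X 1 + MvPolynomial.X 0) :
      MvPolynomial (Fin 2) ℚ) = bernH (m + 1) (MvPolynomial.X 0) (MvPolynomial.X 1) +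
        ((m + 1 : ℕ) : ℚ) • (MvPolynomial.X 0 * MvPolynomial.X 1 ^ m) := by
    refine MvPolynomial.funext fun x => ?_
    rw [map_add, map_rat_smul (MvPolynomial.eval x), map_bernH, map_bernH]
    simp only [map_add, map_mul, map_pow, MvPolynomial.eval_X]
    exact bernH_add_rat m _ _
  have h' := congrArg (MvPolynomial.aeval ![t, y] : MvPolynomial (Fin 2) ℚ →ₐ[ℚ] S) h
  have hm : ∀ a b, (MvPolynomial.aeval ![t, y] : MvPolynomial (Fin 2) ℚ →ₐ[ℚ] S)
      (bernH (m + 1) a b) = bernH (m + 1) (MvPolynomial.aeval ![t, y] a)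
        (MvPolynomial.aeval ![t, y] b) := fun a b =>
    map_bernH (MvPolynomial.aeval ![t, y] : MvPolynomial (Fin 2) ℚ →ₐ[ℚ] S).toRingHom _ a b
  rw [map_add, map_smul, hm, hm] at h'
  simpa using h'

/-- The Appell property `B_m' = m B_(m-1)`. -/
lemma derivation_bernH {R : Type*} [CommRing R] [Algebra R S] (D : Derivation R S S) {t : S}
    (hD : D t = 0) (m : ℕ) (y : S) :
    D (bernH (m + 1) t y) = ((m + 1 : ℕ) : ℚ) • (bernH m t y * D y) := by
  rw [bernH, map_sum, Finset.sum_range_succ]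
  have h0 : D ((bernoulli (m + 1) * ((m + 1).choose (m + 1) : ℕ) : ℚ) •
      (t ^ (m + 1) * y ^ (m + 1 - (m + 1)))) = 0 := by
    rw [map_rat_smul D, Nat.sub_self, pow_zero, mul_one, D.leibniz_pow, hD, smul_zero, smul_zero,
      smul_zero]
  rw [h0, add_zero, bernH, Finset.sum_mul, Finset.smul_sum]
  refine Finset.sum_congr rfl fun k hk => ?_
  have hk' : k ≤ m := Nat.lt_succ_iff.1 (Finset.mem_range.1 hk)
  obtain ⟨j, rfl⟩ := Nat.exists_eq_add_of_le hk'
  rw [map_rat_smul D, D.leibniz, D.leibniz_pow, D.leibniz_pow, hD, smul_zero, smul_zero, smul_zero,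
    add_zero, Nat.add_sub_cancel_left, show k + j + 1 - k = j + 1 by omega, Nat.add_sub_cancel,
    smul_eq_mul, smul_eq_mul, smul_mul_assoc, smul_smul, ← Nat.cast_smul_eq_nsmul ℚ, mul_smul_comm,
    smul_smul, mul_assoc]
  refine congrArg₂ (· • ·) ?_ (by ring)
  have : (k + j + 1).choose k * (j + 1) = (k + j + 1) * (k + j).choose k := by
    have := Nat.choose_mul_succ_eq (k + j) k
    rw [show k + j + 1 - k = j + 1 by omega] at this
    lia
  have h2 : (((k + j + 1).choose k : ℕ) : ℚ) * ((j + 1 : ℕ) : ℚ) =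
      ((k + j + 1 : ℕ) : ℚ) * ((k + j).choose k : ℕ) := by exact_mod_cast this
  linear_combination (bernoulli k) * h2

lemma bernH_one (t y : S) : bernH 1 t y = y - MvPolynomial.half S * t := by
  simp only [bernH, Finset.sum_range_succ, MvPolynomial.half, Algebra.smul_def, bernoulli_one,
    Finset.range_zero, Finset.sum_empty, bernoulli_zero]
  rw [show (-1 / 2 * ((1 : ℕ).choose 1 : ℕ) : ℚ) = -(1 / 2) by norm_num, map_neg]
  simp
  ring

/-- Written so that `t` divides everything except `y ^ 2`, the one term that the condition `k + ℓ/2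
> 1` removes from this polynomial in the exponent of `ψ`. What is left is nilpotent. -/
lemma bernH_two (t y : S) : bernH 2 t y = y ^ 2 + t * (-y + (1 / 6 : ℚ) • t) := by
  simp [bernH, Finset.sum_range_succ, bernoulli_one, bernoulli_two, Nat.choose]
  rw [mul_add, mul_smul_comm]
  ring_nf

end Bernoulli

/-! ### The series `ψ` at a nilpotent parameter -/

section PsiNil

open MvPolynomial (half)

variable {S S' : Type*} [CommRing S] [Algebra ℚ S] [CommRing S'] [Algebra ℚ S']

/-- The exponent of `ψ`, at an element `t` with `t ^ N = 0` and with `u = z / (1 - z)`. -/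
def psiLog (N : ℕ) (t u y : S) : S :=
  -∑ m ∈ Finset.range N, ((m + 2).factorial : ℚ)⁻¹ •
    (t ^ m * (bernH (m + 2) t y - if m = 0 then y ^ 2 else 0) * polylogAt m u)

/-- The series `ψ`, at an element `t` with `t ^ N = 0` and with `u = z / (1 - z)`. -/
def psiNil (N : ℕ) (t u y : S) : S := IsNilpotent.exp (psiLog N t u y)

/-- The derivative of `psiLog` with respect to `y`. -/
def psiLogDeriv (N : ℕ) (t u y : S) : S :=
  u * y - ∑ m ∈ Finset.range N, ((m + 1).factorial : ℚ)⁻¹ •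
    (t ^ m * bernH (m + 1) t y * polylogAt m u)

variable {N : ℕ} {t : S}

lemma dvd_psiLog (N : ℕ) (t u y : S) : t ∣ psiLog N t u y := by
  rw [psiLog, dvd_neg]
  refine Finset.dvd_sum fun m _ => ?_
  rw [Algebra.smul_def]
  refine Dvd.dvd.mul_left (Dvd.dvd.mul_right ?_ _) _
  rcases m with _ | m
  · rw [if_pos rfl, bernH_two]
    exact ⟨-y + (1 / 6 : ℚ) • t, by ring⟩
  · exact Dvd.dvd.mul_right (dvd_pow_self t (Nat.succ_ne_zero m)) _

lemma isNilpotent_psiLog (ht : IsNilpotent t) (u y : S) : IsNilpotent (psiLog N t u y) := by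
  obtain ⟨a, ha⟩ := dvd_psiLog N t u y
  rw [ha]
  exact ht.mul_left' a

lemma isUnit_psiNil (ht : IsNilpotent t) (u y : S) : IsUnit (psiNil N t u y) :=
  IsNilpotent.isUnit_exp (isNilpotent_psiLog ht u y)

lemma map_psiNil (f : S →+* S') (ht : IsNilpotent t) (u y : S) :
    f (psiNil N t u y) = psiNil N (f t) (f u) (f y) := by
  rw [psiNil, IsNilpotent.map_exp (isNilpotent_psiLog ht u y), psiNil, psiLog, map_neg, map_sum,
    psiLog]
  congr 2
  refine Finset.sum_congr rfl fun m _ => ?_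
  rw [map_rat_smul f, map_mul, map_mul, map_sub, map_bernH, map_polylogAt, map_pow, apply_ite f,
    map_pow, map_zero]

/-- The functional equation of the quantum dilogarithm. Under `y ↦ y + t` each Bernoulli polynomial
changes by a monomial; the changes add up to the exponent of `exp_polylogSum`, which gives `1 + u -
u e^(ty)`. The omitted square `y ^ 2` accounts for the other exponential. -/
lemma psiNil_add (hN : 0 < N) (ht : t ^ N = 0) (u y : S) :
    psiNil N t u (y + t) =
      psiNil N t u y * ((1 + u - u * texp t y) * texp t (u * (y + half S * t))) := by
  have htn : IsNilpotent t := ⟨N, ht⟩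
  have hty : (t * y) ^ N = 0 := by rw [mul_pow, ht, zero_mul]
  set L := -∑ m ∈ Finset.range N, ((m + 1).factorial : ℚ)⁻¹ • ((t * y) ^ (m + 1) * polylogAt m u)
    with hL
  have hLn : IsNilpotent L := by
    refine IsNilpotent.neg (isNilpotent_sum fun m _ => ?_)
    rw [Algebra.smul_def, pow_succ, mul_comm _ (t * y), mul_assoc t, mul_assoc t, mul_left_comm]
    exact htn.mul_left' _
  rw [texp, ← exp_polylogSum hty, ← hL, psiNil, psiNil, texp, ← IsNilpotent.exp_add_of_commute
    (Commute.all _ _) hLn (htn.mul_left' _), ← IsNilpotent.exp_add_of_commute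
    (Commute.all _ _) (isNilpotent_psiLog htn _ _)
    ((Commute.all _ _).isNilpotent_add hLn (htn.mul_left' _))]
  congr 1
  obtain ⟨M, rfl⟩ : ∃ M, N = M + 1 := ⟨N - 1, by omega⟩
  have h : ∀ m, ((m + 2).factorial : ℚ)⁻¹ • (t ^ m * (bernH (m + 2) t (y + t) -
        if m = 0 then (y + t) ^ 2 else 0) * polylogAt m u) =
      ((m + 2).factorial : ℚ)⁻¹ • (t ^ m * (bernH (m + 2) t y -
        if m = 0 then y ^ 2 else 0) * polylogAt m u) +
      (((m + 1).factorial : ℚ)⁻¹ • ((t * y) ^ (m + 1) * polylogAt m u) -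
        if m = 0 then u * (t * (y + half S * t)) else 0) := by
    intro m
    have hf : ((m + 2).factorial : ℚ)⁻¹ * ((m + 1 + 1 : ℕ) : ℚ) = ((m + 1).factorial : ℚ)⁻¹ := by
      rw [Nat.factorial_succ (m + 1)]
      push_cast
      field_simp
    rw [bernH_add (m + 1) t y, ← hf, mul_smul]
    have h0 : (if m = 0 then u * (t * (y + half S * t)) else 0) =
        ((m + 2).factorial : ℚ)⁻¹ • (if m = 0 then 2 * (u * (t * (y + half S * t))) else 0) := by
      split_ifs with hm
      · subst hm
        have : (2 : S) = algebraMap ℚ S 2 := (map_ofNat (algebraMap ℚ S) 2).symm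
        rw [this, ← Algebra.smul_def, smul_smul]
        norm_num
      · simp
    rw [h0, ← smul_sub, ← smul_add]
    congr 1
    simp only [Algebra.smul_def]
    split_ifs with hm
    · subst hm
      simp only [polylogAt, polylogPoly, Polynomial.aeval_X]
      linear_combination (t ^ 2 * u) * MvPolynomial.half_mul_two (A := S)
    · ring
  rw [psiLog, psiLog, Finset.sum_congr rfl fun m _ => h m, Finset.sum_add_distrib,
    Finset.sum_sub_distrib, Finset.sum_ite_eq', hL]
  simp only [Finset.mem_range, Nat.succ_pos, if_true]
  ring

/-- Moving `u` along `u + u²` raises the index of the polylogarithm by one. By the Appell property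
the effect, after multiplication by `t`, is that of moving `y`, apart from the terms of lowest
index, which give the last summand. -/
lemma derivation_psiLog {R : Type*} [CommRing R] [Algebra R S] (D : Derivation R S S)
    (hN : 0 < N) (ht : t ^ N = 0) (hDt : D t = 0) {u l : S} (hDu : D u = l * (u + u ^ 2)) (y : S) :
    t * D (psiLog N t u y) = (t * D y + l) * psiLogDeriv N t u y +
      t * l * (half S * (y ^ 2 * (u + u ^ 2) - u)) := by
  obtain ⟨M, rfl⟩ : ∃ M, N = M + 1 := ⟨N - 1, by omega⟩
  have hf : ∀ m : ℕ, ((m + 2).factorial : ℚ)⁻¹ * ((m + 1 + 1 : ℕ) : ℚ) =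
      ((m + 1).factorial : ℚ)⁻¹ := by
    intro m
    rw [Nat.factorial_succ (m + 1)]
    push_cast
    field_simp
  have h : ∀ m, D (((m + 2).factorial : ℚ)⁻¹ • (t ^ m * (bernH (m + 2) t y -
        if m = 0 then y ^ 2 else 0) * polylogAt m u)) =
      (((m + 1).factorial : ℚ)⁻¹ • (t ^ m * bernH (m + 1) t y * polylogAt m u) * D y -
        if m = 0 then u * y * D y else 0) +
      (((m + 2).factorial : ℚ)⁻¹ • (t ^ m * bernH (m + 2) t y * polylogAt (m + 1) u) * l -
        if m = 0 then half S * y ^ 2 * l * (u + u ^ 2) else 0) := by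
    intro m
    have hD0 : D (t ^ m) = 0 := by rw [D.leibniz_pow, hDt, smul_zero, smul_zero]
    rw [map_rat_smul D, D.leibniz, D.leibniz, hD0, derivation_polylogAt D m hDu, map_sub,
      derivation_bernH D hDt, ← hf m]
    split_ifs with hm
    · subst hm
      have h2 : ((0 + 2).factorial : ℚ)⁻¹ = 1 / 2 := by norm_num
      rw [h2]
      simp only [Algebra.smul_def, map_mul]
      rw [show algebraMap ℚ S (1 / 2) = half S from rfl,
        show algebraMap ℚ S ((0 + 1 + 1 : ℕ) : ℚ) = 2 by rw [map_natCast]; norm_num]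
      simp only [polylogAt, polylogPoly, D.leibniz_pow, Polynomial.aeval_X, map_mul, map_add,
        map_pow, Polynomial.derivative_X, mul_one, smul_eq_mul, nsmul_eq_mul]
      push_cast
      linear_combination (-u * y * D y) * MvPolynomial.half_mul_two (A := S)
    · simp only [map_zero, sub_zero, smul_eq_mul, mul_zero, add_zero, Algebra.smul_def (R := ℚ),
        map_mul]
      ring
  -- After the index shift the top term carries `t ^ (M + 1) = 0`, and the missing bottom term is
  -- that of `B₁`.
  have hs : ∑ m ∈ Finset.range (M + 1), ((m + 2).factorial : ℚ)⁻¹ •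
        (t ^ (m + 1) * bernH (m + 2) t y * polylogAt (m + 1) u) =
      ∑ m ∈ Finset.range (M + 1), ((m + 1).factorial : ℚ)⁻¹ •
        (t ^ m * bernH (m + 1) t y * polylogAt m u) - (y - half S * t) * u := by
    rw [Finset.sum_range_succ, ht, Finset.sum_range_succ' _ M]
    simp [bernH_one, polylogAt, polylogPoly]
  have hs' : t * ∑ m ∈ Finset.range (M + 1), ((m + 2).factorial : ℚ)⁻¹ •
        (t ^ m * bernH (m + 2) t y * polylogAt (m + 1) u) =
      ∑ m ∈ Finset.range (M + 1), ((m + 2).factorial : ℚ)⁻¹ •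
        (t ^ (m + 1) * bernH (m + 2) t y * polylogAt (m + 1) u) := by
    rw [Finset.mul_sum]
    refine Finset.sum_congr rfl fun m _ => ?_
    rw [mul_smul_comm]
    congr 1
    ring
  rw [psiLog, map_neg, map_sum, Finset.sum_congr rfl fun m _ => h m, Finset.sum_add_distrib,
    Finset.sum_sub_distrib, Finset.sum_sub_distrib, Finset.sum_ite_eq', Finset.sum_ite_eq',
    ← Finset.sum_mul, ← Finset.sum_mul]
  simp only [Finset.mem_range, Nat.succ_pos, if_true]
  rw [psiLogDeriv]
  rw [hs] at hs'
  linear_combination (-l) * hs'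

lemma derivation_psiNil {R : Type*} [CommRing R] [Algebra R S] (D : Derivation R S S)
    (hN : 0 < N) (ht : t ^ N = 0) (hDt : D t = 0) {u l : S} (hDu : D u = l * (u + u ^ 2)) (y : S) :
    t * D (psiNil N t u y) = ((t * D y + l) * psiLogDeriv N t u y +
      t * l * (half S * (y ^ 2 * (u + u ^ 2) - u))) * psiNil N t u y := by
  rw [psiNil, D.map_nilpotent_exp (isNilpotent_psiLog ⟨N, ht⟩ u y), ← mul_assoc,
    derivation_psiLog D hN ht hDt hDu]

omit [Algebra ℚ S] in
lemma polylogAt_zero_right (m : ℕ) : polylogAt m (0 : S) = 0 := by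
  cases m <;> simp [polylogAt, polylogPoly]

omit [Algebra ℚ S] in
lemma polylogAt_neg_one (m : ℕ) : polylogAt (m + 1) (-1 : S) = 0 := by
  simp [polylogAt, polylogPoly]

@[simp] lemma psiNil_zero (N : ℕ) (t y : S) : psiNil N t 0 y = 1 := by
  simp [psiNil, psiLog, polylogAt_zero_right]

/-- Here `u = -1` is the shape `z = ∞`. Every `Pₙ` with `n ≥ 1` is divisible by `X + X²` and
vanishes there, so only `P₀` contributes. -/
lemma psiNil_neg_one (hN : 0 < N) (t y : S) :
    psiNil N t (-1) y = texp t (half S * (-y + (1 / 6 : ℚ) • t)) := by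
  obtain ⟨M, rfl⟩ : ∃ M, N = M + 1 := ⟨N - 1, by omega⟩
  rw [psiNil, psiLog, Finset.sum_range_succ', Finset.sum_eq_zero, texp]
  · congr 1
    rw [if_pos rfl, bernH_two]
    have h2 : ((0 + 2).factorial : ℚ)⁻¹ = 1 / 2 := by norm_num
    rw [h2, Algebra.smul_def, show algebraMap ℚ S (1 / 2) = half S from rfl]
    simp only [polylogAt, polylogPoly, Polynomial.aeval_X]
    ring
  · intro m _
    rw [polylogAt_neg_one, mul_zero, smul_zero]

-- Reindexes the exponent of `ψ` from the power `n = 2k + ℓ - 2` of `t` to the index `m = k + ℓ - 2`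
-- of the polylogarithm. The two ranges differ only in terms with `t ^ (m + k) = 0`; the excluded
-- pair `m = k = 0` is the omitted square.
omit [Algebra ℚ S] in
lemma sum_psiTerm (N : ℕ) (F : ℕ → ℕ → S) (ht : t ^ N = 0) :
    ∑ n ∈ Finset.range N, (if n = 0 then 0 else
      ∑ p ∈ (Finset.range (n + 3) ×ˢ Finset.range (n + 3)).filter
        (fun p => 2 * p.1 + p.2 = n + 2), F p.1 p.2) * t ^ n =
    ∑ m ∈ Finset.range N, ∑ k ∈ Finset.range (m + 3),
      if m = 0 ∧ k = 0 then 0 else F k (m + 2 - k) * t ^ (m + k) := by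
  have h1 : ∀ n ∈ Finset.range N, (if n = 0 then 0 else
      ∑ p ∈ (Finset.range (n + 3) ×ˢ Finset.range (n + 3)).filter
        (fun p => 2 * p.1 + p.2 = n + 2), F p.1 p.2) * t ^ n =
      ∑ p ∈ (Finset.range (n + 3) ×ˢ Finset.range (n + 3)).filter
        (fun p => 2 * p.1 + p.2 = n + 2 ∧ n ≠ 0), F p.1 p.2 * t ^ n := by
    intro n _
    split_ifs with hn
    · simp [hn]
    · simp [hn, Finset.sum_mul]
  rw [Finset.sum_congr rfl h1, Finset.sum_sigma', Finset.sum_sigma']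
  rw [← Finset.sum_filter_of_ne (s := (Finset.range N).sigma fun m => Finset.range (m + 3))
    (p := fun x => x.1 + x.2 < N ∧ ¬(x.1 = 0 ∧ x.2 = 0))]
  · refine Finset.sum_nbij' (fun x => ⟨x.2.1 + x.2.2 - 2, x.2.1⟩)
      (fun x => ⟨x.1 + x.2, (x.2, x.1 + 2 - x.2)⟩) ?_ ?_ ?_ ?_ ?_
    · rintro ⟨n, k, l⟩ h
      simp only [Finset.mem_sigma, Finset.mem_filter, Finset.mem_product, Finset.mem_range] at h ⊢
      omega
    · rintro ⟨m, k⟩ h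
      simp only [Finset.mem_sigma, Finset.mem_filter, Finset.mem_product, Finset.mem_range] at h ⊢
      omega
    · rintro ⟨n, k, l⟩ h
      simp only [Finset.mem_sigma, Finset.mem_filter, Finset.mem_product, Finset.mem_range] at h
      have h1 : k + l - 2 + k = n := by omega
      have h2 : k + l - 2 + 2 - k = l := by omega
      simp only [h1, h2]
    · rintro ⟨m, k⟩ h
      simp only [Finset.mem_sigma, Finset.mem_filter, Finset.mem_range] at h
      have h1 : k + (m + 2 - k) - 2 = m := by omega
      simp only [h1]
    · rintro ⟨n, k, l⟩ h
      simp only [Finset.mem_sigma, Finset.mem_filter, Finset.mem_product, Finset.mem_range] at h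
      have h1 : k + l - 2 + k = n := by omega
      have h2 : k + l - 2 + 2 - k = l := by omega
      have h3 : ¬(k + l - 2 = 0 ∧ k = 0) := by omega
      simp only [h1, h2, if_neg h3]
  · rintro ⟨m, k⟩ _ hne
    refine ⟨?_, fun h => hne (if_pos h)⟩
    by_contra hlt
    refine hne ?_
    simp only
    rw [pow_eq_zero_of_le (by simpa using hlt) ht, mul_zero, ite_self]

/-- The terms with `k + ℓ = m + 2` share the factor `Li_{-m}` and add up to a homogeneous Bernoulli
polynomial. This links the definition of `ψ` to the form in which its equations are proved. -/
lemma nilEval_psi {ι K : Type*} [Field K] [CharZero K] (φ : MvPolynomial ι K →+* S)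
    (ht : t ^ N = 0) (x : MvPolynomial ι K) (z : K) :
    nilEval φ ht (psi x z) = psiNil N t (φ (MvPolynomial.C (z / (1 - z)))) (φ x) := by
  have h0 : PowerSeries.constantCoeff (psiExponent x z) = 0 := by
    rw [← PowerSeries.coeff_zero_eq_constantCoeff_apply, psiExponent, PowerSeries.coeff_mk,
      if_pos rfl]
  have hQ : ∀ q : ℚ, φ (MvPolynomial.C (q : K)) = algebraMap ℚ S q := fun q => by
    have : (MvPolynomial.C (q : K) : MvPolynomial ι K) = algebraMap ℚ _ q := by
      rw [show ((q : K)) = algebraMap ℚ K q from (eq_ratCast _ q).symm]; rfl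
    rw [this, RingHom.map_rat_algebraMap]
  rw [psi, nilEval_formalExp _ _ h0, psiNil, psiLog, nilEval_apply]
  congr 1
  set G : ℕ → ℕ → S := fun k l => algebraMap ℚ S (bernoulli k * ((l.factorial : ℚ) * k.factorial)⁻¹)
    * polylogAt (k + l - 2) (φ (MvPolynomial.C (z / (1 - z)))) * φ x ^ l with hG
  have hc : ∀ n, φ (PowerSeries.coeff n (psiExponent x z)) * t ^ n = -((if n = 0 then 0 else
      ∑ p ∈ (Finset.range (n + 3) ×ˢ Finset.range (n + 3)).filter
        (fun p => 2 * p.1 + p.2 = n + 2), G p.1 p.2) * t ^ n) := by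
    intro n
    rw [psiExponent, PowerSeries.coeff_mk, ← neg_mul]
    congr 1
    split_ifs with hn
    · simp
    · rw [map_neg, map_sum]
      congr 1
      refine Finset.sum_congr rfl fun p _ => ?_
      have h1 : ((bernoulli p.1 : K) / ((p.2.factorial : K) * (p.1.factorial : K))) =
          ((bernoulli p.1 * ((p.2.factorial : ℚ) * p.1.factorial)⁻¹ : ℚ) : K) := by
        push_cast
        rw [div_eq_mul_inv]
      have h2 : φ (MvPolynomial.C (polylogNeg (p.1 + p.2 - 2) z)) =
          polylogAt (p.1 + p.2 - 2) (φ (MvPolynomial.C (z / (1 - z)))) := by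
        have := map_polylogAt (φ.comp MvPolynomial.C) (p.1 + p.2 - 2) (z / (1 - z))
        exact this
      rw [map_mul, map_pow, h1, MvPolynomial.C_mul, map_mul, hQ, h2]
  rw [Finset.sum_congr rfl fun n _ => hc n, Finset.sum_neg_distrib, sum_psiTerm N G ht]
  congr 1
  refine Finset.sum_congr rfl fun m _ => ?_
  have hb : bernH (m + 2) t (φ x) - (if m = 0 then φ x ^ 2 else 0) =
      ∑ k ∈ Finset.range (m + 3), (if m = 0 ∧ k = 0 then 0 else
        (bernoulli k * (m + 2).choose k : ℚ) • (t ^ k * φ x ^ (m + 2 - k))) := by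
    rw [bernH, Finset.sum_range_succ', Finset.sum_range_succ' _ (m + 2)]
    simp only [Nat.add_eq_zero_iff, one_ne_zero, and_false, if_false, and_true]
    split_ifs with hm
    · subst hm; simp
    · simp
  rw [hb, Finset.mul_sum, Finset.sum_mul, Finset.smul_sum]
  refine Finset.sum_congr rfl fun k hk => ?_
  split_ifs with hmk
  · simp
  · have hk' : k ≤ m + 2 := by have := Finset.mem_range.1 hk; omega
    rw [hG]
    simp only
    rw [show k + (m + 2 - k) - 2 = m by omega, mul_smul_comm, smul_mul_assoc, smul_smul,
      Algebra.smul_def]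
    have : (bernoulli k * (((m + 2 - k).factorial : ℚ) * k.factorial)⁻¹) =
        ((m + 2).factorial : ℚ)⁻¹ * (bernoulli k * (m + 2).choose k) := by
      rw [Nat.cast_choose ℚ hk']
      have := Nat.factorial_pos (m + 2)
      field_simp
    rw [this, pow_add]
    ring

end PsiNil

/-! ### The difference equation of a Gaussian average of ψ. -/

namespace MvPolynomial

variable {σ A : Type*} [CommRing A] [Algebra ℚ A]

section General

variable [Fintype σ] {Q : Matrix σ σ A} {N : ℕ} {t : A}

lemma wick_shift (hQ : Q.IsSymm) (c : σ → A) (p : MvPolynomial σ A) :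
    wick Q (shift c p) = shift c (wick Q p) := by
  induction p using MvPolynomial.induction_on with
  | C a => simp
  | add p q hp hq => simp only [map_add, wick_add, hp, hq]
  | mul_X p i hp =>
    rw [mul_comm, map_mul, shift_X, add_mul, wick_add, wick_C_mul, wick_X_mul hQ, wick_X_mul hQ,
      hp, map_add, map_mul, shift_X, dirD_shift]
    ring

omit [Fintype σ] in
lemma shift_psiNil (ht : IsNilpotent t) (c : σ → A) (u y : MvPolynomial σ A) :
    shift c (psiNil N (C t) u y) = psiNil N (C t) (shift c u) (shift c y) := by
  have := map_psiNil (N := N) (shift c : MvPolynomial σ A →+* MvPolynomial σ A)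
    (isNilpotent_C ht) u y
  simpa using this

omit [Fintype σ] in
lemma shift_texp (ht : IsNilpotent t) (c : σ → A) (a : MvPolynomial σ A) :
    shift c (texp (C t) a) = texp (C t) (shift c a) := by
  have := map_texp (isNilpotent_C ht) (shift c : MvPolynomial σ A →+* MvPolynomial σ A) a
  simpa using this

omit [Algebra ℚ A] in
lemma linForm_single [DecidableEq σ] (i : σ) (c : A) : linForm (Pi.single i c) = C c * X i := by
  rw [linForm, Finset.sum_eq_single i]
  · simp
  · intro j _ hj; simp [hj]
  · simp

omit [Algebra ℚ A] [Fintype σ] in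
lemma C_pow_eq_zero (ht : t ^ N = 0) : (C t : MvPolynomial σ A) ^ N = 0 := by
  rw [← C_pow, ht, C_0]

/-- The Gaussian average of `ψ(X_i) p` satisfies a difference equation. -/
lemma shift_wick_psiNil [DecidableEq σ] (hN : 0 < N) (ht : t ^ N = 0) (hQ : Q.IsSymm) (i : σ)
    (U : A) {p : MvPolynomial σ A} (hp : shift (Pi.single i t) p = p) :
    shift (Pi.single i t) (wick Q (psiNil N (C t) (C U) (X i) * p)) =
      C (1 + U) * texp (C t) (C U * X i + C (t * (half A * (U + U ^ 2 * Q i i)))) *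
        shift (fun j => t * (U * Q i j)) (wick Q (psiNil N (C t) (C U) (X i) * p)) -
      C U * texp (C t) (C (1 + U) * X i + C (t * (half A * (U + (1 + U) ^ 2 * Q i i)))) *
        shift (fun j => t * ((1 + U) * Q i j)) (wick Q (psiNil N (C t) (C U) (X i) * p)) := by
  have htn : IsNilpotent t := ⟨N, ht⟩
  have htC : IsNilpotent (C t : MvPolynomial σ A) := isNilpotent_C htn
  set F := psiNil N (C t) (C U) (X i) * p with hF
  have hb : ∀ c : A, (Pi.single i c ⬝ᵥ Q.mulVec (Pi.single i c)) = c ^ 2 * Q i i := by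
    intro c
    rw [single_dotProduct, Matrix.mulVec, dotProduct_single]
    ring
  have hs : ∀ c : A, (fun j => t * Q.mulVec (Pi.single i c) j) = fun j => t * (c * Q i j) := by
    intro c
    ext j
    simp [Matrix.mulVec_single, hQ.apply i j, mul_comm]
  have key : ∀ c : A, wick Q (texp (C t) (C c * X i) * F) =
      texp (C t) (C c * X i + C (t * (half A * (c ^ 2 * Q i i)))) *
        shift (fun j => t * (c * Q i j)) (wick Q F) := by
    intro c
    rw [← linForm_single, wick_texp_mul htn hQ, hb, hs]
  have hhalf : half (MvPolynomial σ A) = C (half A) := (map_half (C : A →+* MvPolynomial σ A)).symm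
  -- By `psiNil_add` the shifted integrand is a combination of the integrand times the exponentials
  -- of `U X_i` and of `(1 + U) X_i`. Inside the average each exponential becomes a translation.
  have h1 : shift (Pi.single i t) F =
      C (1 + U) * (texp (C t) (C (half A * (U * t))) * (texp (C t) (C U * X i) * F)) -
      C U * (texp (C t) (C (half A * (U * t))) * (texp (C t) (C (1 + U) * X i) * F)) := by
    rw [hF, map_mul, hp, shift_psiNil htn, shift_C, shift_X, Pi.single_eq_same,
      psiNil_add hN (C_pow_eq_zero ht), hhalf,
      show C U * (X i + C (half A) * C t) = C (half A * (U * t)) + C U * X i by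
        simp only [C_mul]; ring,
      show C (1 + U) * X i = X i + C U * X i by simp only [C_add, C_1]; ring,
      texp_add htC, texp_add htC, C_add, C_1]
    ring
  have hC : texp (C t) (C (half A * (U * t))) = C (texp t (half A * (U * t))) :=
    (map_texp htn (C : A →+* MvPolynomial σ A) _).symm
  rw [← wick_shift hQ, h1, wick_sub, wick_C_mul, wick_C_mul, hC, wick_C_mul, wick_C_mul, key, key,
    ← hC]
  have e1 : texp (C t) (C (half A * (U * t))) *
      texp (C t) (C U * X i + C (t * (half A * (U ^ 2 * Q i i)))) =
      texp (C t) (C U * X i + C (t * (half A * (U + U ^ 2 * Q i i)))) := by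
    rw [← texp_add htC]
    congr 1
    simp only [C_mul, C_add]
    ring
  have e2 : texp (C t) (C (half A * (U * t))) *
      texp (C t) (C (1 + U) * X i + C (t * (half A * ((1 + U) ^ 2 * Q i i)))) =
      texp (C t) (C (1 + U) * X i + C (t * (half A * (U + (1 + U) ^ 2 * Q i i)))) := by
    rw [← texp_add htC]
    congr 1
    simp only [C_mul, C_add]
    ring
  rw [← e1, ← e2]
  ring

end General

end MvPolynomial

namespace MvPolynomial

/-! ### The two sides of the pentagon identity and their difference equations -/

section Pentagon

variable {A : Type*} [CommRing A] [Algebra ℚ A]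

/-- The quadratic form of the Gaussian average on the left of the pentagon identity. -/
def pentMatrix (τ : A) : Matrix (Fin 2) (Fin 2) A := !![τ, -τ; -τ, τ]

omit [Algebra ℚ A] in
lemma pentMatrix_isSymm (τ : A) : (pentMatrix τ).IsSymm := by
  ext i j
  fin_cases i <;> fin_cases j <;> rfl

/-- The left hand side of the pentagon identity. -/
def pentLeft (N : ℕ) (t U V τ : A) : MvPolynomial (Fin 2) A :=
  wick (pentMatrix τ) (psiNil N (C t) (C U) (X 0) * psiNil N (C t) (C V) (X 1))

/-- The linear form `U X₀ - (1 + V) X₁`. -/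
def pentForm₁ (U V : A) : MvPolynomial (Fin 2) A := C U * X 0 - C (1 + V) * X 1

/-- The linear form `V X₁ - (1 + U) X₀`. -/
def pentForm₂ (U V : A) : MvPolynomial (Fin 2) A := C V * X 1 - C (1 + U) * X 0

/-- The exponent of the elementary factor on the right of the pentagon identity. -/
def pentExponent (t U V τ : A) : MvPolynomial (Fin 2) A :=
  C (t * (algebraMap ℚ A (5 / 24) + half A ^ 3 * τ)) +
    C (half A * τ) * (C (1 + U) * pentForm₁ U V + C (1 + V) * pentForm₂ U V)

/-- The right hand side of the pentagon identity. -/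
def pentRight (N : ℕ) (t U V τ : A) : MvPolynomial (Fin 2) A :=
  texp (C t) (pentExponent t U V τ) *
    (psiNil N (C t) (C (U * V * τ)) (X 0 + X 1) *
      psiNil N (C t) (C (-((1 + U) * τ))) (pentForm₁ U V + C (half A * t)) *
      psiNil N (C t) (C (-((1 + V) * τ))) (pentForm₂ U V + C (half A * t)))

variable {N : ℕ} {t U V τ : A}

/-- The difference equation of the first factor, normalised by a translation so that it involves
`pentLeft` and just two of its translates. The equation of the second factor can be brought to the
same three translates, and this makes elimination possible. -/
lemma shift_pentLeft_fst (hN : 0 < N) (ht : t ^ N = 0) (hτ : τ * (1 + U + V) = 1) :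
    shift ![t * ((1 + V) * τ), t * (U * τ)] (pentLeft N t U V τ) =
      C (1 + U) * texp (C t) (C U * (X 0 - C (t * (U * τ))) +
        C (t * (half A * (U + U ^ 2 * τ)))) * pentLeft N t U V τ -
      C U * texp (C t) (C (1 + U) * (X 0 - C (t * (U * τ))) +
        C (t * (half A * (U + (1 + U) ^ 2 * τ)))) *
          shift ![t * τ, -(t * τ)] (pentLeft N t U V τ) := by
  have htn : IsNilpotent t := ⟨N, ht⟩
  have h := shift_wick_psiNil hN ht (pentMatrix_isSymm τ) 0 U
    (p := psiNil N (C t) (C V) (X 1)) (by rw [shift_psiNil htn]; simp)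
  -- This translation undoes the one in the first term on the right, because `(1 + V) τ - 1 = -U τ`.
  have h' := congrArg (shift ![t * ((1 + V) * τ) - t, t * (U * τ)]) h
  simp only [map_sub, map_mul, shift_shift, shift_texp htn, shift_C, map_add, shift_X] at h'
  have e1 : (fun i => (![t * ((1 + V) * τ) - t, t * (U * τ)] : Fin 2 → A) i +
      (Pi.single 0 t : Fin 2 → A) i) = ![t * ((1 + V) * τ), t * (U * τ)] := by
    ext i
    fin_cases i <;> simp
  have e2 : (fun i => (![t * ((1 + V) * τ) - t, t * (U * τ)] : Fin 2 → A) i +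
      t * (U * pentMatrix τ 0 i)) = fun _ => 0 := by
    ext i
    fin_cases i <;> simp [pentMatrix]
    linear_combination t * hτ
  have e3 : (fun i => (![t * ((1 + V) * τ) - t, t * (U * τ)] : Fin 2 → A) i +
      t * ((1 + U) * pentMatrix τ 0 i)) = ![t * τ, -(t * τ)] := by
    ext i
    fin_cases i <;> simp [pentMatrix]
    · linear_combination t * hτ
    · ring
  have e4 : (X 0 : MvPolynomial (Fin 2) A) +
      C ((![t * ((1 + V) * τ) - t, t * (U * τ)] : Fin 2 → A) 0) = X 0 - C (t * (U * τ)) := by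
    rw [sub_eq_add_neg (X _) (C _), ← C_neg]
    refine congrArg₂ _ rfl (congrArg _ ?_)
    rw [Matrix.cons_val_zero]
    linear_combination t * hτ
  rw [e1, e2, e3, e4, shift_zero] at h'
  simpa [pentLeft, pentMatrix] using h'

lemma shift_pentLeft_snd (hN : 0 < N) (ht : t ^ N = 0) (hτ : τ * (1 + U + V) = 1) :
    shift ![t * ((1 + V) * τ), t * (U * τ)] (pentLeft N t U V τ) =
      C (1 + V) * texp (C t) (C V * (X 1 - C (t * ((1 + V) * τ))) +
        C (t * (half A * (V + V ^ 2 * τ)))) * shift ![t * τ, -(t * τ)] (pentLeft N t U V τ) -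
      C V * texp (C t) (C (1 + V) * (X 1 - C (t * ((1 + V) * τ))) +
        C (t * (half A * (V + (1 + V) ^ 2 * τ)))) * pentLeft N t U V τ := by
  have htn : IsNilpotent t := ⟨N, ht⟩
  have h := shift_wick_psiNil hN ht (pentMatrix_isSymm τ) 1 V
    (p := psiNil N (C t) (C U) (X 0)) (by rw [shift_psiNil htn]; simp)
  have h' := congrArg (shift ![t * ((1 + V) * τ), t * (U * τ) - t]) h
  simp only [map_sub, map_mul, shift_shift, shift_texp htn, shift_C, map_add, shift_X] at h'
  have e1 : (fun i => (![t * ((1 + V) * τ), t * (U * τ) - t] : Fin 2 → A) i +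
      (Pi.single 1 t : Fin 2 → A) i) = ![t * ((1 + V) * τ), t * (U * τ)] := by
    ext i
    fin_cases i <;> simp
  have e2 : (fun i => (![t * ((1 + V) * τ), t * (U * τ) - t] : Fin 2 → A) i +
      t * ((1 + V) * pentMatrix τ 1 i)) = fun _ => 0 := by
    ext i
    fin_cases i <;> simp [pentMatrix]
    linear_combination t * hτ
  have e3 : (fun i => (![t * ((1 + V) * τ), t * (U * τ) - t] : Fin 2 → A) i +
      t * (V * pentMatrix τ 1 i)) = ![t * τ, -(t * τ)] := by
    ext i
    fin_cases i <;> simp [pentMatrix]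
    · ring
    · linear_combination t * hτ
  have e4 : (X 1 : MvPolynomial (Fin 2) A) +
      C ((![t * ((1 + V) * τ), t * (U * τ) - t] : Fin 2 → A) 1) = X 1 - C (t * ((1 + V) * τ)) := by
    rw [sub_eq_add_neg (X _) (C _), ← C_neg]
    refine congrArg₂ _ rfl (congrArg _ ?_)
    rw [Matrix.cons_val_one]
    simp
    linear_combination t * hτ
  rw [e1, e2, e3, e4, shift_zero] at h'
  rw [mul_comm (psiNil N (C t) (C V) (X 1))] at h'
  simpa [pentLeft, pentMatrix] using h'

/-- Two linear relations between three translates, solved for two first-order ones. The factors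
`E₁`, `E₂` stand for exponentials of the arguments of the last two `ψ` on the right of the pentagon.
-/
lemma combine_difference {S : Type*} [CommRing S] {u v τ H H₁ H₂ a₁ a₂ b₁ b₂ E₁ E₂ : S}
    (hA : H₂ = (1 + u) * a₁ * H - u * a₂ * H₁) (hB : H₂ = (1 + v) * b₁ * H₁ - v * b₂ * H)
    (h₁ : a₁ = b₂ * E₁) (h₂ : b₁ = a₂ * E₂) :
    a₂ * (u * τ + (1 + v) * τ * E₂) * H₁ = b₂ * (v * τ + (1 + u) * τ * E₁) * H ∧
    (u * τ + (1 + v) * τ * E₂) * H₂ =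
      b₂ * τ * ((1 + u) * (1 + v) * (E₁ * E₂) - u * v) * H := by
  subst h₁ h₂
  have h : a₂ * (u * τ + (1 + v) * τ * E₂) * H₁ = b₂ * (v * τ + (1 + u) * τ * E₁) * H := by
    linear_combination τ * (hA - hB)
  refine ⟨h, ?_⟩
  linear_combination (u * τ + (1 + v) * τ * E₂) * hA - u * h

/-- The linear forms are such that each of the two translations moves every argument on the right of
the pentagon by `0`, `t` or `-t`, so that `psiNil_add` applies there. -/
lemma shift_pentForm₁_fst (hτ : τ * (1 + U + V) = 1) :
    shift ![t * τ, -(t * τ)] (pentForm₁ U V) = pentForm₁ U V + C t := by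
  have hC := congrArg (C : A → MvPolynomial (Fin 2) A) hτ
  simp only [pentForm₁, map_sub, map_add, map_mul, shift_X, shift_C, map_one, C_1, C_neg,
    Matrix.cons_val_zero, Matrix.cons_val_one] at hC ⊢
  linear_combination C t * hC

lemma shift_pentForm₂_fst (hτ : τ * (1 + U + V) = 1) :
    shift ![t * τ, -(t * τ)] (pentForm₂ U V) = pentForm₂ U V - C t := by
  have hC := congrArg (C : A → MvPolynomial (Fin 2) A) hτ
  simp only [pentForm₂, map_sub, map_add, map_mul, shift_X, shift_C, map_one, C_1, C_neg,
    Matrix.cons_val_zero, Matrix.cons_val_one] at hC ⊢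
  linear_combination -C t * hC

lemma shift_pentForm₁_snd :
    shift ![t * ((1 + V) * τ), t * (U * τ)] (pentForm₁ U V) = pentForm₁ U V := by
  simp only [pentForm₁, map_sub, map_add, map_mul, shift_X, shift_C, map_one, C_1,
    Matrix.cons_val_zero, Matrix.cons_val_one]
  ring

lemma shift_pentForm₂_snd (hτ : τ * (1 + U + V) = 1) :
    shift ![t * ((1 + V) * τ), t * (U * τ)] (pentForm₂ U V) = pentForm₂ U V - C t := by
  have hC := congrArg (C : A → MvPolynomial (Fin 2) A) hτ
  simp only [pentForm₂, map_sub, map_add, map_mul, shift_X, shift_C, map_one, C_1,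
    Matrix.cons_val_zero, Matrix.cons_val_one] at hC ⊢
  linear_combination -C t * hC

lemma C_half : (C (half A) : MvPolynomial (Fin 2) A) = half (MvPolynomial (Fin 2) A) :=
  map_half (C : A →+* MvPolynomial (Fin 2) A)

/-- The factor by which `ψ` changes under a shift of its argument. -/
def stepFactor (t w y : A) : A := 1 + w - w * texp t y

lemma isUnit_stepFactor (ht : IsNilpotent t) (w y : A) : IsUnit (stepFactor t w y) := by
  have h := ((Commute.all (-w) (texp t y - 1)).isNilpotent_mul_left
    (texp_sub_one ht y)).isUnit_one_add
  rwa [show 1 + -w * (texp t y - 1) = stepFactor t w y by rw [stepFactor]; ring] at h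

lemma shift_pentRight_fst (hN : 0 < N) (ht : t ^ N = 0) (hτ : τ * (1 + U + V) = 1) :
    texp (C t) (C (1 + U) * (X 0 - C (t * (U * τ))) +
        C (t * (half A * (U + (1 + U) ^ 2 * τ)))) *
      stepFactor (C t) (C (-((1 + V) * τ))) (pentForm₂ U V + C (half A * t) - C t) *
      shift ![t * τ, -(t * τ)] (pentRight N t U V τ) =
    texp (C t) (C (1 + V) * (X 1 - C (t * ((1 + V) * τ))) +
        C (t * (half A * (V + (1 + V) ^ 2 * τ)))) *
      stepFactor (C t) (C (-((1 + U) * τ))) (pentForm₁ U V + C (half A * t)) *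
      pentRight N t U V τ := by
  have htn : IsNilpotent t := ⟨N, ht⟩
  have htC : IsNilpotent (C t : MvPolynomial (Fin 2) A) := isNilpotent_C htn
  have hC := congrArg (C : A → MvPolynomial (Fin 2) A) hτ
  have hh := C_half_mul_two (σ := Fin 2) (A := A)
  set α := (C (1 + U) * (X 0 - C (t * (U * τ))) +
        C (t * (half A * (U + (1 + U) ^ 2 * τ))) : MvPolynomial (Fin 2) A) with hα
  set β := (C (1 + V) * (X 1 - C (t * ((1 + V) * τ))) +
        C (t * (half A * (V + (1 + V) ^ 2 * τ))) : MvPolynomial (Fin 2) A) with hβ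
  set Y₁ := (pentForm₁ U V + C (half A * t) : MvPolynomial (Fin 2) A) with hY₁
  set Y₂ := (pentForm₂ U V + C (half A * t) - C t : MvPolynomial (Fin 2) A) with hY₂
  have hR : pentRight N t U V τ = texp (C t) (pentExponent t U V τ) *
      (psiNil N (C t) (C (U * V * τ)) (X 0 + X 1) * psiNil N (C t) (C (-((1 + U) * τ))) Y₁ *
        psiNil N (C t) (C (-((1 + V) * τ))) (Y₂ + C t)) := by
    rw [pentRight, hY₂, sub_add_cancel]
  have hS : shift ![t * τ, -(t * τ)] (pentRight N t U V τ) =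
      texp (C t) (shift ![t * τ, -(t * τ)] (pentExponent t U V τ)) *
        (psiNil N (C t) (C (U * V * τ)) (X 0 + X 1) *
        psiNil N (C t) (C (-((1 + U) * τ))) (Y₁ + C t) *
        psiNil N (C t) (C (-((1 + V) * τ))) Y₂) := by
    have h0 : shift ![t * τ, -(t * τ)] (X 0 + X 1 : MvPolynomial (Fin 2) A) = X 0 + X 1 := by
      simp only [map_add, shift_X, Matrix.cons_val_zero, Matrix.cons_val_one, C_neg]
      ring
    have h1 : shift ![t * τ, -(t * τ)] Y₁ = Y₁ + C t := by
      rw [hY₁, map_add, shift_C, shift_pentForm₁_fst hτ]; ring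
    have h2 : shift ![t * τ, -(t * τ)] (pentForm₂ U V + C (half A * t)) = Y₂ := by
      rw [hY₂, map_add, shift_C, shift_pentForm₂_fst hτ]; ring
    rw [pentRight, map_mul, map_mul, map_mul, shift_texp htn, shift_psiNil htn, shift_psiNil htn,
      shift_psiNil htn, shift_C, shift_C, shift_C, h0, h1, h2]
  rw [hS, hR, psiNil_add hN (C_pow_eq_zero ht) _ Y₁, psiNil_add hN (C_pow_eq_zero ht) _ Y₂,
    ← stepFactor, ← stepFactor]
  have key : texp (C t) α * texp (C t) (shift ![t * τ, -(t * τ)] (pentExponent t U V τ)) *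
      texp (C t) (C (-((1 + U) * τ)) * (Y₁ + half (MvPolynomial (Fin 2) A) * C t)) =
      texp (C t) β * texp (C t) (pentExponent t U V τ) *
      texp (C t) (C (-((1 + V) * τ)) * (Y₂ + half (MvPolynomial (Fin 2) A) * C t)) := by
    rw [← texp_add htC, ← texp_add htC, ← texp_add htC, ← texp_add htC]
    refine congrArg (texp (C t)) ?_
    rw [hY₁, hY₂, hα, hβ, ← C_half]
    simp only [pentExponent, map_add, map_mul, map_one, shift_C, shift_pentForm₁_fst hτ,
      shift_pentForm₂_fst hτ]
    rw [pentForm₁, pentForm₂]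
    simp only [C_add, C_mul, C_neg, C_pow, C_1] at hC ⊢
    grind
  linear_combination
    (psiNil N (C t) (C (U * V * τ)) (X 0 + X 1) * psiNil N (C t) (C (-((1 + U) * τ))) Y₁ *
        psiNil N (C t) (C (-((1 + V) * τ))) Y₂ * stepFactor (C t) (C (-((1 + V) * τ))) Y₂ *
        stepFactor (C t) (C (-((1 + U) * τ))) Y₁) * key

lemma shift_pentRight_snd (hN : 0 < N) (ht : t ^ N = 0) (hτ : τ * (1 + U + V) = 1) :
    stepFactor (C t) (C (-((1 + V) * τ))) (pentForm₂ U V + C (half A * t) - C t) *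
      shift ![t * ((1 + V) * τ), t * (U * τ)] (pentRight N t U V τ) =
    texp (C t) (C (1 + V) * (X 1 - C (t * ((1 + V) * τ))) +
        C (t * (half A * (V + (1 + V) ^ 2 * τ))) - (X 0 + X 1)) *
      stepFactor (C t) (C (U * V * τ)) (X 0 + X 1) *
      pentRight N t U V τ := by
  have htn : IsNilpotent t := ⟨N, ht⟩
  have htC : IsNilpotent (C t : MvPolynomial (Fin 2) A) := isNilpotent_C htn
  have hC := congrArg (C : A → MvPolynomial (Fin 2) A) hτ
  have hh := C_half_mul_two (σ := Fin 2) (A := A)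
  set β := (C (1 + V) * (X 1 - C (t * ((1 + V) * τ))) +
        C (t * (half A * (V + (1 + V) ^ 2 * τ))) : MvPolynomial (Fin 2) A) with hβ
  set Y₁ := (pentForm₁ U V + C (half A * t) : MvPolynomial (Fin 2) A) with hY₁
  set Y₂ := (pentForm₂ U V + C (half A * t) - C t : MvPolynomial (Fin 2) A) with hY₂
  have hR : pentRight N t U V τ = texp (C t) (pentExponent t U V τ) *
      (psiNil N (C t) (C (U * V * τ)) (X 0 + X 1) * psiNil N (C t) (C (-((1 + U) * τ))) Y₁ *
        psiNil N (C t) (C (-((1 + V) * τ))) (Y₂ + C t)) := by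
    rw [pentRight, hY₂, sub_add_cancel]
  have hS : shift ![t * ((1 + V) * τ), t * (U * τ)] (pentRight N t U V τ) =
      texp (C t) (shift ![t * ((1 + V) * τ), t * (U * τ)] (pentExponent t U V τ)) *
        (psiNil N (C t) (C (U * V * τ)) (X 0 + X 1 + C t) *
        psiNil N (C t) (C (-((1 + U) * τ))) Y₁ *
        psiNil N (C t) (C (-((1 + V) * τ))) Y₂) := by
    have h0 : shift ![t * ((1 + V) * τ), t * (U * τ)] (X 0 + X 1 : MvPolynomial (Fin 2) A) =
        X 0 + X 1 + C t := by
      simp only [map_add, map_mul, shift_X, Matrix.cons_val_zero, Matrix.cons_val_one, C_1] at hC ⊢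
      linear_combination C t * hC
    have h1 : shift ![t * ((1 + V) * τ), t * (U * τ)] Y₁ = Y₁ := by
      rw [hY₁, map_add, shift_C, shift_pentForm₁_snd]
    have h2 : shift ![t * ((1 + V) * τ), t * (U * τ)] (pentForm₂ U V + C (half A * t)) = Y₂ := by
      rw [hY₂, map_add, shift_C, shift_pentForm₂_snd hτ]; ring
    rw [pentRight, map_mul, map_mul, map_mul, shift_texp htn, shift_psiNil htn, shift_psiNil htn,
      shift_psiNil htn, shift_C, shift_C, shift_C, h0, h1, h2]
  rw [hS, hR, psiNil_add hN (C_pow_eq_zero ht) _ (X 0 + X 1), psiNil_add hN (C_pow_eq_zero ht) _ Y₂,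
    ← stepFactor, ← stepFactor]
  have key : texp (C t) (shift ![t * ((1 + V) * τ), t * (U * τ)] (pentExponent t U V τ)) *
      texp (C t) (C (U * V * τ) * (X 0 + X 1 + half (MvPolynomial (Fin 2) A) * C t)) =
      texp (C t) (β - (X 0 + X 1)) * texp (C t) (pentExponent t U V τ) *
      texp (C t) (C (-((1 + V) * τ)) * (Y₂ + half (MvPolynomial (Fin 2) A) * C t)) := by
    rw [← texp_add htC, ← texp_add htC, ← texp_add htC]
    refine congrArg (texp (C t)) ?_
    rw [hY₂, hβ, ← C_half]
    simp only [pentExponent, map_add, map_mul, map_one, shift_C, shift_pentForm₁_snd,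
      shift_pentForm₂_snd hτ]
    rw [pentForm₁, pentForm₂]
    simp only [C_add, C_mul, C_neg, C_pow, C_1] at hC ⊢
    grind
  linear_combination
    (psiNil N (C t) (C (U * V * τ)) (X 0 + X 1) * psiNil N (C t) (C (-((1 + U) * τ))) Y₁ *
        psiNil N (C t) (C (-((1 + V) * τ))) Y₂ * stepFactor (C t) (C (-((1 + V) * τ))) Y₂ *
        stepFactor (C t) (C (U * V * τ)) (X 0 + X 1)) * key

/-- The average satisfies the same two first-order equations, with literally the same coefficients,
as `pentRight`. -/
lemma shift_pentLeft (hN : 0 < N) (ht : t ^ N = 0) (hτ : τ * (1 + U + V) = 1) :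
    texp (C t) (C (1 + U) * (X 0 - C (t * (U * τ))) +
        C (t * (half A * (U + (1 + U) ^ 2 * τ)))) *
      stepFactor (C t) (C (-((1 + V) * τ))) (pentForm₂ U V + C (half A * t) - C t) *
      shift ![t * τ, -(t * τ)] (pentLeft N t U V τ) =
    texp (C t) (C (1 + V) * (X 1 - C (t * ((1 + V) * τ))) +
        C (t * (half A * (V + (1 + V) ^ 2 * τ)))) *
      stepFactor (C t) (C (-((1 + U) * τ))) (pentForm₁ U V + C (half A * t)) *
      pentLeft N t U V τ ∧
    stepFactor (C t) (C (-((1 + V) * τ))) (pentForm₂ U V + C (half A * t) - C t) *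
      shift ![t * ((1 + V) * τ), t * (U * τ)] (pentLeft N t U V τ) =
    texp (C t) (C (1 + V) * (X 1 - C (t * ((1 + V) * τ))) +
        C (t * (half A * (V + (1 + V) ^ 2 * τ))) - (X 0 + X 1)) *
      stepFactor (C t) (C (U * V * τ)) (X 0 + X 1) *
      pentLeft N t U V τ := by
  have htn : IsNilpotent t := ⟨N, ht⟩
  have htC : IsNilpotent (C t : MvPolynomial (Fin 2) A) := isNilpotent_C htn
  have hC := congrArg (C : A → MvPolynomial (Fin 2) A) hτ
  have hh := C_half_mul_two (σ := Fin 2) (A := A)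
  have hA := shift_pentLeft_fst hN ht hτ
  have hB := shift_pentLeft_snd hN ht hτ
  set α := (C (1 + U) * (X 0 - C (t * (U * τ))) +
        C (t * (half A * (U + (1 + U) ^ 2 * τ))) : MvPolynomial (Fin 2) A) with hα
  set β := (C (1 + V) * (X 1 - C (t * ((1 + V) * τ))) +
        C (t * (half A * (V + (1 + V) ^ 2 * τ))) : MvPolynomial (Fin 2) A) with hβ
  set Y₁ := (pentForm₁ U V + C (half A * t) : MvPolynomial (Fin 2) A) with hY₁
  set Y₂ := (pentForm₂ U V + C (half A * t) - C t : MvPolynomial (Fin 2) A) with hY₂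
  -- The exponents in the equations of one factor differ from those of the other by exactly the
  -- arguments `Y₁`, `Y₂` of the right side; this is the form that `combine_difference` needs.
  have h1 : texp (C t) (C U * (X 0 - C (t * (U * τ))) + C (t * (half A * (U + U ^ 2 * τ)))) =
      texp (C t) β * texp (C t) Y₁ := by
    rw [← texp_add htC]
    refine congrArg (texp (C t)) ?_
    rw [hβ, hY₁, pentForm₁]
    simp only [C_add, C_mul, C_neg, C_pow, C_1] at hC ⊢
    grind
  have h2 : texp (C t) (C V * (X 1 - C (t * ((1 + V) * τ))) +
        C (t * (half A * (V + V ^ 2 * τ)))) = texp (C t) α * texp (C t) Y₂ := by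
    rw [← texp_add htC]
    refine congrArg (texp (C t)) ?_
    rw [hα, hY₂, pentForm₂]
    simp only [C_add, C_mul, C_neg, C_pow, C_1] at hC ⊢
    grind
  simp only [C_add, C_1] at hA hB
  simp only [← C_1 (σ := Fin 2) (R := A)] at hA hB
  simp only [C_1] at hA hB
  obtain ⟨hc1, hc2⟩ := combine_difference (τ := C τ) hA hB h1 h2
  have e0 : texp (C t) (β - (X 0 + X 1)) = texp (C t) β * texp (C t) (-(X 0 + X 1)) := by
    rw [← texp_add htC, sub_eq_add_neg]
  have e12 : texp (C t) Y₁ * texp (C t) Y₂ = texp (C t) (-(X 0 + X 1)) := by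
    rw [← texp_add htC]
    refine congrArg (texp (C t)) ?_
    rw [hY₁, hY₂, pentForm₁, pentForm₂]
    simp only [C_add, C_mul, C_neg, C_pow, C_1] at hC ⊢
    grind
  have e3 := texp_neg_mul_self htC (X 0 + X 1 : MvPolynomial (Fin 2) A)
  rw [e12] at hc2
  rw [e0]
  simp only [stepFactor, C_add, C_mul, C_neg, C_1] at hC ⊢
  refine ⟨?_, ?_⟩
  · linear_combination hc1 - (texp (C t) α * shift ![t * τ, -(t * τ)] (pentLeft N t U V τ) -
      texp (C t) β * pentLeft N t U V τ) * hC
  · linear_combination hc2 + (texp (C t) β * texp (C t) (-(X 0 + X 1)) * pentLeft N t U V τ -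
      shift ![t * ((1 + V) * τ), t * (U * τ)] (pentLeft N t U V τ)) * hC +
      texp (C t) β * pentLeft N t U V τ * (C U * C V * C τ) * e3

end Pentagon
end MvPolynomial

/-! ### The derivative of ψ for a constant shape. -/

section PsiDerivative

variable {S : Type*} [CommRing S] [Algebra ℚ S] {N : ℕ} {t : S}

lemma derivation_psiNil_of_const {R : Type*} [CommRing R] [Algebra R S] (D : Derivation R S S)
    (hN : 0 < N) (ht : t ^ N = 0) (hDt : D t = 0) {u : S} (hDu : D u = 0) (y : S) :
    D (psiNil N t u y) = D y * psiLogDeriv N t u y * psiNil N t u y := by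
  obtain ⟨M, rfl⟩ : ∃ M, N = M + 1 := ⟨N - 1, by omega⟩
  have h : ∀ m, D (((m + 2).factorial : ℚ)⁻¹ • (t ^ m * (bernH (m + 2) t y -
        if m = 0 then y ^ 2 else 0) * polylogAt m u)) =
      ((m + 1).factorial : ℚ)⁻¹ • (t ^ m * bernH (m + 1) t y * polylogAt m u) * D y -
        if m = 0 then u * y * D y else 0 := by
    intro m
    have hf : ((m + 2).factorial : ℚ)⁻¹ * ((m + 1 + 1 : ℕ) : ℚ) = ((m + 1).factorial : ℚ)⁻¹ := by
      rw [Nat.factorial_succ (m + 1)]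
      push_cast
      field_simp
    have hD0 : D (t ^ m) = 0 := by rw [D.leibniz_pow, hDt, smul_zero, smul_zero]
    rw [map_rat_smul D, D.leibniz, D.leibniz, hD0,
      derivation_polylogAt D m (l := 0) (by rw [hDu, zero_mul]), map_sub,
      derivation_bernH D hDt, ← hf]
    split_ifs with hm
    · subst hm
      have h2 : ((0 + 2).factorial : ℚ)⁻¹ = 1 / 2 := by norm_num
      rw [h2]
      simp only [Algebra.smul_def, map_mul]
      rw [show algebraMap ℚ S (1 / 2) = MvPolynomial.half S from rfl,
        show algebraMap ℚ S ((0 + 1 + 1 : ℕ) : ℚ) = 2 by rw [map_natCast]; norm_num]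
      simp only [polylogAt, polylogPoly, D.leibniz_pow, Polynomial.aeval_X, smul_eq_mul,
        nsmul_eq_mul]
      push_cast
      linear_combination (-u * y * D y) * MvPolynomial.half_mul_two (A := S)
    · simp only [map_zero, sub_zero, smul_eq_mul, mul_zero, zero_mul, zero_add,
        Algebra.smul_def (R := ℚ), map_mul]
      ring
  have hL : D (psiLog (M + 1) t u y) = D y * psiLogDeriv (M + 1) t u y := by
    rw [psiLog, map_neg, map_sum, Finset.sum_congr rfl fun m _ => h m, Finset.sum_sub_distrib,
      Finset.sum_ite_eq', ← Finset.sum_mul, psiLogDeriv]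
    simp only [Finset.mem_range, Nat.succ_pos, if_true]
    ring
  rw [psiNil, D.map_nilpotent_exp (isNilpotent_psiLog ⟨M + 1, ht⟩ u y), hL]

end PsiDerivative

namespace MvPolynomial

/-! ### Polynomials that are invariant under small shifts -/

section Invariant

variable {σ A : Type*} [CommRing A]

lemma shift_mul_eq_add (t : A) (v : σ → A) (p : MvPolynomial σ A) :
    ∃ m, shift (fun i => t * v i) p = p + C t * (dirD v p + C t * m) := by
  induction p using MvPolynomial.induction_on with
  | C a => exact ⟨0, by simp⟩
  | add p q hp hq =>
    obtain ⟨m, hm⟩ := hp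
    obtain ⟨m', hm'⟩ := hq
    exact ⟨m + m', by rw [map_add, hm, hm', map_add]; ring⟩
  | mul_X p i hp =>
    obtain ⟨m, hm⟩ := hp
    refine ⟨m * X i + C (v i) * (dirD v p + C t * m), ?_⟩
    rw [map_mul, hm, shift_X, Derivation.leibniz, dirD_X, smul_eq_mul, smul_eq_mul, C_mul]
    ring

variable [Algebra ℚ A]

/-- A polynomial whose derivatives are divisible by `t` is constant modulo `t`. -/
lemma eq_C_add_of_dvd_pderiv {t : A} {h : MvPolynomial σ A} (H : ∀ i, C t ∣ pderiv i h) :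
    ∃ g, h = C (coeff 0 h) + C t * g := by
  classical
  suffices C t ∣ h - C (coeff 0 h) by
    obtain ⟨g, hg⟩ := this
    exact ⟨g, by rw [← hg]; ring⟩
  rw [C_dvd_iff_dvd_coeff]
  intro s
  rw [coeff_sub, coeff_C]
  rcases eq_or_ne s 0 with rfl | hs
  · simp
  · rw [if_neg hs.symm, sub_zero]
    -- A nonconstant coefficient is recovered from a partial derivative by dividing by a positive
    -- integer, a unit in a `ℚ`-algebra.
    obtain ⟨i, hi⟩ := Finsupp.ne_iff.1 hs
    have hi' : 1 ≤ s i := Nat.one_le_iff_ne_zero.2 hi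
    have h1 := (C_dvd_iff_dvd_coeff t _).1 (H i) (s - Finsupp.single i 1)
    rw [coeff_pderiv, tsub_add_cancel_of_le (by simpa using hi')] at h1
    set k : ℕ := (s - Finsupp.single i 1 : σ →₀ ℕ) i
    have hu : ((k : A) + 1) * algebraMap ℚ A (1 / ((k : ℚ) + 1)) = 1 := by
      have : ((k : A) + 1) = algebraMap ℚ A ((k : ℚ) + 1) := by simp
      rw [this, ← map_mul, mul_one_div_cancel (by positivity), map_one]
    have := h1.mul_right (algebraMap ℚ A (1 / ((k : ℚ) + 1)))
    rwa [mul_assoc, hu, mul_one] at this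

/-- If the annihilators of the powers of `t` are as small as possible, then a polynomial that is
invariant under sufficiently many shifts by multiples of `t` is constant modulo `t^(N-1)`. -/
lemma eq_C_add_of_shift_eq {t : A} {N : ℕ} (hN : 0 < N)
    (hann : ∀ k ≤ N, ∀ a : A, t ^ k * a = 0 → t ^ (N - k) ∣ a) {v w : σ → A}
    (hvw : ∀ i, ∃ a b : A, ∀ p : MvPolynomial σ A,
      pderiv i p = C a * dirD v p + C b * dirD w p)
    {r : MvPolynomial σ A} (hv : shift (fun i => t * v i) r = r)
    (hw : shift (fun i => t * w i) r = r) :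
    ∃ r₀ h, r = C r₀ + C (t ^ (N - 1)) * h := by
  have key : ∀ k, k + 1 ≤ N → ∃ r₀ h, r = C r₀ + C (t ^ k) * h := by
    intro k
    induction k with
    | zero => exact fun _ => ⟨0, r, by simp⟩
    | succ k ih =>
      intro hk
      obtain ⟨r₀, h, hr⟩ := ih (by omega)
      -- One more power of `t` is gained per step. If `r = r₀ + t^k h` is invariant, Taylor
      -- expansion gives `t^(k+1) (∂_v h + t m) = 0`. The annihilator hypothesis makes the bracket
      -- divisible by `t`, hence also `∂_v h`. Since `v` and `w` generate all directions, `h` is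
      -- constant modulo `t`.
      have dvd : ∀ v : σ → A, shift (fun i => t * v i) r = r → C t ∣ dirD v h := by
        intro v hv
        obtain ⟨m, hm⟩ := shift_mul_eq_add t v h
        have h0 : C (t ^ (k + 1)) * (dirD v h + C t * m) = 0 := by
          rw [hr, map_add, map_mul, shift_C, shift_C, hm] at hv
          rw [pow_succ, C_mul]
          linear_combination hv
        have h1 : C t ∣ dirD v h + C t * m := by
          rw [C_dvd_iff_dvd_coeff]
          intro s
          have h2 := congrArg (coeff s) h0
          rw [coeff_C_mul, coeff_zero] at h2
          exact (dvd_pow_self t (by omega)).trans (hann (k + 1) (by omega) _ h2)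
        exact (dvd_add_left (dvd_mul_right _ _)).1 h1
      obtain ⟨g, hg⟩ := eq_C_add_of_dvd_pderiv (t := t) (h := h) fun i => by
        obtain ⟨a, b, hab⟩ := hvw i
        rw [hab]
        exact dvd_add ((dvd v hv).mul_left _) ((dvd w hw).mul_left _)
      refine ⟨r₀ + t ^ k * coeff 0 h, g, ?_⟩
      rw [hr, pow_succ, C_add, C_mul, C_mul]
      linear_combination C (t ^ k) * hg
  exact key (N - 1) (by omega)

end Invariant

/-! ### The pentagon identity, up to a constant -/

section Pentagon

variable {A : Type*} [CommRing A] [Algebra ℚ A] {N : ℕ} {t U V τ : A}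

lemma isUnit_pentRight (ht : IsNilpotent t) : IsUnit (pentRight N t U V τ) := by
  have htC : IsNilpotent (C t : MvPolynomial (Fin 2) A) := isNilpotent_C ht
  exact (isUnit_texp htC _).mul (((isUnit_psiNil htC _ _).mul (isUnit_psiNil htC _ _)).mul
    (isUnit_psiNil htC _ _))

/-- Solutions of the same first-order equation have an invariant ratio, provided the reference
solution and the leading coefficient are units. -/
lemma eq_of_step {S : Type*} [CommRing S] {a b H R H' R' r r' : S} (ha : IsUnit a)
    (hR' : IsUnit R') (hH : a * H' = b * H) (hR : a * R' = b * R) (h : H = r * R)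
    (h' : H' = r' * R') : r' = r := by
  refine hR'.mul_right_cancel (ha.mul_left_cancel ?_)
  rw [← h', hH, h, mul_left_comm, ← hR]
  ring

/-- The two directions have determinant `τ² (1 + U + V) = τ`, which is a unit. -/
lemma pderiv_eq_pentagon_directions (hτ : τ * (1 + U + V) = 1) (i : Fin 2) :
    ∃ a b : A, ∀ p : MvPolynomial (Fin 2) A,
      pderiv i p = C a * dirD ![τ, -τ] p + C b * dirD ![(1 + V) * τ, U * τ] p := by
  have h : ∀ a b : A, (∀ j, (Pi.single i 1 : Fin 2 → A) j =
      a * (![τ, -τ] : Fin 2 → A) j + b * (![(1 + V) * τ, U * τ] : Fin 2 → A) j) →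
      ∀ p : MvPolynomial (Fin 2) A,
        pderiv i p = C a * dirD ![τ, -τ] p + C b * dirD ![(1 + V) * τ, U * τ] p := by
    intro a b hab p
    rw [pderiv_eq_dirD, ← dirD_smul, ← dirD_smul, ← dirD_add]
    rw [show (Pi.single i 1 : Fin 2 → A) = _ from _root_.funext hab]
  fin_cases i
  · refine ⟨U, 1, h _ _ fun j => ?_⟩
    fin_cases j <;> simp <;> grind
  · refine ⟨-(1 + V), 1, h _ _ fun j => ?_⟩
    fin_cases j <;> (simp; grind)

/-- The two sides of the pentagon identity agree up to a constant. -/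
lemma pentLeft_eq_mul (hN : 0 < N) (ht : t ^ N = 0)
    (hann : ∀ k ≤ N, ∀ a : A, t ^ k * a = 0 → t ^ (N - k) ∣ a) (hτ : τ * (1 + U + V) = 1) :
    ∃ r₀ h, pentLeft N t U V τ = (C r₀ + C (t ^ (N - 1)) * h) * pentRight N t U V τ := by
  have htn : IsNilpotent t := ⟨N, ht⟩
  have htC : IsNilpotent (C t : MvPolynomial (Fin 2) A) := isNilpotent_C htn
  have hR : IsUnit (pentRight N t U V τ) := isUnit_pentRight htn
  obtain ⟨r, hr⟩ : ∃ r, pentLeft N t U V τ = r * pentRight N t U V τ :=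
    by
    obtain ⟨r, hr⟩ := hR.dvd (a := pentLeft N t U V τ)
    exact ⟨r, by rw [hr, mul_comm]⟩
  have hinv : ∀ c : Fin 2 → A, shift c (pentLeft N t U V τ) =
      shift c r * shift c (pentRight N t U V τ) := fun c => by rw [hr, map_mul]
  obtain ⟨h1, h2⟩ := shift_pentLeft hN ht hτ
  have e1 := eq_of_step ((isUnit_texp htC _).mul (isUnit_stepFactor htC _ _)) (hR.map (shift _))
    h1 (shift_pentRight_fst hN ht hτ) hr (hinv _)
  have e2 := eq_of_step (isUnit_stepFactor htC _ _) (hR.map (shift _)) h2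
    (shift_pentRight_snd hN ht hτ) hr (hinv _)
  obtain ⟨r₀, h, rfl⟩ := eq_C_add_of_shift_eq hN hann (pderiv_eq_pentagon_directions hτ) (r := r)
    (by rw [show (fun i => t * (![τ, -τ] : Fin 2 → A) i) = ![t * τ, -(t * τ)] by
          ext i; fin_cases i <;> simp]; exact e1)
    (by rw [show (fun i => t * (![(1 + V) * τ, U * τ] : Fin 2 → A) i) =
          ![t * ((1 + V) * τ), t * (U * τ)] by ext i; fin_cases i <;> simp]; exact e2)
  exact ⟨r₀, h, hr⟩

/-! ### The dependence of the constant on the parameters -/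

variable {D : Derivation ℚ A A} {l₁ l₂ : A}

/-- The differential operator that annihilates the ratio of the two sides of the pentagon. -/
def pentDerivation (D : Derivation ℚ A A) (t U V τ l₁ l₂ : A) :
    Derivation ℚ (MvPolynomial (Fin 2) A) (MvPolynomial (Fin 2) A) :=
  -- The terms with `l₁`, `l₂` alone cancel the displacement of the arguments in
  -- `derivation_psiNil`; the last term absorbs the cross terms `X_i ∂` that arise when `X_i ^ 2`
  -- passes through the average.
  (C t : MvPolynomial (Fin 2) A) • coeffD D -
    ((C l₁ : MvPolynomial (Fin 2) A) • (dirD ![1, 0]).restrictScalars ℚ +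
     (C l₂ : MvPolynomial (Fin 2) A) • (dirD ![0, 1]).restrictScalars ℚ +
     (C t * C τ * (C (l₁ * (U + U ^ 2)) * X 0 - C (l₂ * (V + V ^ 2)) * X 1) :
       MvPolynomial (Fin 2) A) • (dirD ![1, -1]).restrictScalars ℚ)

/-- The logarithmic derivative of both sides of the pentagon. -/
def pentMultiplier (t U V τ l₁ l₂ : A) : MvPolynomial (Fin 2) A :=
  C t * C (half A) * (C (l₁ * (U + U ^ 2)) * (X 0 ^ 2 + C τ) +
    C (l₂ * (V + V ^ 2)) * (X 1 ^ 2 + C τ) - C (l₁ * U + l₂ * V))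

lemma pentDerivation_apply (p : MvPolynomial (Fin 2) A) :
    pentDerivation D t U V τ l₁ l₂ p = C t * coeffD D p - (C l₁ * dirD ![1, 0] p +
      C l₂ * dirD ![0, 1] p + C t * C τ * (C (l₁ * (U + U ^ 2)) * X 0 -
        C (l₂ * (V + V ^ 2)) * X 1) * dirD ![1, -1] p) := rfl

lemma pentDerivation_C (a : A) : pentDerivation D t U V τ l₁ l₂ (C a) = C (t * D a) := by
  simp [pentDerivation_apply]

lemma derivation_tau (hτ : τ * (1 + U + V) = 1) (hU : D U = l₁ * (U + U ^ 2))
    (hV : D V = l₂ * (V + V ^ 2)) :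
    D τ = -τ ^ 2 * (l₁ * (U + U ^ 2) + l₂ * (V + V ^ 2)) := by
  have h := congrArg D hτ
  rw [D.leibniz, map_add, map_add, D.map_one_eq_zero, hU, hV, smul_eq_mul, smul_eq_mul] at h
  linear_combination τ * h - D τ * hτ

lemma pentDerivation_pentLeft (hN : 0 < N) (ht : t ^ N = 0) (hDt : D t = 0)
    (hτ : τ * (1 + U + V) = 1) (hU : D U = l₁ * (U + U ^ 2)) (hV : D V = l₂ * (V + V ^ 2)) :
    pentDerivation D t U V τ l₁ l₂ (pentLeft N t U V τ) =
      pentMultiplier t U V τ l₁ l₂ * pentLeft N t U V τ := by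
  have htN := C_pow_eq_zero (σ := Fin 2) ht
  have hh := C_half_mul_two (σ := Fin 2) (A := A)
  set Q := pentMatrix τ with hQdef
  have hQ : Q.IsSymm := pentMatrix_isSymm τ
  set F : MvPolynomial (Fin 2) A :=
    psiNil N (C t) (C U) (X 0) * psiNil N (C t) (C V) (X 1) with hF
  have hH : pentLeft N t U V τ = wick Q F := rfl
  have hCt : coeffD D (C t : MvPolynomial (Fin 2) A) = 0 := by rw [coeffD_C, hDt, C_0]
  have h0 := derivation_psiNil (coeffD D) hN htN hCt (u := C U) (l := C l₁)
    (by rw [coeffD_C, hU]; simp only [C_mul, C_add, C_pow]) (X 0)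
  have h1 := derivation_psiNil (coeffD D) hN htN hCt (u := C V) (l := C l₂)
    (by rw [coeffD_C, hV]; simp only [C_mul, C_add, C_pow]) (X 1)
  have d00 := derivation_psiNil_of_const (dirD ![1, 0]) hN htN (dirD_C _ _) (dirD_C _ U) (X 0)
  have d01 := derivation_psiNil_of_const (dirD ![1, 0]) hN htN (dirD_C _ _) (dirD_C _ V) (X 1)
  have d10 := derivation_psiNil_of_const (dirD ![0, 1]) hN htN (dirD_C _ _) (dirD_C _ U) (X 0)
  have d11 := derivation_psiNil_of_const (dirD ![0, 1]) hN htN (dirD_C _ _) (dirD_C _ V) (X 1)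
  simp only [dirD_X, coeffD_X, Matrix.cons_val_zero, Matrix.cons_val_one, C_0, C_1] at h0 h1 d00 d01 d10 d11
  have hDF : C t * coeffD D F = C l₁ * dirD ![1, 0] F + C l₂ * dirD ![0, 1] F +
      (C (t * half A * (l₁ * (U + U ^ 2))) * (X 0 * (X 0 * F)) +
        C (t * half A * (l₂ * (V + V ^ 2))) * (X 1 * (X 1 * F)) -
        C (t * half A * (l₁ * U + l₂ * V)) * F) := by
    rw [hF, Derivation.leibniz, Derivation.leibniz, Derivation.leibniz]
    simp only [smul_eq_mul, d00, d01, d10, d11, C_mul, C_add, C_pow, C_half] at h0 h1 ⊢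
    linear_combination psiNil N (C t) (C U) (X 0) * h1 + psiNil N (C t) (C V) (X 1) * h0
  have r0 : ∀ p : MvPolynomial (Fin 2) A, dirD (Q.row 0) p = C τ * dirD ![1, -1] p := by
    intro p
    rw [← dirD_smul]
    congr 2
    ext j; fin_cases j <;> simp [hQdef, pentMatrix]
  have r1 : ∀ p : MvPolynomial (Fin 2) A, dirD (Q.row 1) p = -(C τ * dirD ![1, -1] p) := by
    intro p
    rw [← neg_mul, ← C_neg, ← dirD_smul]
    congr 2
    ext j; fin_cases j <;> simp [hQdef, pentMatrix]
  have hW : wickOp (Q.map D) (wick Q F) =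
      C (half A) * C (D τ) * dirD ![1, -1] (dirD ![1, -1] (wick Q F)) := by
    have e0 : ∀ p : MvPolynomial (Fin 2) A, dirD ((Q.map D).row 0) p = C (D τ) * dirD ![1, -1] p := by
      intro p
      rw [← dirD_smul]
      congr 2
      ext j; fin_cases j <;> simp [hQdef, pentMatrix]
    have e1 : ∀ p : MvPolynomial (Fin 2) A,
        dirD ((Q.map D).row 1) p = -(C (D τ) * dirD ![1, -1] p) := by
      intro p
      rw [← neg_mul, ← C_neg, ← dirD_smul]
      congr 2
      ext j; fin_cases j <;> simp [hQdef, pentMatrix]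
    have e2 : ∀ p : MvPolynomial (Fin 2) A, dirD ![1, -1] p = pderiv 0 p - pderiv 1 p := by
      intro p
      rw [dirD_eq_sum, Fin.sum_univ_two]
      simp
      ring
    rw [wickOp_apply, Fin.sum_univ_two, e0, e1, map_neg, pderiv_C_mul, pderiv_C_mul,
      e2 (dirD _ _)]
    ring
  -- Averaging `X_i ^ 2` produces second derivatives with coefficient `τ²`. They cancel against the
  -- heat operator of `D τ`, because `D τ = -τ² (l₁ (U + U²) + l₂ (V + V²))`.
  have key := congrArg (wick Q) hDF
  simp only [wick_C_mul, wick_add, wick_sub, wick_dirD hQ, wick_X_mul hQ, r0, r1] at key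
  rw [hH, pentDerivation_apply, coeffD_wick hQ, hW, derivation_tau hτ hU hV, pentMultiplier]
  generalize wick Q F = G at key ⊢
  simp only [map_add, map_sub, map_neg, map_mul, map_pow, Derivation.leibniz, dirD_X, dirD_C,
    smul_eq_mul, Matrix.cons_val_zero, Matrix.cons_val_one, C_1, map_one] at key ⊢
  linear_combination key + C t * C τ * dirD ![1, -1] G * (C l₁ * (C U + C U ^ 2) * X 0 -
    C l₂ * (C V + C V ^ 2) * X 1) * hh

/-- Each argument on the right has constant derivative, minus the speed at which its parameter moves
along `u + u²`. This is the balance that `derivation_psiNil_of_balanced` requires; the same holds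
for the other two forms. -/
lemma pentDerivation_form₀ :
    pentDerivation D t U V τ l₁ l₂ (X 0 + X 1) = -C (l₁ + l₂) := by
  rw [pentDerivation_apply]
  simp only [map_add, coeffD_X, dirD_X, Matrix.cons_val_zero, Matrix.cons_val_one, C_1, C_0, C_neg]
  ring

lemma pentDerivation_form₁ (hDt : D t = 0) (hτ : τ * (1 + U + V) = 1)
    (hU : D U = l₁ * (U + U ^ 2)) (hV : D V = l₂ * (V + V ^ 2)) :
    pentDerivation D t U V τ l₁ l₂ (pentForm₁ U V + C (half A * t)) =
      -C (l₁ * U - l₂ * (1 + V)) := by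
  have hC := congrArg (C : A → MvPolynomial (Fin 2) A) hτ
  have hDh : D (half A) = 0 := D.map_algebraMap _
  rw [pentDerivation_apply, pentForm₁]
  simp only [map_add, map_sub, map_mul, map_one, coeffD_X, coeffD_C, dirD_C, Derivation.leibniz,
    dirD_X, Matrix.cons_val_zero, Matrix.cons_val_one, C_1, C_0, C_neg, hU, hV, hDt, hDh,
    Derivation.map_one_eq_zero, smul_eq_mul, C_pow, map_pow] at hC ⊢
  linear_combination -C t * (C l₁ * (C U + C U ^ 2) * X 0 - C l₂ * (C V + C V ^ 2) * X 1) * hC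

lemma pentDerivation_form₂ (hDt : D t = 0) (hτ : τ * (1 + U + V) = 1)
    (hU : D U = l₁ * (U + U ^ 2)) (hV : D V = l₂ * (V + V ^ 2)) :
    pentDerivation D t U V τ l₁ l₂ (pentForm₂ U V + C (half A * t)) =
      -C (l₂ * V - l₁ * (1 + U)) := by
  have hC := congrArg (C : A → MvPolynomial (Fin 2) A) hτ
  have hDh : D (half A) = 0 := D.map_algebraMap _
  rw [pentDerivation_apply, pentForm₂]
  simp only [map_add, map_sub, map_mul, map_one, coeffD_X, coeffD_C, dirD_C, Derivation.leibniz,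
    dirD_X, Matrix.cons_val_zero, Matrix.cons_val_one, C_1, C_0, C_neg, hU, hV, hDt, hDh,
    Derivation.map_one_eq_zero, smul_eq_mul, C_pow, map_pow] at hC ⊢
  linear_combination C t * (C l₁ * (C U + C U ^ 2) * X 0 - C l₂ * (C V + C V ^ 2) * X 1) * hC

/-- When shape and argument move at opposite speeds, the transcendental part `psiLogDeriv` drops out
and the logarithmic derivative is elementary. -/
lemma derivation_psiNil_of_balanced {S : Type*} [CommRing S] [Algebra ℚ S] {t : S}
    (D : Derivation ℚ S S) (hN : 0 < N) (ht : t ^ N = 0) (hDt : D t = 0) {u l y : S}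
    (hDu : D u = t * l * (u + u ^ 2)) (hy : D y = -l) :
    t * D (psiNil N t u y) = t * (t * l * (half S * (y ^ 2 * (u + u ^ 2) - u))) * psiNil N t u y := by
  rw [derivation_psiNil D hN ht hDt hDu, hy]
  ring

/-- The elementary parts from the exponent and from the three balanced `ψ` add up to
`pentMultiplier`. Here `h` is `1/2`, and `T` is the parameter `t`. -/
lemma pentExponent_balance {S : Type*} [CommRing S] {u v τ h T x y l m : S} (hh : h * 2 = 1)
    (hτ : τ * (1 + u + v) = 1) :
    T * (T * (h ^ 3 * (T * (-τ ^ 2 * (l * (u + u ^ 2) + m * (v + v ^ 2))))) +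
      (h * τ * ((1 + u) * -(l * u - m * (1 + v)) +
          (u * x - (1 + v) * y) * (T * (l * (u + u ^ 2))) +
          ((1 + v) * -(m * v - l * (1 + u)) + (v * y - (1 + u) * x) * (T * (m * (v + v ^ 2))))) +
        ((1 + u) * (u * x - (1 + v) * y) + (1 + v) * (v * y - (1 + u) * x)) *
          (h * (T * (-τ ^ 2 * (l * (u + u ^ 2) + m * (v + v ^ 2))))))) +
      T * (l + m) * (h * ((x + y) ^ 2 * (u * v * τ + (u * v * τ) ^ 2) - u * v * τ)) +
      T * (l * u - m * (1 + v)) * (h * ((u * x - (1 + v) * y + h * T) ^ 2 *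
        (-((1 + u) * τ) + (-((1 + u) * τ)) ^ 2) - -((1 + u) * τ))) +
      T * (m * v - l * (1 + u)) * (h * ((v * y - (1 + u) * x + h * T) ^ 2 *
        (-((1 + v) * τ) + (-((1 + v) * τ)) ^ 2) - -((1 + v) * τ))) =
    T * h * (l * (u + u ^ 2) * (x ^ 2 + τ) + m * (v + v ^ 2) * (y ^ 2 + τ) - (l * u + m * v)) := by
  grind

lemma pentDerivation_pentRight (hN : 0 < N) (ht : t ^ N = 0) (hDt : D t = 0)
    (hτ : τ * (1 + U + V) = 1) (hU : D U = l₁ * (U + U ^ 2)) (hV : D V = l₂ * (V + V ^ 2)) :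
    C t * pentDerivation D t U V τ l₁ l₂ (pentRight N t U V τ) =
      C t * pentMultiplier t U V τ l₁ l₂ * pentRight N t U V τ := by
  have htn : IsNilpotent t := ⟨N, ht⟩
  have htC : IsNilpotent (C t : MvPolynomial (Fin 2) A) := isNilpotent_C htn
  have htN := C_pow_eq_zero (σ := Fin 2) ht
  have hh := C_half_mul_two (σ := Fin 2) (A := A)
  have hC := congrArg (C : A → MvPolynomial (Fin 2) A) hτ
  have hDτ := derivation_tau hτ hU hV
  have hDh : D (half A) = 0 := D.map_algebraMap _
  have hDt' : pentDerivation D t U V τ l₁ l₂ (C t) = 0 := by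
    rw [pentDerivation_C, hDt, mul_zero, C_0]
  have w0 : D (U * V * τ) = (l₁ + l₂) * (U * V * τ + (U * V * τ) ^ 2) := by
    simp only [D.leibniz, smul_eq_mul, hU, hV, hDτ]
    grind
  have w1 : D (-((1 + U) * τ)) =
      (l₁ * U - l₂ * (1 + V)) * (-((1 + U) * τ) + (-((1 + U) * τ)) ^ 2) := by
    simp only [map_neg, map_add, D.map_one_eq_zero, D.leibniz, smul_eq_mul, hU, hDτ]
    grind
  have w2 : D (-((1 + V) * τ)) =
      (l₂ * V - l₁ * (1 + U)) * (-((1 + V) * τ) + (-((1 + V) * τ)) ^ 2) := by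
    simp only [map_neg, map_add, D.map_one_eq_zero, D.leibniz, smul_eq_mul, hV, hDτ]
    grind
  have k0 := derivation_psiNil_of_balanced (pentDerivation D t U V τ l₁ l₂) hN htN hDt'
    (u := C (U * V * τ)) (l := C (l₁ + l₂))
    (by rw [pentDerivation_C, w0]; simp only [C_mul, C_add, C_pow]; ring) pentDerivation_form₀
  have k1 := derivation_psiNil_of_balanced (pentDerivation D t U V τ l₁ l₂) hN htN hDt'
    (u := C (-((1 + U) * τ))) (l := C (l₁ * U - l₂ * (1 + V)))
    (by rw [pentDerivation_C, w1, ← mul_assoc, C_mul, C_add, C_pow, C_mul])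
    (pentDerivation_form₁ hDt hτ hU hV)
  have k2 := derivation_psiNil_of_balanced (pentDerivation D t U V τ l₁ l₂) hN htN hDt'
    (u := C (-((1 + V) * τ))) (l := C (l₂ * V - l₁ * (1 + U)))
    (by rw [pentDerivation_C, w2, ← mul_assoc, C_mul, C_add, C_pow, C_mul])
    (pentDerivation_form₂ hDt hτ hU hV)
  have ke := Derivation.map_texp htC (pentDerivation D t U V τ l₁ l₂) hDt' (pentExponent t U V τ)
  have key : C t * pentDerivation D t U V τ l₁ l₂ (pentExponent t U V τ) +
      C t * C (l₁ + l₂) * (half _ * ((X 0 + X 1) ^ 2 * (C (U * V * τ) + C (U * V * τ) ^ 2) -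
        C (U * V * τ))) +
      C t * C (l₁ * U - l₂ * (1 + V)) * (half _ * ((pentForm₁ U V + C (half A * t)) ^ 2 *
        (C (-((1 + U) * τ)) + C (-((1 + U) * τ)) ^ 2) - C (-((1 + U) * τ)))) +
      C t * C (l₂ * V - l₁ * (1 + U)) * (half _ * ((pentForm₂ U V + C (half A * t)) ^ 2 *
        (C (-((1 + V) * τ)) + C (-((1 + V) * τ)) ^ 2) - C (-((1 + V) * τ)))) =
      pentMultiplier t U V τ l₁ l₂ := by
    have hq : D (algebraMap ℚ A (5 / 24)) = 0 := D.map_algebraMap _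
    have f1 := pentDerivation_form₁ hDt hτ hU hV
    have f2 := pentDerivation_form₂ hDt hτ hU hV
    have hz : D (half A * t) = 0 := by rw [D.leibniz, hDt, hDh, smul_zero, smul_zero, add_zero]
    rw [map_add, pentDerivation_C, hz, mul_zero, C_0, add_zero] at f1 f2
    have hh3 : D (half A ^ 3) = 0 := by rw [D.leibniz_pow, hDh, smul_zero, smul_zero]
    have g1 : pentDerivation D t U V τ l₁ l₂ (pentExponent t U V τ) =
        C t * (C (half A) ^ 3 * (C t * C (D τ))) +
        (C (half A) * C τ * ((1 + C U) * -C (l₁ * U - l₂ * (1 + V)) +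
          pentForm₁ U V * (C t * C (D U)) +
          ((1 + C V) * -C (l₂ * V - l₁ * (1 + U)) + pentForm₂ U V * (C t * C (D V)))) +
        ((1 + C U) * pentForm₁ U V + (1 + C V) * pentForm₂ U V) *
          (C (half A) * (C t * C (D τ)))) := by
      rw [pentExponent, map_add, pentDerivation_C, (pentDerivation D t U V τ l₁ l₂).leibniz,
        pentDerivation_C, map_add (pentDerivation D t U V τ l₁ l₂),
        (pentDerivation D t U V τ l₁ l₂).leibniz, (pentDerivation D t U V τ l₁ l₂).leibniz,
        pentDerivation_C, pentDerivation_C, f1, f2]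
      simp only [D.leibniz, map_add, hDt, hq, hDh, hh3, D.map_one_eq_zero, smul_eq_mul, C_mul,
        C_0, C_add, C_1, C_pow]
      ring
    rw [g1, hU, hV, hDτ, pentMultiplier, pentForm₁, pentForm₂, ← C_half]
    simp only [C_mul, C_add, C_neg, C_pow, C_1, map_sub] at hC ⊢
    exact pentExponent_balance hh hC
  rw [pentRight, Derivation.leibniz, Derivation.leibniz, Derivation.leibniz]
  simp only [smul_eq_mul]
  rw [ke, ← key]
  generalize pentDerivation D t U V τ l₁ l₂ (pentExponent t U V τ) = ρ' at *
  generalize texp (C t) (pentExponent t U V τ) = E at *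
  linear_combination (E * psiNil N (C t) (C (U * V * τ)) (X 0 + X 1) *
      psiNil N (C t) (C (-((1 + U) * τ))) (pentForm₁ U V + C (half A * t))) * k2 +
    (E * psiNil N (C t) (C (U * V * τ)) (X 0 + X 1) *
      psiNil N (C t) (C (-((1 + V) * τ))) (pentForm₂ U V + C (half A * t))) * k1 +
    (E * psiNil N (C t) (C (-((1 + U) * τ))) (pentForm₁ U V + C (half A * t)) *
      psiNil N (C t) (C (-((1 + V) * τ))) (pentForm₂ U V + C (half A * t))) * k0

/-- The constant in the pentagon identity does not depend on the parameters. -/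
lemma exists_pentLeft_eq_mul (hN : 0 < N) (ht : t ^ N = 0)
    (hann : ∀ k ≤ N, ∀ a : A, t ^ k * a = 0 → t ^ (N - k) ∣ a) (hDt : D t = 0)
    (hτ : τ * (1 + U + V) = 1) (hU : D U = l₁ * (U + U ^ 2)) (hV : D V = l₂ * (V + V ^ 2)) :
    ∃ r₀ h, pentLeft N t U V τ = (C r₀ + C (t ^ (N - 1)) * h) * pentRight N t U V τ ∧
      t ^ 2 * D r₀ = 0 := by
  obtain ⟨r₀, h, hr⟩ := pentLeft_eq_mul hN ht hann hτ
  refine ⟨r₀, h, hr, ?_⟩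
  have hL := pentDerivation_pentLeft hN ht hDt hτ hU hV
  have hR := pentDerivation_pentRight hN ht hDt hτ hU hV
  have hRu : IsUnit (pentRight N t U V τ) := isUnit_pentRight ⟨N, ht⟩
  have htN := C_pow_eq_zero (σ := Fin 2) ht
  have htD : D (t ^ (N - 1)) = 0 := by rw [D.leibniz_pow, hDt, smul_zero, smul_zero]
  -- Both sides have the same multiplier, so the operator annihilates their ratio after
  -- multiplication by `t`. This factor also kills the error term, since `t * t ^ (N - 1) = 0`.
  have h0 : C t * pentDerivation D t U V τ l₁ l₂ (C r₀ + C (t ^ (N - 1)) * h) = 0 := by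
    refine hRu.mul_right_cancel ?_
    have := congrArg (fun p => C t * pentDerivation D t U V τ l₁ l₂ p) hr
    simp only [hL, Derivation.leibniz, smul_eq_mul] at this
    rw [hr] at this
    simp only [smul_eq_mul, Derivation.leibniz, map_add] at this ⊢
    linear_combination -(C r₀ + C (t ^ (N - 1)) * h) * hR - this
  rw [map_add, Derivation.leibniz, pentDerivation_C, pentDerivation_C, htD, mul_zero, C_0,
    smul_zero, add_zero, smul_eq_mul, mul_add, ← mul_assoc, ← C_mul, ← C_mul, ← pow_succ',
    Nat.sub_add_cancel hN, ht, C_0, zero_mul, add_zero, ← mul_assoc, ← pow_two] at h0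
  exact C_injective _ _ (by rw [h0, C_0])

end Pentagon
end MvPolynomial

lemma psiNil_eq_of_le {S : Type*} [CommRing S] [Algebra ℚ S] {N M : ℕ} {t : S} (ht : t ^ N = 0)
    (h : N ≤ M) (u y : S) : psiNil M t u y = psiNil N t u y := by
  rw [psiNil, psiNil, psiLog, psiLog, ← Finset.sum_subset (Finset.range_mono h)]
  intro m _ hm
  rw [pow_eq_zero_of_le (by simpa using hm) ht, zero_mul, zero_mul, smul_zero]

namespace MvPolynomial

/-! ### The pentagon identity -/

section Pentagon

variable {A B : Type*} [CommRing A] [Algebra ℚ A] [CommRing B] [Algebra ℚ B] {N : ℕ} {t U V τ : A}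

lemma map_pentLeft (f : A →+* B) (ht : IsNilpotent t) :
    map f (pentLeft N t U V τ) = pentLeft N (f t) (f U) (f V) (f τ) := by
  have htC : IsNilpotent (C t : MvPolynomial (Fin 2) A) := isNilpotent_C ht
  have hm : (pentMatrix τ).map f = pentMatrix (f τ) := by
    ext i j; fin_cases i <;> fin_cases j <;> simp [pentMatrix]
  rw [pentLeft, map_wick f (pentMatrix_isSymm τ), map_mul, map_psiNil (map f) htC,
    map_psiNil (map f) htC, hm, pentLeft]
  simp only [map_C, map_X]

lemma map_pentRight (f : A →+* B) (ht : IsNilpotent t) :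
    map f (pentRight N t U V τ) = pentRight N (f t) (f U) (f V) (f τ) := by
  have htC : IsNilpotent (C t : MvPolynomial (Fin 2) A) := isNilpotent_C ht
  rw [pentRight, map_mul, map_mul, map_mul, map_texp htC (map f), map_psiNil (map f) htC,
    map_psiNil (map f) htC, map_psiNil (map f) htC, pentRight]
  simp only [pentExponent, pentForm₁, pentForm₂, map_C, map_X, map_mul, map_add, map_sub, map_neg,
    map_one, map_pow, map_half, RingHom.map_rat_algebraMap]

lemma pentLeft_zero : pentLeft N t 0 0 τ = 1 := by
  rw [pentLeft, C_0, psiNil_zero, psiNil_zero, mul_one, ← C_1, wick_C]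

/-- The normalisation of the pentagon. Two factors have `u = -1` and are elementary; the constant
`5/24` in `pentExponent` is the one for which all exponents cancel. -/
lemma pentRight_zero (hN : 0 < N) (ht : t ^ N = 0) : pentRight N t 0 0 1 = 1 := by
  have htC : IsNilpotent (C t : MvPolynomial (Fin 2) A) := isNilpotent_C ⟨N, ht⟩
  rw [pentRight]
  simp only [zero_mul, C_0, psiNil_zero, add_zero, mul_one, C_neg, C_1, one_mul,
    psiNil_neg_one hN]
  rw [← texp_add htC, ← texp_add htC, pentExponent, pentForm₁, pentForm₂]
  have h1 : half A ^ 3 = algebraMap ℚ A (1 / 8) := by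
    rw [half, ← map_pow, show ((1 / 2) ^ 3 : ℚ) = 1 / 8 by norm_num]
  have h2 : ((1 / 6 : ℚ) • C t : MvPolynomial (Fin 2) A) = C (algebraMap ℚ A (1 / 6) * t) := by
    rw [Algebra.smul_def, C_mul]; rfl
  have h3 : half (MvPolynomial (Fin 2) A) = C (half A) := C_half.symm
  rw [h1, h2, h3]
  simp only [add_zero, C_0, C_1, C_mul, mul_one, zero_mul, zero_sub, C_add, one_mul]
  have h4 : (C (half A) * C (half A) : MvPolynomial (Fin 2) A) = C (algebraMap ℚ A (1 / 4)) := by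
    rw [← C_mul, half, ← map_mul, show (1 / 2 * (1 / 2) : ℚ) = 1 / 4 by norm_num]
  have h5 : (C (half A) * C (algebraMap ℚ A (1 / 6)) : MvPolynomial (Fin 2) A) =
      C (algebraMap ℚ A (1 / 12)) := by
    rw [← C_mul, half, ← map_mul, show (1 / 2 * (1 / 6) : ℚ) = 1 / 12 by norm_num]
  have h6 : (C (algebraMap ℚ A (5 / 24)) + C (algebraMap ℚ A (1 / 8)) -
      2 * C (algebraMap ℚ A (1 / 4)) + 2 * C (algebraMap ℚ A (1 / 12)) :
        MvPolynomial (Fin 2) A) = 0 := by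
    rw [show (2 : MvPolynomial (Fin 2) A) = C (algebraMap ℚ A 2) by
      rw [map_ofNat, map_ofNat], ← C_mul, ← C_mul, ← C_add,
      ← C_sub, ← C_add, ← map_mul, ← map_mul, ← map_add, ← map_sub, ← map_add,
      show (5 / 24 + 1 / 8 - 2 * (1 / 4) + 2 * (1 / 12) : ℚ) = 0 by norm_num, map_zero, C_0]
  have : C t * (C (algebraMap ℚ A (5 / 24)) + C (algebraMap ℚ A (1 / 8))) +
      C (half A) * (-X 1 + -X 0) +
      (C (half A) * (-(-X 1 + C (half A) * C t) + C (algebraMap ℚ A (1 / 6)) * C t) +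
      C (half A) * (-(-X 0 + C (half A) * C t) + C (algebraMap ℚ A (1 / 6)) * C t)) =
      (0 : MvPolynomial (Fin 2) A) := by
    linear_combination C t * h6 - 2 * C t * h4 + 2 * C t * h5
  rw [this, texp_zero]

/-! ### The constant of the pentagon, found by scaling the parameters to zero. -/

section PowerSeries

/-- The derivation `s (1 + s U) (1 + s V) d/ds`. -/
def scaleDerivation (U V : A) : Derivation ℚ A⟦X⟧ A⟦X⟧ :=
  (PowerSeries.X * (1 + PowerSeries.C U * PowerSeries.X) * (1 + PowerSeries.C V * PowerSeries.X) :
    A⟦X⟧) • (PowerSeries.derivative A).restrictScalars ℚ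

lemma scaleDerivation_apply (U V : A) (f : A⟦X⟧) :
    scaleDerivation U V f = PowerSeries.X * (1 + PowerSeries.C U * PowerSeries.X) *
      (1 + PowerSeries.C V * PowerSeries.X) * PowerSeries.derivative A f := rfl

/-- With parameters `s U`, `s V` the constant `r` of proportionality satisfies `t² dr/ds = 0`. Hence
`t² r` equals its value at `s = 0`, where both sides are `1`. The factor `t²` is also what removes
the error term with `t ^ (N - 1)`. -/
lemma pentagon_powerSeries (hN : 0 < N) (ht : t ^ N = 0)
    (hann : ∀ k ≤ N, ∀ a : A, t ^ k * a = 0 → t ^ (N - k) ∣ a) (U V : A) {τ : A⟦X⟧}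
    (hτ : τ * (1 + PowerSeries.C U * PowerSeries.X + PowerSeries.C V * PowerSeries.X) = 1) :
    C (PowerSeries.C t ^ 2) * pentLeft N (PowerSeries.C t) (PowerSeries.C U * PowerSeries.X)
      (PowerSeries.C V * PowerSeries.X) τ =
    C (PowerSeries.C t ^ 2) * pentRight N (PowerSeries.C t) (PowerSeries.C U * PowerSeries.X)
      (PowerSeries.C V * PowerSeries.X) τ := by
  have htN : (PowerSeries.C t : A⟦X⟧) ^ N = 0 := by rw [← map_pow, ht, map_zero]
  have hann' : ∀ k ≤ N, ∀ a : A⟦X⟧, PowerSeries.C t ^ k * a = 0 →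
      PowerSeries.C t ^ (N - k) ∣ a := by
    intro k hk a ha
    have h : ∀ n, ∃ b, PowerSeries.coeff n a = t ^ (N - k) * b := by
      intro n
      refine hann k hk _ ?_
      have := congrArg (PowerSeries.coeff n) ha
      rwa [← map_pow, PowerSeries.coeff_C_mul, map_zero] at this
    choose b hb using h
    refine ⟨PowerSeries.mk b, ?_⟩
    ext n
    rw [← map_pow, PowerSeries.coeff_C_mul, PowerSeries.coeff_mk, hb]
  have hd : ∀ c : A, PowerSeries.derivative A (PowerSeries.C c * PowerSeries.X) =
      PowerSeries.C c := by
    intro c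
    rw [Derivation.leibniz, PowerSeries.derivative_C, PowerSeries.derivative_X]
    simp
  -- The speeds are polynomials in `s` because the derivation was multiplied by both `1 + s U` and
  -- `1 + s V`.
  obtain ⟨r, h, hr, hD⟩ := exists_pentLeft_eq_mul hN htN hann' (D := scaleDerivation U V)
    (U := PowerSeries.C U * PowerSeries.X) (V := PowerSeries.C V * PowerSeries.X)
    (l₁ := 1 + PowerSeries.C V * PowerSeries.X) (l₂ := 1 + PowerSeries.C U * PowerSeries.X)
    (by rw [scaleDerivation_apply, PowerSeries.derivative_C, mul_zero]) hτ
    (by rw [scaleDerivation_apply, hd]; ring) (by rw [scaleDerivation_apply, hd]; ring)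
  have hu : IsUnit ((1 + PowerSeries.C U * PowerSeries.X) * (1 + PowerSeries.C V * PowerSeries.X) :
      A⟦X⟧) := by
    rw [PowerSeries.isUnit_iff_constantCoeff]
    simp
  have hr' : PowerSeries.C t ^ 2 * PowerSeries.derivative A r = 0 := by
    refine hu.mul_left_cancel ?_
    ext n
    have := congrArg (PowerSeries.coeff (n + 1)) hD
    rw [scaleDerivation_apply, show PowerSeries.C t ^ 2 * (PowerSeries.X *
      (1 + PowerSeries.C U * PowerSeries.X) * (1 + PowerSeries.C V * PowerSeries.X) *
      PowerSeries.derivative A r) = PowerSeries.X * (((1 + PowerSeries.C U * PowerSeries.X) *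
      (1 + PowerSeries.C V * PowerSeries.X)) *
      (PowerSeries.C t ^ 2 * PowerSeries.derivative A r)) by ring,
      PowerSeries.coeff_succ_X_mul] at this
    rw [this, mul_zero, map_zero, map_zero]
  have hconst : PowerSeries.C t ^ 2 * r =
      PowerSeries.C (t ^ 2 * PowerSeries.constantCoeff r) := by
    have : IsAddTorsionFree A := IsAddTorsionFree.of_module_rat A
    refine PowerSeries.derivative.ext ?_ ?_
    · rw [← map_pow, Derivation.leibniz, PowerSeries.derivative_C, PowerSeries.derivative_C,
        smul_zero, add_zero, smul_eq_mul, map_pow, hr']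
    · simp
  have hpow : (PowerSeries.C t ^ 2 * PowerSeries.C t ^ (N - 1) : A⟦X⟧) = 0 := by
    rw [← pow_add]
    exact pow_eq_zero_of_le (by omega) htN
  have hτ0 : PowerSeries.constantCoeff τ = 1 := by
    have := congrArg PowerSeries.constantCoeff hτ
    simpa using this
  have h0 := congrArg (map (PowerSeries.constantCoeff (R := A))) hr
  rw [map_pentLeft _ ⟨N, htN⟩,
    map_mul (map (PowerSeries.constantCoeff (R := A))) (C r + C (PowerSeries.C t ^ (N - 1)) * h),
    map_pentRight _ ⟨N, htN⟩] at h0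
  simp only [map_mul, PowerSeries.constantCoeff_X, mul_zero, hτ0, PowerSeries.constantCoeff_C,
    pentLeft_zero, pentRight_zero hN ht, mul_one, map_add, map_C, map_pow] at h0
  have h1 : t ^ 2 * PowerSeries.constantCoeff r = t ^ 2 := by
    refine C_injective (Fin 2) A ?_
    have h2 := congrArg (fun p => C t ^ 2 * p) h0
    have h3 : (C t ^ 2 * C t ^ (N - 1) : MvPolynomial (Fin 2) A) = 0 := by
      rw [← pow_add]
      exact pow_eq_zero_of_le (by omega) (C_pow_eq_zero ht)
    rw [C_mul, C_pow]
    linear_combination -h2 - h3 * map (PowerSeries.constantCoeff (R := A)) h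
  rw [hr, ← mul_assoc, mul_add, ← C_mul, hconst, h1, ← mul_assoc, ← C_mul, hpow, C_0, zero_mul,
    add_zero, map_pow]

/-- Pairs of the expansion at `s = 0` and the value at `s = 1` of a rational function of `s`. -/
def expansionPairs (A : Type*) [CommRing A] [Algebra ℚ A] : Subalgebra ℚ (A⟦X⟧ × A) where
  carrier := {x | ∃ p q : A[X], x.1 * q = p ∧ x.2 * q.eval 1 = p.eval 1 ∧ IsUnit (q.eval 1)}
  mul_mem' := by
    rintro ⟨f, a⟩ ⟨g, b⟩ ⟨p, q, h1, h2, h3⟩ ⟨p', q', h1', h2', h3'⟩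
    refine ⟨p * p', q * q', ?_, ?_, ?_⟩
    · have h1 : f * q = p := h1
      have h1' : g * q' = p' := h1'
      change f * g * ((q * q' : A[X]) : A⟦X⟧) = ((p * p' : A[X]) : A⟦X⟧)
      rw [Polynomial.coe_mul, Polynomial.coe_mul, ← h1, ← h1']
      ring
    · have h2 : a * q.eval 1 = p.eval 1 := h2
      have h2' : b * q'.eval 1 = p'.eval 1 := h2'
      change a * b * (q * q').eval 1 = (p * p').eval 1
      rw [Polynomial.eval_mul, Polynomial.eval_mul, ← h2, ← h2']
      ring
    · rw [Polynomial.eval_mul]; exact h3.mul h3'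
  add_mem' := by
    rintro ⟨f, a⟩ ⟨g, b⟩ ⟨p, q, h1, h2, h3⟩ ⟨p', q', h1', h2', h3'⟩
    refine ⟨p * q' + p' * q, q * q', ?_, ?_, ?_⟩
    · have h1 : f * q = p := h1
      have h1' : g * q' = p' := h1'
      change (f + g) * ((q * q' : A[X]) : A⟦X⟧) = ((p * q' + p' * q : A[X]) : A⟦X⟧)
      rw [Polynomial.coe_add, Polynomial.coe_mul, Polynomial.coe_mul, Polynomial.coe_mul, ← h1, ← h1']
      ring
    · have h2 : a * q.eval 1 = p.eval 1 := h2
      have h2' : b * q'.eval 1 = p'.eval 1 := h2'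
      change (a + b) * (q * q').eval 1 = (p * q' + p' * q).eval 1
      rw [Polynomial.eval_add, Polynomial.eval_mul, Polynomial.eval_mul, Polynomial.eval_mul,
        ← h2, ← h2']
      ring
    · rw [Polynomial.eval_mul]; exact h3.mul h3'
  algebraMap_mem' r := by
    refine ⟨Polynomial.C (algebraMap ℚ A r), 1, ?_, ?_, ?_⟩
    · change algebraMap ℚ A⟦X⟧ r * ((1 : A[X]) : A⟦X⟧) = _
      rw [Polynomial.coe_one, mul_one, Polynomial.coe_C, PowerSeries.algebraMap_apply]
    · change algebraMap ℚ A r * _ = _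
      rw [Polynomial.eval_one, Polynomial.eval_C, mul_one]
    · rw [Polynomial.eval_one]
      exact isUnit_one

/-- Passage from formal `s` to `s = 1`. All ingredients lift to pairs of an expansion at `0` and a
value at `1` of one rational function. A pair with vanishing expansion has zero numerator, and its
value is `0` because the denominator is a unit at `1`. -/
lemma pentagon_of_annihilator (hN : 0 < N) (ht : t ^ N = 0)
    (hann : ∀ k ≤ N, ∀ a : A, t ^ k * a = 0 → t ^ (N - k) ∣ a) (hτ : τ * (1 + U + V) = 1) :
    C (t ^ 2) * pentLeft N t U V τ = C (t ^ 2) * pentRight N t U V τ := by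
  set W := expansionPairs A
  have hu : IsUnit (1 + U + V) := IsUnit.of_mul_eq_one τ (by rw [mul_comm]; exact hτ)
  set σ : A⟦X⟧ := PowerSeries.invOfUnit
    (1 + PowerSeries.C U * PowerSeries.X + PowerSeries.C V * PowerSeries.X) 1 with hσ
  have hσ1 : σ * (1 + PowerSeries.C U * PowerSeries.X + PowerSeries.C V * PowerSeries.X) = 1 := by
    rw [mul_comm]
    exact PowerSeries.mul_invOfUnit _ 1 (by simp)
  let t' : W := ⟨(PowerSeries.C t, t), Polynomial.C t, 1, by simp, by simp, by simp⟩
  let U' : W := ⟨(PowerSeries.C U * PowerSeries.X, U), Polynomial.C U * Polynomial.X, 1,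
    by simp, by simp, by simp⟩
  let V' : W := ⟨(PowerSeries.C V * PowerSeries.X, V), Polynomial.C V * Polynomial.X, 1,
    by simp, by simp, by simp⟩
  let τ' : W := ⟨(σ, τ), 1, 1 + Polynomial.C U * Polynomial.X + Polynomial.C V * Polynomial.X,
    by simpa using hσ1, by simpa using hτ, by simpa using hu⟩
  have ht' : t' ^ N = 0 := by
    refine Subtype.ext (Prod.ext ?_ ?_)
    · change PowerSeries.C t ^ N = 0
      rw [← map_pow, ht, map_zero]
    · exact ht
  let π₁ : W →+* A⟦X⟧ := (RingHom.fst _ _).comp W.val.toRingHom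
  let π₂ : W →+* A := (RingHom.snd _ _).comp W.val.toRingHom
  have hinj : ∀ w : W, π₁ w = 0 → π₂ w = 0 := by
    rintro ⟨⟨f, a⟩, p, q, h1, h2, h3⟩ (rfl : f = 0)
    have hp : p = 0 := Polynomial.coe_injective A (by simpa using h1.symm)
    have h2 : a * q.eval 1 = p.eval 1 := h2
    rw [hp, Polynomial.eval_zero] at h2
    exact h3.mul_left_eq_zero.1 h2
  have h1 : map π₁ (C (t' ^ 2) * pentLeft N t' U' V' τ' - C (t' ^ 2) * pentRight N t' U' V' τ') = 0 := by
    rw [map_sub, map_mul, map_mul, map_C, map_pentLeft _ ⟨N, ht'⟩, map_pentRight _ ⟨N, ht'⟩, map_pow]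
    exact sub_eq_zero.2 (pentagon_powerSeries hN ht hann U V hσ1)
  have h2 : map π₂ (C (t' ^ 2) * pentLeft N t' U' V' τ' - C (t' ^ 2) * pentRight N t' U' V' τ') = 0 := by
    ext s
    rw [coeff_map, coeff_zero]
    refine hinj _ ?_
    rw [← coeff_map, h1, coeff_zero]
  rw [map_sub, map_mul, map_mul, map_C, map_pentLeft _ ⟨N, ht'⟩, map_pentRight _ ⟨N, ht'⟩,
    map_pow] at h2
  exact sub_eq_zero.1 h2

end PowerSeries

/-- The pentagon identity for the series `ψ`. -/
theorem pentagon (hN : 0 < N) (ht : t ^ N = 0) (hτ : τ * (1 + U + V) = 1) :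
    pentLeft N t U V τ = pentRight N t U V τ := by
  -- In `A⟦X⟧ / (X^(N+2))` the annihilators of powers of `X` are as small as possible, which need
  -- not hold for `t` in `A`.
  set I : Ideal A⟦X⟧ := Ideal.span {PowerSeries.X ^ (N + 2)}
  set E := A⟦X⟧ ⧸ I
  set ξ : E := Ideal.Quotient.mk I PowerSeries.X with hξ
  have hξN : ξ ^ (N + 2) = 0 := by
    rw [hξ, ← map_pow]
    exact Ideal.Quotient.eq_zero_iff_mem.2 (Ideal.subset_span rfl)
  have ht2 : t ^ (N + 2) = 0 := pow_eq_zero_of_le (by omega) ht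
  have hann : ∀ k ≤ N + 2, ∀ a : E, ξ ^ k * a = 0 → ξ ^ (N + 2 - k) ∣ a := by
    intro k hk a ha
    obtain ⟨f, rfl⟩ := Ideal.Quotient.mk_surjective a
    rw [hξ, ← map_pow, ← map_mul, Ideal.Quotient.eq_zero_iff_mem, Ideal.mem_span_singleton] at ha
    obtain ⟨g, hg⟩ := ha
    have : f = PowerSeries.X ^ (N + 2 - k) * g := by
      ext n
      have := congrArg (PowerSeries.coeff (n + k)) hg
      rw [← Nat.add_sub_of_le hk, pow_add, mul_assoc, PowerSeries.coeff_X_pow_mul,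
        PowerSeries.coeff_X_pow_mul] at this
      simpa using this
    rw [this, map_mul, map_pow]
    exact dvd_mul_right _ _
  let c : A →+* E := (Ideal.Quotient.mk I).comp PowerSeries.C
  let ev : E →+* A := Ideal.Quotient.lift I (nilEval (RingHom.id A) ht2) (by
    intro f hf
    obtain ⟨g, rfl⟩ := Ideal.mem_span_singleton.1 hf
    rw [map_mul, map_pow, nilEval_X, ht2, zero_mul])
  have hc : ∀ a, ev (c a) = a := fun a => by
    change ev (Ideal.Quotient.mk I (PowerSeries.C a)) = a
    rw [Ideal.Quotient.lift_mk, nilEval_C, RingHom.id_apply]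
  have hevξ : ev ξ = t := by rw [hξ, Ideal.Quotient.lift_mk, nilEval_X]
  have hτ' : c τ * (1 + c U + c V) = 1 := by rw [← map_one c, ← map_add, ← map_add, ← map_mul, hτ]
  have h := pentagon_of_annihilator (by omega) hξN hann hτ'
  -- Cancelling `ξ²` leaves the identity modulo `ξ^N`, which suffices because `ξ` is then sent to
  -- `t` with `t ^ N = 0`. The two extra orders were added for this.
  have h1 : C (ξ ^ N) ∣ pentLeft (N + 2) ξ (c U) (c V) (c τ) - pentRight (N + 2) ξ (c U) (c V) (c τ) := by
    rw [C_dvd_iff_dvd_coeff]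
    intro s
    have := congrArg (coeff s) (sub_eq_zero.2 h)
    rw [← mul_sub, coeff_C_mul, coeff_zero] at this
    exact hann 2 (by omega) _ this
  obtain ⟨g, hg⟩ := h1
  have h2 := congrArg (map ev) hg
  rw [map_sub, map_mul, map_C, map_pow, hevξ, ht, C_0, zero_mul, map_pentLeft _ ⟨_, hξN⟩,
    map_pentRight _ ⟨_, hξN⟩, hc, hc, hc, hevξ, sub_eq_zero] at h2
  have htN := C_pow_eq_zero (σ := Fin 2) ht
  rw [pentLeft, pentRight] at h2 ⊢
  simpa only [psiNil_eq_of_le htN (show N ≤ N + 2 by omega)] using h2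

end Pentagon
end MvPolynomial

/-! ### The building blocks `φ` of the series of a Neumann–Zagier datum -/

section Phi

open MvPolynomial (half)

variable {S S' : Type*} [CommRing S] [Algebra ℚ S] [CommRing S'] [Algebra ℚ S'] {N : ℕ} {t : S}

/-- The contribution of a tetrahedron with `u = z / (1 - z)` and flattening `(f, g)`. -/
def phi (N : ℕ) (t u f g x : S) : S :=
  texp t (half S ^ 3 * t * (2 * (1 - g) * f - (1 + u) * f ^ 2) +
    half S * (1 - g - (1 + u) * f) * x) * psiNil N t u (x + half S * t * f)

lemma map_phi (F : S →+* S') (ht : IsNilpotent t) (u f g x : S) :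
    F (phi N t u f g x) = phi N (F t) (F u) (F f) (F g) (F x) := by
  rw [phi, map_mul, map_texp ht, map_psiNil F ht, phi]
  simp only [map_add, map_mul, map_sub, map_pow, map_one, MvPolynomial.map_half, map_ofNat]

/-- Blocks for the degenerate parameters `u = 0` and, in the next lemma, `u = -1`, with flattenings
for which they do not depend on `x`. They reduce the pentagon to the change of quad. -/
lemma phi_zero (N : ℕ) (t x : S) : phi N t 0 0 1 x = 1 := by
  rw [phi, psiNil_zero]
  simp

lemma phi_neg_one (hN : 0 < N) (ht : IsNilpotent t) (f x : S) :
    phi N t (-1) f 0 x = texp t ((1 / 12 : ℚ) • t) := by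
  have h6 : half S * algebraMap ℚ S (1 / 6) = algebraMap ℚ S (1 / 12) := by
    rw [half, ← map_mul, show (1 / 2 * (1 / 6) : ℚ) = 1 / 12 by norm_num]
  rw [phi, psiNil_neg_one hN, ← texp_add ht]
  congr 1
  rw [Algebra.smul_def, Algebra.smul_def, ← h6]
  linear_combination (half S ^ 2 * t * f) * MvPolynomial.half_mul_two (A := S)

end Phi

/-! ### The pentagon identity with flattenings. -/

namespace MvPolynomial

section PhiPentagon

/-- The coefficient of `ħ` by which the two sides of the pentagon identity for `φ` differ. -/
def pentConstant {A : Type*} [CommRing A] [Algebra ℚ A] (F₁ G₁ F₂ G₂ e : A) : A :=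
  half A ^ 3 * (2 * (F₁ - G₁ + F₂ - G₂) + 4 * e - F₁ ^ 2 - G₁ ^ 2 - F₂ ^ 2 - G₂ ^ 2 -
    2 * F₁ * G₁ + 2 * F₁ * G₂ + 2 * G₁ * F₂ + 2 * G₁ * G₂ - 2 * F₂ * G₂) - algebraMap ℚ A (1 / 6)

/-- The comparison of all elementary exponents in `phi_pentagon`. Here `h` is `1/2` and `s` stands
for `1/6`, so that the constant `5/24` of `pentExponent` reads `3 h³ - s`. The flattening parameter
`e` is free. -/
lemma pentagon_exponents {S : Type*} [CommRing S] {h s T u v τ x y F₁ G₁ F₂ G₂ e : S}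
    (hh : h * 2 = 1) (hτ : τ * (1 + u + v) = 1) :
    h ^ 3 * T * (2 * (1 - G₁) * F₁ - (1 + u) * F₁ ^ 2) +
      h ^ 3 * T * (2 * (1 - G₂) * F₂ - (1 + v) * F₂ ^ 2) +
      (h * (1 - G₁ - (1 + u) * F₁) * x + h * (1 - G₂ - (1 + v) * F₂) * y +
        T * (h * (τ * (h * (1 - G₁ - (1 + u) * F₁) - h * (1 - G₂ - (1 + v) * F₂)) ^ 2))) +
      (T * (3 * h ^ 3 - s + h ^ 3 * τ) + h * τ *
        ((1 + u) * (u * (x + (T * (τ * (h * (1 - G₁ - (1 + u) * F₁) - h * (1 - G₂ - (1 + v) * F₂))) +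
          h * T * F₁)) - (1 + v) * (y + (-(T * (τ * (h * (1 - G₁ - (1 + u) * F₁) -
            h * (1 - G₂ - (1 + v) * F₂)))) + h * T * F₂))) +
        (1 + v) * (v * (y + (-(T * (τ * (h * (1 - G₁ - (1 + u) * F₁) -
            h * (1 - G₂ - (1 + v) * F₂)))) + h * T * F₂)) -
          (1 + u) * (x + (T * (τ * (h * (1 - G₁ - (1 + u) * F₁) - h * (1 - G₂ - (1 + v) * F₂))) +
          h * T * F₁))))) =
    T * (h ^ 3 * (2 * (F₁ - G₁ + F₂ - G₂) + 4 * e - F₁ ^ 2 - G₁ ^ 2 - F₂ ^ 2 - G₂ ^ 2 -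
    2 * F₁ * G₁ + 2 * F₁ * G₂ + 2 * G₁ * F₂ + 2 * G₁ * G₂ - 2 * F₂ * G₂) - s) +
    ((h ^ 3 * T * (2 * (1 - e) * (F₁ + F₂) - (1 + u * v * τ) * (F₁ + F₂) ^ 2) +
      h * (1 - e - (1 + u * v * τ) * (F₁ + F₂)) * (x + y)) +
    (h ^ 3 * T * (2 * (1 - (F₁ - G₂ + e)) * (1 - F₁ - G₁ + G₂) -
        (1 + -((1 + u) * τ)) * (1 - F₁ - G₁ + G₂) ^ 2) +
      h * (1 - (F₁ - G₂ + e) - (1 + -((1 + u) * τ)) * (1 - F₁ - G₁ + G₂)) *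
        (u * x - (1 + v) * y)) +
    (h ^ 3 * T * (2 * (1 - (F₂ - G₁ + e)) * (1 - F₂ - G₂ + G₁) -
        (1 + -((1 + v) * τ)) * (1 - F₂ - G₂ + G₁) ^ 2) +
      h * (1 - (F₂ - G₁ + e) - (1 + -((1 + v) * τ)) * (1 - F₂ - G₂ + G₁)) *
        (v * y - (1 + u) * x))) := by
  grind

variable {A : Type*} [CommRing A] [Algebra ℚ A] {N : ℕ} {t U V τ : A}

/-- The building block in one of the variables, as a shift of `ψ`. -/
lemma phi_C_X {σ : Type*} (ht : IsNilpotent t) (u f g : A) (i : σ) {c : σ → A}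
    (hc : c i = half A * t * f) :
    phi N (C t) (C u) (C f) (C g) (X i) =
      C (texp t (half A ^ 3 * t * (2 * (1 - g) * f - (1 + u) * f ^ 2))) *
        (texp (C t) (C (half A * (1 - g - (1 + u) * f)) * X i) *
          shift c (psiNil N (C t) (C u) (X i))) := by
  have hhalf : half (MvPolynomial σ A) = C (half A) :=
    (map_half (C : A →+* MvPolynomial σ A)).symm
  rw [map_texp ht (C : A →+* MvPolynomial σ A), shift_psiNil ht, shift_C, shift_X, hc, phi,
    texp_add (isNilpotent_C ht), mul_assoc, hhalf]
  simp only [C_mul, C_sub, C_add, C_pow, C_1, map_ofNat]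

lemma mul_rearrange {S : Type*} [CommRing S] (a b c a' b' c' : S) :
    a * (b * c) * (a' * (b' * c')) = a * a' * (b * b' * (c * c')) := by
  ring

/-- A block `phi` is a translated `ψ` times a linear exponential, and the exponential acts on the
average by a further translation. So this is the pentagon for `ψ` evaluated at translated variables;
the new flattenings are those that absorb the translation. -/
theorem phi_pentagon (hN : 0 < N) (ht : t ^ N = 0) (hτ : τ * (1 + U + V) = 1)
    (F₁ G₁ F₂ G₂ e : A) :
    wick (pentMatrix τ) (phi N (C t) (C U) (C F₁) (C G₁) (X 0) *
      phi N (C t) (C V) (C F₂) (C G₂) (X 1)) =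
    texp (C t) (C (t * pentConstant F₁ G₁ F₂ G₂ e)) *
      (phi N (C t) (C (U * V * τ)) (C (F₁ + F₂)) (C e) (X 0 + X 1) *
      phi N (C t) (C (-((1 + U) * τ))) (C (1 - F₁ - G₁ + G₂)) (C (F₁ - G₂ + e)) (pentForm₁ U V) *
      phi N (C t) (C (-((1 + V) * τ))) (C (1 - F₂ - G₂ + G₁)) (C (F₂ - G₁ + e))
        (pentForm₂ U V)) := by
  have htn : IsNilpotent t := ⟨N, ht⟩
  have htC : IsNilpotent (C t : MvPolynomial (Fin 2) A) := isNilpotent_C htn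
  have hC := congrArg (C : A → MvPolynomial (Fin 2) A) hτ
  have hh := C_half_mul_two (σ := Fin 2) (A := A)
  have hQ := pentMatrix_isSymm τ
  set b : Fin 2 → A := ![half A * (1 - G₁ - (1 + U) * F₁), half A * (1 - G₂ - (1 + V) * F₂)] with hb
  set c : Fin 2 → A := ![half A * t * F₁, half A * t * F₂] with hc
  set e₁ := half A ^ 3 * t * (2 * (1 - G₁) * F₁ - (1 + U) * F₁ ^ 2)
  set e₂ := half A ^ 3 * t * (2 * (1 - G₂) * F₂ - (1 + V) * F₂ ^ 2)
  set E := psiNil N (C t) (C U) (X 0 : MvPolynomial (Fin 2) A) * psiNil N (C t) (C V) (X 1) with hE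
  have hlin : linForm b = C (half A * (1 - G₁ - (1 + U) * F₁)) * X 0 +
      C (half A * (1 - G₂ - (1 + V) * F₂)) * X 1 := by
    rw [linForm, Fin.sum_univ_two, hb, Matrix.cons_val_zero, Matrix.cons_val_one]
    rfl
  have hprod : phi N (C t) (C U) (C F₁) (C G₁) (X 0 : MvPolynomial (Fin 2) A) *
      phi N (C t) (C V) (C F₂) (C G₂) (X 1) =
      C (texp t (e₁ + e₂)) * (texp (C t) (linForm b) * shift c E) := by
    rw [phi_C_X htn U F₁ G₁ (0 : Fin 2) (c := c) rfl, phi_C_X htn V F₂ G₂ (1 : Fin 2) (c := c) rfl,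
      mul_rearrange, ← texp_add htC, ← C_mul, ← texp_add htn, hE, map_mul (shift c), hlin]
  have hbQ : b ⬝ᵥ (pentMatrix τ).mulVec b = τ * (b 0 - b 1) ^ 2 := by
    simp [pentMatrix, dotProduct, Matrix.mulVec, Fin.sum_univ_two]
    ring
  have hd : (fun i => t * (pentMatrix τ).mulVec b i + c i) =
      ![t * (τ * (b 0 - b 1)) + half A * t * F₁, -(t * (τ * (b 0 - b 1))) + half A * t * F₂] := by
    ext i
    fin_cases i <;> simp [pentMatrix, dotProduct, Matrix.mulVec, Fin.sum_univ_two, hc] <;> ring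
  rw [hprod, wick_C_mul, wick_texp_mul htn hQ, wick_shift hQ, shift_shift, hd, hbQ]
  have hL : wick (pentMatrix τ) E = pentRight N t U V τ := pentagon hN ht hτ
  have hq : algebraMap ℚ A (5 / 24) = 3 * half A ^ 3 - algebraMap ℚ A (1 / 6) := by
    rw [half, ← map_pow, show (3 : A) = algebraMap ℚ A 3 from (map_ofNat _ 3).symm, ← map_mul,
      ← map_sub]
    congr 1; norm_num
  set d : Fin 2 → A :=
    ![t * (τ * (b 0 - b 1)) + half A * t * F₁, -(t * (τ * (b 0 - b 1))) + half A * t * F₂] with hdd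
  have hd0 : (C (d 0) : MvPolynomial (Fin 2) A) = C t * (C τ * (C (half A) * (1 - C G₁ - (1 + C U) * C F₁) -
      C (half A) * (1 - C G₂ - (1 + C V) * C F₂))) + C (half A) * C t * C F₁ := by
    simp only [hdd, hb, Matrix.cons_val_zero, Matrix.cons_val_one, C_add, C_mul, C_sub, C_1]
  have hd1 : (C (d 1) : MvPolynomial (Fin 2) A) = -(C t * (C τ * (C (half A) * (1 - C G₁ - (1 + C U) * C F₁) -
      C (half A) * (1 - C G₂ - (1 + C V) * C F₂)))) + C (half A) * C t * C F₂ := by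
    simp only [hdd, hb, Matrix.cons_val_zero, Matrix.cons_val_one, C_add, C_mul, C_sub, C_1, C_neg]
  have y0 : shift d (X 0 + X 1) = X 0 + X 1 + half _ * C t * C (F₁ + F₂) := by
    rw [map_add, shift_X, shift_X, hd0, hd1, ← C_half, C_add]
    ring
  have y1 : shift d (pentForm₁ U V + C (half A * t)) =
      pentForm₁ U V + half _ * C t * C (1 - F₁ - G₁ + G₂) := by
    rw [map_add, shift_C, pentForm₁, map_sub, map_mul, map_mul, shift_X, shift_X, shift_C, shift_C,
      hd0, hd1, ← C_half]
    simp only [C_mul, C_sub, C_add, C_1] at hC ⊢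
    grind
  have y2 : shift d (pentForm₂ U V + C (half A * t)) =
      pentForm₂ U V + half _ * C t * C (1 - F₂ - G₂ + G₁) := by
    rw [map_add, shift_C, pentForm₂, map_sub, map_mul, map_mul, shift_X, shift_X, shift_C, shift_C,
      hd0, hd1, ← C_half]
    simp only [C_mul, C_sub, C_add, C_1] at hC ⊢
    grind
  have key : texp (C t) (C (e₁ + e₂)) * (texp (C t) (linForm b + C (t * (half A *
      (τ * (b 0 - b 1) ^ 2)))) * texp (C t) (shift d (pentExponent t U V τ))) =
      texp (C t) (C (t * pentConstant F₁ G₁ F₂ G₂ e)) *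
      (texp (C t) (half _ ^ 3 * C t * (2 * (1 - C e) * C (F₁ + F₂) - (1 + C (U * V * τ)) *
        C (F₁ + F₂) ^ 2) + half _ * (1 - C e - (1 + C (U * V * τ)) * C (F₁ + F₂)) * (X 0 + X 1)) *
      texp (C t) (half _ ^ 3 * C t * (2 * (1 - C (F₁ - G₂ + e)) * C (1 - F₁ - G₁ + G₂) -
        (1 + C (-((1 + U) * τ))) * C (1 - F₁ - G₁ + G₂) ^ 2) + half _ * (1 - C (F₁ - G₂ + e) -
        (1 + C (-((1 + U) * τ))) * C (1 - F₁ - G₁ + G₂)) * pentForm₁ U V) *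
      texp (C t) (half _ ^ 3 * C t * (2 * (1 - C (F₂ - G₁ + e)) * C (1 - F₂ - G₂ + G₁) -
        (1 + C (-((1 + V) * τ))) * C (1 - F₂ - G₂ + G₁) ^ 2) + half _ * (1 - C (F₂ - G₁ + e) -
        (1 + C (-((1 + V) * τ))) * C (1 - F₂ - G₂ + G₁)) * pentForm₂ U V)) := by
    simp only [← texp_add htC]
    refine congrArg _ ?_
    rw [pentExponent, hq, map_add (shift d), shift_C, map_mul (shift d), map_add (shift d), map_mul (shift d),
      map_mul (shift d), shift_C, shift_C, shift_C, pentForm₁, pentForm₂, map_sub (shift d),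
      map_sub (shift d), map_mul (shift d), map_mul (shift d), map_mul (shift d), map_mul (shift d),
      shift_X, shift_X, shift_C, shift_C, shift_C, shift_C, hd0, hd1, ← C_half, hlin, pentConstant]
    simp only [hb, e₁, e₂, Matrix.cons_val_zero, Matrix.cons_val_one, C_mul, C_sub, C_add, C_1,
      C_neg, C_pow, map_ofNat] at hC ⊢
    have h := pentagon_exponents (s := C (algebraMap ℚ A (1 / 6))) (T := C t) hh hC (x := X 0)
      (y := X 1) (F₁ := C F₁) (G₁ := C G₁) (F₂ := C F₂) (G₂ := C G₂) (e := C e)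
    linear_combination h
  rw [hL, pentRight, map_mul (shift d), map_mul (shift d), map_mul (shift d), shift_texp htn, shift_psiNil htn, shift_psiNil htn,
    shift_psiNil htn, shift_C, shift_C, shift_C, map_texp htn (C : A →+* MvPolynomial (Fin 2) A),
    y0, y1, y2, phi, phi, phi]
  linear_combination (psiNil N (C t) (C (U * V * τ)) (X 0 + X 1 + half _ * C t * C (F₁ + F₂)) *
    psiNil N (C t) (C (-((1 + U) * τ))) (pentForm₁ U V + half _ * C t * C (1 - F₁ - G₁ + G₂)) *
    psiNil N (C t) (C (-((1 + V) * τ))) (pentForm₂ U V + half _ * C t * C (1 - F₂ - G₂ + G₁))) * key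

end PhiPentagon
end MvPolynomial

lemma texp_sum {S κ : Type*} [CommRing S] [Algebra ℚ S] {t : S} (ht : IsNilpotent t)
    (s : Finset κ) (a : κ → S) : texp t (∑ j ∈ s, a j) = ∏ j ∈ s, texp t (a j) := by
  classical
  induction s using Finset.induction_on with
  | empty => simp
  | insert j s hj ih => rw [Finset.sum_insert hj, Finset.prod_insert hj, texp_add ht, ih]

namespace MvPolynomial

variable {ι κ A : Type*} [CommRing A] [Algebra ℚ A] {N : ℕ} {t : A}

lemma C_texp (ht : IsNilpotent t) (a : A) :
    (C (texp t a) : MvPolynomial ι A) = texp (C t) (C a) :=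
  map_texp ht (C : A →+* MvPolynomial ι A) a

/-! ### The formal Gaussian integral of a product of building blocks -/

variable [Fintype ι]

/-- The formal Gaussian integral of a product of building blocks `φ`, at an element `t` with
`t ^ N = 0`. -/
def amp (N : ℕ) (t : A) (Q : Matrix ι ι A) (u f g : ι → A) : A :=
  constantCoeff (wick Q (∏ j, phi N (C t) (C (u j)) (C (f j)) (C (g j)) (X j)))

lemma constantCoeff_affineSubst_zero (P : Matrix κ ι A) (p : MvPolynomial κ A) :
    constantCoeff (affineSubst P 0 p) = constantCoeff p := by
  induction p using MvPolynomial.induction_on with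
  | C a => simp
  | add p q hp hq => simp only [map_add, hp, hq]
  | mul_X p i hp => simp [hp]

/-- The dependence on the flattening, made explicit. -/
lemma amp_eq (ht : IsNilpotent t) {Q : Matrix ι ι A} (hQ : Q.IsSymm) (u f g : ι → A) {b : ι → A}
    (hb : ∀ j, b j = half A * (1 - g j - (1 + u j) * f j)) :
    amp N t Q u f g =
      texp t (∑ j, half A ^ 3 * t * (2 * (1 - g j) * f j - (1 + u j) * f j ^ 2) +
        t * (half A * (b ⬝ᵥ Q.mulVec b))) *
      constantCoeff (shift (fun j => t * Q.mulVec b j + half A * t * f j)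
        (wick Q (∏ j, psiNil N (C t) (C (u j)) (X j)))) := by
  have htC : IsNilpotent (C t : MvPolynomial ι A) := isNilpotent_C ht
  set c : ι → A := fun j => half A * t * f j with hc
  have hprod : ∏ j, phi N (C t) (C (u j)) (C (f j)) (C (g j)) (X j : MvPolynomial ι A) =
      C (texp t (∑ j, half A ^ 3 * t * (2 * (1 - g j) * f j - (1 + u j) * f j ^ 2))) *
        (texp (C t) (linForm b) * shift c (∏ j, psiNil N (C t) (C (u j)) (X j))) := by
    rw [linForm, texp_sum htC, map_prod, texp_sum ht, map_prod, ← Finset.prod_mul_distrib,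
      ← Finset.prod_mul_distrib]
    refine Finset.prod_congr rfl fun j _ => ?_
    rw [phi_C_X ht (u j) (f j) (g j) j (c := c) rfl, hb]
  rw [amp, hprod, wick_C_mul, wick_texp_mul ht hQ, wick_shift hQ, shift_shift, map_mul, map_mul,
    constantCoeff_C, map_texp htC constantCoeff, texp_add ht, map_add, constantCoeff_C,
    constantCoeff_C]
  have h0 : constantCoeff (linForm b) = 0 := by simp [linForm]
  rw [h0, zero_add, mul_assoc]

/-- The dependence on the flattening. -/
lemma amp_flattening (ht : IsNilpotent t) {Q : Matrix ι ι A} (hQ : Q.IsSymm)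
    {u f g f' g' : ι → A} (h : Q.mulVec (fun j => (1 + u j) * (f' j - f j) + (g' j - g j)) = f' - f) :
    amp N t Q u f g =
      texp t (t * (half A ^ 3 * ∑ j, (g' j - g j) * (f j + f' j))) * amp N t Q u f' g' := by
  set b : ι → A := fun j => half A * (1 - g j - (1 + u j) * f j) with hb
  set b' : ι → A := fun j => half A * (1 - g' j - (1 + u j) * f' j) with hb'
  set β : ι → A := fun j => (1 + u j) * (f' j - f j) + (g' j - g j) with hβ
  have hh := half_mul_two (A := A)
  have hbb : b = b' + half A • β := by
    ext j
    simp only [hb, hb', hβ, Pi.add_apply, Pi.smul_apply, smul_eq_mul]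
    ring
  have hQb : Q.mulVec b = Q.mulVec b' + half A • (f' - f) := by
    rw [hbb, Matrix.mulVec_add, Matrix.mulVec_smul, h]
  have hd : b ⬝ᵥ Q.mulVec b = b' ⬝ᵥ Q.mulVec b' + b' ⬝ᵥ (f' - f) +
      half A ^ 2 * (β ⬝ᵥ (f' - f)) := by
    have hs : β ⬝ᵥ Q.mulVec b' = b' ⬝ᵥ (f' - f) := by
      rw [Matrix.dotProduct_mulVec, ← Matrix.mulVec_transpose, hQ.eq, h, dotProduct_comm]
    rw [hQb, hbb, dotProduct_add, add_dotProduct, add_dotProduct, smul_dotProduct, smul_dotProduct,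
      dotProduct_smul, dotProduct_smul, hs]
    simp only [smul_eq_mul]
    linear_combination (b' ⬝ᵥ (f' - f)) * hh
  -- The hypothesis says that the linear coefficients change so as to compensate the translation by
  -- half of `t f` in the arguments. Only the elementary prefactor is affected.
  have hfun : (fun j => t * Q.mulVec b j + half A * t * f j) =
      fun j => t * Q.mulVec b' j + half A * t * f' j := by
    ext j
    rw [hQb]
    simp only [Pi.add_apply, Pi.smul_apply, Pi.sub_apply, smul_eq_mul]
    ring
  have hexp : ∑ j, half A ^ 3 * t * (2 * (1 - g j) * f j - (1 + u j) * f j ^ 2) +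
        t * (half A * (b ⬝ᵥ Q.mulVec b)) =
      t * (half A ^ 3 * ∑ j, (g' j - g j) * (f j + f' j)) +
      (∑ j, half A ^ 3 * t * (2 * (1 - g' j) * f' j - (1 + u j) * f' j ^ 2) +
        t * (half A * (b' ⬝ᵥ Q.mulVec b'))) := by
    have hz : ∀ j, half A ^ 3 * t * (2 * (1 - g j) * f j - (1 + u j) * f j ^ 2) =
        half A ^ 3 * t * (2 * (1 - g' j) * f' j - (1 + u j) * f' j ^ 2) +
        t * half A ^ 3 * ((g' j - g j) * (f j + f' j)) -
        t * half A * (b' j * (f' j - f j)) - t * half A ^ 3 * (β j * (f' j - f j)) := by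
      intro j
      simp only [hb', hβ]
      linear_combination (half A ^ 2 * t * ((1 - g' j - (1 + u j) * f' j) * (f' j - f j))) * (-hh)
    rw [hd, Finset.sum_congr rfl fun j _ => hz j]
    simp only [Finset.sum_add_distrib, Finset.sum_sub_distrib, ← Finset.mul_sum, dotProduct,
      Pi.sub_apply]
    ring
  rw [amp_eq ht hQ u f g (b := b) (fun j => rfl), amp_eq ht hQ u f' g' (b := b') (fun j => rfl),
    hfun, hexp, texp_add ht, mul_assoc]

/-- The linear forms that replace the two variables of a bipyramid. -/
def pachnerSubst [DecidableEq κ] (U V : A) : Matrix (Fin 3 ⊕ κ) (Fin 2 ⊕ κ) A :=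
  Matrix.fromBlocks !![1, 1; U, -(1 + V); -(1 + U), V] 0 0 1

/-- The direction along which the two variables of a bipyramid are integrated. -/
def pachnerDir : Fin 2 ⊕ κ → A := Sum.elim ![1, -1] 0

/-- The pentagon identity for a pair of linear forms. -/
lemma wick_phi_mul_phi (hN : 0 < N) (ht : t ^ N = 0) {U V τ : A} (hτ : τ * (1 + U + V) = 1)
    (F₁ G₁ F₂ G₂ e : A) (P : Matrix (Fin 2) ι A) {θ : ι → A}
    (hθ : Matrix.vecMulVec (P.mulVec θ) (P.mulVec θ) = !![1, -1; -1, 1])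
    {x y : MvPolynomial ι A} (hx : affineSubst P 0 (X 0) = x) (hy : affineSubst P 0 (X 1) = y)
    {r : MvPolynomial ι A} (hr : dirD θ r = 0) :
    wick (τ • Matrix.vecMulVec θ θ) (phi N (C t) (C U) (C F₁) (C G₁) x *
      phi N (C t) (C V) (C F₂) (C G₂) y * r) =
    C (texp t (t * pentConstant F₁ G₁ F₂ G₂ e)) *
      (phi N (C t) (C (U * V * τ)) (C (F₁ + F₂)) (C e) (x + y) *
      phi N (C t) (C (-((1 + U) * τ))) (C (1 - F₁ - G₁ + G₂)) (C (F₁ - G₂ + e))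
        (C U * x - C (1 + V) * y) *
      phi N (C t) (C (-((1 + V) * τ))) (C (1 - F₂ - G₂ + G₁)) (C (F₂ - G₁ + e))
        (C V * y - C (1 + U) * x) * r) := by
  have htn : IsNilpotent t := ⟨N, ht⟩
  have htC : IsNilpotent (C t : MvPolynomial (Fin 2) A) := isNilpotent_C htn
  have hQ : (τ • Matrix.vecMulVec θ θ).IsSymm := by
    ext i j
    simp [Matrix.vecMulVec_apply, mul_comm]
  have hP : P * (τ • Matrix.vecMulVec θ θ) * P.transpose = pentMatrix τ := by
    rw [Matrix.mul_smul, Matrix.smul_mul, Matrix.mul_vecMulVec, Matrix.vecMulVec_mul,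
      Matrix.vecMul_transpose, hθ]
    ext i j
    fin_cases i <;> fin_cases j <;> simp [pentMatrix]
  have hr' : ∀ i, dirD ((τ • Matrix.vecMulVec θ θ).row i) r = 0 := by
    intro i
    have : (τ • Matrix.vecMulVec θ θ).row i = fun j => (τ * θ i) * θ j := by
      ext j
      simp [Matrix.vecMulVec_apply, mul_assoc]
    rw [this, dirD_smul, hr, mul_zero]
  have mp : ∀ u f g z, affineSubst P 0 (phi N (C t) (C u) (C f) (C g) z) =
      phi N (C t) (C u) (C f) (C g) (affineSubst P 0 z) := by
    intro u f g z
    have := map_phi (N := N) (affineSubst P 0 : MvPolynomial (Fin 2) A →+* MvPolynomial ι A) htC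
      (C u) (C f) (C g) z
    simpa using this
  rw [wick_mul_of_dirD_eq_zero hQ hr', ← hx, ← hy, ← mp, ← mp, ← map_mul, wick_affineSubst hQ, hP,
    phi_pentagon hN ht hτ F₁ G₁ F₂ G₂ e, ← C_texp htn, map_mul, map_mul, map_mul, mp, mp, mp,
    affineSubst_C, pentForm₁, pentForm₂, map_add (affineSubst P 0), map_sub (affineSubst P 0),
    map_sub (affineSubst P 0), map_mul (affineSubst P 0), map_mul (affineSubst P 0),
    map_mul (affineSubst P 0), map_mul (affineSubst P 0), affineSubst_C, affineSubst_C,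
    affineSubst_C, affineSubst_C, mul_assoc]

lemma affineSubst_phi [Fintype κ] (ht : IsNilpotent t) (P : Matrix ι κ A) (u f g : A)
    (z : MvPolynomial ι A) :
    affineSubst P 0 (phi N (C t) (C u) (C f) (C g) z) =
      phi N (C t) (C u) (C f) (C g) (affineSubst P 0 z) := by
  have := map_phi (N := N) (affineSubst P 0 : MvPolynomial ι A →+* MvPolynomial κ A)
    (isNilpotent_C ht) (C u) (C f) (C g) z
  simpa using this

lemma dirD_phi (ht : IsNilpotent t) {θ : ι → A} (u f g : A) {j : ι} (h : θ j = 0) :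
    dirD θ (phi N (C t) (C u) (C f) (C g) (X j)) = 0 := by
  classical
  have hX : affineSubst (Matrix.of fun _ : Unit => Pi.single j (1 : A)) 0 (X ()) = (X j : MvPolynomial ι A) := by
    rw [affineSubst_X, Finset.sum_eq_single j] <;> simp +contextual
  rw [← hX, ← affineSubst_phi ht, dirD_affineSubst]
  have h0 : Matrix.mulVec (Matrix.of fun _ : Unit => Pi.single j (1 : A)) θ = 0 := by
    ext i
    simp [Matrix.mulVec, h]
  have h1 : ∀ p : MvPolynomial Unit A, dirD (0 : Unit → A) p = 0 := by
    intro p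
    simp [dirD_eq_sum]
  rw [h0, h1, map_zero]

lemma dirD_prod_eq_zero {σ κ : Type*} {θ : σ → A} (s : Finset κ) {p : κ → MvPolynomial σ A}
    (h : ∀ i ∈ s, dirD θ (p i) = 0) : dirD θ (∏ i ∈ s, p i) = 0 := by
  classical
  induction s using Finset.induction_on with
  | empty => simp
  | insert j s hj ih =>
    rw [Finset.prod_insert hj, Derivation.leibniz, h j (by simp), ih fun i hi => h i (by simp [hi])]
    simp

/-- The change of quad at the index `j`. -/
lemma amp_quad [DecidableEq ι] (hN : 0 < N) (ht : t ^ N = 0) {Q : Matrix ι ι A} (hQ : Q.IsSymm)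
    (u f g : ι → A) (j : ι) {v f' : A} (hv : u j * v = -(1 + u j)) (hf' : f' = 1 - f j - g j) :
    amp N t (Matrix.diagonal (Function.update 1 j (u j)) * Q *
        Matrix.diagonal (Function.update 1 j (u j)) - u j • Matrix.single j j 1)
      (Function.update u j v) (Function.update f j f') (Function.update g j (f j)) =
    texp t (t * (half A ^ 3 * (1 - f j ^ 2 - 2 * f j * f') - algebraMap ℚ A (1 / 12))) *
      amp N t Q u f g := by
  have htn : IsNilpotent t := ⟨N, ht⟩
  have htC : IsNilpotent (C t : MvPolynomial ι A) := isNilpotent_C htn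
  set D : Matrix ι ι A := Matrix.diagonal (Function.update 1 j (u j)) with hD
  have hDt : D.transpose = D := Matrix.diagonal_transpose _
  have hDQ : (D * Q * D).IsSymm := by
    simp [Matrix.IsSymm, Matrix.transpose_mul, hQ.eq, hDt, Matrix.mul_assoc]
  set θ : ι → A := Pi.single j 1 with hθ
  have hθs : ((-u j) • Matrix.vecMulVec θ θ).IsSymm := by
    ext i j
    simp [Matrix.vecMulVec_apply, mul_comm]
  -- The new covariance is a rescaled copy of the old one plus the variance `-u j` in the single
  -- coordinate `j`, so that coordinate can be averaged first.
  have hQ' : D * Q * D - u j • Matrix.single j j 1 =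
      D * Q * D + (-u j) • Matrix.vecMulVec θ θ := by
    rw [sub_eq_add_neg, hθ, Matrix.single_eq_single_vecMulVec_single, neg_smul]
  set r : MvPolynomial ι A :=
    ∏ i ∈ Finset.univ.erase j, phi N (C t) (C (u i)) (C (f i)) (C (g i)) (X i) with hr
  have hr0 : dirD θ r = 0 := dirD_prod_eq_zero _ fun i hi =>
    dirD_phi htn _ _ _ (by simp [hθ, Finset.ne_of_mem_erase hi])
  have hτ : -u j * (1 + 0 + v) = 1 := by linear_combination -hv
  set P : Matrix (Fin 2) ι A := ![Pi.single j (-1), Pi.single j 1] with hP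
  have hx : affineSubst P 0 (X 0) = -X j := by
    rw [affineSubst_X, Finset.sum_eq_single j] <;> simp +contextual [hP]
  have hy : affineSubst P 0 (X 1) = X j := by
    rw [affineSubst_X, Finset.sum_eq_single j] <;> simp +contextual [hP]
  have hPθ : Matrix.vecMulVec (P.mulVec θ) (P.mulVec θ) = !![1, -1; -1, 1] := by
    ext i k
    fin_cases i <;> fin_cases k <;> simp [hP, hθ, Matrix.vecMulVec_apply, Matrix.mulVec]
  -- The pentagon with `U = 0`, `V = v` and the forms `-X j`, `X j`: the first block is trivial. On
  -- the right the parameters are `0`, `u j` and `-1`. The outer blocks are constants, the first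
  -- because its argument vanishes and the last by `phi_neg_one`. The middle one has argument `-(1 +
  -- v) X j`, which the rescaling turns into `X j`.
  have key := wick_phi_mul_phi hN ht hτ 0 1 f' (f j) (f j + g j) P hPθ hx hy hr0
  have hprod : ∏ i, phi N (C t) (C (Function.update u j v i)) (C (Function.update f j f' i))
      (C (Function.update g j (f j) i)) (X i : MvPolynomial ι A) =
      phi N (C t) (C v) (C f') (C (f j)) (X j) * r := by
    rw [← Finset.mul_prod_erase _ _ (Finset.mem_univ j)]
    simp only [Function.update_self]
    refine congrArg _ (Finset.prod_congr rfl fun i hi => ?_)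
    have := Finset.ne_of_mem_erase hi
    simp [this]
  rw [C_0, C_1, phi_zero, one_mul] at key
  rw [amp, hprod, hQ', wick_add_matrix hDQ hθs, key, wick_C_mul, map_mul, constantCoeff_C]
  have e0 : (0 : A) * v * -u j = 0 := by ring
  have e1 : -((1 + 0) * -u j) = u j := by ring
  have e2 : (1 : A) - 0 - 1 + f j = f j := by ring
  have e3 : 0 - f j + (f j + g j) = g j := by ring
  have e4 : -((1 + v) * -u j) = -1 := by linear_combination hv
  have e5 : f' - 1 + (f j + g j) = 0 := by rw [hf']; ring
  have e6 : 0 + f' = f' := zero_add _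
  have hD0 : ∀ p, constantCoeff (wick (D * Q * D) p) = constantCoeff (wick Q (affineSubst D 0 p)) := by
    intro p
    rw [wick_affineSubst hQ, constantCoeff_affineSubst_zero, hDt]
  have hDr : affineSubst D 0 r = r := by
    rw [hr, map_prod]
    refine Finset.prod_congr rfl fun i hi => ?_
    have := Finset.ne_of_mem_erase hi
    rw [affineSubst_phi htn, affineSubst_X, Finset.sum_eq_single i] <;>
      simp +contextual [hD, this, eq_comm]
  have hDj : affineSubst D 0 (C 0 * -X j - C (1 + v) * X j) = X j := by
    have h1 : affineSubst D 0 (X j) = C (u j) * X j := by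
      rw [affineSubst_X, Finset.sum_eq_single j] <;>
        simp +contextual [hD, eq_comm]
    have h2 : (C (u j) * C v : MvPolynomial ι A) = -(1 + C (u j)) := by
      rw [← C_mul, hv, C_neg, C_add, C_1]
    rw [map_sub (affineSubst D 0), map_mul (affineSubst D 0), map_mul (affineSubst D 0), C_0,
      map_zero, h1, affineSubst_C, C_add, C_1]
    linear_combination (-X j : MvPolynomial ι A) * h2
  have h0 : phi N (C t) (C 0) (C f') (C (f j + g j)) (-X j + X j : MvPolynomial ι A) =
      C (texp t (t * (half A ^ 3 * f' ^ 2))) := by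
    rw [neg_add_cancel, C_0, phi, psiNil_zero, C_texp htn, mul_one, hf']
    refine congrArg _ ?_
    simp only [← map_half (C : A →+* MvPolynomial ι A), C_add, C_mul, C_pow, C_sub, C_1]
    ring
  have h12 : texp (C t) ((1 / 12 : ℚ) • C t : MvPolynomial ι A) =
      C (texp t (t * algebraMap ℚ A (1 / 12))) := by
    rw [C_texp htn, Algebra.smul_def, mul_comm, C_mul]
    rfl
  have hk : t * pentConstant 0 1 f' (f j) (f j + g j) + (t * (half A ^ 3 * f' ^ 2) +
      t * algebraMap ℚ A (1 / 12)) =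
      t * (half A ^ 3 * (1 - f j ^ 2 - 2 * f j * f') - algebraMap ℚ A (1 / 12)) := by
    have h6 : algebraMap ℚ A (1 / 6) = 2 * algebraMap ℚ A (1 / 12) := by
      rw [show (1 / 6 : ℚ) = 2 * (1 / 12) by norm_num, map_mul, map_ofNat]
    rw [pentConstant, h6, hf']
    ring
  rw [e0, e1, e2, e3, e4, e5, e6, h0, C_neg, C_1, C_0, phi_neg_one hN htC, h12]
  rw [show ∀ a b c d : MvPolynomial ι A, a * b * c * d = a * (c * (b * d)) by intros; ring,
    wick_C_mul, wick_C_mul, map_mul, map_mul, constantCoeff_C, constantCoeff_C, ← C_0, hD0,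
    map_mul (affineSubst D 0), hDr, affineSubst_phi htn, hDj, ← mul_assoc (texp t _) (texp t _),
    ← texp_add htn, ← mul_assoc (texp t _) (texp t _), ← texp_add htn, add_assoc, hk, amp, hr,
    Finset.mul_prod_erase Finset.univ (fun i => phi N (C t) (C (u i)) (C (f i)) (C (g i)) (X i))
      (Finset.mem_univ j)]

/-- The 2–3 move. -/
lemma amp_pachner [Fintype κ] [DecidableEq κ] (hN : 0 < N) (ht : t ^ N = 0) {U V τ : A}
    (hτ : τ * (1 + U + V) = 1) {Q : Matrix (Fin 2 ⊕ κ) (Fin 2 ⊕ κ) A} (hQ : Q.IsSymm)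
    (F₁ G₁ F₂ G₂ : A) (u f g : κ → A) :
    amp N t Q (Sum.elim ![U, V] u) (Sum.elim ![F₁, F₂] f) (Sum.elim ![G₁, G₂] g) =
    texp t (t * pentConstant F₁ G₁ F₂ G₂ 0) *
      amp N t ((pachnerSubst U V : Matrix (Fin 3 ⊕ κ) (Fin 2 ⊕ κ) A) * (Q - τ • Matrix.vecMulVec pachnerDir pachnerDir) *
          (pachnerSubst U V : Matrix (Fin 3 ⊕ κ) (Fin 2 ⊕ κ) A).transpose)
        (Sum.elim ![U * V * τ, -((1 + U) * τ), -((1 + V) * τ)] u)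
        (Sum.elim ![F₁ + F₂, 1 - F₁ - G₁ + G₂, 1 - F₂ - G₂ + G₁] f)
        (Sum.elim ![0, F₁ - G₂, F₂ - G₁] g) := by
  have htn : IsNilpotent t := ⟨N, ht⟩
  set θ : Fin 2 ⊕ κ → A := pachnerDir with hθ
  have hθs : (τ • Matrix.vecMulVec θ θ).IsSymm := by
    ext i j
    simp [Matrix.vecMulVec_apply, mul_comm]
  have hQs : (Q - τ • Matrix.vecMulVec θ θ).IsSymm := hQ.sub hθs
  set r : MvPolynomial (Fin 2 ⊕ κ) A :=
    ∏ i, phi N (C t) (C (u i)) (C (f i)) (C (g i)) (X (Sum.inr i)) with hr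
  have hr0 : dirD θ r = 0 := dirD_prod_eq_zero _ fun i hi =>
    dirD_phi htn _ _ _ (by simp [hθ, pachnerDir])
  set P : Matrix (Fin 2) (Fin 2 ⊕ κ) A := fun i => Pi.single (Sum.inl i) 1 with hP
  have hx : ∀ i, affineSubst P 0 (X i) = X (Sum.inl i) := by
    intro i
    rw [affineSubst_X, Finset.sum_eq_single (Sum.inl i)] <;> simp +contextual [hP]
  have hPθ : Matrix.vecMulVec (P.mulVec θ) (P.mulVec θ) = !![1, -1; -1, 1] := by
    ext i k
    fin_cases i <;> fin_cases k <;>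
      simp [hP, hθ, Matrix.vecMulVec_apply, Matrix.mulVec, pachnerDir]
  have key := wick_phi_mul_phi hN ht hτ F₁ G₁ F₂ G₂ 0 P hPθ (hx 0) (hx 1) hr0
  have hprod : ∏ i, phi N (C t) (C ((Sum.elim ![U, V] u : Fin 2 ⊕ κ → A) i))
      (C ((Sum.elim ![F₁, F₂] f : Fin 2 ⊕ κ → A) i))
      (C ((Sum.elim ![G₁, G₂] g : Fin 2 ⊕ κ → A) i)) (X i : MvPolynomial (Fin 2 ⊕ κ) A) =
      phi N (C t) (C U) (C F₁) (C G₁) (X (Sum.inl 0)) *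
        phi N (C t) (C V) (C F₂) (C G₂) (X (Sum.inl 1)) * r := by
    rw [Fintype.prod_sum_type, Fin.prod_univ_two]
    simp [hr]
  have y0 : affineSubst (pachnerSubst U V) 0 (X (Sum.inl 0 : Fin 3 ⊕ κ)) =
      X (Sum.inl 0) + X (Sum.inl 1) := by
    rw [affineSubst_X, Fintype.sum_sum_type, Fin.sum_univ_two]
    simp [pachnerSubst]
  have y1 : affineSubst (pachnerSubst U V) 0 (X (Sum.inl 1 : Fin 3 ⊕ κ)) =
      C U * X (Sum.inl 0) - C (1 + V) * X (Sum.inl 1) := by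
    rw [affineSubst_X, Fintype.sum_sum_type, Fin.sum_univ_two]
    simp [pachnerSubst]
    ring
  have y2 : affineSubst (pachnerSubst U V) 0 (X (Sum.inl 2 : Fin 3 ⊕ κ)) =
      C V * X (Sum.inl 1) - C (1 + U) * X (Sum.inl 0) := by
    rw [affineSubst_X, Fintype.sum_sum_type, Fin.sum_univ_two]
    simp [pachnerSubst]
    ring
  have y3 : ∀ k : κ, affineSubst (pachnerSubst U V) 0 (X (Sum.inr k : Fin 3 ⊕ κ)) =
      X (Sum.inr k) := by
    intro k
    rw [affineSubst_X, Fintype.sum_sum_type, Fin.sum_univ_two]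
    simp [pachnerSubst, Matrix.one_apply, apply_ite C]
  -- The part of the covariance in the direction `θ = (1, -1)` is split off and averaged by the
  -- pentagon. The remaining average is pushed forward along the three new linear forms.
  have hw : ∀ p, wick Q p = wick (Q - τ • Matrix.vecMulVec θ θ) (wick (τ • Matrix.vecMulVec θ θ) p) := by
    intro p
    rw [← wick_add_matrix hQs hθs, sub_add_cancel]
  rw [amp, hprod, hw, key, wick_C_mul, map_mul, constantCoeff_C, amp,
    ← constantCoeff_affineSubst_zero (pachnerSubst U V), ← wick_affineSubst hQs, map_prod,
    Fintype.prod_sum_type, Fin.prod_univ_three]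
  simp only [affineSubst_phi htn, y0, y1, y2, y3, Sum.elim_inl, Sum.elim_inr, Matrix.cons_val_zero,
    Matrix.cons_val_one, Matrix.cons_val, add_zero, hr]

end MvPolynomial

open MvPolynomial (amp wick wickOp half constantCoeff affineSubst dirD linForm)

/-! ### Truncated power series -/

section Trunc

variable (K : Type*) [Field K] (N : ℕ)

/-- The ring of power series modulo `X ^ N`. -/
abbrev TruncSeries : Type _ := K⟦X⟧ ⧸ Ideal.span {(PowerSeries.X : K⟦X⟧) ^ N}

/-- The parameter `t = ħ^(1/2)`. -/
def truncX : TruncSeries K N := Ideal.Quotient.mk _ PowerSeries.X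

/-- The constants. -/
def truncC : K →+* TruncSeries K N :=
  (Ideal.Quotient.mk (Ideal.span {(PowerSeries.X : K⟦X⟧) ^ N})).comp PowerSeries.C

lemma truncX_pow : truncX K N ^ N = 0 := by
  rw [truncX, ← map_pow, Ideal.Quotient.eq_zero_iff_mem]
  exact Ideal.mem_span_singleton_self _

lemma truncX_isNilpotent : IsNilpotent (truncX K N) := ⟨N, truncX_pow K N⟩

variable {K}

lemma mk_eq_nilEval (F : K⟦X⟧) :
    (Ideal.Quotient.mk _ F : TruncSeries K N) = nilEval (truncC K N) (truncX_pow K N) F := by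
  have h : (PowerSeries.X : K⟦X⟧) ^ N ∣
      F - ∑ n ∈ Finset.range N, PowerSeries.C (PowerSeries.coeff n F) * PowerSeries.X ^ n := by
    rw [PowerSeries.X_pow_dvd_iff]
    intro m hm
    simp [PowerSeries.coeff_X_pow, hm]
  rw [nilEval_apply, Ideal.Quotient.eq.2 (Ideal.mem_span_singleton.2 h), map_sum]
  simp [truncC, truncX]

lemma eq_of_mk_eq {F G : K⟦X⟧}
    (h : ∀ N, 0 < N → (Ideal.Quotient.mk _ F : TruncSeries K N) = Ideal.Quotient.mk _ G) :
    F = G := by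
  ext n
  have := Ideal.mem_span_singleton.1 (Ideal.Quotient.eq.1 (h (n + 1) n.succ_pos))
  have := PowerSeries.X_pow_dvd_iff.1 this n n.lt_succ_self
  rwa [map_sub, sub_eq_zero] at this

end Trunc

lemma gaussPoly_eq {ι K : Type*} [Field K] [CharZero K] [Fintype ι] [DecidableEq ι]
    (L : Matrix ι ι K) (p : MvPolynomial ι K) :
    gaussPoly L p = constantCoeff (wick L⁻¹ p) := by
  have h : gaussOperator L = wickOp L⁻¹ := by
    ext1 p
    have hc : ∀ i, MvPolynomial.pderiv i (dirD (L⁻¹.row i) p) =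
        ∑ j, MvPolynomial.C (L⁻¹ i j) * MvPolynomial.pderiv i (MvPolynomial.pderiv j p) := by
      intro i
      rw [MvPolynomial.dirD_eq_sum, map_sum]
      simp [Derivation.leibniz]
    rw [gaussOperator, MvPolynomial.wickOp_apply, Finset.sum_congr rfl fun i _ => hc i, half]
    norm_num
  rw [gaussPoly, wick, map_sum, h]
  refine Finset.sum_congr rfl fun k _ => ?_
  rw [Algebra.smul_def, map_mul, IsScalarTower.algebraMap_apply ℚ K (MvPolynomial ι K)]
  simp

/-! ### The series of a datum, also for singular `B`. -/

namespace NZDatum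

variable {ι K : Type*} [Fintype ι] [DecidableEq ι] [Field K]

/-- The matrix `B diag (1 / (1 - z_j)) - A`. -/
def mat (Ξ : NZDatum ι K) : Matrix ι ι K :=
  Ξ.BK * Matrix.diagonal (fun j => 1 / (1 - Ξ.z j)) - Ξ.AK

/-- The matrix `Λ⁻¹`, in a form that does not need `B` to be invertible. -/
def quadForm (Ξ : NZDatum ι K) : Matrix ι ι K := Ξ.mat⁻¹ * Ξ.BK

lemma mat_apply (Ξ : NZDatum ι K) (i j : ι) :
    Ξ.mat i j = Ξ.B i j * (1 / (1 - Ξ.z j)) - Ξ.A i j := by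
  simp [mat, BK, AK]

lemma symm_K {Ξ : NZDatum ι K} (h : (Ξ.A * Ξ.B.transpose).IsSymm) :
    Ξ.AK * Ξ.BK.transpose = Ξ.BK * Ξ.AK.transpose := by
  have h1 : Ξ.A * Ξ.B.transpose = Ξ.B * Ξ.A.transpose := by
    have := h.eq
    rw [Matrix.transpose_mul, Matrix.transpose_transpose] at this
    exact this.symm
  have := congrArg (fun M : Matrix ι ι ℤ => M.map (Int.castRingHom K)) h1
  simp only [Matrix.map_mul] at this
  exact this

/-- For `M = B Z - A` with `Z` diagonal, the symmetry of `A Bᵗ` gives `B Mᵗ = M Bᵗ`, and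
multiplication by the inverses on both sides gives the claim. -/
lemma quadForm_isSymm {Ξ : NZDatum ι K} (h : (Ξ.A * Ξ.B.transpose).IsSymm) (hM : Ξ.mat.det ≠ 0) :
    Ξ.quadForm.IsSymm := by
  have hu : IsUnit Ξ.mat.det := hM.isUnit
  have h1 : Ξ.BK * Ξ.mat.transpose = Ξ.mat * Ξ.BK.transpose := by
    rw [mat, Matrix.transpose_sub, Matrix.mul_sub, Matrix.sub_mul, symm_K h, Matrix.transpose_mul,
      Matrix.diagonal_transpose, Matrix.mul_assoc]
  rw [Matrix.IsSymm, quadForm, Matrix.transpose_mul, Matrix.transpose_nonsing_inv]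
  have hut : IsUnit Ξ.mat.transpose.det := by rwa [Matrix.det_transpose]
  calc Ξ.BK.transpose * Ξ.mat.transpose⁻¹
      = Ξ.mat⁻¹ * (Ξ.mat * Ξ.BK.transpose) * Ξ.mat.transpose⁻¹ := by
        rw [← Matrix.mul_assoc, Matrix.nonsing_inv_mul _ hu, Matrix.one_mul]
    _ = _ := by
        rw [← h1, ← Matrix.mul_assoc, Matrix.mul_assoc _ Ξ.mat.transpose,
          Matrix.mul_nonsing_inv _ hut, Matrix.mul_one]

lemma quadForm_eq {Ξ : NZDatum ι K} (hM : Ξ.mat.det ≠ 0) {Q : Matrix ι ι K}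
    (h : Ξ.mat * Q = Ξ.BK) : Ξ.quadForm = Q := by
  rw [quadForm, ← h, ← Matrix.mul_assoc, Matrix.nonsing_inv_mul _ hM.isUnit, Matrix.one_mul]

lemma mat_mul_quadForm {Ξ : NZDatum ι K} (hM : Ξ.mat.det ≠ 0) : Ξ.mat * Ξ.quadForm = Ξ.BK := by
  rw [quadForm, ← Matrix.mul_assoc, Matrix.mul_nonsing_inv _ hM.isUnit, Matrix.one_mul]

variable [CharZero K]

/-- The series of a Neumann–Zagier datum, truncated, in terms of the quadratic form, the shape
parameters and the flattening. -/
def ampK (N : ℕ) (Q : Matrix ι ι K) (u f g : ι → K) : TruncSeries K N :=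
  amp N (truncX K N) (Q.map (truncC K N)) (fun j => truncC K N (u j)) (fun j => truncC K N (f j))
    (fun j => truncC K N (g j))

/-- The truncated series of a Neumann–Zagier datum. It makes sense for singular `B` too. -/
def trunc (N : ℕ) (Ξ : NZDatum ι K) : TruncSeries K N :=
  ampK N Ξ.quadForm (fun j => Ξ.z j / (1 - Ξ.z j)) (fun j => Ξ.f j) (fun j => Ξ.f'' j)

/-- The factor `e^(cħ)`. -/
def truncExp (N : ℕ) (c : K) : TruncSeries K N :=
  texp (truncX K N) (truncX K N * truncC K N c)

lemma truncExp_add (N : ℕ) (a b : K) : truncExp N (a + b) = truncExp N a * truncExp N b := by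
  rw [truncExp, map_add, mul_add, texp_add (truncX_isNilpotent K N), truncExp, truncExp]

lemma truncExp_zero (N : ℕ) : truncExp N (0 : K) = 1 := by simp [truncExp]

/-- The series of one datum is defined if and only if that of the other is, and they agree up to
`e^(cħ)` with `c ∈ (1/24)ℤ`. -/
def Rel {ι' : Type*} [Fintype ι'] [DecidableEq ι'] (Ξ : NZDatum ι K) (Ξ' : NZDatum ι' K) : Prop :=
  (Ξ.mat.det ≠ 0 ↔ Ξ'.mat.det ≠ 0) ∧
    (Ξ.mat.det ≠ 0 → ∃ k : ℤ, ∀ N, 0 < N → Ξ.trunc N = truncExp N ((k : K) / 24) * Ξ'.trunc N)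

lemma Rel.symm {ι' : Type*} [Fintype ι'] [DecidableEq ι'] {Ξ : NZDatum ι K} {Ξ' : NZDatum ι' K}
    (h : Ξ.Rel Ξ') : Ξ'.Rel Ξ := by
  refine ⟨h.1.symm, fun hM => ?_⟩
  obtain ⟨k, hk⟩ := h.2 (h.1.2 hM)
  refine ⟨-k, fun N hN => ?_⟩
  rw [hk N hN, ← mul_assoc, ← truncExp_add]
  push_cast
  rw [neg_div, neg_add_cancel, truncExp_zero, one_mul]

lemma Rel.trans {ι' ι'' : Type*} [Fintype ι'] [DecidableEq ι'] [Fintype ι''] [DecidableEq ι'']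
    {Ξ : NZDatum ι K} {Ξ' : NZDatum ι' K} {Ξ'' : NZDatum ι'' K} (h : Ξ.Rel Ξ') (h' : Ξ'.Rel Ξ'') :
    Ξ.Rel Ξ'' := by
  refine ⟨h.1.trans h'.1, fun hM => ?_⟩
  obtain ⟨k, hk⟩ := h.2 hM
  obtain ⟨l, hl⟩ := h'.2 (h.1.1 hM)
  refine ⟨k + l, fun N hN => ?_⟩
  rw [hk N hN, hl N hN, ← mul_assoc, ← truncExp_add, ← add_div]
  push_cast
  rfl

lemma Rel.refl (Ξ : NZDatum ι K) : Ξ.Rel Ξ :=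
  ⟨Iff.rfl, fun _ => ⟨0, fun N _ => by simp [truncExp_zero]⟩⟩

lemma ampK_flattening (N : ℕ) {Q : Matrix ι ι K} (hQ : Q.IsSymm) {u f g f' g' : ι → K}
    (h : Q.mulVec (fun j => (1 + u j) * (f' j - f j) + (g' j - g j)) = f' - f) :
    ampK N Q u f g = truncExp N ((∑ j, (g' j - g j) * (f j + f' j)) / 8) * ampK N Q u f' g' := by
  have hQ' : (Q.map (truncC K N)).IsSymm := by
    rw [Matrix.IsSymm, ← Matrix.transpose_map, hQ.eq]
  rw [ampK, MvPolynomial.amp_flattening (f' := fun j => truncC K N (f' j))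
    (g' := fun j => truncC K N (g' j)) (truncX_isNilpotent K N) hQ', ← ampK, truncExp]
  · congr 3
    rw [← MvPolynomial.map_half (truncC K N), ← map_pow, div_eq_mul_inv, mul_comm, map_mul]
    congr 1
    · rw [map_sum]
      simp
    · congr 1
      rw [half]
      norm_num
  · have := congrArg (fun v : ι → K => fun j => truncC K N (v j)) h
    ext i
    have := congrFun this i
    simpa [Matrix.mulVec, dotProduct] using this

-- Since `1 / (1 - z) = 1 + u`, an equation between flattenings becomes one for `mat`. For `c = 0`
-- it is the hypothesis of `ampK_flattening`.
omit [CharZero K] in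
lemma mat_mulVec {Ξ : NZDatum ι K} (hz : Ξ.Shapes) {δ ε c : ι → K}
    (h : Ξ.AK.mulVec δ + Ξ.BK.mulVec ε = c) :
    Ξ.BK.mulVec (fun j => (1 + Ξ.z j / (1 - Ξ.z j)) * δ j + ε j) = Ξ.mat.mulVec δ + c := by
  rw [← h]
  ext i
  simp only [Matrix.mulVec, dotProduct, Pi.add_apply, mat_apply, ← Finset.sum_add_distrib]
  refine Finset.sum_congr rfl fun j _ => ?_
  have h1 : 1 - Ξ.z j ≠ 0 := sub_ne_zero.2 (hz j).2.symm
  simp only [AK, BK, Matrix.map_apply]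
  field_simp
  ring

omit [CharZero K] in
lemma mulVec_cast {Ξ : NZDatum ι K} {x y c : ι → ℤ} (h : Ξ.A.mulVec x + Ξ.B.mulVec y = c) :
    Ξ.AK.mulVec (fun j => (x j : K)) + Ξ.BK.mulVec (fun j => (y j : K)) = fun j => (c j : K) := by
  rw [← h]
  ext i
  simp [Matrix.mulVec, dotProduct, AK, BK]

/-- Data with equivalent equations for the same shapes have the same series. -/
lemma rel_of_row_equiv {Ξ Ξ' : NZDatum ι K} (hs : Ξ.IsNZ) (hf' : Ξ'.Flattened) {H H' : Matrix ι ι ℤ}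
    (hA : Ξ.A = H' * Ξ'.A) (hB : Ξ.B = H' * Ξ'.B) (hν : Ξ.ν = H'.mulVec Ξ'.ν)
    (hA' : Ξ'.A = H * Ξ.A) (hB' : Ξ'.B = H * Ξ.B) (hz : Ξ'.z = Ξ.z) : Ξ.Rel Ξ' := by
  have hM : Ξ.mat = H'.map (Int.castRingHom K) * Ξ'.mat := by
    rw [mat, mat, Matrix.mul_sub, ← Matrix.mul_assoc, AK, BK, AK, BK, hz]
    change (Ξ.B.map (Int.castRingHom K)) * _ - Ξ.A.map (Int.castRingHom K) = _ *
      Ξ'.B.map (Int.castRingHom K) * _ - _ * Ξ'.A.map (Int.castRingHom K)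
    rw [← Matrix.map_mul, ← Matrix.map_mul, ← hA, ← hB]
  have hM' : Ξ'.mat = H.map (Int.castRingHom K) * Ξ.mat := by
    rw [mat, mat, Matrix.mul_sub, ← Matrix.mul_assoc, AK, BK, AK, BK, hz]
    change (Ξ'.B.map (Int.castRingHom K)) * _ - Ξ'.A.map (Int.castRingHom K) = _ *
      Ξ.B.map (Int.castRingHom K) * _ - _ * Ξ.A.map (Int.castRingHom K)
    rw [← Matrix.map_mul, ← Matrix.map_mul, ← hA', ← hB']
  -- `H` and `H'` are not assumed inverse to each other; each factorisation carries vanishing of the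
  -- determinant in one direction.
  have hdet : Ξ.mat.det ≠ 0 ↔ Ξ'.mat.det ≠ 0 := by
    constructor
    · intro h h0
      rw [hM, Matrix.det_mul, h0, mul_zero] at h
      exact h rfl
    · intro h h0
      rw [hM', Matrix.det_mul, h0, mul_zero] at h
      exact h rfl
  refine ⟨hdet, fun h => ?_⟩
  have hQ : Ξ.quadForm = Ξ'.quadForm := by
    refine quadForm_eq h ?_
    rw [hM, Matrix.mul_assoc, mat_mul_quadForm (hdet.1 h), BK, BK]
    change _ * Ξ'.B.map (Int.castRingHom K) = Ξ.B.map (Int.castRingHom K)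
    rw [← Matrix.map_mul, ← hB]
  -- The factor `3` rewrites the `1/8` of `ampK_flattening` as `3/24`.
  refine ⟨3 * ∑ j, (Ξ'.f'' j - Ξ.f'' j) * (Ξ.f j + Ξ'.f j), fun N _ => ?_⟩
  have h1 : Ξ.A.mulVec Ξ'.f + Ξ.B.mulVec Ξ'.f'' = Ξ.ν := by
    rw [hν, ← hf', hA, hB, Matrix.mulVec_add, Matrix.mulVec_mulVec, Matrix.mulVec_mulVec]
  have hfl : Ξ.A.mulVec (Ξ'.f - Ξ.f) + Ξ.B.mulVec (Ξ'.f'' - Ξ.f'') = 0 := by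
    rw [Matrix.mulVec_sub, Matrix.mulVec_sub]
    have h2 : Ξ.A.mulVec Ξ.f + Ξ.B.mulVec Ξ.f'' = Ξ.ν := hs.flattened
    rw [← sub_eq_zero.2 (h1.trans h2.symm)]
    abel
  rw [trunc, ampK_flattening N (quadForm_isSymm hs.symm h) (f' := fun j => (Ξ'.f j : K))
    (g' := fun j => (Ξ'.f'' j : K)), trunc, hQ, hz]
  · congr 2
    push_cast
    ring
  · have hv := mat_mulVec hs.shapes (mulVec_cast hfl)
    simp only [Pi.sub_apply, Int.cast_sub, Pi.zero_apply, Int.cast_zero] at hv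
    rw [quadForm, ← Matrix.mulVec_mulVec, hv, Matrix.mulVec_add, Matrix.mulVec_mulVec,
      Matrix.nonsing_inv_mul _ h.isUnit, Matrix.one_mulVec]
    ext i
    simp [Matrix.mulVec, dotProduct]

/-! ### Comparison with the definition -/

omit [CharZero K] in
lemma BK_det (Ξ : NZDatum ι K) : Ξ.BK.det = (Ξ.B.det : K) :=
  (RingHom.map_det (Int.castRingHom K) Ξ.B).symm

omit [CharZero K] in
lemma Lam_eq {Ξ : NZDatum ι K} (hB : IsUnit Ξ.BK.det) : Ξ.Lam = Ξ.BK⁻¹ * Ξ.mat := by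
  rw [Lam, mat, Matrix.mul_sub, ← Matrix.mul_assoc, Matrix.nonsing_inv_mul _ hB, Matrix.one_mul]
  abel

omit [CharZero K] in
lemma Lam_det_ne_zero {Ξ : NZDatum ι K} (hB : IsUnit Ξ.BK.det) :
    Ξ.Lam.det ≠ 0 ↔ Ξ.mat.det ≠ 0 := by
  have h : Ξ.BK⁻¹.det ≠ 0 := (Matrix.isUnit_nonsing_inv_det _ hB).ne_zero
  rw [Lam_eq hB, Matrix.det_mul, mul_ne_zero_iff, and_iff_right h]

omit [CharZero K] in
lemma Lam_inv {Ξ : NZDatum ι K} (hB : IsUnit Ξ.BK.det) : Ξ.Lam⁻¹ = Ξ.quadForm := by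
  rw [Lam_eq hB, Matrix.mul_inv_rev, Matrix.nonsing_inv_nonsing_inv _ hB, quadForm]

lemma mk_gaussIntegral (N : ℕ) {L : Matrix ι ι K} (hL : L⁻¹.IsSymm) (F : (MvPolynomial ι K)⟦X⟧) :
    (Ideal.Quotient.mk _ (gaussIntegral L F) : TruncSeries K N) =
      constantCoeff (wick (L⁻¹.map (truncC K N)) (nilEval (MvPolynomial.map (truncC K N))
        (MvPolynomial.C_pow_eq_zero (σ := ι) (truncX_pow K N)) F)) := by
  rw [mk_eq_nilEval, nilEval_apply, nilEval_apply, ← MvPolynomial.wickHom_apply, map_sum, map_sum]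
  refine Finset.sum_congr rfl fun n _ => ?_
  rw [MvPolynomial.wickHom_apply, mul_comm (MvPolynomial.map _ _), ← map_pow,
    MvPolynomial.wick_C_mul, map_mul, MvPolynomial.constantCoeff_C, ← MvPolynomial.map_wick _ hL,
    MvPolynomial.constantCoeff_map, gaussIntegral, PowerSeries.coeff_mk, gaussPoly_eq, mul_comm]

/-- The truncation of the series `Φ`. -/
lemma mk_Phi {Ξ : NZDatum ι K} (hΞ : Ξ.IsNZ) (hB : Ξ.B.det ≠ 0) (hM : Ξ.mat.det ≠ 0) (N : ℕ) :
    (Ideal.Quotient.mk _ Ξ.Phi : TruncSeries K N) = Ξ.trunc N := by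
  have hBu : IsUnit Ξ.BK.det := by
    rw [BK_det]
    exact IsUnit.mk0 _ (by exact_mod_cast hB)
  have hQ := quadForm_isSymm hΞ.symm hM
  have ht := truncX_isNilpotent K N
  have htC := MvPolynomial.isNilpotent_C (σ := ι) ht
  set w : ι → K := Ξ.BK⁻¹.mulVec fun i => (Ξ.ν i : K) with hw
  set κ : K := (fun i => (Ξ.f i : K)) ⬝ᵥ (Ξ.BK⁻¹ * Ξ.AK).mulVec (fun i => (Ξ.f i : K)) / 8 with hκ
  have h0 : PowerSeries.constantCoeff Ξ.exponent = 0 := by simp [exponent]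
  -- The integrand in the definition is the product of blocks for the flattening `(0, B⁻¹ ν)`, which
  -- exists over `K` because `B` is invertible.
  have hint : nilEval (MvPolynomial.map (truncC K N))
      (MvPolynomial.C_pow_eq_zero (σ := ι) (truncX_pow K N)) Ξ.integrand =
      MvPolynomial.C (truncExp N κ) * ∏ j, phi N (MvPolynomial.C (truncX K N))
        (MvPolynomial.C (truncC K N (Ξ.z j / (1 - Ξ.z j)))) (MvPolynomial.C (truncC K N 0))
        (MvPolynomial.C (truncC K N (w j))) (MvPolynomial.X j) := by
    have hexp : nilEval (MvPolynomial.map (truncC K N))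
        (MvPolynomial.C_pow_eq_zero (σ := ι) (truncX_pow K N)) (formalExp Ξ.exponent) =
        MvPolynomial.C (truncExp N κ) * ∏ j, texp (MvPolynomial.C (truncX K N))
          (MvPolynomial.C (truncC K N ((1 - w j) / 2)) * MvPolynomial.X j) := by
      rw [nilEval_formalExp _ _ h0, truncExp, MvPolynomial.C_texp ht, ← texp_sum htC,
        ← texp_add htC, texp, exponent]
      congr 1
      rw [map_add, map_mul, map_mul, map_pow, nilEval_X, nilEval_C, nilEval_C, map_sum,
        MvPolynomial.map_C]
      simp only [map_mul, MvPolynomial.map_C, MvPolynomial.map_X]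
      rw [← hw, ← hκ]
      ring
    rw [integrand, map_mul, map_prod, hexp, mul_assoc, ← Finset.prod_mul_distrib]
    refine congrArg _ (Finset.prod_congr rfl fun j _ => ?_)
    have h2 : half (MvPolynomial ι (TruncSeries K N)) =
        MvPolynomial.C (truncC K N (1 / 2)) := by
      rw [← MvPolynomial.map_half (MvPolynomial.C : TruncSeries K N →+* _),
        ← MvPolynomial.map_half (truncC K N), half]
      norm_num
    rw [nilEval_psi, phi, MvPolynomial.map_C, MvPolynomial.map_X, map_zero, MvPolynomial.C_0, h2]
    congr 2
    · rw [show (1 - w j) / 2 = 1 / 2 * (1 - w j) by ring, map_mul, map_sub, map_one,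
        MvPolynomial.C_mul, MvPolynomial.C_sub, MvPolynomial.C_1]
      ring
    · ring
  have hflat : Ξ.quadForm.mulVec (fun j => (1 + Ξ.z j / (1 - Ξ.z j)) * ((Ξ.f j : K) - 0) +
      ((Ξ.f'' j : K) - w j)) = (fun j => (Ξ.f j : K)) - fun _ => 0 := by
    have h1 : Ξ.AK.mulVec (fun j => (Ξ.f j : K)) + Ξ.BK.mulVec (fun j => (Ξ.f'' j : K) - w j) = 0 := by
      have h2 := mulVec_cast hΞ.flattened
      have h3 : Ξ.BK.mulVec w = fun i => (Ξ.ν i : K) := by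
        rw [hw, Matrix.mulVec_mulVec, Matrix.mul_nonsing_inv _ hBu, Matrix.one_mulVec]
      have h4 : (fun j => (Ξ.f'' j : K) - w j) = (fun j => (Ξ.f'' j : K)) - w := rfl
      rw [h4, Matrix.mulVec_sub, h3, ← h2]
      abel
    have hv := mat_mulVec hΞ.shapes h1
    simp only [sub_zero]
    rw [quadForm, ← Matrix.mulVec_mulVec, hv, add_zero, Matrix.mulVec_mulVec,
      Matrix.nonsing_inv_mul _ hM.isUnit, Matrix.one_mulVec]
    ext i
    simp
  -- From `B⁻¹ A f + f'' = B⁻¹ ν` the prefactor `fᵗ B⁻¹ A f / 8` in the definition is exactly what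
  -- the passage from `(0, B⁻¹ ν)` to `(f, f'')` costs.
  have hconst : κ + (∑ j, ((Ξ.f'' j : K) - w j) * (0 + (Ξ.f j : K))) / 8 = 0 := by
    have h2 := congrArg Ξ.BK⁻¹.mulVec (mulVec_cast hΞ.flattened)
    rw [Matrix.mulVec_add, Matrix.mulVec_mulVec, Matrix.mulVec_mulVec,
      Matrix.nonsing_inv_mul _ hBu, Matrix.one_mulVec, ← hw] at h2
    rw [hκ, ← add_div, dotProduct, ← Finset.sum_add_distrib, Finset.sum_eq_zero, zero_div]
    intro j _
    have := congrFun h2 j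
    simp only [Pi.add_apply] at this
    rw [← this]
    ring
  rw [Phi, mk_gaussIntegral N (by rwa [Lam_inv hBu]), hint, Lam_inv hBu, MvPolynomial.wick_C_mul,
    map_mul, MvPolynomial.constantCoeff_C]
  change truncExp N κ * ampK N Ξ.quadForm (fun j => Ξ.z j / (1 - Ξ.z j)) (fun _ => 0) w = _
  rw [ampK_flattening N hQ hflat, ← mul_assoc, ← truncExp_add, hconst, truncExp_zero, one_mul, trunc]

/-- The comparison of two data, in terms of the series `Φ`. -/
theorem Rel.sameSeries {ι' : Type*} [Fintype ι'] [DecidableEq ι'] {Ξ : NZDatum ι K}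
    {Ξ' : NZDatum ι' K} (h : Ξ.Rel Ξ') (hΞ : Ξ.IsNZ) (hΞ' : Ξ'.IsNZ) (hB : Ξ.B.det ≠ 0)
    (hB' : Ξ'.B.det ≠ 0) : Ξ.SameSeries Ξ' := by
  have hBu : IsUnit Ξ.BK.det := by
    rw [BK_det]
    exact IsUnit.mk0 _ (by exact_mod_cast hB)
  have hBu' : IsUnit Ξ'.BK.det := by
    rw [BK_det]
    exact IsUnit.mk0 _ (by exact_mod_cast hB')
  rw [SameSeries, Lam_det_ne_zero hBu, Lam_det_ne_zero hBu']
  refine ⟨h.1, fun hM => ?_⟩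
  obtain ⟨k, hk⟩ := h.2 hM
  refine ⟨k, eq_of_mk_eq fun N hN => ?_⟩
  rw [mk_Phi hΞ hB hM, map_mul, mk_Phi hΞ' hB' (h.1.1 hM), hk N hN, mk_eq_nilEval,
    nilEval_formalExp _ _ (by simp), truncExp, texp, map_mul, map_pow, nilEval_X, nilEval_C]
  congr 2
  ring

end NZDatum

open MvPolynomial (amp half)

/-! ### Changes of quad -/

namespace NZDatum

variable {ι K : Type*} [Fintype ι] [Field K]

lemma isSymm_iff {A B : Matrix ι ι ℤ} :
    (A * B.transpose).IsSymm ↔ ∀ i k, ∑ l, (A i l * B k l - A k l * B i l) = 0 := by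
  rw [Matrix.IsSymm.ext_iff]
  simp only [Matrix.mul_apply, Matrix.transpose_apply, Finset.sum_sub_distrib, sub_eq_zero]
  exact ⟨fun h i k => h k i, fun h i k => h k i⟩

lemma flattened_iff {Ξ : NZDatum ι K} :
    Ξ.Flattened ↔ ∀ i, ∑ j, (Ξ.A i j * Ξ.f j + Ξ.B i j * Ξ.f'' j) = Ξ.ν i := by
  rw [Flattened, funext_iff]
  simp [Matrix.mulVec, dotProduct, Finset.sum_add_distrib]

lemma one_div_one_sub_one_div_one_sub {z : K} (h0 : z ≠ 0) (h1 : 1 - z ≠ 0) :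
    1 / (1 - 1 / (1 - z)) = 1 - 1 / z := by
  have : 1 - 1 / (1 - z) = -z / (1 - z) := by field_simp; ring
  rw [this]
  field_simp
  ring

lemma one_sub_one_div_one_sub_one_div {z : K} (h0 : z ≠ 0) (h1 : 1 - z ≠ 0) :
    1 - 1 / (1 - 1 / z) = 1 / (1 - z) := by
  have h2 : z - 1 ≠ 0 := fun h => h1 (by linear_combination -h)
  have : 1 - 1 / z = (z - 1) / z := by field_simp
  rw [this, one_div_div, eq_div_iff h1]
  field_simp
  ring

lemma shapes_quad {z : K} (hz : z ≠ 0 ∧ z ≠ 1) (q : Fin 3) :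
    ![z, 1 / (1 - z), 1 - 1 / z] q ≠ 0 ∧ ![z, 1 / (1 - z), 1 - 1 / z] q ≠ 1 := by
  obtain ⟨h0, h1⟩ := hz
  have h1' : 1 - z ≠ 0 := sub_ne_zero.2 h1.symm
  fin_cases q
  · exact ⟨h0, h1⟩
  · refine ⟨one_div_ne_zero h1', fun h => h0 ?_⟩
    simp only [Fin.mk_one, Matrix.cons_val_one, Matrix.cons_val_zero] at h
    rw [div_eq_one_iff_eq h1'] at h
    linear_combination h
  · simp only [Fin.reduceFinMk, Matrix.cons_val]
    refine ⟨fun h => h1 ?_, fun h => one_div_ne_zero h0 ?_⟩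
    · rw [sub_eq_zero, eq_comm, div_eq_one_iff_eq h0] at h
      exact h.symm
    · linear_combination -h

lemma IsNZ.quad {Ξ : NZDatum ι K} (h : Ξ.IsNZ) (q : ι → Fin 3) : (Ξ.quad q).IsNZ := by
  refine ⟨?_, fun j => shapes_quad (h.shapes j) (q j), ?_⟩
  · rw [isSymm_iff]
    intro i k
    rw [← isSymm_iff.1 h.symm i k]
    refine Finset.sum_congr rfl fun l _ => ?_
    simp only [NZDatum.quad, Matrix.of_apply]
    generalize q l = c
    fin_cases c <;> simp <;> ring
  · rw [flattened_iff]
    intro i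
    simp only [NZDatum.quad, Matrix.of_apply]
    rw [← flattened_iff.1 h.flattened i, ← Finset.sum_sub_distrib]
    refine Finset.sum_congr rfl fun l _ => ?_
    generalize q l = c
    fin_cases c <;> simp <;> ring

lemma quad_zero (Ξ : NZDatum ι K) : Ξ.quad 0 = Ξ := by
  cases Ξ
  simp [quad]
  exact ⟨rfl, rfl⟩

lemma quad_quad {Ξ : NZDatum ι K} (h : Ξ.Shapes) (q q' : ι → Fin 3) :
    (Ξ.quad q).quad q' = Ξ.quad (q + q') := by
  cases Ξ with | mk A B ν z f f'' =>
  simp only [quad, mk.injEq, Pi.add_apply, Matrix.of_apply]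
  refine ⟨?_, ?_, ?_, ?_, ?_, ?_⟩
  · ext i j
    simp only [Matrix.of_apply]
    generalize q j = c
    generalize q' j = d
    fin_cases c <;> fin_cases d <;> simp; ring
  · ext i j
    simp only [Matrix.of_apply]
    generalize q j = c
    generalize q' j = d
    fin_cases c <;> fin_cases d <;> simp; ring
  · ext i
    rw [sub_sub, ← Finset.sum_add_distrib]
    congr 1
    refine Finset.sum_congr rfl fun j _ => ?_
    generalize q j = c
    generalize q' j = d
    fin_cases c <;> fin_cases d <;> simp
  · ext j
    have h0 : z j ≠ 0 := (h j).1
    have h1 : 1 - z j ≠ 0 := sub_ne_zero.2 (h j).2.symm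
    generalize q j = c
    generalize q' j = d
    have e1 := one_div_one_sub_one_div_one_sub h0 h1
    have e4 := one_sub_one_div_one_sub_one_div h0 h1
    fin_cases c <;> fin_cases d <;> simp at e1 e4 ⊢ <;> assumption
  · ext j
    generalize q j = c
    generalize q' j = d
    fin_cases c <;> fin_cases d <;> simp; ring
  · ext j
    generalize q j = c
    generalize q' j = d
    fin_cases c <;> fin_cases d <;> simp; ring

variable [DecidableEq ι] [CharZero K]

lemma ampK_quad {N : ℕ} (hN : 0 < N) {Q : Matrix ι ι K} (hQ : Q.IsSymm) (u f g : ι → K) (j : ι)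
    {v f' : K} (hv : u j * v = -(1 + u j)) (hf' : f' = 1 - f j - g j) :
    ampK N (Matrix.diagonal (Function.update 1 j (u j)) * Q *
        Matrix.diagonal (Function.update 1 j (u j)) - u j • Matrix.single j j 1)
      (Function.update u j v) (Function.update f j f') (Function.update g j (f j)) =
    truncExp N ((1 - f j ^ 2 - 2 * f j * f') / 8 - 1 / 12) * ampK N Q u f g := by
  set c := truncC K N with hc
  have hQ' : (Q.map c).IsSymm := by
    rw [Matrix.IsSymm, ← Matrix.transpose_map, hQ.eq]
  have h := MvPolynomial.amp_quad hN (truncX_pow K N) hQ' (fun i => c (u i)) (fun i => c (f i))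
    (fun i => c (g i)) j (v := c v) (f' := c f')
    (by rw [← map_mul, hv, map_neg, map_add, map_one])
    (by rw [hf', map_sub, map_sub, map_one])
  have hup : ∀ (x : ι → K) (a : K), (fun i => c (Function.update x j a i)) =
      Function.update (fun i => c (x i)) j (c a) := by
    intro x a
    ext i
    by_cases h : i = j
    · subst h; simp
    · simp [h]
  have hmat : (Matrix.diagonal (Function.update 1 j (u j)) * Q *
        Matrix.diagonal (Function.update 1 j (u j)) - u j • Matrix.single j j 1).map c =
      Matrix.diagonal (Function.update 1 j (c (u j))) * Q.map c *
        Matrix.diagonal (Function.update 1 j (c (u j))) - c (u j) • Matrix.single j j 1 := by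
    rw [Matrix.map_sub _ (fun a b => map_sub c a b), Matrix.map_mul, Matrix.map_mul,
      Matrix.diagonal_map (map_zero c)]
    have h2 : (fun m => c (Function.update (1 : ι → K) j (u j) m)) =
        Function.update (1 : ι → TruncSeries K N) j (c (u j)) := by
      rw [hup]
      congr 1
    have h3 : (u j • Matrix.single j j (1 : K)).map c = c (u j) • Matrix.single j j 1 := by
      ext a b
      simp only [Matrix.map_apply, Matrix.smul_apply, smul_eq_mul, map_mul, Matrix.single_apply]
      split_ifs <;> simp
    rw [h2, h3]
  rw [ampK, hmat, hup, hup, hup, h, truncExp, ← ampK]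
  congr 3
  have h8 : half (TruncSeries K N) ^ 3 = c (1 / 8) := by
    rw [← MvPolynomial.map_half c, ← map_pow, half]
    norm_num
  have h12 : algebraMap ℚ (TruncSeries K N) (1 / 12) = c (1 / 12) := by
    rw [RingHom.congr_fun (Subsingleton.elim (algebraMap ℚ (TruncSeries K N))
      (c.comp (algebraMap ℚ K))) (1 / 12)]
    simp
  rw [h8, h12, show (1 - f j ^ 2 - 2 * f j * f') / 8 - 1 / 12 =
    1 / 8 * (1 - f j ^ 2 - 2 * f j * f') - 1 / 12 by ring, ← hc]
  simp only [map_sub, map_mul, map_pow, map_one, map_ofNat]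

/-- The change of quad divides column `j` of `mat` by `u j`. Hence nonvanishing of the determinant
is preserved, and the new quadratic form is the covariance in `amp_quad`. -/
lemma rel_quad_single {Ξ : NZDatum ι K} (hΞ : Ξ.IsNZ) (j : ι) :
    Ξ.Rel (Ξ.quad (Pi.single j 1)) := by
  set Ξ' := Ξ.quad (Pi.single j 1) with hΞ'
  set u : ι → K := fun i => Ξ.z i / (1 - Ξ.z i) with hu
  set D : Matrix ι ι K := Matrix.diagonal (Function.update 1 j (u j)) with hD
  have h0 : Ξ.z j ≠ 0 := (hΞ.shapes j).1
  have h1 : 1 - Ξ.z j ≠ 0 := sub_ne_zero.2 (hΞ.shapes j).2.symm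
  have hmat : Ξ'.mat * D = Ξ.mat := by
    ext i k
    rw [hD, Matrix.mul_diagonal, mat_apply, mat_apply]
    by_cases hk : k = j
    · subst hk
      simp [hΞ', quad, hu]
      rw [← one_div, ← one_div, one_div_one_sub_one_div_one_sub h0 h1]
      field_simp
      ring
    · simp [hΞ', quad, hk]
  have hdetD : D.det = u j := by
    rw [hD, Matrix.det_diagonal, Finset.prod_update_of_mem (Finset.mem_univ j)]
    simp
  have huj : u j ≠ 0 := div_ne_zero h0 h1
  have hdet : Ξ.mat.det ≠ 0 ↔ Ξ'.mat.det ≠ 0 := by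
    rw [← hmat, Matrix.det_mul, hdetD]
    simp [huj]
  refine ⟨hdet, fun hM => ?_⟩
  have hQ : Ξ'.quadForm = D * Ξ.quadForm * D - u j • Matrix.single j j 1 := by
    refine quadForm_eq (hdet.1 hM) ?_
    have hE : Ξ'.mat * (u j • Matrix.single j j 1) = Ξ.mat * Matrix.single j j 1 := by
      rw [← hmat, Matrix.mul_assoc]
      congr 1
      ext i k
      rw [hD, Matrix.diagonal_mul]
      by_cases hi : i = j
      · subst hi; simp
      · simp [hi, Matrix.single_apply_of_row_ne (Ne.symm hi)]
    rw [Matrix.mul_sub, hE, ← Matrix.mul_assoc, ← Matrix.mul_assoc, hmat, mat_mul_quadForm hM]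
    ext i k
    rw [Matrix.sub_apply, hD, Matrix.mul_diagonal]
    by_cases hk : k = j
    · subst hk
      rw [Matrix.mul_single_apply_same, mat_apply]
      simp [hΞ', quad, hu, BK]
      field_simp
      ring
    · rw [Matrix.mul_single_apply_of_ne _ _ _ _ _ hk]
      simp [hΞ', quad, hk, BK]
  -- `24 (x/8 - 1/12) = 3x - 2`; the sign occurs because the factor moves to the other side of the
  -- equation.
  refine ⟨-(3 * (1 - Ξ.f j ^ 2 - 2 * Ξ.f j * (1 - Ξ.f j - Ξ.f'' j)) - 2), fun N hN => ?_⟩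
  have key := ampK_quad hN (quadForm_isSymm hΞ.symm hM) u (fun i => (Ξ.f i : K))
    (fun i => (Ξ.f'' i : K)) j (v := -(1 / Ξ.z j)) (f' := 1 - Ξ.f j - Ξ.f'' j)
    (by simp only [hu]; field_simp; ring) rfl
  have hT : Ξ'.trunc N = truncExp N ((1 - (Ξ.f j : K) ^ 2 - 2 * Ξ.f j * (1 - Ξ.f j - Ξ.f'' j)) / 8 -
      1 / 12) * Ξ.trunc N := by
    rw [trunc, hQ, trunc, ← key]
    congr 1
    · ext i
      by_cases hi : i = j
      · subst hi
        simp [hΞ', quad]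
        rw [show 1 - (1 - Ξ.z i)⁻¹ = -Ξ.z i * (1 - Ξ.z i)⁻¹ by field_simp; ring]
        field_simp
      · simp [hΞ', quad, hi, hu]
    · ext i
      by_cases hi : i = j
      · subst hi
        simp [hΞ', quad]
      · simp [hΞ', quad, hi]
    · ext i
      by_cases hi : i = j
      · subst hi
        simp [hΞ', quad]
      · simp [hΞ', quad, hi]
  rw [hT, ← mul_assoc, ← truncExp_add]
  push_cast
  rw [show ∀ x : K, -(3 * x - 2) / 24 + (x / 8 - 1 / 12) = 0 by intro x; ring, truncExp_zero,
    one_mul]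

/-- By `quad_quad` the changes of quad form an action of `(ℤ/3)^ι`, and this group is generated by
the elementary changes at single tetrahedra. -/
theorem rel_quad {Ξ : NZDatum ι K} (hΞ : Ξ.IsNZ) (q : ι → Fin 3) : Ξ.Rel (Ξ.quad q) := by
  let p : (ι → Fin 3) → Prop := fun q => ∀ Ξ : NZDatum ι K, Ξ.IsNZ → Ξ.Rel (Ξ.quad q)
  have hadd : ∀ q q', p q → p q' → p (q + q') := fun q q' h h' Ξ hΞ => by
    rw [← quad_quad hΞ.shapes]
    exact (h Ξ hΞ).trans (h' _ (hΞ.quad q))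
  have h0 : p 0 := fun Ξ _ => by rw [quad_zero]; exact Rel.refl Ξ
  have h1 : ∀ j, p (Pi.single j 1) := fun j Ξ hΞ => rel_quad_single hΞ j
  have hs : ∀ j (k : Fin 3), p (Pi.single j k) := by
    intro j k
    fin_cases k
    · simpa using h0
    · exact h1 j
    · have := hadd _ _ (h1 j) (h1 j)
      rwa [← Pi.single_add] at this
  have : p (∑ j, Pi.single j (q j)) :=
    Finset.sum_induction _ p hadd h0 fun j _ => hs j (q j)
  rw [Finset.univ_sum_single] at this
  exact this Ξ hΞ

end NZDatum

open MvPolynomial (amp half pachnerSubst pachnerDir)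

/-! ### The 2–3 move on Neumann–Zagier data -/

section Stack

variable {N : ℕ}

/-- The position of an old row in a stack of rows. -/
def oldRow : Fin 2 ⊕ Fin N → Fin 3 ⊕ Fin N := Sum.elim ![.inl 1, .inl 2] .inr

lemma forall_stack {p : Fin 3 ⊕ Fin N → Prop} (h0 : p (.inl 0)) (h : ∀ i, p (oldRow i)) :
    ∀ i, p i := by
  rintro (i | i)
  · fin_cases i
    · exact h0
    · exact h (.inl 0)
    · exact h (.inl 1)
  · exact h (.inr i)

@[simp] lemma stackRows_new {α : Type*} (a : α) (b : Fin 2 ⊕ Fin N → α) :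
    stackRows a b (.inl 0) = a := rfl

@[simp] lemma stackRows_old {α : Type*} (a : α) (b : Fin 2 ⊕ Fin N → α) (i : Fin 2 ⊕ Fin N) :
    stackRows a b (oldRow i) = b i := by
  rcases i with i | i
  · fin_cases i <;> rfl
  · rfl

end Stack

namespace NZDatum

variable {N : ℕ} {K : Type*} [Field K]

/-- The matrix `A` after a 2–3 move, in the quads that suit the pentagon identity. -/
def stdA (A B : Matrix (Fin 2 ⊕ Fin N) (Fin 2 ⊕ Fin N) ℤ) :
    Matrix (Fin 3 ⊕ Fin N) (Fin 3 ⊕ Fin N) ℤ :=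
  Matrix.of <| stackRows (Sum.elim ![1, 1, 1] fun _ => 0) fun i =>
    Sum.elim ![0, -B i (.inl 0) - A i (.inl 1), -B i (.inl 1) - A i (.inl 0)] fun j => A i (.inr j)

/-- The matrix `B` after a 2–3 move, in the quads that suit the pentagon identity. -/
def stdB (A B : Matrix (Fin 2 ⊕ Fin N) (Fin 2 ⊕ Fin N) ℤ) :
    Matrix (Fin 3 ⊕ Fin N) (Fin 3 ⊕ Fin N) ℤ :=
  Matrix.of <| stackRows (fun _ => 0) fun i =>
    Sum.elim ![B i (.inl 0) + B i (.inl 1), -B i (.inl 0) + A i (.inl 0) - A i (.inl 1),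
      -B i (.inl 1) + A i (.inl 1) - A i (.inl 0)] fun j => B i (.inr j)

/-- The vector `ν` after a 2–3 move, in the quads that suit the pentagon identity. -/
def stdν (A B : Matrix (Fin 2 ⊕ Fin N) (Fin 2 ⊕ Fin N) ℤ) (ν : Fin 2 ⊕ Fin N → ℤ) :
    Fin 3 ⊕ Fin N → ℤ :=
  stackRows 2 fun i => ν i - B i (.inl 0) - B i (.inl 1) - A i (.inl 0) - A i (.inl 1)

lemma mat_apply' {ι : Type*} [Fintype ι] [DecidableEq ι] {Ξ : NZDatum ι K} (hz : Ξ.Shapes)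
    (i j : ι) : Ξ.mat i j = Ξ.B i j * (1 + Ξ.z j / (1 - Ξ.z j)) - Ξ.A i j := by
  have h1 : 1 - Ξ.z j ≠ 0 := sub_ne_zero.2 (hz j).2.symm
  rw [mat_apply]
  congr 2
  field_simp
  ring

/-- The new row of `mat` is `-(1, 1, 1, 0)`, and its kernel is the image of `pachnerSubst`. On this
image the new matrix acts as the old one, which lets kernels and inverses be compared. -/
lemma mat_mul_pachnerSubst {Ξ : NZDatum (Fin 2 ⊕ Fin N) K} {Ξ' : NZDatum (Fin 3 ⊕ Fin N) K}
    (hs : Ξ.Shapes) (hs' : Ξ'.Shapes) (hA : Ξ'.A = stdA Ξ.A Ξ.B) (hB : Ξ'.B = stdB Ξ.A Ξ.B)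
    {U V τ : K} (hτ : τ * (1 + U + V) = 1) {u : Fin N → K}
    (hu : (fun j => Ξ.z j / (1 - Ξ.z j)) = Sum.elim ![U, V] u)
    (hu' : (fun j => Ξ'.z j / (1 - Ξ'.z j)) =
      Sum.elim ![U * V * τ, -((1 + U) * τ), -((1 + V) * τ)] u) :
    Ξ'.mat * (pachnerSubst U V : Matrix (Fin 3 ⊕ Fin N) (Fin 2 ⊕ Fin N) K) = Matrix.of (stackRows (fun _ => 0) fun i => Ξ.mat i) := by
  have e : ∀ i j, Ξ.mat i j = Ξ.B i j * (1 + Sum.elim ![U, V] u j) - Ξ.A i j := fun i j => by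
    rw [mat_apply' hs, ← congrFun hu j]
  have e' : ∀ i j, Ξ'.mat i j = stdB Ξ.A Ξ.B i j * (1 +
      Sum.elim ![U * V * τ, -((1 + U) * τ), -((1 + V) * τ)] u j) - stdA Ξ.A Ξ.B i j := fun i j => by
    rw [mat_apply' hs', ← congrFun hu' j, hA, hB]
  ext i c
  revert i
  refine forall_stack ?_ fun i => ?_
  · rw [Matrix.mul_apply, Fintype.sum_sum_type, Fin.sum_univ_three]
    rcases c with c | c
    · fin_cases c <;> simp [e', stdA, stdB, pachnerSubst]; ring
    · simp [e', stdA, stdB, pachnerSubst]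
  · rw [Matrix.mul_apply, Fintype.sum_sum_type, Fin.sum_univ_three]
    rcases c with c | c
    · fin_cases c
      · simp [e, e', stdA, stdB, pachnerSubst]
        grind
      · simp [e, e', stdA, stdB, pachnerSubst]
        grind
    · simp [e, e', stdA, stdB, pachnerSubst, Matrix.one_apply]

lemma pachnerSubst_mulVec_eq_zero {U V τ : K} (hτ : τ * (1 + U + V) = 1)
    {v : Fin 2 ⊕ Fin N → K}
    (h : (pachnerSubst U V : Matrix (Fin 3 ⊕ Fin N) (Fin 2 ⊕ Fin N) K).mulVec v = 0) : v = 0 := by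
  have h0 := congrFun h (.inl 0)
  have h1 := congrFun h (.inl 1)
  have h2 := fun j => congrFun h (.inr j)
  simp [Matrix.mulVec, dotProduct, pachnerSubst, Matrix.one_apply] at h0 h1 h2
  ext i
  rcases i with i | i
  · fin_cases i
    · simp
      linear_combination (-v (.inl 0)) * hτ + τ * (1 + V) * h0 + τ * h1
    · simp
      linear_combination (-v (.inl 1)) * hτ + τ * U * h0 - τ * h1
  · simpa using h2 i

lemma exists_pachnerSubst_mulVec {U V τ : K} (hτ : τ * (1 + U + V) = 1)
    {w : Fin 3 ⊕ Fin N → K} (h : w (.inl 0) + w (.inl 1) + w (.inl 2) = 0) :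
    ∃ v, (pachnerSubst U V : Matrix (Fin 3 ⊕ Fin N) (Fin 2 ⊕ Fin N) K).mulVec v = w := by
  refine ⟨Sum.elim ![τ * ((1 + V) * w (.inl 0) + w (.inl 1)), τ * (U * w (.inl 0) - w (.inl 1))]
    fun j => w (.inr j), ?_⟩
  ext i
  rcases i with i | i
  · fin_cases i <;> simp [Matrix.mulVec, dotProduct, pachnerSubst] <;> grind
  · simp [Matrix.mulVec, dotProduct, pachnerSubst, Matrix.one_apply]

variable [CharZero K]

lemma ampK_pachner {M : ℕ} (hM : 0 < M) {U V τ : K} (hτ : τ * (1 + U + V) = 1)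
    {Q : Matrix (Fin 2 ⊕ Fin N) (Fin 2 ⊕ Fin N) K} (hQ : Q.IsSymm) (F₁ G₁ F₂ G₂ : K)
    (u f g : Fin N → K) :
    ampK M Q (Sum.elim ![U, V] u) (Sum.elim ![F₁, F₂] f) (Sum.elim ![G₁, G₂] g) =
    truncExp M ((2 * (F₁ - G₁ + F₂ - G₂) - F₁ ^ 2 - G₁ ^ 2 - F₂ ^ 2 - G₂ ^ 2 - 2 * F₁ * G₁ +
        2 * F₁ * G₂ + 2 * G₁ * F₂ + 2 * G₁ * G₂ - 2 * F₂ * G₂) / 8 - 1 / 6) *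
      ampK M ((pachnerSubst U V : Matrix (Fin 3 ⊕ Fin N) (Fin 2 ⊕ Fin N) K) *
          (Q - τ • Matrix.vecMulVec pachnerDir pachnerDir) *
          (pachnerSubst U V : Matrix (Fin 3 ⊕ Fin N) (Fin 2 ⊕ Fin N) K).transpose)
        (Sum.elim ![U * V * τ, -((1 + U) * τ), -((1 + V) * τ)] u)
        (Sum.elim ![F₁ + F₂, 1 - F₁ - G₁ + G₂, 1 - F₂ - G₂ + G₁] f)
        (Sum.elim ![0, F₁ - G₂, F₂ - G₁] g) := by
  set c := truncC K M with hc
  have hQ' : (Q.map c).IsSymm := by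
    rw [Matrix.IsSymm, ← Matrix.transpose_map, hQ.eq]
  have h2 : ∀ (a b : K) (x : Fin N → K), (fun j => c ((Sum.elim ![a, b] x : Fin 2 ⊕ Fin N → K) j)) =
      Sum.elim ![c a, c b] fun k => c (x k) := by
    intro a b x
    ext j
    rcases j with j | j
    · fin_cases j <;> rfl
    · rfl
  have h3 : ∀ (a b d : K) (x : Fin N → K),
      (fun j => c ((Sum.elim ![a, b, d] x : Fin 3 ⊕ Fin N → K) j)) =
      Sum.elim ![c a, c b, c d] fun k => c (x k) := by
    intro a b d x
    ext j
    rcases j with j | j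
    · fin_cases j <;> rfl
    · rfl
  have hP : (pachnerSubst U V : Matrix (Fin 3 ⊕ Fin N) (Fin 2 ⊕ Fin N) K).map c =
      pachnerSubst (c U) (c V) := by
    ext i j
    rcases i with i | i <;> rcases j with j | j
    · fin_cases i <;> fin_cases j <;> simp [pachnerSubst]
    · simp [pachnerSubst]
    · simp [pachnerSubst]
    · simp [pachnerSubst, Matrix.one_apply, apply_ite c]
  have hθ : (τ • Matrix.vecMulVec pachnerDir pachnerDir :
      Matrix (Fin 2 ⊕ Fin N) (Fin 2 ⊕ Fin N) K).map c =
      c τ • Matrix.vecMulVec pachnerDir pachnerDir := by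
    have hd : ∀ i : Fin 2 ⊕ Fin N, c (pachnerDir i) = pachnerDir i := by
      rintro (i | i)
      · fin_cases i <;> simp [pachnerDir]
      · simp [pachnerDir]
    ext i j
    simp [Matrix.vecMulVec_apply, hd]
  have key := MvPolynomial.amp_pachner hM (truncX_pow K M) (U := c U) (V := c V) (τ := c τ)
    (by rw [← map_one c, ← map_add, ← map_add, ← map_mul, hτ]) hQ' (c F₁) (c G₁) (c F₂) (c G₂)
    (fun k => c (u k)) (fun k => c (f k)) (fun k => c (g k))
  have h8 : half (TruncSeries K M) ^ 3 = c (1 / 8) := by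
    rw [← MvPolynomial.map_half c, ← map_pow, half]
    norm_num
  have h6 : algebraMap ℚ (TruncSeries K M) (1 / 6) = c (1 / 6) := by
    rw [RingHom.congr_fun (Subsingleton.elim (algebraMap ℚ (TruncSeries K M))
      (c.comp (algebraMap ℚ K))) (1 / 6)]
    simp
  have hk : MvPolynomial.pentConstant (c F₁) (c G₁) (c F₂) (c G₂) 0 =
      c ((2 * (F₁ - G₁ + F₂ - G₂) - F₁ ^ 2 - G₁ ^ 2 - F₂ ^ 2 - G₂ ^ 2 - 2 * F₁ * G₁ +
        2 * F₁ * G₂ + 2 * G₁ * F₂ + 2 * G₁ * G₂ - 2 * F₂ * G₂) / 8 - 1 / 6) := by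
    rw [MvPolynomial.pentConstant, h8, h6, map_sub c, div_eq_mul_one_div (_ - _) (8 : K), map_mul c]
    simp only [map_add, map_sub, map_mul, map_pow, map_ofNat]
    ring
  rw [hk] at key
  rw [ampK, ampK, h2, h2, h2, h3, h3, h3, key, Matrix.map_mul, Matrix.map_mul,
    Matrix.map_sub _ (fun a b => map_sub c a b), Matrix.transpose_map, hP, hθ, truncExp]
  rw [← hc]
  simp only [map_add, map_sub, map_mul, map_neg, map_one, map_zero]

/-- Identifies `Λ⁻¹` of the new datum with the covariance in `amp_pachner`. It is enough to multiply
the proposed form by `mat` and compare with `B`. -/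
lemma quadForm_pachner {Ξ : NZDatum (Fin 2 ⊕ Fin N) K} {Ξ' : NZDatum (Fin 3 ⊕ Fin N) K}
    (hΞ : Ξ.IsNZ) (hΞ' : Ξ'.IsNZ) (hA : Ξ'.A = stdA Ξ.A Ξ.B) (hB : Ξ'.B = stdB Ξ.A Ξ.B)
    {U V τ : K} (hτ : τ * (1 + U + V) = 1) {u : Fin N → K}
    (hu : (fun j => Ξ.z j / (1 - Ξ.z j)) = Sum.elim ![U, V] u)
    (hu' : (fun j => Ξ'.z j / (1 - Ξ'.z j)) =
      Sum.elim ![U * V * τ, -((1 + U) * τ), -((1 + V) * τ)] u)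
    (hM : Ξ.mat.det ≠ 0) (hM' : Ξ'.mat.det ≠ 0) :
    Ξ'.quadForm = (pachnerSubst U V : Matrix (Fin 3 ⊕ Fin N) (Fin 2 ⊕ Fin N) K) *
      (Ξ.quadForm - τ • Matrix.vecMulVec pachnerDir pachnerDir) *
      (pachnerSubst U V : Matrix (Fin 3 ⊕ Fin N) (Fin 2 ⊕ Fin N) K).transpose := by
  have hMP := mat_mul_pachnerSubst hΞ.shapes hΞ'.shapes hA hB hτ hu hu'
  set X : Matrix (Fin 2 ⊕ Fin N) (Fin 2 ⊕ Fin N) K :=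
    Ξ.quadForm - τ • Matrix.vecMulVec pachnerDir pachnerDir with hX
  set S : Matrix (Fin 3 ⊕ Fin N) (Fin 2 ⊕ Fin N) K :=
    Matrix.of (stackRows (fun _ => 0) fun i => Ξ.mat i) with hS
  refine quadForm_eq hM' ?_
  rw [← Matrix.mul_assoc, ← Matrix.mul_assoc, hMP]
  ext i c
  revert i
  refine forall_stack ?_ fun i => ?_
  · rw [Matrix.mul_apply]
    simp [hS, Matrix.mul_apply, BK, hB, stdB]
  · have h1 : Ξ.mat * X =
        Ξ.BK - τ • Matrix.vecMulVec (Ξ.mat.mulVec pachnerDir) pachnerDir := by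
      rw [hX, Matrix.mul_sub, mat_mul_quadForm hM, Matrix.mul_smul, Matrix.mul_vecMulVec]
    have h2 : ∀ c, (S * X) (oldRow i) c =
        Ξ.BK i c - τ * ((Ξ.mat i (.inl 0) - Ξ.mat i (.inl 1)) * pachnerDir c) := by
      intro c
      have := congrFun (congrFun h1 i) c
      rw [Matrix.mul_apply] at this ⊢
      simp only [hS, Matrix.of_apply, stackRows_old]
      have hd : (Ξ.mat.mulVec pachnerDir) i = Ξ.mat i (.inl 0) - Ξ.mat i (.inl 1) := by
        simp [Matrix.mulVec, dotProduct, pachnerDir, Fin.sum_univ_two]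
        ring
      rw [this, Matrix.sub_apply, Matrix.smul_apply, Matrix.vecMulVec_apply, hd, smul_eq_mul]
    have e : ∀ i j, Ξ.mat i j = Ξ.B i j * (1 + Sum.elim ![U, V] u j) - Ξ.A i j := fun i j => by
      rw [mat_apply' hΞ.shapes, ← congrFun hu j]
    rw [Matrix.mul_apply, Fintype.sum_sum_type, Fin.sum_univ_two]
    simp only [h2, e]
    rcases c with c | c
    · fin_cases c
      · simp [BK, hB, stdB, pachnerSubst, pachnerDir]
        grind
      · simp [BK, hB, stdB, pachnerSubst, pachnerDir]
        grind
      · simp [BK, hB, stdB, pachnerSubst, pachnerDir]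
        grind
    · simp [BK, hB, stdB, pachnerSubst, pachnerDir, Matrix.one_apply]

omit [CharZero K] in
lemma mat_det_pachner {Ξ : NZDatum (Fin 2 ⊕ Fin N) K} {Ξ' : NZDatum (Fin 3 ⊕ Fin N) K}
    (hs : Ξ.Shapes) (hs' : Ξ'.Shapes) (hA : Ξ'.A = stdA Ξ.A Ξ.B) (hB : Ξ'.B = stdB Ξ.A Ξ.B)
    {U V τ : K} (hτ : τ * (1 + U + V) = 1) {u : Fin N → K}
    (hu : (fun j => Ξ.z j / (1 - Ξ.z j)) = Sum.elim ![U, V] u)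
    (hu' : (fun j => Ξ'.z j / (1 - Ξ'.z j)) =
      Sum.elim ![U * V * τ, -((1 + U) * τ), -((1 + V) * τ)] u) :
    Ξ.mat.det ≠ 0 ↔ Ξ'.mat.det ≠ 0 := by
  set P : Matrix (Fin 3 ⊕ Fin N) (Fin 2 ⊕ Fin N) K := pachnerSubst U V with hP
  have hMP := mat_mul_pachnerSubst hs hs' hA hB hτ hu hu'
  rw [← hP] at hMP
  rw [not_iff_not, ← Matrix.exists_mulVec_eq_zero_iff, ← Matrix.exists_mulVec_eq_zero_iff]
  constructor
  · rintro ⟨v, hv, h⟩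
    refine ⟨P.mulVec v, fun h0 => hv (pachnerSubst_mulVec_eq_zero hτ h0), ?_⟩
    rw [Matrix.mulVec_mulVec, hMP]
    ext i
    revert i
    refine forall_stack ?_ fun i => ?_
    · simp [Matrix.mulVec]
    · simpa [Matrix.mulVec] using congrFun h i
  · rintro ⟨w, hw, h⟩
    -- The new row forces a kernel vector into the image of `pachnerSubst`, so the two kernels are
    -- isomorphic.
    have hw0 : w (.inl 0) + w (.inl 1) + w (.inl 2) = 0 := by
      have := congrFun h (.inl 0)
      simp [Matrix.mulVec, dotProduct, mat_apply' hs', hA, hB, stdA, stdB,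
        Fin.sum_univ_three] at this
      linear_combination -this
    obtain ⟨v, rfl⟩ := exists_pachnerSubst_mulVec hτ hw0
    refine ⟨v, fun h0 => hw (by rw [h0, Matrix.mulVec_zero]), ?_⟩
    rw [Matrix.mulVec_mulVec, ← hP, hMP] at h
    ext i
    simpa [Matrix.mulVec] using congrFun h (oldRow i)

/-- The flattening `f` after a 2–3 move, in the quads that suit the pentagon identity. -/
def stdf (f f'' : Fin 2 ⊕ Fin N → ℤ) : Fin 3 ⊕ Fin N → ℤ :=
  Sum.elim ![f (.inl 0) + f (.inl 1), 1 - f (.inl 0) - f'' (.inl 0) + f'' (.inl 1),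
    1 - f (.inl 1) - f'' (.inl 1) + f'' (.inl 0)] fun j => f (.inr j)

/-- The flattening `f''` after a 2–3 move, in the quads that suit the pentagon identity. -/
def stdf'' (f f'' : Fin 2 ⊕ Fin N → ℤ) : Fin 3 ⊕ Fin N → ℤ :=
  Sum.elim ![0, f (.inl 0) - f'' (.inl 1), f (.inl 1) - f'' (.inl 0)] fun j => f'' (.inr j)

omit [CharZero K] in
lemma flattened_std {Ξ : NZDatum (Fin 2 ⊕ Fin N) K} (h : Ξ.Flattened) (z : Fin 3 ⊕ Fin N → K) :
    (⟨stdA Ξ.A Ξ.B, stdB Ξ.A Ξ.B, stdν Ξ.A Ξ.B Ξ.ν, z, stdf Ξ.f Ξ.f'', stdf'' Ξ.f Ξ.f''⟩ :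
      NZDatum (Fin 3 ⊕ Fin N) K).Flattened := by
  rw [flattened_iff]
  refine forall_stack ?_ fun i => ?_
  · rw [Fintype.sum_sum_type, Fin.sum_univ_three]
    simp [stdA, stdB, stdν, stdf, stdf'']
    ring
  · have := flattened_iff.1 h i
    rw [Fintype.sum_sum_type, Fin.sum_univ_two] at this
    rw [Fintype.sum_sum_type, Fin.sum_univ_three]
    simp [stdA, stdB, stdν, stdf, stdf'']
    linear_combination this

lemma trunc_pachner {Ξ : NZDatum (Fin 2 ⊕ Fin N) K} {Ξ' : NZDatum (Fin 3 ⊕ Fin N) K}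
    (hΞ : Ξ.IsNZ) (hΞ' : Ξ'.IsNZ) (hA : Ξ'.A = stdA Ξ.A Ξ.B) (hB : Ξ'.B = stdB Ξ.A Ξ.B)
    (hf : Ξ'.f = stdf Ξ.f Ξ.f'') (hf'' : Ξ'.f'' = stdf'' Ξ.f Ξ.f'')
    {U V τ : K} (hτ : τ * (1 + U + V) = 1) {u : Fin N → K}
    (hu : (fun j => Ξ.z j / (1 - Ξ.z j)) = Sum.elim ![U, V] u)
    (hu' : (fun j => Ξ'.z j / (1 - Ξ'.z j)) =
      Sum.elim ![U * V * τ, -((1 + U) * τ), -((1 + V) * τ)] u)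
    (hM : Ξ.mat.det ≠ 0) (hM' : Ξ'.mat.det ≠ 0) :
    ∃ k : ℤ, ∀ M, 0 < M → Ξ.trunc M = truncExp M ((k : K) / 24) * Ξ'.trunc M := by
  have e2 : ∀ x : Fin 2 ⊕ Fin N → ℤ, (fun j => (x j : K)) =
      Sum.elim ![(x (.inl 0) : K), (x (.inl 1) : K)] fun j => (x (.inr j) : K) := by
    intro x
    ext j
    rcases j with j | j
    · fin_cases j <;> rfl
    · rfl
  have e3 : ∀ (a b c : ℤ) (x : Fin N → ℤ),
      (fun j => (((Sum.elim ![a, b, c] x : Fin 3 ⊕ Fin N → ℤ) j : ℤ) : K)) =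
      Sum.elim ![(a : K), (b : K), (c : K)] fun j => (x j : K) := by
    intro a b c x
    ext j
    rcases j with j | j
    · fin_cases j <;> rfl
    · rfl
  -- Twenty-four times the constant of `ampK_pachner`: the `1/8` becomes `3`, the `1/6` becomes `4`.
  refine ⟨3 * (2 * (Ξ.f (.inl 0) - Ξ.f'' (.inl 0) + Ξ.f (.inl 1) - Ξ.f'' (.inl 1)) -
    Ξ.f (.inl 0) ^ 2 - Ξ.f'' (.inl 0) ^ 2 - Ξ.f (.inl 1) ^ 2 - Ξ.f'' (.inl 1) ^ 2 -
    2 * Ξ.f (.inl 0) * Ξ.f'' (.inl 0) + 2 * Ξ.f (.inl 0) * Ξ.f'' (.inl 1) +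
    2 * Ξ.f'' (.inl 0) * Ξ.f (.inl 1) + 2 * Ξ.f'' (.inl 0) * Ξ.f'' (.inl 1) -
    2 * Ξ.f (.inl 1) * Ξ.f'' (.inl 1)) - 4, fun M hM0 => ?_⟩
  have key := ampK_pachner hM0 hτ (quadForm_isSymm hΞ.symm hM) (Ξ.f (.inl 0)) (Ξ.f'' (.inl 0))
    (Ξ.f (.inl 1)) (Ξ.f'' (.inl 1)) u (fun j => (Ξ.f (.inr j) : K)) (fun j => (Ξ.f'' (.inr j) : K))
  rw [trunc, hu, e2 Ξ.f, e2 Ξ.f'', key, trunc, quadForm_pachner hΞ hΞ' hA hB hτ hu hu' hM hM',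
    hu', hf, hf'', stdf, stdf'', e3, e3]
  push_cast
  refine congrArg (fun x => truncExp M x * _) ?_
  ring

/-- The 2–3 move, in the quads that suit the pentagon identity. -/
theorem rel_pachner_std {Ξ : NZDatum (Fin 2 ⊕ Fin N) K} {Ξ' : NZDatum (Fin 3 ⊕ Fin N) K}
    (hΞ : Ξ.IsNZ) (hΞ' : Ξ'.IsNZ) (hA : Ξ'.A = stdA Ξ.A Ξ.B) (hB : Ξ'.B = stdB Ξ.A Ξ.B)
    (hν : Ξ'.ν = stdν Ξ.A Ξ.B Ξ.ν)
    {U V τ : K} (hτ : τ * (1 + U + V) = 1) {u : Fin N → K}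
    (hu : (fun j => Ξ.z j / (1 - Ξ.z j)) = Sum.elim ![U, V] u)
    (hu' : (fun j => Ξ'.z j / (1 - Ξ'.z j)) =
      Sum.elim ![U * V * τ, -((1 + U) * τ), -((1 + V) * τ)] u) : Ξ.Rel Ξ' := by
  have hdet := mat_det_pachner hΞ.shapes hΞ'.shapes hA hB hτ hu hu'
  obtain ⟨A', B', ν', z', f', g'⟩ := Ξ'
  obtain ⟨h1, h2, h3⟩ := hΞ'
  have hfl := flattened_std hΞ.flattened z'
  simp only at hA hB hν h1
  subst hA hB hν
  -- The pentagon yields the series for the flattening induced from `Ξ`; the given flattening of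
  -- `Ξ'` differs from it by a change of flattening for the same equations.
  let Ξ₂ : NZDatum (Fin 3 ⊕ Fin N) K := ⟨stdA Ξ.A Ξ.B, stdB Ξ.A Ξ.B, stdν Ξ.A Ξ.B Ξ.ν, z',
    stdf Ξ.f Ξ.f'', stdf'' Ξ.f Ξ.f''⟩
  have hΞ₂ : Ξ₂.IsNZ := ⟨h1, h2, hfl⟩
  refine Rel.trans (Ξ' := Ξ₂) ⟨hdet, fun hM => ?_⟩ (rel_of_row_equiv hΞ₂ h3 (H := 1) (H' := 1)
    (Matrix.one_mul _).symm (Matrix.one_mul _).symm (Matrix.one_mulVec _).symm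
    (Matrix.one_mul _).symm (Matrix.one_mul _).symm rfl)
  exact trunc_pachner hΞ hΞ₂ rfl rfl rfl rfl hτ hu hu' hM (hdet.1 hM)

/-- The 2–3 move on Neumann–Zagier data. -/
theorem IsPachner.rel {Ξ : NZDatum (Fin 2 ⊕ Fin N) K} {Ξ' : NZDatum (Fin 3 ⊕ Fin N) K}
    (hΞ : Ξ.IsNZ) (hΞ' : Ξ'.IsNZ) (h : Ξ.IsPachner Ξ') : Ξ.Rel Ξ' := by
  -- These quads bring the move into the form `stdA`, `stdB`, where the parameters are those of the
  -- pentagon.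
  set q : Fin 2 ⊕ Fin N → Fin 3 := Sum.elim ![1, 1] fun _ => 0 with hq
  set q' : Fin 3 ⊕ Fin N → Fin 3 := Sum.elim ![1, 2, 2] fun _ => 0 with hq'
  refine (rel_quad hΞ q).trans (Rel.trans ?_ (rel_quad hΞ' q').symm)
  have hz1 := hΞ.shapes (.inl 0)
  have hz2 := hΞ.shapes (.inl 1)
  have hz0 := hΞ'.shapes (.inl 0)
  have hz3 := hΞ'.shapes (.inl 1)
  have hz4 := hΞ'.shapes (.inl 2)
  rw [h.z_eq] at hz0 hz3 hz4
  simp only [pachnerShape, Sum.elim_inl, Matrix.cons_val_zero, Matrix.cons_val_one,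
    Matrix.cons_val] at hz0 hz3 hz4
  set z₁ := Ξ.z (.inl 0) with hz₁
  set z₂ := Ξ.z (.inl 1) with hz₂
  set z₀ := z₁ + z₂ - z₁ * z₂ with hz₀
  obtain ⟨h10, h11⟩ := hz1
  obtain ⟨h20, h21⟩ := hz2
  obtain ⟨h00, h01⟩ := hz0
  have u1 : ∀ z : K, z ≠ 0 → z ≠ 1 → 1 / (1 - z) / (1 - 1 / (1 - z)) = -(1 / z) := by
    intro z h0 h1
    have h1' : 1 - z ≠ 0 := sub_ne_zero.2 h1.symm
    rw [show 1 - 1 / (1 - z) = -z * (1 / (1 - z)) by field_simp; ring]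
    field_simp
  have u2 : ∀ z : K, z ≠ 0 → (1 - 1 / z) / (1 - (1 - 1 / z)) = z - 1 := by
    intro z h0
    rw [show 1 - (1 - 1 / z) = 1 / z by ring]
    field_simp
  -- For the shape `z'` the parameter `u` is `-1/z`, and `1 - 1/z₁ - 1/z₂ = -z₀ / (z₁ z₂)`
  -- determines `τ`.
  refine rel_pachner_std (hΞ.quad q) (hΞ'.quad q') ?_ ?_ ?_ (U := -(1 / z₁)) (V := -(1 / z₂))
    (τ := -(z₁ * z₂ / z₀)) (u := fun j => Ξ.z (.inr j) / (1 - Ξ.z (.inr j))) ?_ ?_ ?_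
  · ext i j
    revert i
    refine forall_stack ?_ fun i => ?_
    · rcases j with j | j
      · fin_cases j <;> simp [quad, hq', h.A_eq, h.B_eq, pachnerA, pachnerB, stdA]
      · simp [quad, hq', h.A_eq, h.B_eq, pachnerA, pachnerB, stdA]
    · rcases j with j | j
      · fin_cases j <;> simp [quad, hq, hq', h.A_eq, h.B_eq, pachnerA, pachnerB, stdA] <;> ring
      · simp [quad, hq, hq', h.A_eq, h.B_eq, pachnerA, pachnerB, stdA]
  · ext i j
    revert i
    refine forall_stack ?_ fun i => ?_
    · rcases j with j | j
      · fin_cases j <;> simp [quad, hq', h.A_eq, h.B_eq, pachnerA, pachnerB, stdB]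
      · simp [quad, hq', h.A_eq, h.B_eq, pachnerA, pachnerB, stdB]
    · rcases j with j | j
      · fin_cases j <;> simp [quad, hq, hq', h.A_eq, h.B_eq, pachnerA, pachnerB, stdB] <;> ring
      · simp [quad, hq, hq', h.A_eq, h.B_eq, pachnerA, pachnerB, stdB]
  · ext i
    revert i
    refine forall_stack ?_ fun i => ?_
    · simp [quad, hq', h.A_eq, h.B_eq, h.ν_eq, pachnerA, pachnerB, stdν, Fin.sum_univ_three]
    · simp [quad, hq, hq', h.A_eq, h.B_eq, h.ν_eq, pachnerA, pachnerB, stdν, Fin.sum_univ_three]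
      ring
  · field_simp
    rw [hz₀]
    ring
  · ext j
    rcases j with j | j
    · fin_cases j
      · simpa [quad, hq] using u1 z₁ h10 h11
      · simpa [quad, hq] using u1 z₂ h20 h21
    · simp [quad, hq]
  · ext j
    rcases j with j | j
    · fin_cases j
      · have := u1 z₀ h00 h01
        simp [quad, hq', h.z_eq, pachnerShape] at this ⊢
        rw [this]
        field_simp
      · have := u2 _ hz3.1
        simp [quad, hq', h.z_eq, pachnerShape] at this ⊢
        rw [this]
        field_simp
        rw [hz₀]
        ring
      · have := u2 _ hz4.1
        simp [quad, hq', h.z_eq, pachnerShape] at this ⊢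
        rw [this]
        field_simp
        rw [hz₀]
        ring
    · simp [quad, hq', h.z_eq, pachnerShape]

end NZDatum

/-! ### The symplectic relations of the gluing equations -/

section Perm

/-- The signs and the values of the permutations of four vertices. -/
def permCodes : List (ℤ × Fin 4 × Fin 4 × Fin 4 × Fin 4) :=
  [(1, 0, 1, 2, 3), (-1, 0, 1, 3, 2), (-1, 0, 2, 1, 3), (1, 0, 2, 3, 1), (1, 0, 3, 1, 2),
    (-1, 0, 3, 2, 1), (-1, 1, 0, 2, 3), (1, 1, 0, 3, 2), (1, 1, 2, 0, 3), (-1, 1, 2, 3, 0),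
    (-1, 1, 3, 0, 2), (1, 1, 3, 2, 0), (1, 2, 0, 1, 3), (-1, 2, 0, 3, 1), (-1, 2, 1, 0, 3),
    (1, 2, 1, 3, 0), (1, 2, 3, 0, 1), (-1, 2, 3, 1, 0), (-1, 3, 0, 1, 2), (1, 3, 0, 2, 1),
    (1, 3, 1, 0, 2), (-1, 3, 1, 2, 0), (-1, 3, 2, 0, 1), (1, 3, 2, 1, 0)]

lemma perm_fin_four : (Finset.univ : Finset (Equiv.Perm (Fin 4))).val.map
    (fun π => ((Equiv.Perm.sign π : ℤ), π 0, π 1, π 2, π 3)) =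
    permCodes := by
  decide +kernel

lemma perm_fin_four_mem (π : Equiv.Perm (Fin 4)) :
    ((Equiv.Perm.sign π : ℤ), π 0, π 1, π 2, π 3) ∈
    permCodes := by
  rw [← Multiset.mem_coe, ← perm_fin_four]
  exact Multiset.mem_map_of_mem _ (Finset.mem_univ π)

/-- The sum of the values at the two edges with a given label. -/
def edgeSum (X : Fin 4 → Fin 4 → ℤ) (k : Fin 3) : ℤ :=
  ![X 0 1 + X 2 3, X 0 2 + X 1 3, X 0 3 + X 1 2] k

/-- The symplectic pairing in one tetrahedron as a signed sum over orderings of its vertices. Only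
edges of the face opposite to `π 3` occur in a summand, so gluing along that face pairs the summands
of neighbouring tetrahedra. -/
lemma sum_perm_eq {X Y : Fin 4 → Fin 4 → ℤ} (hX : ∀ v w, X v w = X w v)
    (hY : ∀ v w, Y v w = Y w v) :
    ∑ π : Equiv.Perm (Fin 4), (Equiv.Perm.sign π : ℤ) * (X (π 0) (π 1) * Y (π 1) (π 2)) =
      (edgeSum X 0 - edgeSum X 1) * (edgeSum Y 2 - edgeSum Y 1) -
      (edgeSum Y 0 - edgeSum Y 1) * (edgeSum X 2 - edgeSum X 1) := by
  have h := congrArg (fun m => (Multiset.map (fun p : ℤ × Fin 4 × Fin 4 × Fin 4 × Fin 4 =>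
    p.1 * (X p.2.1 p.2.2.1 * Y p.2.2.1 p.2.2.2.1)) m).sum) perm_fin_four
  simp only [Multiset.map_map, Function.comp_def] at h
  change ∑ π : Equiv.Perm (Fin 4), (Equiv.Perm.sign π : ℤ) * (X (π 0) (π 1) * Y (π 1) (π 2)) = _ at h
  rw [h]
  simp only [permCodes, Multiset.map_coe, List.map_cons, List.map_nil, Multiset.sum_coe, List.sum_cons,
    List.sum_nil, edgeSum, Matrix.cons_val_zero, Matrix.cons_val_one, Matrix.cons_val]
  rw [hX 1 0, hX 2 0, hX 3 0, hX 2 1, hX 3 1, hX 3 2, hY 1 0, hY 2 0, hY 3 0, hY 2 1, hY 3 1,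
    hY 3 2]
  ring

/-- The value at a side of a triangle of the vertex links, namely the side at the vertex `v` of the
face `v a b`. -/
def sideSum (X : Fin 4 → Fin 4 → ℤ) (v a b : Fin 4) : ℤ := X v a + X v b - X a b

lemma perm_eq_or (π ρ : Equiv.Perm (Fin 4)) (h0 : π 0 = ρ 0) (h2 : π 2 = ρ 3) :
    π 1 = ρ 1 ∧ π 3 = ρ 2 ∨ π 1 = ρ 2 ∧ π 3 = ρ 1 := by
  revert π ρ
  decide +kernel

/-- The pairing of one corner with an edge function is a difference between the entry side and the
exit side, so that it telescopes along a curve. -/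
lemma step_eq {X : Fin 4 → Fin 4 → ℤ} (hX : ∀ v w, X v w = X w v) (π : Equiv.Perm (Fin 4)) :
    (Equiv.Perm.sign π : ℤ) *
      (((if edgeLabel (π 0) (π 1) = 0 then 1 else 0) - (if edgeLabel (π 0) (π 1) = 1 then 1 else 0)) *
        (edgeSum X 2 - edgeSum X 1) -
      ((if edgeLabel (π 0) (π 1) = 2 then 1 else 0) - (if edgeLabel (π 0) (π 1) = 1 then 1 else 0)) *
        (edgeSum X 0 - edgeSum X 1)) =
      sideSum X (π 0) (π 1) (π 3) - sideSum X (π 0) (π 1) (π 2) := by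
  have h := perm_fin_four_mem π
  generalize (Equiv.Perm.sign π : ℤ) = s at h ⊢
  generalize π 0 = a at h ⊢
  generalize π 1 = b at h ⊢
  generalize π 2 = c at h ⊢
  generalize π 3 = d at h ⊢
  simp only [permCodes, List.mem_cons, Prod.mk.injEq, List.not_mem_nil, or_false] at h
  rcases h with ⟨rfl, rfl, rfl, rfl, rfl⟩ | ⟨rfl, rfl, rfl, rfl, rfl⟩ | ⟨rfl, rfl, rfl, rfl, rfl⟩ |
    ⟨rfl, rfl, rfl, rfl, rfl⟩ | ⟨rfl, rfl, rfl, rfl, rfl⟩ | ⟨rfl, rfl, rfl, rfl, rfl⟩ |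
    ⟨rfl, rfl, rfl, rfl, rfl⟩ | ⟨rfl, rfl, rfl, rfl, rfl⟩ | ⟨rfl, rfl, rfl, rfl, rfl⟩ |
    ⟨rfl, rfl, rfl, rfl, rfl⟩ | ⟨rfl, rfl, rfl, rfl, rfl⟩ | ⟨rfl, rfl, rfl, rfl, rfl⟩ |
    ⟨rfl, rfl, rfl, rfl, rfl⟩ | ⟨rfl, rfl, rfl, rfl, rfl⟩ | ⟨rfl, rfl, rfl, rfl, rfl⟩ |
    ⟨rfl, rfl, rfl, rfl, rfl⟩ | ⟨rfl, rfl, rfl, rfl, rfl⟩ | ⟨rfl, rfl, rfl, rfl, rfl⟩ |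
    ⟨rfl, rfl, rfl, rfl, rfl⟩ | ⟨rfl, rfl, rfl, rfl, rfl⟩ | ⟨rfl, rfl, rfl, rfl, rfl⟩ |
    ⟨rfl, rfl, rfl, rfl, rfl⟩ | ⟨rfl, rfl, rfl, rfl, rfl⟩ | ⟨rfl, rfl, rfl, rfl, rfl⟩ <;>
  simp [edgeLabel, edgeSum, sideSum] <;>
  linarith [hX 1 0, hX 2 0, hX 3 0, hX 2 1, hX 3 1, hX 3 2]

end Perm

namespace IdealTriangulation

variable {ι : Type*} (T : IdealTriangulation ι)

/-- The value at an edge of a tetrahedron of a function on the edges of the triangulation. -/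
def edgeVal (χ : T.EdgeClass → ℤ) (t : ι) (v w : Fin 4) : ℤ :=
  if h : v ≠ w then χ (Quot.mk _ ⟨t, v, w, h⟩) else 0

variable {T}

lemma edgeVal_of_ne (χ : T.EdgeClass → ℤ) (t : ι) {v w : Fin 4} (h : v ≠ w) :
    T.edgeVal χ t v w = χ (Quot.mk _ ⟨t, v, w, h⟩) := dif_pos h

lemma edgeVal_comm (χ : T.EdgeClass → ℤ) (t : ι) (v w : Fin 4) :
    T.edgeVal χ t v w = T.edgeVal χ t w v := by
  by_cases h : v = w
  · rw [h]
  · rw [edgeVal_of_ne χ t h, edgeVal_of_ne χ t (Ne.symm h)]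
    exact congrArg χ (Quot.sound (EdgeStep.flip ⟨t, v, w, h⟩))

lemma edgeVal_glue (χ : T.EdgeClass → ℤ) (t : ι) {f v w : Fin 4} (hv : v ≠ f) (hw : w ≠ f) :
    T.edgeVal χ (T.glue t f).1 ((T.glue t f).2 v) ((T.glue t f).2 w) = T.edgeVal χ t v w := by
  by_cases h : v = w
  · subst h
    simp [edgeVal]
  · rw [edgeVal_of_ne χ t h, edgeVal_of_ne χ _ fun h' => h ((T.glue t f).2.injective h')]
    exact congrArg χ (Quot.sound (EdgeStep.glue ⟨t, v, w, h⟩ f hv hw)).symm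

variable (T) in
/-- The action of the gluing maps on tetrahedra with ordered vertices. -/
def glueFlag (p : ι × Equiv.Perm (Fin 4)) : ι × Equiv.Perm (Fin 4) :=
  ((T.glue p.1 (p.2 3)).1, (T.glue p.1 (p.2 3)).2 * p.2)

variable (T) in
lemma glueFlag_glueFlag (p : ι × Equiv.Perm (Fin 4)) : T.glueFlag (T.glueFlag p) = p := by
  simp only [glueFlag, Equiv.Perm.coe_mul, Function.comp_apply, T.glue_glue, inv_mul_cancel_left]

lemma sign_glueFlag (p : ι × Equiv.Perm (Fin 4)) :
    (Equiv.Perm.sign (T.glueFlag p).2 : ℤ) = -Equiv.Perm.sign p.2 := by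
  simp [glueFlag, T.sign_glue]

lemma edgeVal_glueFlag (χ : T.EdgeClass → ℤ) (p : ι × Equiv.Perm (Fin 4)) {i j : Fin 4}
    (hi : i ≠ 3) (hj : j ≠ 3) :
    T.edgeVal χ (T.glueFlag p).1 ((T.glueFlag p).2 i) ((T.glueFlag p).2 j) =
      T.edgeVal χ p.1 (p.2 i) (p.2 j) :=
  edgeVal_glue χ p.1 (fun h => hi (p.2.injective h)) (fun h => hj (p.2.injective h))

/-- The pairing of two edge equations vanishes. -/
lemma edge_pairing [Fintype ι] (χ ψ : T.EdgeClass → ℤ) :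
    ∑ t, ((edgeSum (T.edgeVal χ t) 0 - edgeSum (T.edgeVal χ t) 1) *
        (edgeSum (T.edgeVal ψ t) 2 - edgeSum (T.edgeVal ψ t) 1) -
      (edgeSum (T.edgeVal ψ t) 0 - edgeSum (T.edgeVal ψ t) 1) *
        (edgeSum (T.edgeVal χ t) 2 - edgeSum (T.edgeVal χ t) 1)) = 0 := by
  rw [Finset.sum_congr rfl fun t _ => (sum_perm_eq (edgeVal_comm χ t) (edgeVal_comm ψ t)).symm]
  rw [← Fintype.sum_prod_type' (f := fun t (π : Equiv.Perm (Fin 4)) => (Equiv.Perm.sign π : ℤ) *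
    (T.edgeVal χ t (π 0) (π 1) * T.edgeVal ψ t (π 1) (π 2)))]
  -- The gluing involution preserves the values at edges of the shared face and, by orientedness,
  -- reverses the sign. The sum equals its negative.
  have h := Equiv.sum_comp (Function.Involutive.toPerm T.glueFlag T.glueFlag_glueFlag)
    (fun p : ι × Equiv.Perm (Fin 4) => (Equiv.Perm.sign p.2 : ℤ) *
      (T.edgeVal χ p.1 (p.2 0) (p.2 1) * T.edgeVal ψ p.1 (p.2 1) (p.2 2)))
  have h2 : ∀ p : ι × Equiv.Perm (Fin 4), (Equiv.Perm.sign (T.glueFlag p).2 : ℤ) *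
      (T.edgeVal χ (T.glueFlag p).1 ((T.glueFlag p).2 0) ((T.glueFlag p).2 1) *
        T.edgeVal ψ (T.glueFlag p).1 ((T.glueFlag p).2 1) ((T.glueFlag p).2 2)) =
      -((Equiv.Perm.sign p.2 : ℤ) *
        (T.edgeVal χ p.1 (p.2 0) (p.2 1) * T.edgeVal ψ p.1 (p.2 1) (p.2 2))) := by
    intro p
    rw [sign_glueFlag, edgeVal_glueFlag χ p (by decide) (by decide),
      edgeVal_glueFlag ψ p (by decide) (by decide), neg_mul]
  have h3 := (Finset.sum_congr rfl fun p _ => (h2 p).symm).trans h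
  rw [Finset.sum_neg_distrib] at h3
  omega

open Classical in
lemma edgeCoeff_eq (c : T.EdgeClass) (k : Fin 3) (t : ι) :
    edgeCoeff c k t = edgeSum (T.edgeVal (fun c' => if c' = c then 1 else 0) t) k := by
  have h : ∀ v w : Fin 4, (if ∃ h : v < w, edgeLabel v w = k ∧
      Quot.mk T.EdgeStep ⟨t, v, w, h.ne⟩ = c then (1 : ℤ) else 0) =
      if v < w ∧ edgeLabel v w = k then
        T.edgeVal (fun c' => if c' = c then 1 else 0) t v w else 0 := by
    intro v w
    by_cases hvw : v < w
    · rw [edgeVal_of_ne _ _ hvw.ne]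
      by_cases hk : edgeLabel v w = k
      · simp only [hvw, hk, exists_true_left, true_and, and_self, if_true]
        split_ifs with h1 h2 h2 <;> first | rfl | exact absurd h1 h2 | exact absurd h2 h1
      · simp [hvw, hk]
    · simp [hvw]
  rw [edgeCoeff, Finset.card_filter]
  push_cast
  rw [Fintype.sum_prod_type]
  simp only [h, Fin.sum_univ_four]
  fin_cases k <;> simp [edgeLabel, edgeSum]

open Classical in
/-- The contribution of a step to the coefficients of a curve. -/
def stepCoeff (s : LinkStep ι) (k : Fin 3) (t : ι) : ℤ :=
  if s.tet = t ∧ edgeLabel (s.π 0) (s.π 1) = k then (Equiv.Perm.sign s.π : ℤ) else 0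

lemma coeff_eq (γ : T.PeripheralCurve) (k : Fin 3) (t : ι) :
    γ.coeff k t = (γ.steps.map fun s => stepCoeff s k t).sum := rfl

lemma step_pairing [Fintype ι] (s : LinkStep ι) (χ : T.EdgeClass → ℤ) :
    ∑ t, ((stepCoeff s 0 t - stepCoeff s 1 t) *
        (edgeSum (T.edgeVal χ t) 2 - edgeSum (T.edgeVal χ t) 1) -
      (edgeSum (T.edgeVal χ t) 0 - edgeSum (T.edgeVal χ t) 1) *
        (stepCoeff s 2 t - stepCoeff s 1 t)) =
      sideSum (T.edgeVal χ s.tet) (s.π 0) (s.π 1) (s.π 3) -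
        sideSum (T.edgeVal χ s.tet) (s.π 0) (s.π 1) (s.π 2) := by
  classical
  rw [Finset.sum_eq_single s.tet, ← step_eq (edgeVal_comm χ _) s.π]
  · simp only [stepCoeff, true_and]
    split_ifs <;> ring
  · intro t _ ht
    simp [stepCoeff, Ne.symm ht]
  · simp

lemma list_pairing [Fintype ι] (l : List (LinkStep ι)) (χ : T.EdgeClass → ℤ) :
    ∑ t, (((l.map fun s => stepCoeff s 0 t).sum - (l.map fun s => stepCoeff s 1 t).sum) *
        (edgeSum (T.edgeVal χ t) 2 - edgeSum (T.edgeVal χ t) 1) -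
      (edgeSum (T.edgeVal χ t) 0 - edgeSum (T.edgeVal χ t) 1) *
        ((l.map fun s => stepCoeff s 2 t).sum - (l.map fun s => stepCoeff s 1 t).sum)) =
      (l.map fun s => sideSum (T.edgeVal χ s.tet) (s.π 0) (s.π 1) (s.π 3)).sum -
        (l.map fun s => sideSum (T.edgeVal χ s.tet) (s.π 0) (s.π 1) (s.π 2)).sum := by
  induction l with
  | nil => simp
  | cons s l ih =>
    simp only [List.map_cons, List.sum_cons]
    rw [add_sub_add_comm, ← ih, ← step_pairing, ← Finset.sum_add_distrib]
    refine Finset.sum_congr rfl fun t _ => ?_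
    ring

/-- A side value depends only on the glued side. The next step may turn around either end of it,
which exchanges the two other vertices of the face; the side value is symmetric in them. -/
lemma sideSum_cross (χ : T.EdgeClass → ℤ) {s s' : LinkStep ι} (h : T.cross s.exit = s'.entry) :
    sideSum (T.edgeVal χ s.tet) (s.π 0) (s.π 1) (s.π 2) =
      sideSum (T.edgeVal χ s'.tet) (s'.π 0) (s'.π 1) (s'.π 3) := by
  have ht : (T.glue s.tet (s.π 3)).1 = s'.tet := congrArg Side.tet h
  have hf : (T.glue s.tet (s.π 3)).2 (s.π 3) = s'.π 2 := congrArg Side.face h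
  have hv : (T.glue s.tet (s.π 3)).2 (s.π 0) = s'.π 0 := congrArg Side.vtx h
  have hE : ∀ i j : Fin 4, i ≠ 3 → j ≠ 3 → T.edgeVal χ s'.tet ((T.glue s.tet (s.π 3)).2 (s.π i))
      ((T.glue s.tet (s.π 3)).2 (s.π j)) = T.edgeVal χ s.tet (s.π i) (s.π j) := by
    intro i j hi hj
    rw [← ht]
    exact edgeVal_glue χ s.tet (fun h => hi (s.π.injective h)) (fun h => hj (s.π.injective h))
  have h1 := perm_eq_or s'.π ((T.glue s.tet (s.π 3)).2 * s.π) (by simp [hv]) (by simp [hf])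
  simp only [Equiv.Perm.coe_mul, Function.comp_apply] at h1
  rw [sideSum, sideSum, ← hv, ← hE 0 1 (by decide) (by decide), ← hE 0 2 (by decide) (by decide),
    ← hE 1 2 (by decide) (by decide)]
  rcases h1 with ⟨h1, h3⟩ | ⟨h1, h3⟩
  · rw [h1, h3]
  · rw [h1, h3, edgeVal_comm χ _ ((T.glue s.tet (s.π 3)).2 (s.π 1)) ((T.glue s.tet (s.π 3)).2 (s.π 2))]
    ring

lemma sum_eq_of_isChain {α : Type*} {r : α → α → Prop} {fx fe : α → ℤ}
    (h : ∀ s s', r s s' → fx s = fe s') (a b : α) (l : List α) (hl : (a :: (l ++ [b])).IsChain r) :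
    ((a :: l).map fx).sum = ((l ++ [b]).map fe).sum := by
  induction l generalizing a with
  | nil =>
    simp at hl
    simp [h _ _ hl]
  | cons c l ih =>
    rw [List.cons_append, List.isChain_cons_cons] at hl
    rw [List.map_cons, List.sum_cons, ih c hl.2, List.cons_append, List.map_cons, List.sum_cons,
      h _ _ hl.1]

/-- The pairing of a peripheral curve and an edge equation vanishes. -/
lemma curve_pairing [Fintype ι] (γ : T.PeripheralCurve) (χ : T.EdgeClass → ℤ) :
    ∑ t, ((γ.coeff 0 t - γ.coeff 1 t) *
        (edgeSum (T.edgeVal χ t) 2 - edgeSum (T.edgeVal χ t) 1) -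
      (edgeSum (T.edgeVal χ t) 0 - edgeSum (T.edgeVal χ t) 1) *
        (γ.coeff 2 t - γ.coeff 1 t)) = 0 := by
  obtain ⟨steps, hne, hc⟩ := γ
  simp only [coeff_eq, list_pairing]
  rw [sub_eq_zero]
  obtain ⟨a, l, rfl⟩ := List.exists_cons_of_ne_nil hne
  rw [Cycle.chain_coe_cons] at hc
  rw [sum_eq_of_isChain (fun s s' h => sideSum_cross χ h) a a l hc]
  simp [add_comm]

open Classical in
/-- The equations of the edges and of the peripheral curve are symplectically orthogonal. -/
lemma gluingMatrix_isSymm [Fintype ι] (e : ι ≃ T.EdgeClass) (r : ι) (γ : T.PeripheralCurve) :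
    ((gluingMatrix e r γ 0 - gluingMatrix e r γ 1) *
      (gluingMatrix e r γ 2 - gluingMatrix e r γ 1).transpose).IsSymm := by
  rw [NZDatum.isSymm_iff]
  intro i k
  simp only [gluingMatrix, Matrix.sub_apply, Matrix.of_apply]
  by_cases hi : i = r <;> by_cases hk : k = r
  · simp only [hi, hk, if_true, sub_self, Finset.sum_const_zero]
  · simp only [hi, hk, if_true, if_false, edgeCoeff_eq]
    exact curve_pairing γ _
  · simp only [hi, hk, if_true, if_false, edgeCoeff_eq]
    rw [← neg_eq_zero, ← Finset.sum_neg_distrib]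
    refine Eq.trans (Finset.sum_congr rfl fun t _ => ?_)
      (curve_pairing γ fun c' => if c' = e i then (1 : ℤ) else 0)
    ring
  · simp only [hi, hk, if_false, edgeCoeff_eq]
    exact edge_pairing _ _

end IdealTriangulation

/-! ### The edges before and after a 2–3 Pachner move -/

namespace IdealTriangulation

variable {κ κ' ρ : Type*}

/-- Vertices of tetrahedra of two triangulations that correspond to each other: those of the
bipyramid by their labels, the other ones identically. -/
def VtxCorr (L : κ → Fin 4 → Fin 5) (L' : κ' → Fin 4 → Fin 5) :
    κ ⊕ ρ → Fin 4 → κ' ⊕ ρ → Fin 4 → Prop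
  | .inl i, v, .inl i', v' => L i v = L' i' v'
  | .inr j, v, .inr j', v' => j = j' ∧ v = v'
  | _, _, _, _ => False

/-- Faces of tetrahedra of two triangulations that correspond to each other. -/
def FaceCorr (L : κ → Fin 4 → Fin 5) (L' : κ' → Fin 4 → Fin 5) :
    κ ⊕ ρ → Fin 4 → κ' ⊕ ρ → Fin 4 → Prop
  | .inl i, f, .inl i', f' => faceVertices L i f = faceVertices L' i' f'
  | .inr j, f, .inr j', f' => j = j' ∧ f = f'
  | _, _, _, _ => False

/-- Edges of tetrahedra of two triangulations that correspond to each other. -/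
def EdgeCorr (L : κ → Fin 4 → Fin 5) (L' : κ' → Fin 4 → Fin 5) (e : TetEdge (κ ⊕ ρ))
    (e' : TetEdge (κ' ⊕ ρ)) : Prop :=
  VtxCorr L L' e.tet e.v e'.tet e'.v ∧ VtxCorr L L' e.tet e.w e'.tet e'.w

lemma VtxCorr.symm {L : κ → Fin 4 → Fin 5} {L' : κ' → Fin 4 → Fin 5} {t : κ ⊕ ρ} {v : Fin 4}
    {t' : κ' ⊕ ρ} {v' : Fin 4} (h : VtxCorr L L' t v t' v') : VtxCorr L' L t' v' t v := by
  rcases t with i | j <;> rcases t' with i' | j'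
  · exact Eq.symm h
  · exact h
  · exact h
  · exact ⟨h.1.symm, h.2.symm⟩

lemma FaceCorr.symm {L : κ → Fin 4 → Fin 5} {L' : κ' → Fin 4 → Fin 5} {t : κ ⊕ ρ} {f : Fin 4}
    {t' : κ' ⊕ ρ} {f' : Fin 4} (h : FaceCorr L L' t f t' f') : FaceCorr L' L t' f' t f := by
  rcases t with i | j <;> rcases t' with i' | j'
  · exact Eq.symm h
  · exact h
  · exact h
  · exact ⟨h.1.symm, h.2.symm⟩

lemma EdgeCorr.symm {L : κ → Fin 4 → Fin 5} {L' : κ' → Fin 4 → Fin 5} {e : TetEdge (κ ⊕ ρ)}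
    {e' : TetEdge (κ' ⊕ ρ)} (h : EdgeCorr L L' e e') : EdgeCorr L' L e' e :=
  ⟨h.1.symm, h.2.symm⟩

/-- The tetrahedra with indices in `κ`, with the labels `L`, fill a bipyramid that the triangulation
contains. -/
structure Fills (L : κ → Fin 4 → Fin 5) (T : IdealTriangulation (κ ⊕ ρ)) : Prop where
  inj : ∀ i, Function.Injective (L i)
  inner : ∀ s s' : Side κ, s.tet ≠ s'.tet → SameSide L L s s' →
    T.cross (s.map Sum.inl) = s'.map Sum.inl
  adj : ∀ i i₂ v w v₂ w₂, i ≠ i₂ → v ≠ w → L i v = L i₂ v₂ → L i w = L i₂ w₂ →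
    ∃ f f₂, v ≠ f ∧ w ≠ f ∧ faceVertices L i f = faceVertices L i₂ f₂

/-- Every face of a tetrahedron in the bipyramid is an inner face, or also a face on the
other side. -/
def FaceDichotomy (L : κ → Fin 4 → Fin 5) (L' : κ' → Fin 4 → Fin 5) : Prop :=
  ∀ i f, (∃ i₂ f₂, i ≠ i₂ ∧ faceVertices L i f = faceVertices L i₂ f₂) ∨
    ∃ i' f', faceVertices L i f = faceVertices L' i' f'

/-- The gluings of the faces outside of the bipyramids correspond to each other. -/
def SameGluing (L : κ → Fin 4 → Fin 5) (L' : κ' → Fin 4 → Fin 5) (T : IdealTriangulation (κ ⊕ ρ))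
    (T' : IdealTriangulation (κ' ⊕ ρ)) : Prop :=
  ∀ (s : Side (κ ⊕ ρ)) (s' : Side (κ' ⊕ ρ)), FaceCorr L L' s.tet s.face s'.tet s'.face →
    VtxCorr L L' s.tet s.vtx s'.tet s'.vtx →
    VtxCorr L L' (T.cross s).tet (T.cross s).vtx (T'.cross s').tet (T'.cross s').vtx

lemma SameGluing.symm {L : κ → Fin 4 → Fin 5} {L' : κ' → Fin 4 → Fin 5}
    {T : IdealTriangulation (κ ⊕ ρ)} {T' : IdealTriangulation (κ' ⊕ ρ)}
    (h : SameGluing L L' T T') : SameGluing L' L T' T :=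
  fun s s' hf hv => (h s' s hf.symm hv.symm).symm

lemma exists_vtx {L : κ → Fin 4 → Fin 5} {L' : κ' → Fin 4 → Fin 5} {i : κ} {f v : Fin 4} {i' : κ'}
    {f' : Fin 4} (h : faceVertices L i f = faceVertices L' i' f') (hv : v ≠ f) :
    ∃ v', v' ≠ f' ∧ L' i' v' = L i v := by
  have : L i v ∈ faceVertices L' i' f' := by
    rw [← h]
    exact Finset.mem_image_of_mem _ (by simp [hv])
  obtain ⟨v', hv', h'⟩ := Finset.mem_image.1 this
  exact ⟨v', by simpa using hv', h'⟩

variable {L : κ → Fin 4 → Fin 5} {L' : κ' → Fin 4 → Fin 5} {T : IdealTriangulation (κ ⊕ ρ)}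
  {T' : IdealTriangulation (κ' ⊕ ρ)}

lemma mk_eq_of_glue {ι : Type*} {T : IdealTriangulation ι} {t t₂ : ι} {f v w v₂ w₂ : Fin 4}
    (hv : v ≠ f) (hw : w ≠ f) (hvw : v ≠ w) (hvw₂ : v₂ ≠ w₂) (ht : (T.glue t f).1 = t₂)
    (hv₂ : (T.glue t f).2 v = v₂) (hw₂ : (T.glue t f).2 w = w₂) :
    Quot.mk T.EdgeStep ⟨t, v, w, hvw⟩ = Quot.mk T.EdgeStep ⟨t₂, v₂, w₂, hvw₂⟩ := by
  subst ht hv₂ hw₂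
  exact Quot.sound (EdgeStep.glue ⟨t, v, w, hvw⟩ f hv hw)

lemma Fills.glue_eq (h : Fills L T) {i i₂ : κ} {f f₂ v v₂ : Fin 4} (hi : i ≠ i₂) (hv : v ≠ f)
    (hf : faceVertices L i f = faceVertices L i₂ f₂) (hL : L i v = L i₂ v₂) :
    (T.glue (.inl i) f).1 = .inl i₂ ∧ (T.glue (.inl i) f).2 v = v₂ := by
  obtain ⟨v₃, hv₃, hL₃⟩ := exists_vtx hf hv
  obtain rfl := h.inj _ (hL₃.trans hL)
  have := h.inner ⟨i, f, v, hv⟩ ⟨i₂, f₂, v₃, hv₃⟩ hi ⟨hf, hL⟩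
  exact ⟨congrArg Side.tet this, congrArg Side.vtx this⟩

lemma Fills.mk_eq (h : Fills L T) {i i₂ : κ} {v w v₂ w₂ : Fin 4} (hvw : v ≠ w) (hvw₂ : v₂ ≠ w₂)
    (hv : L i v = L i₂ v₂) (hw : L i w = L i₂ w₂) :
    Quot.mk T.EdgeStep ⟨.inl i, v, w, hvw⟩ = Quot.mk T.EdgeStep ⟨.inl i₂, v₂, w₂, hvw₂⟩ := by
  by_cases hi : i = i₂
  · subst hi
    obtain rfl := h.inj _ hv
    obtain rfl := h.inj _ hw
    rfl
  · obtain ⟨f, f₂, hvf, hwf, hf⟩ := h.adj i i₂ v w v₂ w₂ hi hvw hv hw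
    exact mk_eq_of_glue hvf hwf hvw hvw₂ (h.glue_eq hi hvf hf hv).1 (h.glue_eq hi hvf hf hv).2
      (h.glue_eq hi hwf hf hw).2

lemma Fills.mk_eq_of_corr (h' : Fills L' T') {e : TetEdge (κ ⊕ ρ)} {e₁ e₂ : TetEdge (κ' ⊕ ρ)}
    (h₁ : EdgeCorr L L' e e₁) (h₂ : EdgeCorr L L' e e₂) :
    Quot.mk T'.EdgeStep e₁ = Quot.mk T'.EdgeStep e₂ := by
  obtain ⟨t, v, w, hvw⟩ := e
  obtain ⟨t₁, v₁, w₁, hvw₁⟩ := e₁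
  obtain ⟨t₂, v₂, w₂, hvw₂⟩ := e₂
  obtain ⟨h₁, h₁'⟩ := h₁
  obtain ⟨h₂, h₂'⟩ := h₂
  rcases t with i | j <;> rcases t₁ with i₁ | j₁ <;> rcases t₂ with i₂ | j₂
  · exact h'.mk_eq hvw₁ hvw₂ (Eq.trans (Eq.symm h₁) h₂) (Eq.trans (Eq.symm h₁') h₂')
  · exact h₂.elim
  · exact h₁.elim
  · exact h₁.elim
  · exact h₁.elim
  · exact h₁.elim
  · exact h₂.elim
  · obtain ⟨rfl, rfl⟩ := h₁
    obtain ⟨-, rfl⟩ := h₁'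
    obtain ⟨rfl, rfl⟩ := h₂
    obtain ⟨-, rfl⟩ := h₂'
    rfl

lemma EdgeStep.symm {ι : Type*} {T : IdealTriangulation ι} {e₁ e₂ : TetEdge ι}
    (h : T.EdgeStep e₁ e₂) : T.EdgeStep e₂ e₁ := by
  cases h with
  | flip => exact EdgeStep.flip ⟨e₁.tet, e₁.w, e₁.v, e₁.ne.symm⟩
  | glue f hv hw =>
    have h := EdgeStep.glue (T := T) ⟨(T.glue e₁.tet f).1, (T.glue e₁.tet f).2 e₁.v,
      (T.glue e₁.tet f).2 e₁.w, fun h => e₁.ne ((T.glue e₁.tet f).2.injective h)⟩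
      ((T.glue e₁.tet f).2 f) (fun h => hv ((T.glue e₁.tet f).2.injective h))
      (fun h => hw ((T.glue e₁.tet f).2.injective h))
    convert h using 1
    obtain ⟨t, v, w, hvw⟩ := e₁
    simp [T.glue_glue]

/-- Across an inner face of the bipyramid the labels are unchanged, so the same partner serves.
Across an outer face the partner is first moved, inside the other filling, to a tetrahedron with
that face, and then glued. -/
lemma exists_corr_of_step (h : Fills L T) (h' : Fills L' T') (hd : FaceDichotomy L L')
    (hg : SameGluing L L' T T') {e₁ e₂ : TetEdge (κ ⊕ ρ)} (hs : T.EdgeStep e₁ e₂)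
    {e₁' : TetEdge (κ' ⊕ ρ)} (hc : EdgeCorr L L' e₁ e₁') :
    ∃ e₂', EdgeCorr L L' e₂ e₂' ∧ Quot.mk T'.EdgeStep e₁' = Quot.mk T'.EdgeStep e₂' := by
  cases hs with
  | flip =>
    exact ⟨⟨e₁'.tet, e₁'.w, e₁'.v, e₁'.ne.symm⟩, ⟨hc.2, hc.1⟩, Quot.sound (EdgeStep.flip e₁')⟩
  | glue f hv hw =>
    obtain ⟨t, v, w, hvw⟩ := e₁
    obtain ⟨t', v', w', hvw'⟩ := e₁'
    obtain ⟨hcv, hcw⟩ := hc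
    dsimp only at hv hw hcv hcw ⊢
    rcases t with i | j <;> rcases t' with i' | j'
    · rcases hd i f with ⟨i₂, f₂, hi, hf⟩ | ⟨i₂, f₂, hf⟩
      · obtain ⟨v₂, -, hv₂⟩ := exists_vtx hf hv
        obtain ⟨w₂, -, hw₂⟩ := exists_vtx hf hw
        have g1 := h.glue_eq hi hv hf hv₂.symm
        have g2 := h.glue_eq hi hw hf hw₂.symm
        refine ⟨⟨.inl i', v', w', hvw'⟩, ⟨?_, ?_⟩, rfl⟩
        · dsimp only
          rw [g1.1, g1.2]
          exact hv₂.trans hcv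
        · dsimp only
          rw [g1.1, g2.2]
          exact hw₂.trans hcw
      · obtain ⟨v₂, hv₂f, hv₂⟩ := exists_vtx hf hv
        obtain ⟨w₂, hw₂f, hw₂⟩ := exists_vtx hf hw
        have hne : v₂ ≠ w₂ := fun h0 => hvw (h.inj i (by rw [← hv₂, ← hw₂, h0]))
        refine ⟨⟨(T'.glue (.inl i₂) f₂).1, (T'.glue (.inl i₂) f₂).2 v₂, (T'.glue (.inl i₂) f₂).2 w₂,
          fun h => hne ((T'.glue (.inl i₂) f₂).2.injective h)⟩, ⟨?_, ?_⟩, ?_⟩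
        · exact hg ⟨.inl i, f, v, hv⟩ ⟨.inl i₂, f₂, v₂, hv₂f⟩ hf hv₂.symm
        · exact hg ⟨.inl i, f, w, hw⟩ ⟨.inl i₂, f₂, w₂, hw₂f⟩ hf hw₂.symm
        · refine (h'.mk_eq hvw' hne (hcv.symm.trans hv₂.symm) (hcw.symm.trans hw₂.symm)).trans ?_
          exact Quot.sound (EdgeStep.glue (⟨Sum.inl i₂, v₂, w₂, hne⟩ : TetEdge (κ' ⊕ ρ)) f₂ hv₂f hw₂f)
    · exact hcv.elim
    · exact hcv.elim
    · obtain ⟨rfl, rfl⟩ := hcv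
      obtain ⟨-, rfl⟩ := hcw
      refine ⟨⟨(T'.glue (.inr j) f).1, (T'.glue (.inr j) f).2 v, (T'.glue (.inr j) f).2 w,
        fun h => hvw ((T'.glue (.inr j) f).2.injective h)⟩, ⟨?_, ?_⟩,
        Quot.sound (EdgeStep.glue (⟨Sum.inr j, v, w, hvw'⟩ : TetEdge (κ' ⊕ ρ)) f hv hw)⟩
      · exact hg ⟨.inr j, f, v, hv⟩ ⟨.inr j, f, v, hv⟩ ⟨rfl, rfl⟩ ⟨rfl, rfl⟩
      · exact hg ⟨.inr j, f, w, hw⟩ ⟨.inr j, f, w, hw⟩ ⟨rfl, rfl⟩ ⟨rfl, rfl⟩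

lemma exists_corr_of_mk_eq (h : Fills L T) (h' : Fills L' T') (hd : FaceDichotomy L L')
    (hg : SameGluing L L' T T') {e₁ e₂ : TetEdge (κ ⊕ ρ)}
    (he : Quot.mk T.EdgeStep e₁ = Quot.mk T.EdgeStep e₂) {e₁' : TetEdge (κ' ⊕ ρ)}
    (hc : EdgeCorr L L' e₁ e₁') :
    ∃ e₂', EdgeCorr L L' e₂ e₂' ∧ Quot.mk T'.EdgeStep e₁' = Quot.mk T'.EdgeStep e₂' := by
  -- The claim is made in both directions so that the induction passes through symmetry.
  have key : ∀ a b : TetEdge (κ ⊕ ρ), Relation.EqvGen T.EdgeStep a b →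
      (∀ a', EdgeCorr L L' a a' → ∃ b', EdgeCorr L L' b b' ∧
        Quot.mk T'.EdgeStep a' = Quot.mk T'.EdgeStep b') ∧
      (∀ b', EdgeCorr L L' b b' → ∃ a', EdgeCorr L L' a a' ∧
        Quot.mk T'.EdgeStep b' = Quot.mk T'.EdgeStep a') := by
    intro a b hab
    induction hab with
    | rel a b hab =>
      exact ⟨fun _ h0 => exists_corr_of_step h h' hd hg hab h0,
        fun _ h0 => exists_corr_of_step h h' hd hg hab.symm h0⟩
    | refl a => exact ⟨fun a' h0 => ⟨a', h0, rfl⟩, fun a' h0 => ⟨a', h0, rfl⟩⟩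
    | symm a b _ ih => exact ⟨ih.2, ih.1⟩
    | trans a b c _ _ ih₁ ih₂ =>
      constructor
      · intro a' h0
        obtain ⟨b', hb, e1⟩ := ih₁.1 a' h0
        obtain ⟨c', hc, e2⟩ := ih₂.1 b' hb
        exact ⟨c', hc, e1.trans e2⟩
      · intro c' h0
        obtain ⟨b', hb, e1⟩ := ih₂.2 c' h0
        obtain ⟨a', ha, e2⟩ := ih₁.2 b' hb
        exact ⟨a', ha, e1.trans e2⟩
  exact (key e₁ e₂ (Quot.eqvGen_exact he)).1 e₁' hc

lemma mk_eq_of_mk_eq (h : Fills L T) (h' : Fills L' T') (hd : FaceDichotomy L L')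
    (hg : SameGluing L L' T T') {e₁ e₂ : TetEdge (κ ⊕ ρ)} {e₁' e₂' : TetEdge (κ' ⊕ ρ)}
    (hc₁ : EdgeCorr L L' e₁ e₁') (hc₂ : EdgeCorr L L' e₂ e₂')
    (he : Quot.mk T.EdgeStep e₁ = Quot.mk T.EdgeStep e₂) :
    Quot.mk T'.EdgeStep e₁' = Quot.mk T'.EdgeStep e₂' := by
  obtain ⟨e₃, h₃, h₄⟩ := exists_corr_of_mk_eq h h' hd hg he hc₁
  exact h₄.trans (h'.mk_eq_of_corr h₃ hc₂)

lemma fills_bip2 {N : ℕ} {T : IdealTriangulation (Fin 2 ⊕ Fin N)}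
    {T' : IdealTriangulation (Fin 3 ⊕ Fin N)} (h : T.IsPachner T') : Fills bip2 T where
  inj := by decide
  inner := h.inner2
  adj := by decide +kernel

lemma fills_bip3 {N : ℕ} {T : IdealTriangulation (Fin 2 ⊕ Fin N)}
    {T' : IdealTriangulation (Fin 3 ⊕ Fin N)} (h : T.IsPachner T') : Fills bip3 T' where
  inj := by decide
  inner := h.inner3
  adj := by decide +kernel

lemma faceDichotomy_bip2 : FaceDichotomy bip2 bip3 := by
  unfold FaceDichotomy
  decide +kernel

lemma faceDichotomy_bip3 : FaceDichotomy bip3 bip2 := by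
  unfold FaceDichotomy
  decide +kernel

lemma sameGluing_bip {N : ℕ} {T : IdealTriangulation (Fin 2 ⊕ Fin N)}
    {T' : IdealTriangulation (Fin 3 ⊕ Fin N)} (h : T.IsPachner T') :
    SameGluing bip2 bip3 T T' := by
  intro s s' hf hv
  have hs : SideCorr s s' := by
    obtain ⟨t, f, v, hne⟩ := s
    obtain ⟨t', f', v', hne'⟩ := s'
    rcases t with i | j <;> rcases t' with i' | j'
    · exact SideCorr.bip ⟨i, f, v, hne⟩ ⟨i', f', v', hne'⟩ ⟨hf, hv⟩
    · exact hf.elim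
    · exact hf.elim
    · obtain ⟨rfl, rfl⟩ := hf
      obtain ⟨-, rfl⟩ := hv
      exact SideCorr.rest ⟨j, f, v, hne⟩
  have := h.outer s s' hs
  generalize T.cross s = a at this
  generalize T'.cross s' = b at this
  cases this with
  | bip a b hab => exact hab.2
  | rest a => exact ⟨rfl, rfl⟩

end IdealTriangulation

/-! ### The edge equations before and after a 2–3 Pachner move -/

/-- The row of `(A | B | ν)` with the coefficients `g 0`, `g 1`, `g 2` in `G`, `G'`, `G''`. -/
def eqRow {ι : Type*} [Fintype ι] (g : Fin 3 → ι → ℤ) (w : ℤ) : (ι → ℤ) × (ι → ℤ) × ℤ :=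
  (g 0 - g 1, g 2 - g 1, w - ∑ t, g 1 t)

/-- The action of the 2–3 move on the old rows of `(A | B | ν)`. -/
def pachnerRow {N : ℕ} : (Fin 2 ⊕ Fin N → ℤ) × (Fin 2 ⊕ Fin N → ℤ) × ℤ →ₗ[ℤ]
    (Fin 3 ⊕ Fin N → ℤ) × (Fin 3 ⊕ Fin N → ℤ) × ℤ where
  toFun p := (Sum.elim ![p.1 (.inl 0) + p.1 (.inl 1) - p.2.1 (.inl 0) - p.2.1 (.inl 1),
      p.1 (.inl 0) - p.2.1 (.inl 1), p.1 (.inl 1) - p.2.1 (.inl 0)] fun j => p.1 (.inr j),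
    Sum.elim ![0, p.2.1 (.inl 0), p.2.1 (.inl 1)] fun j => p.2.1 (.inr j), p.2.2)
  map_add' p q := by
    ext t
    · rcases t with t | t
      · fin_cases t <;> simp <;> ring
      · simp
    · rcases t with t | t
      · fin_cases t <;> simp
      · simp
    · simp
  map_smul' c p := by
    ext t
    · rcases t with t | t
      · fin_cases t <;> simp <;> ring
      · simp
    · rcases t with t | t
      · fin_cases t <;> simp
      · simp
    · simp

/-- The new row of `(A | B | ν)` after a 2–3 move. -/
def newRow (N : ℕ) : (Fin 3 ⊕ Fin N → ℤ) × (Fin 3 ⊕ Fin N → ℤ) × ℤ :=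
  (Sum.elim ![-1, 0, 0] fun _ => 0, Sum.elim ![-1, 1, 1] fun _ => 0, 1)

/-- Only the columns of the bipyramid need checking. The integer `m` is the multiple of the new row
by which an equation may change. -/
lemma eqRow_eq_pachnerRow {N : ℕ} {g : Fin 3 → Fin 2 ⊕ Fin N → ℤ}
    {g' : Fin 3 → Fin 3 ⊕ Fin N → ℤ} {w w' m : ℤ} (hr : ∀ k j, g' k (.inr j) = g k (.inr j))
    (ha₀ : g' 0 (.inl 0) - g' 1 (.inl 0) = g 0 (.inl 0) + g 0 (.inl 1) - g 2 (.inl 0) -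
      g 2 (.inl 1) - m)
    (ha₁ : g' 0 (.inl 1) - g' 1 (.inl 1) = g 0 (.inl 0) - g 1 (.inl 0) - g 2 (.inl 1) + g 1 (.inl 1))
    (ha₂ : g' 0 (.inl 2) - g' 1 (.inl 2) = g 0 (.inl 1) - g 1 (.inl 1) - g 2 (.inl 0) + g 1 (.inl 0))
    (hb₀ : g' 2 (.inl 0) - g' 1 (.inl 0) = -m)
    (hb₁ : g' 2 (.inl 1) - g' 1 (.inl 1) = g 2 (.inl 0) - g 1 (.inl 0) + m)
    (hb₂ : g' 2 (.inl 2) - g' 1 (.inl 2) = g 2 (.inl 1) - g 1 (.inl 1) + m)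
    (hν : w' - (g' 1 (.inl 0) + g' 1 (.inl 1) + g' 1 (.inl 2)) =
      w - (g 1 (.inl 0) + g 1 (.inl 1)) + m) :
    eqRow g' w' = pachnerRow (eqRow g w) + m • newRow N := by
  ext t
  · rcases t with t | t
    · fin_cases t <;> simp [eqRow, pachnerRow, newRow] <;> linarith
    · simp [eqRow, pachnerRow, newRow, hr]
  · rcases t with t | t
    · fin_cases t <;> simp [eqRow, pachnerRow, newRow] <;> linarith
    · simp [eqRow, pachnerRow, newRow, hr]
  · simp [eqRow, pachnerRow, newRow, hr, Fin.sum_univ_three]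
    linarith

lemma exists_bip3 : ∀ a b : Fin 5, a ≠ b → ∃ i v w, v ≠ w ∧ bip3 i v = a ∧ bip3 i w = b := by
  decide +kernel

/-- The rows of edges whose values at corresponding edges of tetrahedra agree. -/
lemma eqRow_edgeSum {N : ℕ} {X : Fin 2 ⊕ Fin N → Fin 4 → Fin 4 → ℤ}
    {X' : Fin 3 ⊕ Fin N → Fin 4 → Fin 4 → ℤ} (hr : ∀ j, X' (.inr j) = X (.inr j))
    (hX : ∀ i v w i' v' w', v ≠ w → v' ≠ w' → bip2 i v = bip3 i' v' → bip2 i w = bip3 i' w' →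
      X (.inl i) v w = X' (.inl i') v' w')
    (hX' : ∀ i v w i' v' w', v ≠ w → v' ≠ w' → bip3 i v = bip3 i' v' → bip3 i w = bip3 i' w' →
      X' (.inl i) v w = X' (.inl i') v' w') (hc : ∀ t v w, X' t v w = X' t w v) (w : ℤ) :
    eqRow (fun k t => edgeSum (X' t) k) (w + 2 * X' (.inl 0) 0 2) =
      pachnerRow (eqRow (fun k t => edgeSum (X t) k) w) + (X' (.inl 0) 1 3 - X' (.inl 0) 0 3 -
        X' (.inl 0) 1 2 + X' (.inl 0) 0 2) • newRow N := by
  -- All values in either filling come from one function `Y` on pairs of vertices of the bipyramid,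
  -- whose complete graph the three tetrahedra cover. The rest is linear arithmetic in its ten
  -- values.
  have h : ∀ a b : Fin 5, ∃ y : ℤ, a ≠ b → ∃ i v w, v ≠ w ∧ bip3 i v = a ∧ bip3 i w = b ∧
      y = X' (.inl i) v w := by
    intro a b
    by_cases hab : a = b
    · exact ⟨0, fun h => absurd hab h⟩
    · obtain ⟨i, v, w, h1, h2, h3⟩ := exists_bip3 a b hab
      exact ⟨_, fun _ => ⟨i, v, w, h1, h2, h3, rfl⟩⟩
  choose Y hY using h
  have h2 : ∀ i v w, bip2 i v ≠ bip2 i w → v ≠ w → X (.inl i) v w = Y (bip2 i v) (bip2 i w) := by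
    intro i v w hne hvw
    obtain ⟨i', v', w', h1, h2, h3, h4⟩ := hY _ _ hne
    rw [h4]
    exact hX i v w i' v' w' hvw h1 h2.symm h3.symm
  have h3 : ∀ i v w, bip3 i v ≠ bip3 i w → v ≠ w → X' (.inl i) v w = Y (bip3 i v) (bip3 i w) := by
    intro i v w hne hvw
    obtain ⟨i', v', w', h1, h2, h3, h4⟩ := hY _ _ hne
    rw [h4]
    exact hX' i v w i' v' w' hvw h1 h2.symm h3.symm
  have hs : ∀ a b, a ≠ b → Y a b = Y b a := by
    intro a b hab
    obtain ⟨i, v, w, h1, rfl, rfl, h4⟩ := hY _ _ hab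
    rw [h4, hc]
    exact h3 i w v hab.symm h1.symm
  have e2 := fun i v w (h : bip2 i v ≠ bip2 i w ∧ v ≠ w) => h2 i v w h.1 h.2
  have e3 := fun i v w (h : bip3 i v ≠ bip3 i w ∧ v ≠ w) => h3 i v w h.1 h.2
  refine eqRow_eq_pachnerRow (by simp [hr]) ?_ ?_ ?_ ?_ ?_ ?_ ?_
  all_goals
    simp only [edgeSum, Matrix.cons_val_zero, Matrix.cons_val_one, Matrix.cons_val]
    simp only [e2 0 0 1 (by decide), e2 0 0 2 (by decide), e2 0 0 3 (by decide),
      e2 0 1 2 (by decide), e2 0 1 3 (by decide), e2 0 2 3 (by decide),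
      e2 1 0 1 (by decide), e2 1 0 2 (by decide), e2 1 0 3 (by decide),
      e2 1 1 2 (by decide), e2 1 1 3 (by decide), e2 1 2 3 (by decide),
      e3 0 0 1 (by decide), e3 0 0 2 (by decide), e3 0 0 3 (by decide),
      e3 0 1 2 (by decide), e3 0 1 3 (by decide), e3 0 2 3 (by decide),
      e3 1 0 1 (by decide), e3 1 0 2 (by decide), e3 1 0 3 (by decide),
      e3 1 1 2 (by decide), e3 1 1 3 (by decide), e3 1 2 3 (by decide),
      e3 2 0 1 (by decide), e3 2 0 2 (by decide), e3 2 0 3 (by decide),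
      e3 2 1 2 (by decide), e3 2 1 3 (by decide), e3 2 2 3 (by decide)]
    simp only [bip2, bip3, Matrix.cons_val_zero, Matrix.cons_val_one, Matrix.cons_val]
    linarith [hs 0 1 (by decide), hs 0 2 (by decide), hs 0 3 (by decide), hs 0 4 (by decide),
      hs 1 2 (by decide), hs 1 3 (by decide), hs 1 4 (by decide), hs 2 3 (by decide),
      hs 2 4 (by decide), hs 3 4 (by decide)]

namespace IdealTriangulation

section Sum

variable {ι : Type*} [Fintype ι] {T : IdealTriangulation ι}

/-- The sum of the edge equations is trivial if there are as many edges as tetrahedra. -/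
lemma sum_eqRow (e : ι ≃ T.EdgeClass) : ∑ i, eqRow (edgeCoeff (e i)) 2 = 0 := by
  classical
  have h0 : ∀ c : T.EdgeClass, ∑ i, (if c = e i then (1 : ℤ) else 0) = 1 := by
    intro c
    simp only [← Equiv.symm_apply_eq]
    simp
  have h1 : ∀ t v w, v ≠ w →
      ∑ i, T.edgeVal (fun c' => if c' = e i then 1 else 0) t v w = 1 := by
    intro t v w h
    exact (Finset.sum_congr rfl fun i _ => edgeVal_of_ne _ t h).trans (h0 _)
  -- Each label occurs at two edges of every tetrahedron. This makes the sums of `A` and `B` vanish;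
  -- for `ν` the equality of the numbers of edges and tetrahedra is used.
  have h2 : ∀ k t, ∑ i, edgeCoeff (e i) k t = 2 := by
    intro k t
    simp only [edgeCoeff_eq]
    fin_cases k <;> simp [edgeSum, Finset.sum_add_distrib, h1]
  ext t
  · simp [eqRow, Prod.fst_sum, h2]
  · simp [eqRow, Prod.fst_sum, Prod.snd_sum, h2]
  · simp only [eqRow, Prod.snd_sum, Prod.snd_zero, Finset.sum_sub_distrib]
    rw [Finset.sum_comm]
    simp [h2]

end Sum

variable {N : ℕ} {T : IdealTriangulation (Fin 2 ⊕ Fin N)} {T' : IdealTriangulation (Fin 3 ⊕ Fin N)}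

lemma eqRow_edgeVal (h : T.IsPachner T') {χ : T.EdgeClass → ℤ} {χ' : T'.EdgeClass → ℤ}
    (hχ : ∀ e e', EdgeCorr bip2 bip3 e e' →
      χ (Quot.mk T.EdgeStep e) = χ' (Quot.mk T'.EdgeStep e')) (w : ℤ) :
    eqRow (fun k t => edgeSum (T'.edgeVal χ' t) k) (w + 2 * T'.edgeVal χ' (.inl 0) 0 2) =
      pachnerRow (eqRow (fun k t => edgeSum (T.edgeVal χ t) k) w) +
        (T'.edgeVal χ' (.inl 0) 1 3 - T'.edgeVal χ' (.inl 0) 0 3 - T'.edgeVal χ' (.inl 0) 1 2 +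
          T'.edgeVal χ' (.inl 0) 0 2) • newRow N := by
  refine eqRow_edgeSum (fun j => ?_) ?_ ?_ (fun t => edgeVal_comm χ' t) w
  · ext v w
    by_cases hvw : v = w
    · simp [edgeVal, hvw]
    · rw [edgeVal_of_ne _ _ hvw, edgeVal_of_ne _ _ hvw]
      exact (hχ ⟨Sum.inr j, v, w, hvw⟩ ⟨Sum.inr j, v, w, hvw⟩ ⟨⟨rfl, rfl⟩, rfl, rfl⟩).symm
  · intro i v w i' v' w' hvw hvw' hv hw
    rw [edgeVal_of_ne _ _ hvw, edgeVal_of_ne _ _ hvw']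
    exact hχ ⟨Sum.inl i, v, w, hvw⟩ ⟨Sum.inl i', v', w', hvw'⟩ ⟨hv, hw⟩
  · intro i v w i' v' w' hvw hvw' hv hw
    rw [edgeVal_of_ne _ _ hvw, edgeVal_of_ne _ _ hvw']
    exact congrArg χ' ((fills_bip3 h).mk_eq hvw hvw' hv hw)

/-- The edge between the apexes of the bipyramid. -/
def newTetEdge (N : ℕ) : TetEdge (Fin 3 ⊕ Fin N) := ⟨.inl 0, 0, 2, by decide⟩

lemma not_edgeCorr_newTetEdge (e : TetEdge (Fin 2 ⊕ Fin N)) :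
    ¬ EdgeCorr bip2 bip3 e (newTetEdge N) := by
  obtain ⟨i | j, v, w, hvw⟩ := e
  · rintro ⟨hv, hw⟩
    have : ∀ i v w, ¬ (bip2 i v = bip3 0 0 ∧ bip2 i w = bip3 0 2) := by decide +kernel
    exact this i v w ⟨hv, hw⟩
  · exact fun h => h.1

/-- Otherwise the correspondence of edge classes would give the edge between the apexes a partner in
the old triangulation, where no tetrahedron joins the apexes. -/
lemma mk_ne_newTetEdge (h : T.IsPachner T') {e : TetEdge (Fin 2 ⊕ Fin N)}
    {e' : TetEdge (Fin 3 ⊕ Fin N)} (hc : EdgeCorr bip2 bip3 e e') :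
    Quot.mk T'.EdgeStep e' ≠ Quot.mk T'.EdgeStep (newTetEdge N) := by
  intro he
  obtain ⟨e₂, h₂, -⟩ := exists_corr_of_mk_eq (fills_bip3 h) (fills_bip2 h) faceDichotomy_bip3
    (sameGluing_bip h).symm he hc.symm
  exact not_edgeCorr_newTetEdge e₂ h₂.symm

lemma exists_edgeCorr (e : TetEdge (Fin 2 ⊕ Fin N)) :
    ∃ e' : TetEdge (Fin 3 ⊕ Fin N), EdgeCorr bip2 bip3 e e' := by
  obtain ⟨i | j, v, w, hvw⟩ := e
  · have : ∀ i v w, v ≠ w → ∃ i' v' w', v' ≠ w' ∧ bip2 i v = bip3 i' v' ∧ bip2 i w = bip3 i' w' := by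
      decide +kernel
    obtain ⟨i', v', w', hvw', hv, hw⟩ := this i v w hvw
    exact ⟨⟨.inl i', v', w', hvw'⟩, hv, hw⟩
  · exact ⟨⟨.inr j, v, w, hvw⟩, ⟨rfl, rfl⟩, rfl, rfl⟩

lemma mk_eq_newTetEdge_or (h : T.IsPachner T') (e' : TetEdge (Fin 3 ⊕ Fin N)) :
    Quot.mk T'.EdgeStep e' = Quot.mk T'.EdgeStep (newTetEdge N) ∨
      ∃ e : TetEdge (Fin 2 ⊕ Fin N), EdgeCorr bip2 bip3 e e' := by
  obtain ⟨i' | j, v', w', hvw'⟩ := e'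
  · have : ∀ i' v' w', v' ≠ w' → (∃ i v w, v ≠ w ∧ bip2 i v = bip3 i' v' ∧ bip2 i w = bip3 i' w') ∨
        (bip3 i' v' = bip3 0 0 ∧ bip3 i' w' = bip3 0 2) ∨
        (bip3 i' v' = bip3 0 2 ∧ bip3 i' w' = bip3 0 0) := by
      decide +kernel
    rcases this i' v' w' hvw' with ⟨i, v, w, hvw, hv, hw⟩ | ⟨hv, hw⟩ | ⟨hv, hw⟩
    · exact Or.inr ⟨⟨.inl i, v, w, hvw⟩, hv, hw⟩
    · exact Or.inl ((fills_bip3 h).mk_eq hvw' (by decide) hv hw)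
    · refine Or.inl ((Quot.sound (EdgeStep.flip _)).trans
        ((fills_bip3 h).mk_eq hvw'.symm (by decide) hw hv))
  · exact Or.inr ⟨⟨.inr j, v', w', hvw'⟩, ⟨rfl, rfl⟩, rfl, rfl⟩

/-- The equation of an old edge. -/
lemma eqRow_of_edgeCorr (h : T.IsPachner T') {e : TetEdge (Fin 2 ⊕ Fin N)}
    {e' : TetEdge (Fin 3 ⊕ Fin N)} (hc : EdgeCorr bip2 bip3 e e') :
    ∃ m : ℤ, eqRow (edgeCoeff (T := T') (Quot.mk T'.EdgeStep e')) 2 =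
      pachnerRow (eqRow (edgeCoeff (T := T) (Quot.mk T.EdgeStep e)) 2) + m • newRow N := by
  classical
  have hm := eqRow_edgeVal h
    (χ := fun c => if c = Quot.mk T.EdgeStep e then 1 else 0)
    (χ' := fun c => if c = Quot.mk T'.EdgeStep e' then 1 else 0) (w := 2) (by
      intro e₁ e₁' h₁
      refine if_congr ⟨fun he => ?_, fun he => ?_⟩ rfl rfl
      · exact mk_eq_of_mk_eq (fills_bip2 h) (fills_bip3 h) faceDichotomy_bip2 (sameGluing_bip h)
          h₁ hc he
      · exact mk_eq_of_mk_eq (fills_bip3 h) (fills_bip2 h) faceDichotomy_bip3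
          (sameGluing_bip h).symm h₁.symm hc.symm he)
  have h0 : T'.edgeVal (fun c => if c = Quot.mk T'.EdgeStep e' then 1 else 0) (.inl 0) 0 2 = 0 :=
    (edgeVal_of_ne _ _ (by decide)).trans (if_neg (mk_ne_newTetEdge h hc).symm)
  rw [h0, mul_zero, add_zero] at hm
  have h1 : edgeCoeff (T := T') (Quot.mk T'.EdgeStep e') = fun k t => edgeSum (T'.edgeVal
      (fun c => if c = Quot.mk T'.EdgeStep e' then 1 else 0) t) k := by
    ext k t
    exact edgeCoeff_eq _ k t
  have h2 : edgeCoeff (T := T) (Quot.mk T.EdgeStep e) = fun k t => edgeSum (T.edgeVal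
      (fun c => if c = Quot.mk T.EdgeStep e then 1 else 0) t) k := by
    ext k t
    exact edgeCoeff_eq _ k t
  rw [h1, h2]
  exact ⟨_, hm⟩

/-- The equation of the new edge. -/
lemma eqRow_newTetEdge (h : T.IsPachner T') :
    eqRow (edgeCoeff (T := T') (Quot.mk T'.EdgeStep (newTetEdge N))) 2 = newRow N := by
  classical
  set χ' : T'.EdgeClass → ℤ := fun c => if c = Quot.mk T'.EdgeStep (newTetEdge N) then 1 else 0
    with hχ'
  -- The indicator of the new edge corresponds to the zero function on the old edges; the right-hand
  -- side `2` arises from `w + 2 * 1`.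
  have hm := eqRow_edgeVal h (χ := 0) (χ' := χ') (w := 0) fun e₁ e₁' h₁ =>
    (if_neg (mk_ne_newTetEdge h h₁)).symm
  have h0 : ∀ t v w, T.edgeVal (0 : T.EdgeClass → ℤ) t v w = 0 := by
    intro t v w
    by_cases hvw : v = w
    · exact dif_neg (not_not.2 hvw)
    · exact edgeVal_of_ne _ t hvw
  have h1 : eqRow (fun k t => edgeSum (T.edgeVal 0 t) k) 0 = 0 := by
    have : (fun (k : Fin 3) t => edgeSum (T.edgeVal 0 t) k) = 0 := by
      ext k t
      fin_cases k <;> simp [edgeSum, h0]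
    rw [this]
    ext <;> simp [eqRow]
  have h2 : T'.edgeVal χ' (.inl 0) 0 2 = 1 := (edgeVal_of_ne _ _ (by decide)).trans (if_pos rfl)
  have h3 : T'.edgeVal χ' (.inl 0) 1 3 = 0 := (edgeVal_of_ne _ _ (by decide)).trans
    (if_neg (mk_ne_newTetEdge h (e := ⟨.inl 0, 1, 3, by decide⟩)
      (e' := ⟨.inl 0, 1, 3, by decide⟩) ⟨rfl, rfl⟩))
  have h4 : T'.edgeVal χ' (.inl 0) 0 3 = 0 := (edgeVal_of_ne _ _ (by decide)).trans
    (if_neg (mk_ne_newTetEdge h (e := ⟨.inl 0, 0, 3, by decide⟩)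
      (e' := ⟨.inl 0, 0, 3, by decide⟩) ⟨rfl, rfl⟩))
  have h5 : T'.edgeVal χ' (.inl 0) 1 2 = 0 := (edgeVal_of_ne _ _ (by decide)).trans
    (if_neg (mk_ne_newTetEdge h (e := ⟨.inl 1, 3, 0, by decide⟩)
      (e' := ⟨.inl 0, 1, 2, by decide⟩) ⟨rfl, rfl⟩))
  rw [h1, h2, h3, h4, h5, map_zero] at hm
  simp only [mul_one, zero_add, sub_zero, one_smul] at hm
  refine Eq.trans ?_ hm
  congr 1
  ext k t
  exact edgeCoeff_eq _ k t

end IdealTriangulation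

/-! ### The equation of a peripheral curve before and after a 2–3 Pachner move -/

/-- The steps of normal curves in the tetrahedra of `κ`, listed with the signs of `π` and the
values `π 0`, `π 1`, `π 2`, `π 3`. -/
abbrev StepCode (κ : Type*) := κ × ℤ × Fin 4 × Fin 4 × Fin 4 × Fin 4

namespace StepCode

variable {κ κ' : Type*}

def all (l : List κ) : List (StepCode κ) :=
  l.product permCodes

/-- The vertices of a face, as a sum of powers of two. -/
def faceMask (L : κ → Fin 4 → Fin 5) (i : κ) (f : Fin 4) : ℕ :=
  2 ^ (L i 0).val + 2 ^ (L i 1).val + 2 ^ (L i 2).val + 2 ^ (L i 3).val - 2 ^ (L i f).val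

def entry (L : κ → Fin 4 → Fin 5) (c : StepCode κ) : ℕ × ℕ :=
  (faceMask L c.1 c.2.2.2.2.1, L c.1 c.2.2.1)

def exit (L : κ → Fin 4 → Fin 5) (c : StepCode κ) : ℕ × ℕ :=
  (faceMask L c.1 c.2.2.2.2.2, L c.1 c.2.2.1)

/-- The contribution of a step to the coefficients of a curve. -/
def coeff [DecidableEq κ] (c : StepCode κ) (k : Fin 3) (i : κ) : ℤ :=
  if c.1 = i ∧ edgeLabel c.2.2.1 c.2.2.2.1 = k then c.2.1 else 0

/-- The relation of the coefficients of arcs with the same ends on both sides of the move. -/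
def ArcRel (l : List (StepCode (Fin 2))) (l' : List (StepCode (Fin 3))) : Prop :=
  let g := fun k i => (l.map fun c => c.coeff k i).sum
  let g' := fun k i => (l'.map fun c => c.coeff k i).sum
  -- The repeated difference `g' 1 0 - g' 2 0` is the multiple `m` of the new row, read off from the
  -- first column of `B`.
  g' 0 0 - g' 1 0 = g 0 0 + g 0 1 - g 2 0 - g 2 1 - (g' 1 0 - g' 2 0) ∧
  g' 0 1 - g' 1 1 = g 0 0 - g 1 0 - g 2 1 + g 1 1 ∧
  g' 0 2 - g' 1 2 = g 0 1 - g 1 1 - g 2 0 + g 1 0 ∧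
  g' 2 1 - g' 1 1 = g 2 0 - g 1 0 + (g' 1 0 - g' 2 0) ∧
  g' 2 2 - g' 1 2 = g 2 1 - g 1 1 + (g' 1 0 - g' 2 0) ∧
  0 - (g' 1 0 + g' 1 1 + g' 1 2) = 0 - (g 1 0 + g 1 1) + (g' 1 0 - g' 2 0)

instance (l : List (StepCode (Fin 2))) (l' : List (StepCode (Fin 3))) :
    Decidable (ArcRel l l') := by
  unfold ArcRel
  infer_instance

/-- An arc visits each tetrahedron at most once, so it has at most two steps in one filling and at
most three in the other. The comparison is a finite check, one lemma per pair of lengths, with the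
matching conditions interleaved to prune the search. -/
lemma arcRel_one_one : ∀ s ∈ all [0, 1], ∀ t ∈ all [0, 1, 2], entry bip2 s = entry bip3 t →
    exit bip2 s = exit bip3 t → ArcRel [s] [t] := by
  decide +kernel

lemma arcRel_one_two : ∀ s ∈ all [0, 1], ∀ t ∈ all [0, 1, 2], entry bip2 s = entry bip3 t →
    ∀ t₂ ∈ all [0, 1, 2], exit bip3 t = entry bip3 t₂ → t.1 ≠ t₂.1 →
    exit bip2 s = exit bip3 t₂ → ArcRel [s] [t, t₂] := by
  decide +kernel

lemma arcRel_one_three : ∀ s ∈ all [0, 1], ∀ t ∈ all [0, 1, 2], entry bip2 s = entry bip3 t →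
    ∀ t₂ ∈ all [0, 1, 2], exit bip3 t = entry bip3 t₂ → t.1 ≠ t₂.1 →
    ∀ t₃ ∈ all [0, 1, 2], exit bip3 t₂ = entry bip3 t₃ → t.1 ≠ t₃.1 → t₂.1 ≠ t₃.1 →
    exit bip2 s = exit bip3 t₃ → ArcRel [s] [t, t₂, t₃] := by
  decide +kernel

lemma arcRel_two_one : ∀ s ∈ all [0, 1], ∀ s₂ ∈ all [0, 1], exit bip2 s = entry bip2 s₂ →
    s.1 ≠ s₂.1 → ∀ t ∈ all [0, 1, 2], entry bip2 s = entry bip3 t →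
    exit bip2 s₂ = exit bip3 t → ArcRel [s, s₂] [t] := by
  decide +kernel

lemma arcRel_two_two : ∀ s ∈ all [0, 1], ∀ s₂ ∈ all [0, 1], exit bip2 s = entry bip2 s₂ →
    s.1 ≠ s₂.1 → ∀ t ∈ all [0, 1, 2], entry bip2 s = entry bip3 t →
    ∀ t₂ ∈ all [0, 1, 2], exit bip3 t = entry bip3 t₂ → t.1 ≠ t₂.1 →
    exit bip2 s₂ = exit bip3 t₂ → ArcRel [s, s₂] [t, t₂] := by
  decide +kernel

lemma arcRel_two_three : ∀ s ∈ all [0, 1], ∀ s₂ ∈ all [0, 1], exit bip2 s = entry bip2 s₂ →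
    s.1 ≠ s₂.1 → ∀ t ∈ all [0, 1, 2], entry bip2 s = entry bip3 t →
    ∀ t₂ ∈ all [0, 1, 2], exit bip3 t = entry bip3 t₂ → t.1 ≠ t₂.1 →
    ∀ t₃ ∈ all [0, 1, 2], exit bip3 t₂ = entry bip3 t₃ → t.1 ≠ t₃.1 → t₂.1 ≠ t₃.1 →
    exit bip2 s₂ = exit bip3 t₃ → ArcRel [s, s₂] [t, t₂, t₃] := by
  decide +kernel

end StepCode

namespace LinkStep

variable {κ κ' : Type*}

def code (s : LinkStep κ) : StepCode κ := (s.tet, Equiv.Perm.sign s.π, s.π 0, s.π 1, s.π 2, s.π 3)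

lemma code_mem (s : LinkStep κ) {l : List κ} (h : s.tet ∈ l) : s.code ∈ StepCode.all l :=
  List.mem_product.2 ⟨h, perm_fin_four_mem s.π⟩

open StepCode in
lemma faceMask_bip2 : ∀ i f i' f', faceVertices bip2 i f = faceVertices bip2 i' f' →
    faceMask bip2 i f = faceMask bip2 i' f' := by
  decide +kernel

open StepCode in
lemma faceMask_bip3 : ∀ i f i' f', faceVertices bip3 i f = faceVertices bip3 i' f' →
    faceMask bip3 i f = faceMask bip3 i' f' := by
  decide +kernel

open StepCode in
lemma faceMask_bip23 : ∀ i f i' f', faceVertices bip2 i f = faceVertices bip3 i' f' →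
    faceMask bip2 i f = faceMask bip3 i' f' := by
  decide +kernel

end LinkStep

open LinkStep in
/-- Arcs that cross the bipyramid between the same sides. -/
lemma arcRel_of_isBipArc {l : List (LinkStep (Fin 2))} {l' : List (LinkStep (Fin 3))} (hl : l ≠ [])
    (hl' : l' ≠ []) (h : IsBipArc bip2 l) (h' : IsBipArc bip3 l')
    (first_side : SameSide bip2 bip3 (l.head hl).entry (l'.head hl').entry)
    (last_side : SameSide bip2 bip3 (l.getLast hl).exit (l'.getLast hl').exit) :
    StepCode.ArcRel (l.map code) (l'.map code) := by
  have hm : ∀ s : LinkStep (Fin 2), s.code ∈ StepCode.all [0, 1] := fun s =>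
    s.code_mem (by generalize s.tet = i; revert i; decide)
  have hm' : ∀ s : LinkStep (Fin 3), s.code ∈ StepCode.all [0, 1, 2] := fun s =>
    s.code_mem (by generalize s.tet = i; revert i; decide)
  have e2 : ∀ s s₂ : LinkStep (Fin 2), SameSide bip2 bip2 s.exit s₂.entry →
      s.code.exit bip2 = s₂.code.entry bip2 := fun s s₂ h =>
    Prod.ext (faceMask_bip2 _ _ _ _ h.1) (congrArg Fin.val h.2)
  have e3 : ∀ s s₂ : LinkStep (Fin 3), SameSide bip3 bip3 s.exit s₂.entry →
      s.code.exit bip3 = s₂.code.entry bip3 := fun s s₂ h =>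
    Prod.ext (faceMask_bip3 _ _ _ _ h.1) (congrArg Fin.val h.2)
  have f23 : ∀ (s : LinkStep (Fin 2)) (t : LinkStep (Fin 3)), SameSide bip2 bip3 s.entry t.entry →
      s.code.entry bip2 = t.code.entry bip3 := fun s t h =>
    Prod.ext (faceMask_bip23 _ _ _ _ h.1) (congrArg Fin.val h.2)
  have l23 : ∀ (s : LinkStep (Fin 2)) (t : LinkStep (Fin 3)), SameSide bip2 bip3 s.exit t.exit →
      s.code.exit bip2 = t.code.exit bip3 := fun s t h =>
    Prod.ext (faceMask_bip23 _ _ _ _ h.1) (congrArg Fin.val h.2)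
  have hlen : l.length ≤ 2 := by simpa using h.2.length_le_card
  have hlen' : l'.length ≤ 3 := by simpa using h'.2.length_le_card
  obtain ⟨hc, hn⟩ := h
  obtain ⟨hc', hn'⟩ := h'
  replace first_side := f23 _ _ first_side
  replace last_side := l23 _ _ last_side
  match l, l' with
  | [s], [t] => exact StepCode.arcRel_one_one _ (hm s) _ (hm' t) first_side last_side
  | [s], [t, t₂] =>
    simp only [List.isChain_cons_cons, List.isChain_singleton, and_true] at hc'
    exact StepCode.arcRel_one_two _ (hm s) _ (hm' t) first_side _ (hm' t₂) (e3 _ _ hc'.2) hc'.1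
      last_side
  | [s], [t, t₂, t₃] =>
    simp only [List.isChain_cons_cons, List.isChain_singleton, and_true] at hc'
    simp only [List.map_cons, List.map_nil, List.nodup_cons, List.mem_cons, List.not_mem_nil,
      or_false, not_or] at hn'
    exact StepCode.arcRel_one_three _ (hm s) _ (hm' t) first_side _ (hm' t₂) (e3 _ _ hc'.1.2)
      hc'.1.1 _ (hm' t₃) (e3 _ _ hc'.2.2) hn'.1.2 hc'.2.1 last_side
  | [s, s₂], [t] =>
    simp only [List.isChain_cons_cons, List.isChain_singleton, and_true] at hc
    exact StepCode.arcRel_two_one _ (hm s) _ (hm s₂) (e2 _ _ hc.2) hc.1 _ (hm' t) first_side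
      last_side
  | [s, s₂], [t, t₂] =>
    simp only [List.isChain_cons_cons, List.isChain_singleton, and_true] at hc hc'
    exact StepCode.arcRel_two_two _ (hm s) _ (hm s₂) (e2 _ _ hc.2) hc.1 _ (hm' t) first_side
      _ (hm' t₂) (e3 _ _ hc'.2) hc'.1 last_side
  | [s, s₂], [t, t₂, t₃] =>
    simp only [List.isChain_cons_cons, List.isChain_singleton, and_true] at hc hc'
    simp only [List.map_cons, List.map_nil, List.nodup_cons, List.mem_cons, List.not_mem_nil,
      or_false, not_or] at hn'
    exact StepCode.arcRel_two_three _ (hm s) _ (hm s₂) (e2 _ _ hc.2) hc.1 _ (hm' t) first_side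
      _ (hm' t₂) (e3 _ _ hc'.1.2) hc'.1.1 _ (hm' t₃) (e3 _ _ hc'.2.2) hn'.1.2 hc'.2.1 last_side
  | _ :: _ :: _ :: _, _ => simp only [List.length_cons] at hlen; omega
  | _, _ :: _ :: _ :: _ :: _ => simp only [List.length_cons] at hlen'; omega

/-- The row of `(A | B | ν)` of a list of steps. -/
def stepsRow {ι : Type*} [Fintype ι] (l : List (LinkStep ι)) : (ι → ℤ) × (ι → ℤ) × ℤ :=
  eqRow (fun k t => (l.map fun s => IdealTriangulation.stepCoeff s k t).sum) 0

lemma stepsRow_append {ι : Type*} [Fintype ι] (l₁ l₂ : List (LinkStep ι)) :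
    stepsRow (l₁ ++ l₂) = stepsRow l₁ + stepsRow l₂ := by
  ext t
  · simp [stepsRow, eqRow]
    ring
  · simp [stepsRow, eqRow]
    ring
  · simp [stepsRow, eqRow, Finset.sum_add_distrib]
    ring

lemma stepsRow_perm {ι : Type*} [Fintype ι] {l₁ l₂ : List (LinkStep ι)} (h : l₁.Perm l₂) :
    stepsRow l₁ = stepsRow l₂ := by
  unfold stepsRow
  congr 1
  ext k t
  exact (h.map _).sum_eq

lemma stepsRow_of_arcCorr {N : ℕ} {l : List (LinkStep (Fin 2 ⊕ Fin N))}
    {l' : List (LinkStep (Fin 3 ⊕ Fin N))} (h : ArcCorr l l') :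
    ∃ m : ℤ, stepsRow l' = pachnerRow (stepsRow l) + m • newRow N := by
  cases h with
  | bip l l' hl hl' h h' first_side last_side =>
    obtain ⟨h1, h2, h3, h4, h5, h6⟩ := arcRel_of_isBipArc hl hl' h h' first_side last_side
    have e : ∀ (n : ℕ) (l : List (LinkStep (Fin n))) k (i : Fin n),
        ((l.map (LinkStep.map (Sum.inl : Fin n → Fin n ⊕ Fin N))).map fun s =>
          IdealTriangulation.stepCoeff s k (.inl i)).sum =
        ((l.map LinkStep.code).map fun c => c.coeff k i).sum := by
      intro n l k i
      rw [List.map_map, List.map_map]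
      congr 1
      refine List.map_congr_left fun s _ => ?_
      simp only [Function.comp_apply, LinkStep.map, LinkStep.code, StepCode.coeff,
        IdealTriangulation.stepCoeff, Sum.inl.injEq]
      congr
    have e0 : ∀ (n : ℕ) (l : List (LinkStep (Fin n))) k (j : Fin N),
        ((l.map (LinkStep.map (Sum.inl : Fin n → Fin n ⊕ Fin N))).map fun s =>
          IdealTriangulation.stepCoeff s k (.inr j)).sum = 0 := by
      intro n l k j
      refine List.sum_eq_zero fun x hx => ?_
      simp only [List.mem_map] at hx
      obtain ⟨s, ⟨s, -, rfl⟩, rfl⟩ := hx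
      simp [LinkStep.map, IdealTriangulation.stepCoeff]
    refine ⟨((l'.map LinkStep.code).map fun c => c.coeff 1 0).sum -
      ((l'.map LinkStep.code).map fun c => c.coeff 2 0).sum, ?_⟩
    refine eqRow_eq_pachnerRow (fun k j => by rw [e0, e0]) ?_ ?_ ?_ ?_ ?_ ?_ ?_
    all_goals simp only [e]
    · exact h1
    · exact h2
    · exact h3
    · ring
    · exact h4
    · exact h5
    · exact h6
  | rest s =>
    refine ⟨0, eqRow_eq_pachnerRow (fun k j => ?_) ?_ ?_ ?_ ?_ ?_ ?_ ?_⟩ <;>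
      simp [LinkStep.map, IdealTriangulation.stepCoeff]

namespace IdealTriangulation

variable {N : ℕ} {T : IdealTriangulation (Fin 2 ⊕ Fin N)} {T' : IdealTriangulation (Fin 3 ⊕ Fin N)}

lemma eqRow_curve {γ : T.PeripheralCurve} {γ' : T'.PeripheralCurve} (h : SameCurve γ γ') :
    ∃ m : ℤ, eqRow γ'.coeff 0 = pachnerRow (eqRow γ.coeff 0) + m • newRow N := by
  obtain ⟨P, hP, h1, h2⟩ := h
  have key : ∃ m : ℤ, stepsRow (P.map Prod.snd).flatten =
      pachnerRow (stepsRow (P.map Prod.fst).flatten) + m • newRow N := by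
    clear h1 h2
    induction P with
    | nil =>
      refine ⟨0, ?_⟩
      have h0 : ∀ {ι : Type} [Fintype ι], stepsRow ([] : List (LinkStep ι)) = 0 := by
        intro ι _
        have := stepsRow_append ([] : List (LinkStep ι)) []
        simpa using this
      simp [h0]
    | cons p P ih =>
      obtain ⟨m, hm⟩ := stepsRow_of_arcCorr (hP p (by simp))
      obtain ⟨m', hm'⟩ := ih fun q hq => hP q (by simp [hq])
      refine ⟨m + m', ?_⟩
      rw [List.map_cons, List.map_cons, List.flatten_cons, List.flatten_cons, stepsRow_append,
        stepsRow_append, map_add, hm, hm', add_smul]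
      abel
  -- The row is a sum over steps, so the choice of starting point is irrelevant.
  rw [← stepsRow_perm h1.perm, ← stepsRow_perm h2.perm] at key
  exact key

end IdealTriangulation

/-! ### Changing the rows of a Neumann–Zagier datum -/

namespace NZDatum

variable {ι K : Type*} [Fintype ι] [Field K]

/-- The rows of `(A | B | ν)`. -/
def row (Ξ : NZDatum ι K) (i : ι) : (ι → ℤ) × (ι → ℤ) × ℤ := (Ξ.A i, Ξ.B i, Ξ.ν i)

lemma exists_mul_eq {Ξ Ξ' : NZDatum ι K}
    (h : Submodule.span ℤ (Set.range Ξ.row) ≤ Submodule.span ℤ (Set.range Ξ'.row)) :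
    ∃ H : Matrix ι ι ℤ, Ξ.A = H * Ξ'.A ∧ Ξ.B = H * Ξ'.B ∧ Ξ.ν = H.mulVec Ξ'.ν := by
  have h1 : ∀ i, ∃ c : ι → ℤ, ∑ j, c j • Ξ'.row j = Ξ.row i := fun i =>
    Submodule.mem_span_range_iff_exists_fun ℤ |>.1 (h (Submodule.subset_span ⟨i, rfl⟩))
  choose H hH using h1
  refine ⟨Matrix.of H, ?_, ?_, ?_⟩
  · ext i t
    have := congrFun (congrArg Prod.fst (hH i)) t
    simp only [row, Prod.fst_sum, Finset.sum_apply, Prod.smul_fst, Pi.smul_apply,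
      smul_eq_mul] at this
    rw [Matrix.mul_apply, ← this]
    rfl
  · ext i t
    have := congrFun (congrArg (fun p => p.2.1) (hH i)) t
    simp only [row, Prod.fst_sum, Prod.snd_sum, Finset.sum_apply, Prod.smul_fst, Prod.smul_snd,
      Pi.smul_apply, smul_eq_mul] at this
    rw [Matrix.mul_apply, ← this]
    rfl
  · ext i
    have := congrArg (fun p => p.2.2) (hH i)
    simp only [row, Prod.snd_sum, Prod.smul_snd, smul_eq_mul] at this
    rw [← this]
    rfl

/-- Data with the same row space. -/
lemma isNZ_of_row_span {Ξ Ξ' : NZDatum ι K} (hΞ : Ξ.IsNZ)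
    (h : Submodule.span ℤ (Set.range Ξ'.row) ≤ Submodule.span ℤ (Set.range Ξ.row))
    (hz : Ξ'.z = Ξ.z) (hf : Ξ'.f = Ξ.f) (hf'' : Ξ'.f'' = Ξ.f'') : Ξ'.IsNZ := by
  obtain ⟨H, hA, hB, hν⟩ := exists_mul_eq h
  refine ⟨?_, fun j => hz ▸ hΞ.shapes j, ?_⟩
  · have := hΞ.symm
    rw [Matrix.IsSymm] at this ⊢
    have e : H * Ξ.A * (H * Ξ.B).transpose = H * (Ξ.A * Ξ.B.transpose) * H.transpose := by
      simp only [Matrix.transpose_mul, Matrix.mul_assoc]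
    rw [hA, hB, e, Matrix.transpose_mul, Matrix.transpose_mul, this, Matrix.transpose_transpose]
    simp only [Matrix.mul_assoc]
  · have := hΞ.flattened
    rw [Flattened] at this ⊢
    rw [hA, hB, hν, hf, hf'', ← Matrix.mulVec_mulVec, ← Matrix.mulVec_mulVec, ← Matrix.mulVec_add,
      this]

lemma rel_of_row_span [DecidableEq ι] [CharZero K] {Ξ Ξ' : NZDatum ι K} (hΞ : Ξ.IsNZ)
    (hΞ' : Ξ'.Flattened)
    (h : Submodule.span ℤ (Set.range Ξ'.row) = Submodule.span ℤ (Set.range Ξ.row))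
    (hz : Ξ'.z = Ξ.z) : Ξ.Rel Ξ' := by
  obtain ⟨H, hA, hB, -⟩ := exists_mul_eq h.le
  obtain ⟨H', hA', hB', hν⟩ := exists_mul_eq h.ge
  exact rel_of_row_equiv hΞ hΞ' hA' hB' hν hA hB hz

end NZDatum

/-! ### Row lattices of the data of triangulations. -/

namespace IdealTriangulation

open NZDatum

section Datum

variable {ι K : Type*} [Fintype ι] [Field K] {T : IdealTriangulation ι} {γ : T.PeripheralCurve}
  {Ξ : NZDatum ι K}

lemma IsDatum.isNZ (h : T.IsDatum γ Ξ) : Ξ.IsNZ := by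
  obtain ⟨⟨e, r, hA, hB, -⟩, hs, hf⟩ := h
  refine ⟨?_, hs, hf⟩
  rw [hA, hB]
  exact gluingMatrix_isSymm e r γ

/-- The row space of a datum consists of all equations, also that of the removed edge. -/
lemma IsDatum.span_row (h : T.IsDatum γ Ξ) :
    Submodule.span ℤ (Set.range Ξ.row) = Submodule.span ℤ
      (insert (eqRow γ.coeff 0) (Set.range fun c : T.EdgeClass => eqRow (edgeCoeff c) 2)) := by
  obtain ⟨⟨e, r, hA, hB, hν⟩, -, -⟩ := h
  have hr : Ξ.row r = eqRow γ.coeff 0 := by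
    ext t <;> simp [row, eqRow, hA, hB, hν, gluingMatrix, Matrix.mulVec, dotProduct]
  have hi : ∀ i, i ≠ r → Ξ.row i = eqRow (edgeCoeff (e i)) 2 := by
    intro i hi
    ext t <;> simp [row, eqRow, hA, hB, hν, gluingMatrix, Matrix.mulVec, dotProduct, hi]
  apply le_antisymm
  · rw [Submodule.span_le]
    rintro _ ⟨i, rfl⟩
    by_cases h : i = r
    · rw [h, hr]
      exact Submodule.subset_span (Set.mem_insert _ _)
    · rw [hi i h]
      exact Submodule.subset_span (Set.mem_insert_of_mem _ ⟨e i, rfl⟩)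
  · rw [Submodule.span_le, Set.insert_subset_iff]
    refine ⟨hr ▸ Submodule.subset_span ⟨r, rfl⟩, ?_⟩
    rintro _ ⟨c, rfl⟩
    obtain ⟨i, rfl⟩ := e.surjective c
    by_cases h : i = r
    · classical
      subst h
      -- The equation of the removed edge is minus the sum of the other edge equations, hence lies
      -- in the lattice whichever edge was removed.
      have := sum_eqRow e
      rw [← Finset.add_sum_erase _ _ (Finset.mem_univ i), add_eq_zero_iff_eq_neg] at this
      change eqRow (edgeCoeff (e i)) 2 ∈ _
      rw [this]
      refine Submodule.neg_mem _ (Submodule.sum_mem _ fun j hj => ?_)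
      rw [← hi j (Finset.ne_of_mem_erase hj)]
      exact Submodule.subset_span ⟨j, rfl⟩
    · change eqRow (edgeCoeff (e i)) 2 ∈ _
      rw [← hi i h]
      exact Submodule.subset_span ⟨i, rfl⟩

end Datum

variable {N : ℕ} {K : Type*} [Field K] {T : IdealTriangulation (Fin 2 ⊕ Fin N)}
  {T' : IdealTriangulation (Fin 3 ⊕ Fin N)} {γ : T.PeripheralCurve} {γ' : T'.PeripheralCurve}
  {Ξ : NZDatum (Fin 2 ⊕ Fin N) K} {Ξ' : NZDatum (Fin 3 ⊕ Fin N) K}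

/-- The equations of the new triangulation span the rows that the 2–3 move of data gives. -/
lemma span_row_pachner (h : T.IsPachner T') (hγ : SameCurve γ γ') :
    Submodule.span ℤ (insert (eqRow γ'.coeff 0)
        (Set.range fun c : T'.EdgeClass => eqRow (edgeCoeff c) 2)) =
      Submodule.span ℤ {newRow N} ⊔ (Submodule.span ℤ (insert (eqRow γ.coeff 0)
        (Set.range fun c : T.EdgeClass => eqRow (edgeCoeff c) 2))).map pachnerRow := by
  obtain ⟨m, hm⟩ := eqRow_curve hγ
  apply le_antisymm
  · rw [Submodule.span_le, Set.insert_subset_iff]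
    have key : ∀ x ∈ insert (eqRow γ.coeff 0)
        (Set.range fun c : T.EdgeClass => eqRow (edgeCoeff c) 2), ∀ k : ℤ,
        pachnerRow x + k • newRow N ∈ Submodule.span ℤ {newRow N} ⊔ (Submodule.span ℤ (insert
          (eqRow γ.coeff 0)
            (Set.range fun c : T.EdgeClass => eqRow (edgeCoeff c) 2))).map pachnerRow := by
      intro x hx k
      refine Submodule.add_mem _ (Submodule.mem_sup_right
        (Submodule.mem_map_of_mem (Submodule.subset_span hx))) (Submodule.mem_sup_left
          (Submodule.smul_mem _ _ (Submodule.mem_span_singleton_self _)))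
    refine ⟨?_, ?_⟩
    · rw [hm]
      exact key _ (Set.mem_insert _ _) m
    · rintro _ ⟨c', rfl⟩
      obtain ⟨e', rfl⟩ := Quot.exists_rep c'
      rcases mk_eq_newTetEdge_or h e' with he | ⟨e, he⟩
      · refine Submodule.mem_sup_left ?_
        change eqRow (edgeCoeff (T := T') (Quot.mk T'.EdgeStep e')) 2 ∈ _
        rw [he, eqRow_newTetEdge h]
        exact Submodule.mem_span_singleton_self _
      · obtain ⟨k, hk⟩ := eqRow_of_edgeCorr h he
        change eqRow (edgeCoeff (T := T') (Quot.mk T'.EdgeStep e')) 2 ∈ _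
        rw [hk]
        exact key _ (Set.mem_insert_of_mem _ ⟨_, rfl⟩) k
  · have hn : newRow N ∈ Submodule.span ℤ (insert (eqRow γ'.coeff 0)
        (Set.range fun c : T'.EdgeClass => eqRow (edgeCoeff c) 2)) := by
      rw [← eqRow_newTetEdge h]
      exact Submodule.subset_span (Set.mem_insert_of_mem _ ⟨_, rfl⟩)
    have key : ∀ x ∈ insert (eqRow γ'.coeff 0)
        (Set.range fun c : T'.EdgeClass => eqRow (edgeCoeff c) 2), ∀ y (k : ℤ),
        x = y + k • newRow N → y ∈ Submodule.span ℤ (insert (eqRow γ'.coeff 0)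
          (Set.range fun c : T'.EdgeClass => eqRow (edgeCoeff c) 2)) := by
      intro x hx y k hk
      rw [← sub_eq_iff_eq_add] at hk
      rw [← hk]
      exact Submodule.sub_mem _ (Submodule.subset_span hx) (Submodule.smul_mem _ _ hn)
    rw [sup_le_iff, Submodule.map_span_le, Submodule.span_singleton_le_iff_mem]
    refine ⟨hn, ?_⟩
    rintro x (rfl | ⟨c, rfl⟩)
    · exact key _ (Set.mem_insert _ _) _ m hm
    · obtain ⟨e, rfl⟩ := Quot.exists_rep c
      obtain ⟨e', he⟩ := exists_edgeCorr e
      obtain ⟨k, hk⟩ := eqRow_of_edgeCorr h he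
      exact key _ (Set.mem_insert_of_mem _ ⟨_, rfl⟩) _ k hk

lemma span_row_stack (hA : Ξ'.A = pachnerA Ξ.A Ξ.B)
    (hB : Ξ'.B = pachnerB Ξ.B) (hν : Ξ'.ν = stackRows 1 Ξ.ν) :
    Submodule.span ℤ (Set.range Ξ'.row) = Submodule.span ℤ {newRow N} ⊔
      (Submodule.span ℤ (Set.range Ξ.row)).map pachnerRow := by
  have h0 : Ξ'.row (.inl 0) = newRow N := by
    ext t <;> simp [row, hA, hB, hν, pachnerA, pachnerB, newRow]
  have h1 : ∀ i, Ξ'.row (oldRow i) = pachnerRow (Ξ.row i) := by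
    intro i
    ext t <;> simp [row, hA, hB, hν, pachnerA, pachnerB, pachnerRow]
  rw [Submodule.map_span, ← Submodule.span_union]
  congr 1
  apply le_antisymm
  · rintro _ ⟨i, rfl⟩
    revert i
    refine forall_stack (Or.inl h0) fun i => Or.inr ⟨_, ⟨i, rfl⟩, (h1 i).symm⟩
  · rintro _ (rfl | ⟨_, ⟨i, rfl⟩, rfl⟩)
    · exact ⟨_, h0⟩
    · exact ⟨_, h1 i⟩

/-- The data of two triangulations that are related by a 2–3 Pachner move. -/
theorem IsPachner.rel [CharZero K] (h : T.IsPachner T') (hγ : SameCurve γ γ') (hΞ : T.IsDatum γ Ξ)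
    (hΞ' : T'.IsDatum γ' Ξ') (hz : Ξ'.z = pachnerShape Ξ.z) : Ξ.Rel Ξ' := by
  set Ξp : NZDatum (Fin 3 ⊕ Fin N) K :=
    ⟨pachnerA Ξ.A Ξ.B, pachnerB Ξ.B, stackRows 1 Ξ.ν, Ξ'.z, Ξ'.f, Ξ'.f''⟩ with hΞp
  -- The datum that the algebraic move produces from `Ξ` has the same row lattice as `Ξ'`. It
  -- inherits the laws from `Ξ'`, and the orderings and removed edges cease to matter.
  have hspan : Submodule.span ℤ (Set.range Ξ'.row) = Submodule.span ℤ (Set.range Ξp.row) := by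
    rw [hΞ'.span_row, span_row_pachner h hγ, ← hΞ.span_row]
    exact (span_row_stack (Ξ := Ξ) (Ξ' := Ξp) rfl rfl rfl).symm
  have hp : Ξp.IsNZ := isNZ_of_row_span hΞ'.isNZ hspan.ge rfl rfl rfl
  exact (NZDatum.IsPachner.rel hΞ.isNZ hp ⟨rfl, rfl, rfl, hz⟩).trans
    (rel_of_row_span hp hΞ'.isNZ.flattened hspan rfl)

end IdealTriangulation

end

theorem theorem6p1 {K : Type*} [Field K] [CharZero K] (N : ℕ) :
    -- The 2–3 move on Neumann–Zagier data, whether or not they come from topology.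
    (∀ (Ξ : NZDatum (Fin 2 ⊕ Fin N) K) (Ξ' : NZDatum (Fin 3 ⊕ Fin N) K),
      Ξ.IsNZ → Ξ'.IsNZ → Ξ.IsPachner Ξ' →
      ∀ (q : Fin 2 ⊕ Fin N → Fin 3) (q' : Fin 3 ⊕ Fin N → Fin 3),
        (Ξ.quad q).B.det ≠ 0 → (Ξ'.quad q').B.det ≠ 0 →
        (Ξ.quad q).SameSeries (Ξ'.quad q')) ∧
    -- The 2–3 move on ideal triangulations.
    (∀ (T : IdealTriangulation (Fin 2 ⊕ Fin N)) (T' : IdealTriangulation (Fin 3 ⊕ Fin N))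
      (γ : T.PeripheralCurve) (γ' : T'.PeripheralCurve)
      (Ξ : NZDatum (Fin 2 ⊕ Fin N) K) (Ξ' : NZDatum (Fin 3 ⊕ Fin N) K),
      T.IsPachner T' → SameCurve γ γ' → T.IsDatum γ Ξ → T'.IsDatum γ' Ξ' →
      Ξ'.z = pachnerShape Ξ.z →
      ∀ (q : Fin 2 ⊕ Fin N → Fin 3) (q' : Fin 3 ⊕ Fin N → Fin 3),
        (Ξ.quad q).B.det ≠ 0 → (Ξ'.quad q').B.det ≠ 0 →
        (Ξ.quad q).SameSeries (Ξ'.quad q')) := by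
  refine ⟨fun Ξ Ξ' hΞ hΞ' h q q' hB hB' => ?_, fun T T' γ γ' Ξ Ξ' h hγ hΞ hΞ' hz q q' hB hB' => ?_⟩
  -- The unmodified data may have singular `B`; this is harmless because `Rel` is stated through
  -- `mat`. Invertibility of `B` is used only to return to `Phi`.
  · exact ((NZDatum.rel_quad hΞ q).symm.trans
      ((NZDatum.IsPachner.rel hΞ hΞ' h).trans (NZDatum.rel_quad hΞ' q'))).sameSeries
        (hΞ.quad q) (hΞ'.quad q') hB hB'
  · exact ((NZDatum.rel_quad hΞ.isNZ q).symm.trans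
      ((h.rel hγ hΞ hΞ' hz).trans (NZDatum.rel_quad hΞ'.isNZ q'))).sameSeries
        (hΞ.isNZ.quad q) (hΞ'.isNZ.quad q') hB hB'
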